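/- **Model.** Algorithms are deterministic word-RAM programs with words of $O(\log(\text{input size}))$ bits (all numbers written are bounded by a fixed power of the input size; for a dynamic algorithm the input size is the number $N$ of nodes plus the number of operations). **APSP conjecture.** For every $\varepsilon>0$ there is a $c$ such that no algorithm computes all pairwise distances in $n$-node directed graphs with integer edge weights in $[-n^c,n^c]$ and without negative cycles in time $O(n^{3-\varepsilon})$. **Dynamic APSP.** A dynamic algorithm preprocesses an undirected $N$-node graph whose edge weights are integers in $[1,N^c]$; then it has to process online an arbitrary sequence of updates of the graph and of queries, where a query $(u,v)$ asks for the shortest path distance between $u$ and $v$ in the current graph. It has amortized query time $q(N)$ and amortized update time $u(N)$, with preprocessing time $O(N^P)$, if the total time for the preprocessing and any sequence of $a$ updates and $b$ queries is at most $O(N^P)+a\cdot u(N)+b\cdot q(N)$. **Theorem 1.** Assume the APSP conjecture. Let $\varepsilon>0$ and let $P\in\mathbb N$ be any exponent for the preprocessing time. Then, in each of the following variants, for a sufficiently large constant $c$ no dynamic APSP algorithm with preprocessing time $O(N^P)$ has amortized query time $q(N)$ and amortized update time $u(N)$ with $q(N)\cdot u(N)=O(N^{1-\varepsilon})$: 1.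 planar graphs, where the updates insert and delete edges and keep the graph planar; 2. planar graphs, where the updates only change the weights of existing edges; 3. for any real $M>1$: subgraphs of the infinite square grid, given together with their embedding into the grid, where the updates only change the weights of existing edges, and each weight always stays between its initial value and $M$ times its initial value. Here $c$ may depend on $\varepsilon$ and $P$, and in 3 also on $M$. -/

import Mathlib

/-! ### A word RAM

A program works on finitely many arrays of words; `m a i` is the content of cell `i` of array `a`.
Scalar variables are the cells with index `0`: "variable `x`" means the cell `m x 0`.
(The finitely many arrays that a program mentions can be interleaved in one linear memory, so this
is the usual word RAM up to a constant factor in the running time.) -/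

namespace WordRAM

/-- The memory: array number, index, content. -/
abbrev Mem : Type := ℕ → ℕ → ℤ

/-- Write the word `v` into cell `i` of array `a`. -/
def Mem.write (m : Mem) (a i : ℕ) (v : ℤ) : Mem :=
  fun b j => if b = a ∧ j = i then v else m b j

/-- The unit cost operations on words. -/
inductive BinOp : Type
  | add | sub | mul | div | mod | lt | eq | band | bor | bxor | shl | shr

/-- The value of an operation; comparisons return `0` or `1`. -/
def BinOp.eval : BinOp → ℤ → ℤ → ℤ
  | add, x, y => x + y
  | sub, x, y => x - y
  | mul, x, y => x * y
  | div, x, y => x / y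
  | mod, x, y => x % y
  | lt, x, y => if x < y then 1 else 0
  | eq, x, y => if x = y then 1 else 0
  | band, x, y => Int.land x y
  | bor, x, y => Int.lor x y
  | bxor, x, y => Int.xor x y
  | shl, x, y => x * 2 ^ y.toNat
  | shr, x, y => x / 2 ^ y.toNat

/-- Programs: constants, arithmetic on variables, indirect reads and writes, sequencing,
branching and looping on "variable `x` is nonzero". -/
inductive Prog : Type
  | const (x : ℕ) (v : ℤ)
  | arith (o : BinOp) (x y z : ℕ)
  | load (x a i : ℕ)
  | store (a i y : ℕ)
  | seq (p r : Prog)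
  | branch (x : ℕ) (p r : Prog)
  | loop (x : ℕ) (p : Prog)

/-- `Runs B p m t m'`: started on memory `m`, the program `p` halts after exactly `t` steps with
memory `m'`, and every word that it writes on the way has absolute value at most `B`.
Executions are deterministic. -/
inductive Runs (B : ℕ) : Prog → Mem → ℕ → Mem → Prop
  | const (x : ℕ) (v : ℤ) (m : Mem) (h : |v| ≤ (B : ℤ)) :
      Runs B (.const x v) m 1 (m.write x 0 v)
  | arith (o : BinOp) (x y z : ℕ) (m : Mem) (h : |o.eval (m y 0) (m z 0)| ≤ (B : ℤ)) :
      Runs B (.arith o x y z) m 1 (m.write x 0 (o.eval (m y 0) (m z 0)))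
  | load (x a i : ℕ) (m : Mem) (h : |m a (m i 0).toNat| ≤ (B : ℤ)) :
      Runs B (.load x a i) m 1 (m.write x 0 (m a (m i 0).toNat))
  | store (a i y : ℕ) (m : Mem) (h : |m y 0| ≤ (B : ℤ)) :
      Runs B (.store a i y) m 1 (m.write a (m i 0).toNat (m y 0))
  | seq {p r : Prog} {m m₁ m₂ : Mem} {t₁ t₂ : ℕ} (h₁ : Runs B p m t₁ m₁) (h₂ : Runs B r m₁ t₂ m₂) :
      Runs B (.seq p r) m (t₁ + t₂) m₂
  | branchTrue {x : ℕ} {p r : Prog} {m m₁ : Mem} {t : ℕ} (hx : m x 0 ≠ 0) (h : Runs B p m t m₁) :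
      Runs B (.branch x p r) m (t + 1) m₁
  | branchFalse {x : ℕ} {p r : Prog} {m m₁ : Mem} {t : ℕ} (hx : m x 0 = 0) (h : Runs B r m t m₁) :
      Runs B (.branch x p r) m (t + 1) m₁
  | loopTrue {x : ℕ} {p : Prog} {m m₁ m₂ : Mem} {t₁ t₂ : ℕ} (hx : m x 0 ≠ 0)
      (h₁ : Runs B p m t₁ m₁) (h₂ : Runs B (.loop x p) m₁ t₂ m₂) :
      Runs B (.loop x p) m (t₁ + t₂ + 1) m₂
  | loopFalse {x : ℕ} {p : Prog} {m : Mem} (hx : m x 0 = 0) :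
      Runs B (.loop x p) m 1 m

/-- An array holding an `n × n` matrix row by row, followed by zeros. -/
def matArray {n : ℕ} (f : Fin n → Fin n → ℤ) : ℕ → ℤ :=
  fun i => if h : i / n < n ∧ i % n < n then f ⟨i / n, h.1⟩ ⟨i % n, h.2⟩ else 0

/-- An array holding a vector of length `n`, followed by zeros. -/
def vecArray {n : ℕ} (f : Fin n → ℤ) : ℕ → ℤ :=
  fun i => if h : i < n then f ⟨i, h⟩ else 0

end WordRAM

/-! ### Static all pairs shortest paths in directed graphs with integer weights -/

namespace APSP

open WordRAM

/-- A weighted directed graph on `n` nodes; `none` means that there is no edge. -/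
abbrev WDigraph (n : ℕ) : Type := Fin n → Fin n → Option ℤ

/-- `HasWalk w u v l`: there is a walk from `u` to `v` of total weight `l`. -/
inductive HasWalk {n : ℕ} (w : WDigraph n) : Fin n → Fin n → ℤ → Prop
  | nil (u : Fin n) : HasWalk w u u 0
  | cons {u v x : Fin n} {a l : ℤ} (h : w u v = some a) (p : HasWalk w v x l) :
      HasWalk w u x (a + l)

/-- No closed walk has negative weight. -/
def NoNegCycle {n : ℕ} (w : WDigraph n) : Prop :=
  ∀ u l, HasWalk w u u l → 0 ≤ l

/-- All weights are integers of absolute value at most `n ^ c`. -/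
def WeightsBounded {n : ℕ} (c : ℕ) (w : WDigraph n) : Prop :=
  ∀ u v a, w u v = some a → |a| ≤ (n : ℤ) ^ c

/-- The input: `n` in variable `0`, the 0/1 adjacency matrix in array `1`, the weights in
array `2`; everything else is zero. -/
def input {n : ℕ} (w : WDigraph n) : Mem
  | 0 => fun i => if i = 0 then (n : ℤ) else 0
  | 1 => matArray fun u v => if (w u v).isSome then 1 else 0
  | 2 => matArray fun u v => (w u v).getD 0
  | _ => fun _ => 0

/-- The output: array `3` tells which pairs are connected by a directed walk, array `4` holds the
distances of the connected pairs. -/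
def IsOutput {n : ℕ} (w : WDigraph n) (m : Mem) : Prop :=
  ∀ u v : Fin n,
    ((∃ l, HasWalk w u v l) →
      m 3 (u * n + v) = 1 ∧ IsLeast {l | HasWalk w u v l} (m 4 (u * n + v))) ∧
    ((¬ ∃ l, HasWalk w u v l) → m 3 (u * n + v) = 0)

/-- `p` solves APSP on all `n`-node directed graphs with integer weights in `[-n ^ c, n ^ c]` and
without negative cycles, in time `T n`, with words of `O(log n)` bits. -/
def Solves (p : Prog) (c : ℕ) (T : ℕ → ℝ) : Prop :=
  ∃ k : ℕ, ∀ (n : ℕ) (w : WDigraph n), WeightsBounded c w → NoNegCycle w →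
    ∃ (t : ℕ) (m : Mem), Runs ((n + 2) ^ k) p (input w) t m ∧ (t : ℝ) ≤ T n ∧ IsOutput w m

/-- The APSP conjecture: for every `ε > 0`, APSP with polynomially bounded integer weights (of a
sufficiently large degree) has no `O(n ^ (3 - ε))` time algorithm. -/
def Conjecture : Prop :=
  ∀ ε : ℝ, 0 < ε → ∃ c : ℕ, ¬ ∃ (p : Prog) (T : ℕ → ℝ),
    Asymptotics.IsBigO Filter.atTop T (fun n : ℕ => (n : ℝ) ^ (3 - ε)) ∧ Solves p c T

end APSP

/-! ### Dynamic all pairs shortest paths in undirected graphs with positive integer weights -/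

namespace DynAPSP

open WordRAM

/-- A weighted undirected graph. Only the weights of the edges of `graph` matter. -/
structure WGraph (V : Type) where
  graph : SimpleGraph V
  weight : Sym2 V → ℕ

/-- The shortest path distance; `⊤` if there is no path. -/
noncomputable def WGraph.dist {V : Type} (G : WGraph V) (u v : V) : ℕ∞ :=
  ⨅ p : G.graph.Walk u v, (((p.edges.map G.weight).sum : ℕ) : ℕ∞)

/-- Updates: insert an edge with a weight, delete an edge, change the weight of an edge. -/
inductive Update (V : Type) : Type
  | insertEdge (u v : V) (w : ℕ)
  | deleteEdge (u v : V)
  | setWeight (u v : V) (w : ℕ)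

/-- The graph after an update. -/
def Update.apply {V : Type} [DecidableEq V] : Update V → WGraph V → WGraph V
  | insertEdge u v w, G => ⟨G.graph ⊔ SimpleGraph.edge u v, Function.update G.weight s(u, v) w⟩
  | deleteEdge u v, G => ⟨G.graph.deleteEdges {s(u, v)}, G.weight⟩
  | setWeight u v w, G => ⟨G.graph, Function.update G.weight s(u, v) w⟩

/-- Operations: updates and distance queries. -/
inductive Op (V : Type) : Type
  | update (U : Update V)
  | query (u v : V)

/-- The number of updates in a sequence of operations. -/
def numUpdates {V : Type} : List (Op V) → ℕ
  | [] => 0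
  | .update _ :: ops => numUpdates ops + 1
  | .query _ _ :: ops => numUpdates ops

/-- The number of queries in a sequence of operations. -/
def numQueries {V : Type} : List (Op V) → ℕ
  | [] => 0
  | .update _ :: ops => numQueries ops
  | .query _ _ :: ops => numQueries ops + 1

/-- A variant of the dynamic problem: which initial graphs may occur (together with coordinates of
the nodes that the algorithm is told), and which updates are allowed, depending on the initial and
on the current graph. -/
structure Variant where
  initial : {N : ℕ} → WGraph (Fin N) → (Fin N → ℕ × ℕ) → Prop
  allowed : {N : ℕ} → (start current : WGraph (Fin N)) → Update (Fin N) → Prop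

/-- Every update of the sequence is allowed at the time when it is made. -/
def Variant.Admissible (D : Variant) {N : ℕ} (start : WGraph (Fin N)) :
    WGraph (Fin N) → List (Op (Fin N)) → Prop
  | _, [] => True
  | G, .update U :: ops => D.allowed start G U ∧ D.Admissible start (U.apply G) ops
  | G, .query _ _ :: ops => D.Admissible start G ops

/-- A dynamic algorithm: a preprocessing program and one program for each kind of operation, all
working on the same memory. -/
structure Algorithm where
  preprocess : Prog
  insertEdge : Prog
  deleteEdge : Prog
  setWeight : Prog
  query : Prog

/-- The input of the preprocessing: `N` in variable `0`, the matrix of edge weights in array `1`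
(`0` for non-edges, as edges have positive weights), the coordinates of the nodes in arrays `2`
and `3`; everything else is zero. -/
noncomputable def input {N : ℕ} (G : WGraph (Fin N)) (pos : Fin N → ℕ × ℕ) : Mem
  | 0 => fun i => if i = 0 then (N : ℤ) else 0
  | 1 => matArray fun u v => by classical exact if G.graph.Adj u v then (G.weight s(u, v) : ℤ) else 0
  | 2 => vecArray fun v => ((pos v).1 : ℤ)
  | 3 => vecArray fun v => ((pos v).2 : ℤ)
  | _ => fun _ => 0

/-- The program that is called for an update. -/
def Algorithm.updateProg (A : Algorithm) {N : ℕ} : Update (Fin N) → Prog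
  | .insertEdge _ _ _ => A.insertEdge
  | .deleteEdge _ _ => A.deleteEdge
  | .setWeight _ _ _ => A.setWeight

/-- Before an update, its arguments are put into the variables `0`, `1`, `2`. -/
def updateArgs {N : ℕ} (m : Mem) : Update (Fin N) → Mem
  | .insertEdge u v w => ((m.write 0 0 (u : ℕ)).write 1 0 (v : ℕ)).write 2 0 w
  | .deleteEdge u v => (m.write 0 0 (u : ℕ)).write 1 0 (v : ℕ)
  | .setWeight u v w => ((m.write 0 0 (u : ℕ)).write 1 0 (v : ℕ)).write 2 0 w

/-- Before a query, the two nodes are put into the variables `0` and `1`. -/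
def queryArgs {N : ℕ} (m : Mem) (u v : Fin N) : Mem :=
  (m.write 0 0 (u : ℕ)).write 1 0 (v : ℕ)

/-- The word that represents a distance: `-1` stands for `⊤`. -/
noncomputable def distWord (d : ℕ∞) : ℤ :=
  by classical exact if d = ⊤ then -1 else (d.toNat : ℤ)

/-- `A.Serves B G m ops t`: when the current graph is `G` and the memory is `m`, the algorithm
processes the operations `ops` one after the other, in `t` steps in total and with words of
absolute value at most `B`, and answers every query correctly, in variable `0`. -/
def Algorithm.Serves (A : Algorithm) (B : ℕ) {N : ℕ} :
    WGraph (Fin N) → Mem → List (Op (Fin N)) → ℕ → Prop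
  | _, _, [], t => t = 0
  | G, m, .update U :: ops, t => ∃ (t₁ t₂ : ℕ) (m' : Mem),
      Runs B (A.updateProg U) (updateArgs m U) t₁ m' ∧
      A.Serves B (U.apply G) m' ops t₂ ∧ t = t₁ + t₂
  | G, m, .query u v :: ops, t => ∃ (t₁ t₂ : ℕ) (m' : Mem),
      Runs B A.query (queryArgs m u v) t₁ m' ∧ m' 0 0 = distWord (G.dist u v) ∧
      A.Serves B G m' ops t₂ ∧ t = t₁ + t₂

/-- `A` solves the variant `D` of the dynamic APSP problem with amortized query time `q N` and
amortized update time `u N`, after an initial investment of `O(N ^ P)` steps: on every initial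
graph and every admissible sequence of `a` updates and `b` queries, the total running time
including the preprocessing is at most `O(N ^ P) + a * u N + b * q N`, with words of `O(log N)`
bits (more precisely `O(log (N + a + b))` bits). -/
def Algorithm.Solves (A : Algorithm) (D : Variant) (P : ℕ) (q u : ℕ → ℝ) : Prop :=
  ∃ k C : ℕ, ∀ (N : ℕ) (G : WGraph (Fin N)) (pos : Fin N → ℕ × ℕ), D.initial G pos →
    ∀ ops : List (Op (Fin N)), D.Admissible G G ops →
      ∃ (t₀ t : ℕ) (m : Mem),
        Runs ((N + ops.length + 2) ^ k) A.preprocess (input G pos) t₀ m ∧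
        A.Serves ((N + ops.length + 2) ^ k) G m ops t ∧
        (t₀ : ℝ) + t ≤ C * ((N : ℝ) + 1) ^ P + numUpdates ops * u N + numQueries ops * q N

/-- There is an algorithm for `D` with preprocessing `O(N ^ P)` whose amortized query time `q` and
update time `u` satisfy `q N * u N = O(N ^ (1 - ε))`. -/
def HasFastAlgorithm (D : Variant) (P : ℕ) (ε : ℝ) : Prop :=
  ∃ (A : Algorithm) (q u : ℕ → ℝ), A.Solves D P q u ∧
    Asymptotics.IsBigO Filter.atTop (fun N => q N * u N) (fun N : ℕ => (N : ℝ) ^ (1 - ε))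

/-! ### The variants: planar graphs and grid graphs -/

/-- `G` is planar: it can be drawn in the plane with distinct points for the nodes, and with a
simple arc for each edge that joins its two ends, such that no arc passes through a node and two
arcs meet in common ends only. -/
def IsPlanar {V : Type} (G : SimpleGraph V) : Prop :=
  ∃ (pos : V → ℂ) (arc : Sym2 V → C(unitInterval, ℂ)),
    Function.Injective pos ∧
    (∀ e ∈ G.edgeSet, Function.Injective (arc e) ∧ s(arc e 0, arc e 1) = e.map pos) ∧
    (∀ e ∈ G.edgeSet, ∀ (t : unitInterval) (x : V), arc e t = pos x → t = 0 ∨ t = 1) ∧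
    (∀ e ∈ G.edgeSet, ∀ f ∈ G.edgeSet, e ≠ f →
      ∀ s t : unitInterval, arc e s = arc f t → s = 0 ∨ s = 1)

/-- `pos` embeds `G` as a subgraph of the infinite square grid (inside an `N × N` box). -/
def IsGridEmbedding {N : ℕ} (G : SimpleGraph (Fin N)) (pos : Fin N → ℕ × ℕ) : Prop :=
  Function.Injective pos ∧
  (∀ v, (pos v).1 < N ∧ (pos v).2 < N) ∧
  ∀ u v, G.Adj u v →
    ((pos u).1 = (pos v).1 ∧ ((pos u).2 + 1 = (pos v).2 ∨ (pos v).2 + 1 = (pos u).2)) ∨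
    ((pos u).2 = (pos v).2 ∧ ((pos u).1 + 1 = (pos v).1 ∨ (pos v).1 + 1 = (pos u).1))

/-- An integer edge weight in `[1, N ^ c]`. -/
def WeightOK (c N w : ℕ) : Prop := 1 ≤ w ∧ w ≤ N ^ c

/-- All edge weights are integers in `[1, N ^ c]`. -/
def WGraph.WeightsOK (c : ℕ) {N : ℕ} (G : WGraph (Fin N)) : Prop :=
  ∀ u v, G.graph.Adj u v → WeightOK c N (G.weight s(u, v))

/-- Planar graphs with edge insertions and deletions that keep the graph planar. No embedding is
given. -/
def planarEdgeUpdates (c : ℕ) : Variant where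
  initial G pos := IsPlanar G.graph ∧ G.WeightsOK c ∧ ∀ v, pos v = (0, 0)
  allowed {N} _ G
    | .insertEdge u v w => u ≠ v ∧ ¬ G.graph.Adj u v ∧ WeightOK c N w ∧
        IsPlanar (G.graph ⊔ SimpleGraph.edge u v)
    | .deleteEdge u v => G.graph.Adj u v
    | .setWeight _ _ _ => False

/-- Planar graphs with weight updates only. No embedding is given. -/
def planarWeightUpdates (c : ℕ) : Variant where
  initial G pos := IsPlanar G.graph ∧ G.WeightsOK c ∧ ∀ v, pos v = (0, 0)
  allowed {N} _ G
    | .setWeight u v w => G.graph.Adj u v ∧ WeightOK c N w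
    | _ => False

/-- Grid graphs, given with a fixed embedding into the grid, with weight updates only, which moreover
keep each weight between its initial value and `M` times its initial value. -/
def gridWeightUpdates (c : ℕ) (M : ℝ) : Variant where
  initial G pos := IsGridEmbedding G.graph pos ∧ G.WeightsOK c
  allowed {N} start G
    | .setWeight u v w => G.graph.Adj u v ∧ WeightOK c N w ∧
        start.weight s(u, v) ≤ w ∧ (w : ℝ) ≤ M * start.weight s(u, v)
    | _ => False

end DynAPSP

/-!
The proof is a reduction: a fast dynamic algorithm `A` is turned into a word RAM program that solves
static APSP in truly subcubic time.

**The grid.** Take an `x × y` block `b` of a matrix. A weighted grid with `x` rows and `4 * y` columns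
(`Gadget`) encodes `b` in the weights of its right half, and a vector `a` of length `x` in the weights
of the `x` edges that cross the middle. The weights have large slopes, steeper in the left half for the
upper rows and in the right half for the lower rows, and such that the two slopes have the same sum in
every row. A shortest path between the two terminals of column `j` goes down in the
column of its first terminal, crosses the grid in one row `r`, and goes down in the column of its second
terminal; its length is a known offset plus `a r + b r j`. So the distance of the terminals is the
offset plus `min_r (a r + b r j)` (`Gadget.dist_eq`; the lower bound comes from a potential that
changes by at most the weight along every edge). Hence `x` weight changes and `y` queries compute the
`(min, +)` product of a vector with the block. The variable weights move by at most `5 * Ω` above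
`5 * μ * Ω`, that is, by a factor of at most `1 + 1 / μ`, which is less than any given `M > 1` for large
`μ`. All three variants of the dynamic problem allow these grids and updates (`Gadget.Hosts`); grids are
planar, as they are drawn with straight segments (`isPlanar_of_gridAdj`).

**The product of two matrices.** Let the matrices have size `h ^ D`, and cut one factor into blocks of
size `h ^ j × h ^ (K - j)`. For each block, `A` is started on the grid of the block, with
`N = 4 * h ^ K` nodes, and serves the rows of the other factor one after the other. If
`q N * u N` is at most `N ^ (1 - ε)` and `6 ≤ K * ε`, then some exponent `j` balances the time for the
`h ^ (D + j)` updates and the `h ^ (D + K - j)` queries of a block such that both are smaller by a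
factor `h ^ 2` than the `h ^ (D + K)` steps of the trivial algorithm (`exists_good_exponent`); the
preprocessing does not matter if `D` is large compared with `K * P`. The functions `q` and `u` need not
be computable, so the program cannot know the exponent. It proceeds greedily: it counts the steps of
the simulations for every exponent, and always continues with the exponent that has used the fewest
steps so far. All exponents together then cost at most `K + 1` times as much as the best one, and one
unit of work more for each (`Setup.squareTime`).

**APSP.** Repeated `(min, +)` squaring of the matrix of edge weights, shifted by a large `Ω` so that the
entries are nonnegative and with a code for infinity (`APSP.Enc`), gives the distances
(`APSP.Enc.square`, `APSP.Enc.dist`). The number of squarings is `D * h` where `h` is the `D`-th root of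
`n`, rounded up; this is more than necessary, but costs less than the factor `h ^ 2` that was saved. The
total time is `O(h ^ (3 * D - 1)) = O(n ^ (3 - 1 / D))` (`reductionTime_le`), which contradicts the
conjecture.

**Programs.** The reduction is written in a small language of expressions, assignments and `for` loops
that compiles to the word RAM, and its correctness, its running time and the bound for the words are
proved together with the rules for the predicate `WordRAM.Ex`. The dynamic algorithm is simulated in a
fresh part of the memory for every block, by a transformation of programs that counts steps
(`WordRAM.sim`).
-/

namespace WordRAM

/-! ### Memories and runs -/

theorem Mem.write_apply (m : Mem) (a i : ℕ) (v : ℤ) (b j : ℕ) :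
    m.write a i v b j = if b = a ∧ j = i then v else m b j := rfl

theorem Mem.write_of_ne (m : Mem) {a b : ℕ} (i : ℕ) (v : ℤ) (h : b ≠ a) :
    m.write a i v b = m b := by
  funext j; simp [Mem.write, h]

theorem Mem.write_self (m : Mem) (a i : ℕ) (v : ℤ) : m.write a i v a i = v := by
  simp [Mem.write]

theorem Runs.mono {B B' : ℕ} (h : B ≤ B') {p : Prog} {m m' : Mem} {t : ℕ} (hr : Runs B p m t m') :
    Runs B' p m t m' := by
  have hB : (B : ℤ) ≤ B' := by exact_mod_cast h
  induction hr with
  | const x v m h => exact .const x v m (h.trans hB)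
  | arith o x y z m h => exact .arith o x y z m (h.trans hB)
  | load x a i m h => exact .load x a i m (h.trans hB)
  | store a i y m h => exact .store a i y m (h.trans hB)
  | seq _ _ h₁ h₂ => exact .seq h₁ h₂
  | branchTrue hx _ h => exact .branchTrue hx h
  | branchFalse hx _ h => exact .branchFalse hx h
  | loopTrue hx _ _ h₁ h₂ => exact .loopTrue hx h₁ h₂
  | loopFalse hx => exact .loopFalse hx

theorem Runs.one_le {B : ℕ} {p : Prog} {m m' : Mem} {t : ℕ} (hr : Runs B p m t m') : 1 ≤ t := by
  induction hr <;> omega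

/-! ### Expressions and structured programs -/

/-- Scratch variables for the evaluation of expressions. -/
def IsTemp (a : ℕ) : Prop := 50 ≤ a ∧ a < 100

instance (a : ℕ) : Decidable (IsTemp a) := inferInstanceAs (Decidable (_ ∧ _))

/-- Two memories that agree up to scratch variables. -/
def Eqv (m m' : Mem) : Prop := ∀ a, ¬ IsTemp a → m a = m' a

/-- Expressions: variables, constants, operations, indirect reads, conditionals. -/
inductive Exp : Type
  | v (x : ℕ)
  | c (z : ℤ)
  | op (o : BinOp) (a b : Exp)
  | ld (a : ℕ) (e : Exp)
  | ite (e a b : Exp)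

namespace Exp

/-- The value of an expression in a memory. -/
def eval (m : Mem) : Exp → ℤ
  | v x => m x 0
  | c z => z
  | op o a b => o.eval (a.eval m) (b.eval m)
  | ld a e => m a (e.eval m).toNat
  | ite e a b => if e.eval m ≠ 0 then a.eval m else b.eval m

/-- Code that leaves the value in the scratch variable `d` and uses no scratch variable below `d`. -/
def code : ℕ → Exp → Prog
  | d, v x => .seq (.const d 0) (.arith .add d x d)
  | d, c z => .const d z
  | d, op o a b => .seq (code d a) (.seq (code (d + 1) b) (.arith o d d (d + 1)))
  | d, ld a e => .seq (code d e) (.load d a d)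
  | d, ite e a b => .seq (code d e) (.branch d (code d a) (code d b))

/-- A bound for the running time of the code. -/
def cost : Exp → ℕ
  | v _ => 2
  | c _ => 1
  | op _ a b => a.cost + b.cost + 1
  | ld _ e => e.cost + 1
  | ite e a b => e.cost + 1 + max a.cost b.cost

/-- The number of scratch variables that the code uses. -/
def depth : Exp → ℕ
  | v _ => 1
  | c _ => 1
  | op _ a b => max a.depth (b.depth + 1)
  | ld _ e => e.depth
  | ite e a b => max e.depth (max a.depth b.depth)

/-- An exponent for the growth: on words of absolute value at most `V`, simple expressions have
values of absolute value at most `V ^ size`. -/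
def size : Exp → ℕ
  | v _ => 1
  | c _ => 1
  | op _ a b => a.size + b.size
  | ld _ e => e.size
  | ite e a b => e.size + (a.size + b.size)

/-- No scratch variable is mentioned. -/
def wf : Exp → Prop
  | v x => ¬ IsTemp x
  | c _ => True
  | op _ a b => a.wf ∧ b.wf
  | ld a e => ¬ IsTemp a ∧ e.wf
  | ite e a b => e.wf ∧ a.wf ∧ b.wf

/-- Every intermediate value is at most `B` in absolute value. -/
def Safe (B : ℕ) (m : Mem) : Exp → Prop
  | v x => |m x 0| ≤ (B : ℤ)
  | c z => |z| ≤ (B : ℤ)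
  | op o a b => a.Safe B m ∧ b.Safe B m ∧ |o.eval (a.eval m) (b.eval m)| ≤ (B : ℤ)
  | ld a e => e.Safe B m ∧ |m a (e.eval m).toNat| ≤ (B : ℤ)
  | ite e a b => e.Safe B m ∧ (e.eval m ≠ 0 → a.Safe B m) ∧ (e.eval m = 0 → b.Safe B m)

/-- The code is correct on every memory that agrees with `m` up to scratch variables; it changes
scratch variables from `d` on only. -/
theorem code_runs {B : ℕ} {m : Mem} : ∀ (e : Exp) (d : ℕ) (m₁ : Mem), Eqv m m₁ → e.wf →
    50 ≤ d → d + e.depth ≤ 100 → e.Safe B m →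
    ∃ t m₂, t ≤ e.cost ∧ Runs B (e.code d) m₁ t m₂ ∧ m₂ d 0 = e.eval m ∧
      ∀ a, a < d ∨ 100 ≤ a → m₂ a = m₁ a
  | v x, d, m₁, he, hw, hd, hd', hs => by
      have hx : x ≠ d := by
        rintro rfl; exact hw ⟨hd, by simp [depth] at hd'; omega⟩
      have h1 : BinOp.add.eval ((m₁.write d 0 0) x 0) ((m₁.write d 0 0) d 0) = m x 0 := by
        simp [BinOp.eval, Mem.write_of_ne _ _ _ hx, Mem.write_self, he x hw]
      refine ⟨2, _, le_rfl, .seq (.const d 0 m₁ (by simp)) (.arith .add d x d _ ?_), ?_, ?_⟩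
      · rw [h1]; exact hs
      · rw [Mem.write_self, h1]; rfl
      · intro a ha
        rw [Mem.write_of_ne, Mem.write_of_ne] <;> (simp [depth] at hd'; omega)
  | c z, d, m₁, he, hw, hd, hd', hs => by
      refine ⟨1, _, le_rfl, .const d z m₁ hs, Mem.write_self .., ?_⟩
      intro a ha
      rw [Mem.write_of_ne]; simp [depth] at hd'; omega
  | op o a b, d, m₁, he, hw, hd, hd', hs => by
      simp only [depth] at hd'
      obtain ⟨t₁, m₂, ht₁, r₁, v₁, f₁⟩ := code_runs a d m₁ he hw.1 hd (by omega) hs.1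
      have he₂ : Eqv m m₂ := fun x hx => by
        rw [he x hx, f₁ x]; unfold IsTemp at hx; omega
      obtain ⟨t₂, m₃, ht₂, r₂, v₂, f₂⟩ :=
        code_runs b (d + 1) m₂ he₂ hw.2 (by omega) (by omega) hs.2.1
      have hv : m₃ d 0 = a.eval m := by rw [f₂ d (by omega), v₁]
      refine ⟨t₁ + (t₂ + 1), _, by simp [cost]; omega,
        .seq r₁ (.seq r₂ (.arith o d d (d + 1) _ ?_)), ?_, ?_⟩
      · rw [hv, v₂]; exact hs.2.2
      · rw [Mem.write_self, hv, v₂]; rfl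
      · intro x hx
        rw [Mem.write_of_ne _ _ _ (by omega), f₂ x (by omega), f₁ x hx]
  | ld a e, d, m₁, he, hw, hd, hd', hs => by
      simp only [depth] at hd'
      obtain ⟨t₁, m₂, ht₁, r₁, v₁, f₁⟩ := code_runs e d m₁ he hw.2 hd (by omega) hs.1
      have hp : 1 ≤ e.depth := by
        clear * -; induction e <;> simp_all [depth]
      have ha : m₂ a = m a := by
        rw [he a hw.1, f₁ a]; have := hw.1; unfold IsTemp at this; omega
      refine ⟨t₁ + 1, _, by simp [cost]; omega, .seq r₁ (.load d a d _ ?_), ?_, ?_⟩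
      · rw [v₁, ha]; exact hs.2
      · rw [Mem.write_self, v₁, ha]; rfl
      · intro x hx
        rw [Mem.write_of_ne _ _ _ (by omega), f₁ x hx]
  | ite e a b, d, m₁, he, hw, hd, hd', hs => by
      simp only [depth] at hd'
      obtain ⟨t₁, m₂, ht₁, r₁, v₁, f₁⟩ := code_runs e d m₁ he hw.1 hd (by omega) hs.1
      have he₂ : Eqv m m₂ := fun x hx => by
        rw [he x hx, f₁ x]; unfold IsTemp at hx; omega
      by_cases h0 : e.eval m = 0
      · obtain ⟨t₂, m₃, ht₂, r₂, v₂, f₂⟩ :=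
          code_runs b d m₂ he₂ hw.2.2 hd (by omega) (hs.2.2 h0)
        refine ⟨t₁ + (t₂ + 1), _, by simp only [cost]; omega,
          .seq r₁ (.branchFalse (by rw [v₁, h0]) r₂), by simp [v₂, eval, h0], ?_⟩
        intro x hx; rw [f₂ x hx, f₁ x hx]
      · obtain ⟨t₂, m₃, ht₂, r₂, v₂, f₂⟩ :=
          code_runs a d m₂ he₂ hw.2.1 hd (by omega) (hs.2.1 h0)
        refine ⟨t₁ + (t₂ + 1), _, by simp only [cost]; omega,
          .seq r₁ (.branchTrue (by rwa [v₁]) r₂), by simp [v₂, eval, h0], ?_⟩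
        intro x hx; rw [f₂ x hx, f₁ x hx]

end Exp

/-- `x := e` -/
def assign (x : ℕ) (e : Exp) : Prog := .seq (e.code 50) (.seq (.const 51 0) (.arith .add x 50 51))

/-- `a[i] := e` -/
def put (a : ℕ) (i e : Exp) : Prog := .seq (i.code 50) (.seq (e.code 51) (.store a 50 51))

/-- `if e ≠ 0 then p else r` -/
def cond (e : Exp) (p r : Prog) : Prog := .seq (e.code 50) (.branch 50 p r)

/-- `while e ≠ 0 do p` -/
def while_ (e : Exp) (p : Prog) : Prog := .seq (e.code 50) (.loop 50 (.seq p (e.code 50)))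

/-- `for x = 0, …, e - 1 do p` -/
def for_ (x : ℕ) (e : Exp) (p : Prog) : Prog :=
  .seq (assign x (.c 0))
    (while_ (.op .lt (.v x) e) (.seq p (assign x (.op .add (.v x) (.c 1)))))

/-- `p` leads from `m` to `m'` in at most `τ` steps, where scratch variables are ignored. -/
def Exec (B : ℕ) (p : Prog) (m : Mem) (τ : ℕ) (m' : Mem) : Prop :=
  ∀ m₁, Eqv m m₁ → ∃ t m₂, t ≤ τ ∧ Runs B p m₁ t m₂ ∧ Eqv m' m₂

theorem Exec.mono {B : ℕ} {p : Prog} {m m' : Mem} {τ τ' : ℕ} (h : Exec B p m τ m') (hτ : τ ≤ τ') :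
    Exec B p m τ' m' := fun m₁ h₁ =>
  let ⟨t, m₂, ht, r⟩ := h m₁ h₁
  ⟨t, m₂, ht.trans hτ, r⟩

theorem Exec.seq {B : ℕ} {p r : Prog} {m m' m'' : Mem} {τ τ' : ℕ} (h : Exec B p m τ m')
    (h' : Exec B r m' τ' m'') : Exec B (.seq p r) m (τ + τ') m'' := by
  intro m₁ h₁
  obtain ⟨t, m₂, ht, r₂, e₂⟩ := h m₁ h₁
  obtain ⟨t', m₃, ht', r₃, e₃⟩ := h' m₂ e₂
  exact ⟨t + t', m₃, by omega, .seq r₂ r₃, e₃⟩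

theorem Exec.assign {B : ℕ} {x : ℕ} {e : Exp} {m : Mem} (hw : e.wf) (hd : e.depth ≤ 50)
    (hs : e.Safe B m) (hB : |e.eval m| ≤ (B : ℤ)) :
    Exec B (assign x e) m (e.cost + 2) (m.write x 0 (e.eval m)) := by
  intro m₁ h₁
  obtain ⟨t, m₂, ht, r, hv, hf⟩ := Exp.code_runs e 50 m₁ h₁ hw le_rfl (by omega) hs
  have h2 : BinOp.add.eval ((m₂.write 51 0 0) 50 0) ((m₂.write 51 0 0) 51 0) = e.eval m := by
    simp [BinOp.eval, Mem.write_apply, hv]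
  refine ⟨t + (1 + 1), _, by omega, .seq r (.seq (.const 51 0 _ (by simp)) (.arith .add x 50 51 _ ?_)),
    ?_⟩
  · rw [h2]; exact hB
  · intro a ha
    rw [h2]
    funext j
    have h3 : a ≠ 51 := by rintro rfl; exact ha (by decide)
    simp only [Mem.write_apply, h3, false_and, if_false]
    rw [hf a (by unfold IsTemp at ha; omega), h₁ a ha]

theorem Exec.put {B : ℕ} {a : ℕ} {i e : Exp} {m : Mem} (hwi : i.wf) (hdi : i.depth ≤ 50)
    (hsi : i.Safe B m) (hw : e.wf) (hd : e.depth ≤ 49)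
    (hs : e.Safe B m) (hB : |e.eval m| ≤ (B : ℤ)) :
    Exec B (put a i e) m (i.cost + e.cost + 1) (m.write a (i.eval m).toNat (e.eval m)) := by
  intro m₁ h₁
  obtain ⟨t, m₂, ht, r, hv, hf⟩ := Exp.code_runs i 50 m₁ h₁ hwi le_rfl (by omega) hsi
  have he₂ : Eqv m m₂ := fun x hx => by
    rw [h₁ x hx, hf x]; unfold IsTemp at hx; omega
  obtain ⟨t', m₃, ht', r', hv', hf'⟩ := Exp.code_runs e 51 m₂ he₂ hw (by omega) (by omega) hs
  have h50 : m₃ 50 0 = i.eval m := by rw [hf' 50 (by omega), hv]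
  refine ⟨t + (t' + 1), _, by omega, .seq r (.seq r' (.store a 50 51 _ ?_)), ?_⟩
  · rw [hv']; exact hB
  · intro b hb
    rw [h50, hv']
    funext j
    simp only [Mem.write_apply]
    rw [hf' b (by unfold IsTemp at hb; omega), hf b (by unfold IsTemp at hb; omega), h₁ b hb]

theorem Exec.cond {B : ℕ} {e : Exp} {p r : Prog} {m m' : Mem} {τ : ℕ} (hw : e.wf)
    (hd : e.depth ≤ 50) (hs : e.Safe B m) (hp : e.eval m ≠ 0 → Exec B p m τ m')
    (hr : e.eval m = 0 → Exec B r m τ m') : Exec B (cond e p r) m (e.cost + 1 + τ) m' := by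
  intro m₁ h₁
  obtain ⟨t, m₂, ht, r₂, hv, hf⟩ := Exp.code_runs e 50 m₁ h₁ hw le_rfl (by omega) hs
  have he₂ : Eqv m m₂ := fun x hx => by
    rw [h₁ x hx, hf x]; unfold IsTemp at hx; omega
  by_cases h0 : e.eval m = 0
  · obtain ⟨t', m₃, ht', r₃, he₃⟩ := hr h0 m₂ he₂
    exact ⟨t + (t' + 1), m₃, by omega, .seq r₂ (.branchFalse (by rw [hv, h0]) r₃), he₃⟩
  · obtain ⟨t', m₃, ht', r₃, he₃⟩ := hp h0 m₂ he₂
    exact ⟨t + (t' + 1), m₃, by omega, .seq r₂ (.branchTrue (by rwa [hv]) r₃), he₃⟩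

theorem Exec.while_false {B : ℕ} {e : Exp} {p : Prog} {m : Mem} (hw : e.wf)
    (hd : e.depth ≤ 50) (hs : e.Safe B m) (h0 : e.eval m = 0) :
    Exec B (while_ e p) m (e.cost + 1) m := by
  intro m₁ h₁
  obtain ⟨t, m₂, ht, r₂, hv, hf⟩ := Exp.code_runs e 50 m₁ h₁ hw le_rfl (by omega) hs
  refine ⟨t + 1, m₂, by omega, .seq r₂ (.loopFalse (by rw [hv, h0])), fun x hx => ?_⟩
  rw [h₁ x hx, hf x]; unfold IsTemp at hx; omega

theorem Exec.while_true {B : ℕ} {e : Exp} {p : Prog} {m m' m'' : Mem} {τ τ' : ℕ} (hw : e.wf)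
    (hd : e.depth ≤ 50) (hs : e.Safe B m) (h0 : e.eval m ≠ 0) (hp : Exec B p m τ m')
    (h : Exec B (while_ e p) m' τ' m'') :
    Exec B (while_ e p) m (e.cost + 1 + τ + τ') m'' := by
  intro m₁ h₁
  obtain ⟨t, m₂, ht, r₂, hv, hf⟩ := Exp.code_runs e 50 m₁ h₁ hw le_rfl (by omega) hs
  have he₂ : Eqv m m₂ := fun x hx => by
    rw [h₁ x hx, hf x]; unfold IsTemp at hx; omega
  obtain ⟨t', m₃, ht', r₃, he₃⟩ := hp m₂ he₂
  obtain ⟨s, m₄, hs', r₄, he₄⟩ := h m₃ he₃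
  cases r₄ with
  | @seq _ _ _ n₁ _ s₁ s₂ ra rb =>
    exact ⟨t + ((t' + s₁) + s₂ + 1), m₄, by omega,
      .seq r₂ (.loopTrue (by rwa [hv]) (.seq r₃ ra) rb), he₄⟩

/-! ### A calculus of total correctness with running times -/

/-- Operations whose result is polynomial in the arguments. -/
def BinOp.simple : BinOp → Bool
  | add | sub | mul | div | mod | lt | eq => true
  | _ => false

theorem BinOp.abs_eval_le {o : BinOp} (ho : o.simple) {x y : ℤ} {a b V : ℕ} (hV : 2 ≤ V)
    (ha : 1 ≤ a) (hb : 1 ≤ b) (hx : |x| ≤ (V : ℤ) ^ a) (hy : |y| ≤ (V : ℤ) ^ b) :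
    |o.eval x y| ≤ (V : ℤ) ^ (a + b) := by
  have hV' : (2 : ℤ) ≤ V := by exact_mod_cast hV
  have h1 : (2 : ℤ) ≤ (V : ℤ) ^ a := hV'.trans (le_self_pow₀ (by omega) (by omega))
  have h2 : (2 : ℤ) ≤ (V : ℤ) ^ b := hV'.trans (le_self_pow₀ (by omega) (by omega))
  rw [pow_add]
  generalize (V : ℤ) ^ a = p at *
  generalize (V : ℤ) ^ b = q at *
  have hpq : p + q ≤ p * q := by nlinarith
  have hp : p ≤ p * q := by nlinarith
  have h01 : (1 : ℤ) ≤ p * q := by nlinarith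
  cases o <;> simp only [BinOp.simple, Bool.false_eq_true] at ho <;> simp only [BinOp.eval]
  · exact (abs_add_le x y).trans (by linarith)
  · exact (abs_sub x y).trans (by linarith)
  · rw [abs_mul]; exact mul_le_mul hx hy (abs_nonneg _) (by linarith)
  · exact (Int.abs_ediv_le_abs x y).trans (by linarith)
  · rcases eq_or_ne y 0 with rfl | h
    · simpa using hx.trans hp
    · rw [abs_of_nonneg (Int.emod_nonneg _ h)]
      have := Int.emod_lt_abs x h
      nlinarith
  · split_ifs <;> simp <;> linarith
  · split_ifs <;> simp <;> linarith

namespace Exp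

/-- No scratch variables, simple operations and small constants only. -/
def ok : Exp → Bool
  | v x => !decide (IsTemp x)
  | c z => decide (z.natAbs ≤ 100)
  | op o a b => o.simple && a.ok && b.ok
  | ld a e => !decide (IsTemp a) && e.ok
  | ite e a b => e.ok && a.ok && b.ok

/-- The decidable conditions under which the rules below apply to an expression. -/
def chk (e : Exp) : Bool :=
  e.ok && decide (e.depth ≤ 40) && decide (e.size ≤ 500) && decide (e.cost ≤ 990)

theorem one_le_size (e : Exp) : 1 ≤ e.size := by
  induction e <;> simp_all [size] <;> omega

theorem wf_of_ok : ∀ e : Exp, e.ok → e.wf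
  | v x, h => by simpa [ok, wf] using h
  | c _, _ => trivial
  | op o a b, h => by
      simp only [ok, Bool.and_eq_true] at h
      exact ⟨wf_of_ok a h.1.2, wf_of_ok b h.2⟩
  | ld a e, h => by
      simp only [ok, Bool.and_eq_true] at h
      exact ⟨by simpa using h.1, wf_of_ok e h.2⟩
  | ite e a b, h => by
      simp only [ok, Bool.and_eq_true] at h
      exact ⟨wf_of_ok e h.1.1, wf_of_ok a h.1.2, wf_of_ok b h.2⟩

end Exp

/-- All words outside of the scratch variables are at most `V` in absolute value. -/
def Bdd (V : ℕ) (m : Mem) : Prop := ∀ a, ¬ IsTemp a → ∀ i, |m a i| ≤ (V : ℤ)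

theorem Bdd.write {V : ℕ} {m : Mem} (h : Bdd V m) (a i : ℕ) {v : ℤ} (hv : |v| ≤ (V : ℤ)) :
    Bdd V (m.write a i v) := by
  intro b hb j
  rw [Mem.write_apply]
  split_ifs
  · exact hv
  · exact h b hb j

theorem Exp.abs_eval_le {V : ℕ} {m : Mem} (hV : 100 ≤ V) (hm : Bdd V m) :
    ∀ e : Exp, e.ok → |e.eval m| ≤ (V : ℤ) ^ e.size
  | v x, h => by
      simp only [eval, size, pow_one]; exact hm x (by simpa [ok] using h) 0
  | c z, h => by
      simp only [ok, decide_eq_true_eq] at h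
      simp only [eval, size, pow_one, Int.abs_eq_natAbs]; omega
  | op o a b, h => by
      simp only [ok, Bool.and_eq_true] at h
      exact BinOp.abs_eval_le h.1.1 (by omega) a.one_le_size b.one_le_size
        (abs_eval_le hV hm a h.1.2) (abs_eval_le hV hm b h.2)
  | ld a e, h => by
      simp only [ok, Bool.and_eq_true] at h
      have h1 : (V : ℤ) ≤ (V : ℤ) ^ e.size :=
        le_self_pow₀ (by exact_mod_cast (by omega : 1 ≤ V)) (by have := e.one_le_size; omega)
      exact (hm a (by simpa using h.1) _).trans h1
  | ite e a b, h => by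
      simp only [ok, Bool.and_eq_true] at h
      have hV1 : (1 : ℤ) ≤ V := by exact_mod_cast (by omega : 1 ≤ V)
      simp only [eval, size]
      split_ifs
      · exact (abs_eval_le hV hm a h.1.2).trans (pow_le_pow_right₀ hV1 (by omega))
      · exact (abs_eval_le hV hm b h.2).trans (pow_le_pow_right₀ hV1 (by omega))

theorem Exp.safe_of_ok {V s : ℕ} {m : Mem} (hV : 100 ≤ V) (hm : Bdd V m) :
    ∀ e : Exp, e.ok → e.size ≤ s → e.Safe (V ^ s) m := by
  have hV1 : (1 : ℤ) ≤ V := by exact_mod_cast (by omega : 1 ≤ V)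
  have key : ∀ e : Exp, e.ok → e.size ≤ s → |e.eval m| ≤ ((V ^ s : ℕ) : ℤ) := fun e h hs => by
    push_cast
    exact (abs_eval_le hV hm e h).trans (pow_le_pow_right₀ hV1 hs)
  intro e
  induction e with
  | v x => exact fun h hs => key _ h hs
  | c z => exact fun h hs => key _ h hs
  | op o a b iha ihb =>
    intro h hs
    have h' := h
    simp only [ok, Bool.and_eq_true] at h'
    have hs' := hs
    simp only [size] at hs'
    exact ⟨iha h'.1.2 (by omega), ihb h'.2 (by omega), key _ h hs⟩
  | ld a e ih =>
    intro h hs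
    have h' := h
    simp only [ok, Bool.and_eq_true] at h'
    exact ⟨ih h'.2 hs, key _ h hs⟩
  | ite e a b ih iha ihb =>
    intro h hs
    simp only [ok, Bool.and_eq_true] at h
    simp only [size] at hs
    exact ⟨ih h.1.1 (by omega), fun _ => iha h.1.2 (by omega), fun _ => ihb h.2 (by omega)⟩

theorem Exp.chk_spec {V : ℕ} {m : Mem} {e : Exp} (hV : 100 ≤ V) (hm : Bdd V m) (h : e.chk) :
    e.wf ∧ e.depth ≤ 40 ∧ e.cost ≤ 990 ∧ e.Safe (V ^ 500) m := by
  simp only [chk, Bool.and_eq_true, decide_eq_true_eq] at h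
  exact ⟨wf_of_ok e h.1.1.1, h.1.1.2, h.2, safe_of_ok hV hm e h.1.1.1 h.1.2⟩

/-- From a memory `m` that is bounded by `V`, the program `p` leads to a memory that is bounded by
`V` and, together with a bound for the running time, satisfies `Q`; the intermediate words are
bounded by `V ^ 500`. -/
def Ex (V : ℕ) (p : Prog) (m : Mem) (Q : ℕ → Mem → Prop) : Prop :=
  Bdd V m → ∃ τ m', Exec (V ^ 500) p m τ m' ∧ Bdd V m' ∧ Q τ m'

section rules

variable {V : ℕ} {p r : Prog} {m : Mem} {Q Q' : ℕ → Mem → Prop}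

theorem Ex.intro (h : Bdd V m → Ex V p m Q) : Ex V p m Q := fun hb => h hb hb

theorem Ex.imp (h : Ex V p m Q) (hQ : ∀ τ m', Bdd V m' → Q τ m' → Q' τ m') : Ex V p m Q' :=
  fun hb => let ⟨τ, m', h1, h2, h3⟩ := h hb; ⟨τ, m', h1, h2, hQ τ _ h2 h3⟩

theorem Ex.of_seq (h : Ex V p m fun τ m' => Ex V r m' fun τ' m'' => Q (τ + τ') m'') :
    Ex V (.seq p r) m Q := fun hb =>
  let ⟨τ, _, h1, h2, h3⟩ := h hb
  let ⟨τ', m'', h4, h5, h6⟩ := h3 h2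
  ⟨τ + τ', m'', h1.seq h4, h5, h6⟩

theorem le_pow_fivehundred {V : ℕ} {z : ℤ} (h : |z| ≤ (V : ℤ)) : |z| ≤ ((V ^ 500 : ℕ) : ℤ) :=
  h.trans (by exact_mod_cast Nat.le_self_pow (by norm_num) V)

theorem Ex.of_assign {x : ℕ} {e : Exp} (hV : 100 ≤ V) (hc : e.chk) (he : |e.eval m| ≤ (V : ℤ))
    (hQ : Q 1000 (m.write x 0 (e.eval m))) : Ex V (assign x e) m Q := fun hb =>
  have ⟨h1, h2, h3, h4⟩ := Exp.chk_spec hV hb hc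
  ⟨1000, _, (Exec.assign h1 (by omega) h4 (le_pow_fivehundred he)).mono (by omega),
    hb.write _ _ he, hQ⟩

theorem Ex.of_put {a : ℕ} {i e : Exp} (hV : 100 ≤ V) (hi : i.chk) (hc : e.chk)
    (he : |e.eval m| ≤ (V : ℤ)) (hQ : Q 2000 (m.write a (i.eval m).toNat (e.eval m))) :
    Ex V (put a i e) m Q := fun hb =>
  have ⟨h1, h2, h3, h4⟩ := Exp.chk_spec hV hb hc
  have ⟨h1', h2', h3', h4'⟩ := Exp.chk_spec hV hb hi
  ⟨2000, _, (Exec.put h1' (by omega) h4' h1 (by omega) h4 (le_pow_fivehundred he)).mono (by omega),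
    hb.write _ _ he, hQ⟩

/-- The rule for loops. The invariant `I i t` holds after `i` iterations, where `t` bounds the time
that they have taken. -/
theorem Ex.of_for {x : ℕ} {e : Exp} {n : ℕ} (hV : 100 ≤ V) (I : ℕ → ℕ → Mem → Prop) (hc : e.chk)
    (hx : ¬ IsTemp x) (hn : n ≤ V) (h0 : I 0 0 (m.write x 0 0))
    (hev : ∀ i t m', i ≤ n → I i t m' → m' x 0 = i ∧ e.eval m' = n)
    (hstep : ∀ i t m', i < n → I i t m' → Bdd V m' → Ex V p m' fun t' m'' =>
      m'' x 0 = i ∧ I (i + 1) (t + t') (m''.write x 0 ((i + 1 : ℕ) : ℤ)))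
    (hQ : ∀ t m', I n t m' → Q (t + (n + 1) * 1200) m') : Ex V (for_ x e p) m Q := by
  have hV' : (100 : ℤ) ≤ V := by exact_mod_cast hV
  have hxo : (Exp.v x).ok := by simp [Exp.ok, hx]
  have main : ∀ k i t m', i + k = n → I i t m' → Bdd V m' → ∃ τ m'' t',
      Exec (V ^ 500) (while_ (.op .lt (.v x) e) (.seq p (WordRAM.assign x (.op .add (.v x) (.c 1))))) m' τ m'' ∧
      Bdd V m'' ∧ I n t' m'' ∧ t + τ ≤ t' + (k + 1) * 1100 := by
    intro k
    induction k with
    | zero =>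
      intro i t m' hi hI hb
      obtain ⟨h1, h2, h3, h4⟩ := Exp.chk_spec hV hb hc
      obtain ⟨hx1, he1⟩ := hev i t m' (by omega) hI
      refine ⟨_, m', t, Exec.while_false ⟨hx, h1⟩ (by simp [Exp.depth]; omega) ⟨?_, h4, ?_⟩ ?_, hb,
        by rwa [← show i = n by omega], ?_⟩
      · exact le_pow_fivehundred (hb x hx 0)
      · refine le_pow_fivehundred ?_
        simp only [BinOp.eval]
        split_ifs
        · simp; omega
        · simp
      · simp [Exp.eval, BinOp.eval, hx1, he1]; omega
      · simp [Exp.cost]; omega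
    | succ k ih =>
      intro i t m' hi hI hb
      obtain ⟨h1, h2, h3, h4⟩ := Exp.chk_spec hV hb hc
      obtain ⟨hx1, he1⟩ := hev i t m' (by omega) hI
      obtain ⟨τ₁, m₁, e₁, b₁, hx₁, I₁⟩ := hstep i t m' (by omega) hI hb hb
      have hev1 : Exp.eval m₁ (.op .add (.v x) (.c 1)) = ((i + 1 : ℕ) : ℤ) := by
        simp [Exp.eval, BinOp.eval, hx₁]
      have hle : |(((i + 1 : ℕ) : ℤ))| ≤ (V : ℤ) := by
        rw [abs_of_nonneg (by positivity)]; exact_mod_cast (by omega : i + 1 ≤ V)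
      have ha := Exec.assign (B := V ^ 500) (x := x) (e := .op .add (.v x) (.c 1)) (m := m₁)
        ⟨hx, trivial⟩ (by simp [Exp.depth])
        ⟨le_pow_fivehundred (b₁ x hx 0), le_pow_fivehundred (by simp; omega), by
          have := le_pow_fivehundred hle
          rwa [← hev1] at this⟩ (by rw [hev1]; exact le_pow_fivehundred hle)
      rw [hev1] at ha
      obtain ⟨τ₂, m₂, t₂, e₂, b₂, I₂, ht₂⟩ := ih (i + 1) _ _ (by omega) I₁ (b₁.write _ _ hle)
      refine ⟨_, m₂, t₂, Exec.while_true ⟨hx, h1⟩ (by simp [Exp.depth]; omega) ⟨?_, h4, ?_⟩ ?_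
        (e₁.seq ha) e₂, b₂, I₂, ?_⟩
      · exact le_pow_fivehundred (hb x hx 0)
      · refine le_pow_fivehundred ?_
        simp only [BinOp.eval]
        split_ifs
        · simp; omega
        · simp
      · simp [Exp.eval, BinOp.eval, hx1, he1]; omega
      · simp [Exp.cost]; omega
  intro hb
  have h0' := Exec.assign (B := V ^ 500) (x := x) (e := .c 0) (m := m) trivial
    (by simp [Exp.depth]) (by simp [Exp.Safe]) (by simp [Exp.eval])
  obtain ⟨τ, m', t', h1, h2, h3, h4⟩ := main n 0 0 _ (by omega) h0 (hb.write x 0 (by simp))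
  refine ⟨t' + (n + 1) * 1200, m', (h0'.seq h1).mono ?_, h2, hQ _ _ h3⟩
  simp [Exp.cost]; omega

/-- A loop `for x = 0, …, n - 1 do a[off + x] := f x`. -/
theorem Ex.of_fill {x a : ℕ} {ec ei ev : Exp} {n off : ℕ} (f : ℕ → ℤ) (hV : 100 ≤ V) (hx : ¬ IsTemp x)
    (hxa : x ≠ a) (hcc : ec.chk) (hci : ei.chk) (hcv : ev.chk) (hn : n ≤ V)
    (hf : ∀ i, i < n → |f i| ≤ (V : ℤ))
    (hec : ∀ m' : Mem, (∀ b, b ≠ a → b ≠ x → m' b = m b) → ec.eval m' = n)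
    (hev : ∀ (i : ℕ) (m' : Mem), i < n → Bdd V m' → (∀ b, b ≠ a → b ≠ x → m' b = m b) → m' x 0 = i →
      (∀ j, m' a j = if off ≤ j ∧ j < off + i then f (j - off) else m a j) →
      ei.eval m' = (off + i : ℕ) ∧ ev.eval m' = f i)
    (hQ : ∀ m', (∀ b, b ≠ a → b ≠ x → m' b = m b) →
      (∀ j, m' a j = if off ≤ j ∧ j < off + n then f (j - off) else m a j) →
      Q (n * 2000 + (n + 1) * 1200) m') : Ex V (for_ x ec (put a ei ev)) m Q := by
  refine Ex.of_for (n := n) hV (fun i t m' => t = i * 2000 ∧ (∀ b, b ≠ a → b ≠ x → m' b = m b) ∧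
    m' x 0 = i ∧ ∀ j, m' a j = if off ≤ j ∧ j < off + i then f (j - off) else m a j)
    hcc hx hn ?_ ?_ ?_ ?_
  · refine ⟨by simp, fun b _ hb => Mem.write_of_ne _ _ _ hb, by simp [Mem.write_self], fun j => ?_⟩
    rw [Mem.write_of_ne _ _ _ hxa.symm, if_neg (by omega)]
  · exact fun i t m' _ h => ⟨h.2.2.1, hec m' h.2.1⟩
  · rintro i t m' hi ⟨ht, h1, h2, h3⟩ hb
    obtain ⟨h4, h5⟩ := hev i m' hi hb h1 h2 h3
    refine Ex.of_put hV hci hcv (by rw [h5]; exact hf i hi) ?_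
    rw [h4, h5, Int.toNat_natCast]
    refine ⟨by rw [Mem.write_of_ne _ _ _ hxa, h2], by rw [ht]; ring, fun b hb hbx => ?_,
      by simp [Mem.write_self], fun j => ?_⟩
    · rw [Mem.write_of_ne _ _ _ hbx, Mem.write_of_ne _ _ _ hb, h1 b hb hbx]
    · rw [Mem.write_of_ne _ _ _ hxa.symm, Mem.write_apply, h3]
      simp only [true_and]
      by_cases hj : j = off + i
      · subst hj; rw [if_pos rfl, if_pos (by omega)]; congr 1; omega
      · rw [if_neg hj]
        refine if_congr ?_ rfl rfl; omega
  · rintro t m' ⟨ht, h1, h2, h3⟩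
    subst ht
    exact hQ m' h1 h3

theorem Ex.of_cond {e : Exp} (hV : 100 ≤ V) (hc : e.chk)
    (hp : e.eval m ≠ 0 → Ex V p m fun τ => Q (τ + 1000))
    (hr : e.eval m = 0 → Ex V r m fun τ => Q (τ + 1000)) : Ex V (cond e p r) m Q := fun hb => by
  obtain ⟨h1, h2, h3, h4⟩ := Exp.chk_spec hV hb hc
  by_cases h0 : e.eval m = 0
  · obtain ⟨τ, m', e₁, b₁, q₁⟩ := hr h0 hb
    exact ⟨_, m', (Exec.cond h1 (by omega) h4 (fun h => absurd h0 h) fun _ => e₁).mono (by omega),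
      b₁, q₁⟩
  · obtain ⟨τ, m', e₁, b₁, q₁⟩ := hp h0 hb
    exact ⟨_, m', (Exec.cond h1 (by omega) h4 (fun _ => e₁) fun h => absurd h h0).mono (by omega),
      b₁, q₁⟩

end rules

/-! ### Simulating a program with a shifted memory and a step counter -/

/-- All words are at most `B` in absolute value and all cells of index above `B` are empty. -/
def WF (B : ℕ) (m : Mem) : Prop := ∀ a i, |m a i| ≤ (B : ℤ) ∧ (B < i → m a i = 0)

theorem WF.write {B : ℕ} {m : Mem} (h : WF B m) {a i : ℕ} {v : ℤ} (hi : i ≤ B)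
    (hv : |v| ≤ (B : ℤ)) : WF B (m.write a i v) := by
  intro b j
  rw [Mem.write_apply]
  split_ifs with hc
  · exact ⟨hv, fun hj => by omega⟩
  · exact h b j

theorem WF.toNat_le {B : ℕ} {m : Mem} (h : WF B m) (a i : ℕ) : (m a i).toNat ≤ B := by
  have := (abs_le.1 (h a i).1).2; omega

/-- With words up to `B`, a program reads and writes cells of index at most `B` only, so that a
simulated memory needs `B + 1` cells of every array. -/
theorem Runs.wf {B : ℕ} {p : Prog} {m m' : Mem} {t : ℕ} (hr : Runs B p m t m') :
    WF B m → WF B m' := by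
  induction hr with
  | const x v m h => exact fun hw => hw.write (Nat.zero_le _) h
  | arith o x y z m h => exact fun hw => hw.write (Nat.zero_le _) h
  | load x a i m h => exact fun hw => hw.write (Nat.zero_le _) h
  | store a i y m h => exact fun hw => hw.write (hw.toNat_le _ _) h
  | seq _ _ h₁ h₂ => exact fun hw => h₂ (h₁ hw)
  | branchTrue hx _ h => exact h
  | branchFalse hx _ h => exact h
  | loopTrue hx _ _ h₁ h₂ => exact fun hw => h₂ (h₁ hw)
  | loopFalse hx => exact id

/-- The memory `mA` of a simulated program is kept in the cells of the arrays `100, 101, …` from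
index `base` on, and its step counter `c` in variable `14`; the remaining cells are those of `M`. -/
def overlay (M : Mem) (base : ℕ) (mA : Mem) (c : ℤ) : Mem := fun a i =>
  if 100 ≤ a ∧ base ≤ i then mA (a - 100) (i - base) else if a = 14 ∧ i = 0 then c else M a i

section overlay

variable (M : Mem) (base : ℕ) (mA : Mem) (c : ℤ)

theorem overlay_sim (a i : ℕ) : overlay M base mA c (100 + a) (base + i) = mA a i := by
  simp [overlay]

theorem overlay_own {a : ℕ} (ha : a < 100) (ha' : a ≠ 14) : overlay M base mA c a = M a := by
  funext i; simp only [overlay]; rw [if_neg (by omega), if_neg (by omega)]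

theorem overlay_counter : overlay M base mA c 14 0 = c := by simp [overlay]

theorem overlay_write_sim (a i : ℕ) (v : ℤ) :
    (overlay M base mA c).write (100 + a) (base + i) v = overlay M base (mA.write a i v) c := by
  funext b j
  simp only [Mem.write_apply, overlay]
  by_cases h : 100 ≤ b ∧ base ≤ j
  · rw [if_pos h, if_pos h]; exact if_congr (by omega) rfl rfl
  · rw [if_neg h, if_neg h, if_neg (by omega)]

theorem overlay_write_counter (c' : ℤ) :
    (overlay M base mA c).write 14 0 c' = overlay M base mA c' := by
  funext b j
  simp only [Mem.write_apply, overlay]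
  split_ifs <;> first | rfl | omega

end overlay

/-- `M` holds the simulated memory `mA` at `base`. -/
def Sim (base : ℕ) (mA M : Mem) : Prop := ∀ a i, M (100 + a) (base + i) = mA a i

theorem Sim.eq_overlay {base : ℕ} {mA M : Mem} (h : Sim base mA M) :
    overlay M base mA (M 14 0) = M := by
  funext a i
  simp only [overlay]
  split_ifs with h1 h2
  · rw [← h]; congr 1 <;> omega
  · rw [h2.1, h2.2]
  · rfl

theorem Sim.write_own {base : ℕ} {mA M : Mem} (h : Sim base mA M) {a : ℕ} (ha : a < 100) (i : ℕ)
    (v : ℤ) : Sim base mA (M.write a i v) := fun b j => by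
  rw [Mem.write_of_ne _ _ _ (by omega)]; exact h b j

theorem Sim.write {base : ℕ} {mA M : Mem} (h : Sim base mA M) (a i : ℕ) (v : ℤ) :
    Sim base (mA.write a i v) (M.write (100 + a) (base + i) v) := fun b j => by
  rw [Mem.write_apply, Mem.write_apply, h]
  exact if_congr (by omega) rfl rfl

/-- Cell `0` of the simulated array `a`. -/
def simVar (a : ℕ) : Exp := .ld (100 + a) (.v 13)

/-- The true index of the cell of a simulated array to which the simulated variable `i` points. -/
def simIdx (i : ℕ) : Exp :=
  .op .add (.v 13) (.op .mul (simVar i) (.op .lt (.c 0) (simVar i)))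

/-- Count a simulated step. -/
def tick : Prog := assign 14 (.op .add (.v 14) (.c 1))

/-- The program that simulates `p` on the memory from index "variable `13`" on and counts the steps
of `p` in variable `14`. -/
def sim : Prog → Prog
  | .const x z => .seq (put (100 + x) (.v 13) (.c z)) tick
  | .arith o x y z => .seq (put (100 + x) (.v 13) (.op o (simVar y) (simVar z))) tick
  | .load x a i => .seq (put (100 + x) (.v 13) (.ld (100 + a) (simIdx i))) tick
  | .store a i y => .seq (put (100 + a) (simIdx i) (simVar y)) tick
  | .seq p r => .seq (sim p) (sim r)
  | .branch x p r => .seq tick (cond (simVar x) (sim p) (sim r))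
  | .loop x p => .seq (while_ (simVar x) (.seq (sim p) tick)) tick

/-- The simulation is faithful, with a slowdown by a factor of 100; the counter increases by the
exact number of simulated steps. -/
theorem sim_exec {B Bw base : ℕ} (hbase : base + B ≤ Bw) {p : Prog} {m m' : Mem} {t : ℕ}
    (hr : Runs B p m t m') : WF B m → ∀ (M : Mem) (c : ℕ), M 13 0 = base → c + t ≤ Bw →
      Exec Bw (sim p) (overlay M base m c) (t * 100) (overlay M base m' (c + t : ℕ)) := by
  have hbw : (base : ℤ) + B ≤ Bw := by exact_mod_cast hbase
  have htick : ∀ (M m : Mem) (c : ℕ), c + 1 ≤ Bw →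
      Exec Bw tick (overlay M base m c) 6 (overlay M base m (c + 1 : ℕ)) := by
    intro M m c hc
    have hv : Exp.eval (overlay M base m c) (.op .add (.v 14) (.c 1)) = ((c + 1 : ℕ) : ℤ) := by
      simp [Exp.eval, BinOp.eval, overlay_counter]
    have hc' : |((c + 1 : ℕ) : ℤ)| ≤ Bw := by
      rw [abs_of_nonneg (by positivity)]; exact_mod_cast hc
    have := Exec.assign (B := Bw) (x := 14) (e := .op .add (.v 14) (.c 1)) (m := overlay M base m c)
      ⟨(by decide : ¬ IsTemp 14), trivial⟩ (by decide) ⟨?_, ?_, ?_⟩ (by rw [hv]; exact hc')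
    · rw [hv, overlay_write_counter] at this; exact this
    · simp only [Exp.Safe, overlay_counter]; simp; omega
    · simp only [Exp.Safe]; simp; omega
    · have h2 := hc'
      rw [← hv] at h2; exact h2
  -- the values of the expressions that occur
  have hown : ∀ (M m : Mem) (c : ℤ), M 13 0 = base → overlay M base m c 13 0 = base :=
    fun M m c h => by rw [overlay_own _ _ _ _ (by norm_num) (by norm_num), h]
  have hvar : ∀ (M m : Mem) (c : ℤ) (a : ℕ), M 13 0 = base →
      (simVar a).eval (overlay M base m c) = m a 0 := fun M m c a h => by
    have := overlay_sim M base m c a 0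
    simp only [simVar, Exp.eval, hown M m c h, Int.toNat_natCast]
    simpa using this
  have hidx : ∀ (M m : Mem) (c : ℤ) (i : ℕ), M 13 0 = base →
      (simIdx i).eval (overlay M base m c) = (base + (m i 0).toNat : ℕ) := fun M m c i h => by
    have h1 := hvar M m c i h
    have h2 : (simIdx i).eval (overlay M base m c) =
        BinOp.add.eval (overlay M base m c 13 0) (BinOp.mul.eval
          ((simVar i).eval (overlay M base m c))
          (BinOp.lt.eval 0 ((simVar i).eval (overlay M base m c)))) := rfl
    rw [h2, h1, hown M m c h]
    simp only [BinOp.eval]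
    by_cases h5 : 0 < m i 0
    · rw [if_pos h5]; push_cast; rw [Int.toNat_of_nonneg h5.le, mul_one]
    · rw [if_neg h5, Int.toNat_of_nonpos (by omega)]; simp
  have hbs : |(base : ℤ)| ≤ Bw := by rw [abs_of_nonneg (by positivity)]; omega
  have hBs : ∀ z : ℤ, |z| ≤ (B : ℤ) → |z| ≤ Bw := fun z hz => hz.trans (by omega)
  have swf : ∀ a, (simVar a).wf := fun a => ⟨by unfold IsTemp; omega, (by decide : ¬ IsTemp 13)⟩
  have iwf : ∀ a, (simIdx a).wf := fun a => ⟨(by decide : ¬ IsTemp 13), swf a, trivial, swf a⟩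
  have bsafe : ∀ (M m : Mem) (c : ℤ), M 13 0 = base →
      Exp.Safe Bw (overlay M base m c) (.v 13) := fun M m c h => by
    simp only [Exp.Safe, hown M m c h]; exact hbs
  have ssafe : ∀ (M m : Mem) (c : ℤ) (a : ℕ), M 13 0 = base → WF B m →
      (simVar a).Safe Bw (overlay M base m c) := fun M m c a h hw => by
    have h1 := hvar M m c a h
    refine ⟨bsafe M m c h, ?_⟩
    simp only [simVar, Exp.eval] at h1
    simp only [Exp.eval]
    rw [h1]; exact hBs _ (hw a 0).1
  have isafe : ∀ (M m : Mem) (c : ℤ) (a : ℕ), M 13 0 = base → WF B m →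
      (simIdx a).Safe Bw (overlay M base m c) := fun M m c a h hw => by
    have h1 := hvar M m c a h
    have h2 := hidx M m c a h
    have h3 := hw.toNat_le a 0
    have h4 := (hw a 0).1
    refine ⟨bsafe M m c h, ⟨ssafe M m c a h hw, ⟨by simp [Exp.Safe], ssafe M m c a h hw, ?_⟩, ?_⟩, ?_⟩
    · simp only [Exp.eval, BinOp.eval, h1]
      split_ifs with h5
      · have := h4; rw [abs_of_pos h5] at this; simp; omega
      · simp
    · simp only [Exp.eval, BinOp.eval, h1]
      split_ifs with h5
      · simpa using hBs _ h4
      · simp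
    · change |(simIdx a).eval _| ≤ _
      rw [h2, abs_of_nonneg (by positivity)]; push_cast; omega
  have hput0 : ∀ (M m : Mem) (c : ℕ) (x : ℕ) (e : Exp) (z : ℤ), M 13 0 = base → e.wf → e.depth ≤ 49 →
      e.Safe Bw (overlay M base m c) → e.eval (overlay M base m c) = z → |z| ≤ (B : ℤ) → c + 1 ≤ Bw →
      e.cost ≤ 50 → Exec Bw (.seq (put (100 + x) (.v 13) e) tick) (overlay M base m c) 100
        (overlay M base (m.write x 0 z) (c + 1 : ℕ)) := by
    intro M m c x e z hM hw hd hs hz hzB hc hcost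
    have h1 := Exec.put (B := Bw) (a := 100 + x) (i := .v 13) (e := e) (m := overlay M base m c)
      (by decide : ¬ IsTemp 13) (by decide) (bsafe M m c hM) hw hd hs (by rw [hz]; exact hBs z hzB)
    simp only [hz, Exp.eval, hown M m c hM, Int.toNat_natCast] at h1
    have h2 := overlay_write_sim M base m c x 0 z
    rw [add_zero] at h2
    rw [h2] at h1
    exact (h1.seq (htick M _ c hc)).mono (by simp [Exp.cost]; omega)
  induction hr with
  | const x z m h =>
    intro hw M c hM hc
    exact hput0 M m c x _ z hM trivial (by simp [Exp.depth]) (hBs z h) rfl h hc (by simp [Exp.cost])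
  | arith o x y z m h =>
    intro hw M c hM hc
    have hv : Exp.eval (overlay M base m c) (.op o (simVar y) (simVar z)) =
        o.eval (m y 0) (m z 0) := by
      rw [← hvar M m c y hM, ← hvar M m c z hM]; rfl
    refine hput0 M m c x _ _ hM ⟨swf y, swf z⟩ (by simp [simVar, Exp.depth])
      ⟨ssafe M m c y hM hw, ssafe M m c z hM hw, ?_⟩ hv h hc (by simp [simVar, Exp.cost])
    rw [hvar M m c y hM, hvar M m c z hM]; exact hBs _ h
  | load x a i m h =>
    intro hw M c hM hc
    have hv : Exp.eval (overlay M base m c) (.ld (100 + a) (simIdx i)) = m a (m i 0).toNat := by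
      have := hidx M m c i hM
      simp only [Exp.eval] at this ⊢
      rw [this, Int.toNat_natCast, overlay_sim]
    refine hput0 M m c x _ _ hM ⟨by unfold IsTemp; omega, iwf i⟩ (by simp [simVar, simIdx, Exp.depth])
      ⟨isafe M m c i hM hw, ?_⟩ hv h hc (by simp [simVar, simIdx, Exp.cost])
    have h1 := hBs _ h
    rw [← hv] at h1
    exact h1
  | store a i y m h =>
    intro hw M c hM hc
    have h1 := Exec.put (B := Bw) (a := 100 + a) (i := simIdx i) (e := simVar y)
      (m := overlay M base m c) (iwf i) (by simp [simVar, simIdx, Exp.depth]) (isafe M m c i hM hw)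
      (swf y) (by simp [simVar, Exp.depth]) (ssafe M m c y hM hw)
      (by rw [hvar M m c y hM]; exact hBs _ h)
    rw [hidx M m c i hM, hvar M m c y hM, Int.toNat_natCast, overlay_write_sim] at h1
    exact (h1.seq (htick M _ c hc)).mono (by simp [simVar, simIdx, Exp.cost])
  | seq h₁ h₂ ih₁ ih₂ =>
    intro hw M c hM hc
    have := (ih₁ hw M c hM (by omega)).seq (ih₂ (h₁.wf hw) M _ hM (by omega))
    rw [add_assoc] at this
    exact this.mono (by omega)
  | @branchTrue x p r m m₁ t hx h ih =>
    intro hw M c hM hc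
    have h1 := ih hw M (c + 1) hM (by omega)
    rw [show c + 1 + t = c + (t + 1) by omega] at h1
    refine ((htick M m c (by omega)).seq (Exec.cond (swf x) (by simp [simVar, Exp.depth])
      (ssafe M m _ x hM hw) (fun _ => h1) fun h0 => absurd ?_ hx)).mono (by simp [simVar, Exp.cost]; omega)
    rwa [hvar M m _ x hM] at h0
  | @branchFalse x p r m m₁ t hx h ih =>
    intro hw M c hM hc
    have h1 := ih hw M (c + 1) hM (by omega)
    rw [show c + 1 + t = c + (t + 1) by omega] at h1
    refine ((htick M m c (by omega)).seq (Exec.cond (swf x) (by simp [simVar, Exp.depth])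
      (ssafe M m _ x hM hw) (fun h0 => absurd hx ?_) (fun _ => h1))).mono (by simp [simVar, Exp.cost]; omega)
    rwa [hvar M m _ x hM] at h0
  | @loopFalse x p m hx =>
    intro hw M c hM hc
    refine ((Exec.while_false (swf x) (by simp [simVar, Exp.depth])
      (ssafe M m _ x hM hw) ?_).seq (htick M m c hc)).mono (by simp [simVar, Exp.cost])
    rw [hvar M m _ x hM, hx]
  | @loopTrue x p m m₁ m₂ t₁ t₂ hx h₁ h₂ ih₁ ih₂ =>
    intro hw M c hM hc m₀ he₀
    have hp := (ih₁ hw M c hM (by omega)).seq (htick M m₁ (c + t₁) (by omega))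
    have hl := ih₂ (h₁.wf hw) M (c + t₁ + 1) hM (by omega)
    -- split the run of the remaining iterations into the loop and the final tick
    have hx' : Exp.eval (overlay M base m c) (simVar x) ≠ 0 := by rwa [hvar M m _ x hM]
    obtain ⟨s₀, n₀, hs₀, r₀, v₀, f₀⟩ := Exp.code_runs (simVar x) 50 m₀ he₀ (swf x) le_rfl
      (by simp [simVar, Exp.depth]) (ssafe M m _ x hM hw)
    have he₁ : Eqv (overlay M base m c) n₀ := fun y hy => by
      rw [he₀ y hy, f₀ y]; unfold IsTemp at hy; omega
    obtain ⟨s₁, n₁, hs₁, r₁, e₁⟩ := hp n₀ he₁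
    obtain ⟨s₂, n₂, hs₂, r₂, e₂⟩ := hl n₁ e₁
    cases r₂ with
    | @seq _ _ _ k₁ _ a₁ a₂ ra rb =>
      cases ra with
      | @seq _ _ _ k₂ _ b₁ b₂ rc rd =>
        refine ⟨s₀ + (s₁ + b₁ + b₂ + 1) + a₂, n₂, ?_,
          .seq (.seq r₀ (.loopTrue (by rwa [v₀]) (.seq r₁ rc) rd)) rb, ?_⟩
        · simp [simVar, Exp.cost] at hs₀; omega
        · rwa [show c + t₁ + 1 + t₂ = c + (t₁ + t₂ + 1) by omega] at e₂

end WordRAM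

namespace DynAPSP

open WordRAM

/-! ### Planarity of grid graphs -/

/-- `a` and `b` are neighbours in the infinite square grid. -/
def GridAdj (a b : ℕ × ℕ) : Prop :=
  (a.1 = b.1 ∧ (a.2 + 1 = b.2 ∨ b.2 + 1 = a.2)) ∨ (a.2 = b.2 ∧ (a.1 + 1 = b.1 ∨ b.1 + 1 = a.1))

theorem IsPlanar.mono {V : Type} {G H : SimpleGraph V} (h : G ≤ H) (hH : IsPlanar H) :
    IsPlanar G := by
  obtain ⟨pos, arc, h1, h2, h3, h4⟩ := hH
  have h' : ∀ e, e ∈ G.edgeSet → e ∈ H.edgeSet := fun e he => SimpleGraph.edgeSet_mono h he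
  exact ⟨pos, arc, h1, fun e he => h2 e (h' e he), fun e he => h3 e (h' e he),
    fun e he f hf => h4 e (h' e he) f (h' f hf)⟩

/-- Subgraphs of the square grid are planar: draw the edges as straight segments. -/
theorem isPlanar_of_gridAdj {V : Type} {G : SimpleGraph V} {pos : V → ℕ × ℕ}
    (hpos : Function.Injective pos) (hadj : ∀ u v, G.Adj u v → GridAdj (pos u) (pos v)) :
    IsPlanar G := by
  classical
  -- every edge is a unit segment going right or up from its first end
  have hends : ∀ e : Sym2 V, ∃ uv : V × V, e ∈ G.edgeSet → e = s(uv.1, uv.2) ∧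
      (((pos uv.2).1 = (pos uv.1).1 + 1 ∧ (pos uv.2).2 = (pos uv.1).2) ∨
       ((pos uv.2).1 = (pos uv.1).1 ∧ (pos uv.2).2 = (pos uv.1).2 + 1)) := by
    intro e
    induction e using Sym2.ind with
    | _ u v =>
      by_cases h : G.Adj u v
      · rcases hadj u v h with ⟨h1, h2 | h2⟩ | ⟨h1, h2 | h2⟩
        · exact ⟨(u, v), fun _ => ⟨rfl, .inr ⟨h1.symm, h2.symm⟩⟩⟩
        · exact ⟨(v, u), fun _ => ⟨Sym2.eq_swap, .inr ⟨h1, h2.symm⟩⟩⟩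
        · exact ⟨(u, v), fun _ => ⟨rfl, .inl ⟨h2.symm, h1.symm⟩⟩⟩
        · exact ⟨(v, u), fun _ => ⟨Sym2.eq_swap, .inl ⟨h2.symm, h1⟩⟩⟩
      · exact ⟨(u, v), fun h' => absurd h' h⟩
  choose d hd using hends
  let P : V → ℂ := fun v => ⟨(pos v).1, (pos v).2⟩
  let arc : Sym2 V → C(unitInterval, ℂ) := fun e =>
    ⟨fun t => P (d e).1 + (t : ℝ) * (P (d e).2 - P (d e).1), by fun_prop⟩
  have hre : ∀ e t, (arc e t).re =
      (pos (d e).1).1 + (t : ℝ) * ((pos (d e).2).1 - (pos (d e).1).1) := by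
    intro e t; simp [arc, P]
  have him : ∀ e t, (arc e t).im =
      (pos (d e).1).2 + (t : ℝ) * ((pos (d e).2).2 - (pos (d e).1).2) := by
    intro e t; simp [arc, P]
  have hint : ∀ (t : unitInterval) (a b : ℕ), (a : ℝ) + t = b → t = 0 ∨ t = 1 := by
    intro t a b h
    have h0 := t.2.1
    have h1 := t.2.2
    have ha : (a : ℝ) ≤ b := by linarith
    have hb : (b : ℝ) ≤ a + 1 := by linarith
    have ha' : a ≤ b := by exact_mod_cast ha
    have hb' : b ≤ a + 1 := by exact_mod_cast hb
    rcases (by omega : b = a ∨ b = a + 1) with rfl | rfl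
    · left; apply Subtype.ext; change (t : ℝ) = 0; linarith
    · right; apply Subtype.ext; push_cast at h; change (t : ℝ) = 1; linarith
  have hint' : ∀ (s t : unitInterval) (a b : ℕ), (a : ℝ) + s = b + t → (s = 0 ∨ s = 1) ∨ a = b := by
    intro s t a b h
    by_contra! hc
    obtain ⟨⟨hs0, hs1⟩, hab⟩ := hc
    have h0 : (0 : ℝ) < s := lt_of_le_of_ne s.2.1 fun h => hs0 (Subtype.ext h.symm)
    have h1 : (s : ℝ) < 1 := lt_of_le_of_ne s.2.2 fun h => hs1 (Subtype.ext h)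
    have h0' := t.2.1
    have h1' := t.2.2
    have ha : (a : ℝ) < b + 1 := by linarith
    have hb : (b : ℝ) < a + 1 := by linarith
    have ha' : a < b + 1 := by exact_mod_cast ha
    have hb' : b < a + 1 := by exact_mod_cast hb
    omega
  refine ⟨P, arc, fun u v huv => hpos ?_, fun e he => ⟨fun s t hst => ?_, ?_⟩, fun e he t x htx => ?_,
    fun e he f hf hef s t hst => ?_⟩
  · have h1 := congrArg Complex.re huv
    have h2 := congrArg Complex.im huv
    simp only [P, Nat.cast_inj] at h1 h2
    exact Prod.ext h1 h2
  · have h1 := congrArg Complex.re hst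
    have h2 := congrArg Complex.im hst
    rw [hre, hre] at h1
    rw [him, him] at h2
    rcases (hd e he).2 with ⟨h3, h4⟩ | ⟨h3, h4⟩
    · rw [h3] at h1; push_cast at h1; apply Subtype.ext; linarith
    · rw [h4] at h2; push_cast at h2; apply Subtype.ext; linarith
  · have h0 : arc e 0 = P (d e).1 := by simp [arc]
    have h1 : arc e 1 = P (d e).2 := by simp [arc]
    rw [h0, h1]
    conv_rhs => rw [(hd e he).1]
    rfl
  · have h1 := congrArg Complex.re htx
    have h2 := congrArg Complex.im htx
    rw [hre] at h1
    rw [him] at h2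
    rcases (hd e he).2 with ⟨h3, h4⟩ | ⟨h3, h4⟩
    · rw [h3] at h1; push_cast at h1
      exact hint t (pos (d e).1).1 (pos x).1 (by simp only [P] at h1; linarith)
    · rw [h4] at h2; push_cast at h2
      exact hint t (pos (d e).1).2 (pos x).2 (by simp only [P] at h2; linarith)
  · have h1 := congrArg Complex.re hst
    have h2 := congrArg Complex.im hst
    rw [hre, hre] at h1
    rw [him, him] at h2
    have hne : ∀ u v u' v', e = s(u, v) → f = s(u', v') → pos u = pos u' → pos v = pos v' → False := by
      rintro u v u' v' rfl rfl hu hv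
      rw [hpos hu, hpos hv] at hef
      exact hef rfl
    have hde := (hd e he).1
    have hdf := (hd f hf).1
    rcases (hd e he).2 with ⟨h3, h4⟩ | ⟨h3, h4⟩ <;> rcases (hd f hf).2 with ⟨h5, h6⟩ | ⟨h5, h6⟩
    · rw [h3, h5] at h1; rw [h4, h6] at h2; push_cast at h1 h2
      refine (hint' s t (pos (d e).1).1 (pos (d f).1).1 (by linarith)).resolve_right fun h => ?_
      have h7 : (pos (d e).1).2 = (pos (d f).1).2 := by
        have : ((pos (d e).1).2 : ℝ) = (pos (d f).1).2 := by linarith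
        exact_mod_cast this
      exact hne _ _ _ _ hde hdf (Prod.ext h h7) (Prod.ext (by omega) (by omega))
    · rw [h3, h5] at h1; push_cast at h1
      exact hint s (pos (d e).1).1 (pos (d f).1).1 (by linarith)
    · rw [h4, h6] at h2; push_cast at h2
      exact hint s (pos (d e).1).2 (pos (d f).1).2 (by linarith)
    · rw [h3, h5] at h1; rw [h4, h6] at h2; push_cast at h1 h2
      refine (hint' s t (pos (d e).1).2 (pos (d f).1).2 (by linarith)).resolve_right fun h => ?_
      have h7 : (pos (d e).1).1 = (pos (d f).1).1 := by
        have : ((pos (d e).1).1 : ℝ) = (pos (d f).1).1 := by linarith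
        exact_mod_cast this
      exact hne _ _ _ _ hde hdf (Prod.ext h7 h) (Prod.ext (by omega) (by omega))

/-! ### Distances and walks -/

/-- There is a walk from `u` to `v` of total weight `l`. -/
def WalkOf {V : Type} (G : WGraph V) (u v : V) (l : ℕ) : Prop :=
  ∃ p : G.graph.Walk u v, (p.edges.map G.weight).sum = l

theorem WalkOf.trans {V : Type} {G : WGraph V} {u v w : V} {l l' : ℕ} (h : WalkOf G u v l)
    (h' : WalkOf G v w l') : WalkOf G u w (l + l') := by
  obtain ⟨p, rfl⟩ := h
  obtain ⟨q, rfl⟩ := h'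
  exact ⟨p.append q, by simp [SimpleGraph.Walk.edges_append]⟩

theorem WalkOf.refl {V : Type} (G : WGraph V) (u : V) : WalkOf G u u 0 := ⟨.nil, by simp⟩

theorem WalkOf.edge {V : Type} {G : WGraph V} {u v : V} (h : G.graph.Adj u v) :
    WalkOf G u v (G.weight s(u, v)) := ⟨.cons h .nil, by simp⟩

/-- A walk whose weight is matched by a potential is a shortest path. -/
theorem dist_eq_of_potential {V : Type} {G : WGraph V} {u v : V} {l : ℕ} (h : WalkOf G u v l)
    (φ : V → ℤ) (hφ : ∀ a b, G.graph.Adj a b → φ b ≤ φ a + G.weight s(a, b))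
    (huv : φ v = φ u + l) : G.dist u v = l := by
  have key : ∀ {a b : V} (p : G.graph.Walk a b), φ b ≤ φ a + ((p.edges.map G.weight).sum : ℕ) := by
    intro a b p
    induction p with
    | nil => simp
    | cons hab p ih =>
      have := hφ _ _ hab
      simp only [SimpleGraph.Walk.edges_cons, List.map_cons, List.sum_cons]
      push_cast at ih ⊢
      linarith
  apply le_antisymm
  · obtain ⟨p, hp⟩ := h
    rw [← hp]
    exact iInf_le _ p
  · refine le_iInf fun p => ?_
    have := key p
    rw [huv] at this
    exact_mod_cast (by omega : l ≤ (p.edges.map G.weight).sum)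

/-! ### A grid that encodes a matrix -/

/-- The data of a weighted grid with `x` rows and `4 * y` columns. The columns are split into a left
half, in which column `j` has index `2 * y - 1 - j`, and a right half, in which column `j` has index
`2 * y + j`. The matrix `b` is encoded in the right half; the vector `a` of weights of the edges
between the halves is variable. All entries of `b` lie in `[0, 5 * Ω]`. -/
structure Gadget where
  x : ℕ
  y : ℕ
  Ω : ℕ
  b : ℕ → ℕ → ℤ
  x_pos : 0 < x
  y_pos : 0 < y
  Ω_pos : 0 < Ω
  b_zero : ∀ r, b r 0 = 0
  b_nonneg : ∀ r j, 0 ≤ b r j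
  b_le : ∀ r j, b r j ≤ 5 * Ω

namespace Gadget

variable (g : Gadget)

/-- The number of nodes. -/
def N : ℕ := g.x * (4 * g.y)

/-- The coordinates of a node. -/
def pos (v : ℕ) : ℕ × ℕ := (v / (4 * g.y), v % (4 * g.y))

/-- The full grid. -/
def graph : SimpleGraph (Fin g.N) where
  Adj u v := GridAdj (g.pos u) (g.pos v)
  symm := ⟨fun u v h => by unfold GridAdj at *; omega⟩
  loopless := ⟨fun u h => by unfold GridAdj at h; omega⟩

/-- The slope of the weights in row `r` of the left half. -/
def left (r : ℕ) : ℤ := 6 * g.Ω + 10 * g.Ω * (g.x - 1 - r)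

/-- The slope of the weights in row `r` of the right half. -/
def right (r : ℕ) : ℤ := 6 * g.Ω + 10 * g.Ω * r

/-- The weight of the edge in row `r` between the columns of index `c` and `c + 1`. -/
def hor (a : ℕ → ℤ) (r c : ℕ) : ℤ :=
  if c + 1 < 2 * g.y then g.left r
  else if c + 1 = 2 * g.y then a r
  else g.right r + g.b r (c - 2 * g.y + 1) - g.b r (c - 2 * g.y)

/-- The weight of the edge between two neighbouring positions. -/
def edgeWeight (a : ℕ → ℤ) (p q : ℕ × ℕ) : ℤ :=
  if p.1 = q.1 then g.hor a p.1 (min p.2 q.2) else 10 * g.Ω * g.y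

/-- `G` is the weighted grid with variable weights `a`. -/
def Is (a : ℕ → ℤ) (G : WGraph (Fin g.N)) : Prop :=
  G.graph = g.graph ∧
    ∀ u v, g.graph.Adj u v → (G.weight s(u, v) : ℤ) = g.edgeWeight a (g.pos u) (g.pos v)

/-- The position along row `r`: differences are the lengths of horizontal paths. -/
def pot (a : ℕ → ℤ) (r c : ℕ) : ℤ :=
  if c < 2 * g.y then -(g.left r * (2 * g.y - 1 - c))
  else a r + g.right r * (c - 2 * g.y) + g.b r (c - 2 * g.y)

/-- The positions of the two ends of the variable edge are `0` and `a r`, since `b r 0 = 0`. -/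
theorem hor_eq (a : ℕ → ℤ) (r c : ℕ) : g.hor a r c = g.pot a r (c + 1) - g.pot a r c := by
  unfold hor pot
  by_cases h1 : c + 1 < 2 * g.y
  · rw [if_pos h1, if_pos h1, if_pos (by omega)]; push_cast; ring
  · rw [if_neg h1, if_neg h1]
    by_cases h2 : c + 1 = 2 * g.y
    · rw [if_pos h2, if_pos (by omega)]
      have h3 : (2 * g.y : ℤ) = c + 1 := by exact_mod_cast h2.symm
      have h4 : c + 1 - 2 * g.y = 0 := by omega
      rw [h3, h4, g.b_zero]; push_cast; ring
    · rw [if_neg h2, if_neg (by omega), show c + 1 - 2 * g.y = c - 2 * g.y + 1 by omega]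
      push_cast; ring

/-- The node at a given position. -/
def node (r c : ℕ) (hr : r < g.x) (hc : c < 4 * g.y) : Fin g.N :=
  ⟨r * (4 * g.y) + c, by
    unfold N
    calc r * (4 * g.y) + c < (r + 1) * (4 * g.y) := by linarith
      _ ≤ _ := Nat.mul_le_mul_right _ hr⟩

theorem pos_node {r c : ℕ} (hr : r < g.x) (hc : c < 4 * g.y) : g.pos (g.node r c hr hc) = (r, c) := by
  have := g.y_pos
  have h4 : 0 < 4 * g.y := by omega
  unfold pos node
  simp only [Prod.mk.injEq]
  constructor
  · rw [mul_comm, Nat.mul_add_div h4, Nat.div_eq_of_lt hc, add_zero]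
  · rw [mul_comm, Nat.mul_add_mod, Nat.mod_eq_of_lt hc]

theorem pos_lt (v : Fin g.N) : (g.pos v).1 < g.x ∧ (g.pos v).2 < 4 * g.y := by
  have := g.y_pos
  have h := v.2
  constructor
  · exact Nat.div_lt_of_lt_mul (by rw [mul_comm]; exact h)
  · exact Nat.mod_lt _ (by omega)

theorem pos_injective : Function.Injective fun v : Fin g.N => g.pos v := by
  intro u v h
  simp only [pos, Prod.mk.injEq] at h
  apply Fin.ext
  rw [← Nat.div_add_mod (u : ℕ) (4 * g.y), ← Nat.div_add_mod (v : ℕ) (4 * g.y), h.1, h.2]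

theorem edgeWeight_comm (a : ℕ → ℤ) (p q : ℕ × ℕ) : g.edgeWeight a p q = g.edgeWeight a q p := by
  unfold edgeWeight
  by_cases h : p.1 = q.1
  · rw [if_pos h, if_pos h.symm, h, min_comm]
  · rw [if_neg h, if_neg (Ne.symm h)]

variable {g} {a : ℕ → ℤ} {G : WGraph (Fin g.N)}

theorem left_ge {r : ℕ} (hr : r < g.x) : 6 * (g.Ω : ℤ) ≤ g.left r := by
  have : (0 : ℤ) ≤ g.x - 1 - r := by omega
  unfold left
  nlinarith [mul_nonneg (mul_nonneg (by norm_num : (0 : ℤ) ≤ 10) (Int.natCast_nonneg g.Ω)) this]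

theorem right_ge (r : ℕ) : 6 * (g.Ω : ℤ) ≤ g.right r := by
  unfold right
  have : (0 : ℤ) ≤ 10 * g.Ω * r := by positivity
  linarith

theorem hor_ge (ha : ∀ r, r < g.x → 10 * (g.Ω : ℤ) ≤ a r) {r : ℕ} (hr : r < g.x) (c : ℕ) :
    (g.Ω : ℤ) ≤ g.hor a r c := by
  have h1 := left_ge hr
  have h2 := right_ge (g := g) r
  have h3 := ha r hr
  have h4 := g.b_nonneg r (c - 2 * g.y + 1)
  have h5 := g.b_le r (c - 2 * g.y)
  unfold hor
  split_ifs <;> linarith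

/-- Walking along a row costs the difference of the positions. -/
theorem walk_row (h : g.Is a G) (ha : ∀ r, r < g.x → 10 * (g.Ω : ℤ) ≤ a r) {r c : ℕ}
    (hr : r < g.x) : ∀ (d : ℕ) (hd : c + d < 4 * g.y), ∃ l : ℕ,
      WalkOf G (g.node r c hr (by omega)) (g.node r (c + d) hr hd) l ∧
      (l : ℤ) = g.pot a r (c + d) - g.pot a r c
  | 0, hd => ⟨0, .refl _ _, by simp⟩
  | d + 1, hd => by
      obtain ⟨l, hl, hl'⟩ := walk_row h ha (c := c) hr d (by omega)
      have hadj : g.graph.Adj (g.node r (c + d) hr (by omega)) (g.node r (c + (d + 1)) hr hd) := by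
        change GridAdj _ _
        rw [pos_node, pos_node]
        exact .inl ⟨rfl, .inl rfl⟩
      have hw := h.2 _ _ hadj
      refine ⟨_, hl.trans (.edge (by rw [h.1]; exact hadj)), ?_⟩
      push_cast
      rw [hl', hw, pos_node, pos_node, edgeWeight]
      simp only [if_true]
      rw [min_eq_left (by omega), hor_eq]
      ring_nf

theorem walk_col (h : g.Is a G) {r c : ℕ} (hc : c < 4 * g.y) : ∀ (d : ℕ) (hd : r + d < g.x), ∃ l : ℕ,
      WalkOf G (g.node r c (by omega) hc) (g.node (r + d) c hd hc) l ∧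
      (l : ℤ) = d * (10 * g.Ω * g.y)
  | 0, hd => ⟨0, .refl _ _, by simp⟩
  | d + 1, hd => by
      obtain ⟨l, hl, hl'⟩ := walk_col h (r := r) hc d (by omega)
      have hadj : g.graph.Adj (g.node (r + d) c (by omega) hc) (g.node (r + (d + 1)) c hd hc) := by
        change GridAdj _ _
        rw [pos_node, pos_node]
        exact .inr ⟨rfl, .inl rfl⟩
      have hw := h.2 _ _ hadj
      refine ⟨_, hl.trans (.edge (by rw [h.1]; exact hadj)), ?_⟩
      push_cast
      rw [hl', hw, pos_node, pos_node, edgeWeight, if_neg (by simp)]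
      ring

/-- The length of the paths between the terminals of column `j`, apart from the encoded part. -/
def offset (g : Gadget) (j : ℕ) : ℤ :=
  12 * g.Ω * j + (g.x - 1) * (10 * g.Ω * g.y) + 10 * g.Ω * (g.x - 1) * j

/-- The potential for the terminals of column `j`, where `T` is their distance. -/
def phi (g : Gadget) (a : ℕ → ℤ) (T : ℤ) (j r c : ℕ) : ℤ :=
  if c < 2 * g.y then r * (10 * g.Ω * g.y) + g.pot a r (max c (2 * g.y - 1 - j)) -
    g.pot a r (2 * g.y - 1 - j)
  else T - (g.x - 1 - r) * (10 * g.Ω * g.y) -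
    (g.pot a r (2 * g.y + j) - g.pot a r (min c (2 * g.y + j)))

theorem pot_left_source {j : ℕ} (hj : j < 2 * g.y) (r : ℕ) :
    g.pot a r (2 * g.y - 1 - j) = -(g.left r * j) := by
  unfold pot
  rw [if_pos (by omega)]
  congr 2
  rw [Nat.sub_sub, Nat.cast_sub (by omega)]; push_cast; ring

theorem pot_right_target (j r : ℕ) :
    g.pot a r (2 * g.y + j) = a r + g.right r * j + g.b r j := by
  unfold pot
  rw [if_neg (by omega), Nat.add_sub_cancel_left]; push_cast; ring

/-- The potential changes by at most the weight along horizontal edges. At the middle edge, this is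
where the minimality of `D` enters. -/
theorem phi_hor (ha : ∀ r, r < g.x → 10 * (g.Ω : ℤ) ≤ a r) {j : ℕ} (hj : j < 2 * g.y) {D : ℤ}
    (hD : ∀ r, r < g.x → D ≤ a r + g.b r j) (hD0 : 0 ≤ D) {r : ℕ} (hr : r < g.x) (c : ℕ) :
    |g.phi a (g.offset j + D) j r (c + 1) - g.phi a (g.offset j + D) j r c| ≤ g.hor a r c := by
  have hh := hor_ge ha hr c
  have hΩ : (0 : ℤ) ≤ g.Ω := by positivity
  have he := hor_eq g a r c
  by_cases h1 : c + 1 < 2 * g.y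
  · unfold phi
    rw [if_pos h1, if_pos (by omega)]
    rcases le_or_gt (2 * g.y - 1 - j) c with h2 | h2
    · rw [max_eq_left h2, max_eq_left (by omega), abs_le]
      constructor <;> linarith
    · rw [max_eq_right h2.le, max_eq_right (by omega)]
      simp; linarith
  · by_cases h2 : c + 1 = 2 * g.y
    · have hh' : g.hor a r c = a r := by unfold hor; rw [if_neg h1, if_pos h2]
      unfold phi
      rw [if_neg h1, if_pos (by omega : c < 2 * g.y), max_eq_left (by omega), min_eq_left (by omega), pot_left_source hj,
        pot_right_target, hh']
      have h3 : g.pot a r (c + 1) = a r := by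
        have := pot_right_target (g := g) (a := a) 0 r
        rw [add_zero] at this
        rw [h2, this, g.b_zero]; simp
      have h4 : g.pot a r c = 0 := by
        have := pot_left_source (g := g) (a := a) (j := 0) (by omega) r
        rw [Nat.sub_zero] at this
        rw [show c = 2 * g.y - 1 by omega, this]; simp
      rw [h3, h4]
      have h5 : g.offset j + D - (↑g.x - 1 - ↑r) * (10 * ↑g.Ω * ↑g.y) -
          (a r + g.right r * ↑j + g.b r j - a r) -
          (↑r * (10 * ↑g.Ω * ↑g.y) + 0 - -(g.left r * ↑j)) = D - g.b r j := by
        unfold offset left right; ring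
      rw [h5, abs_le]
      have h6 := hD r hr
      have h7 := ha r hr
      have h8 := g.b_le r j
      constructor <;> linarith
    · unfold phi
      rw [if_neg h1, if_neg (by omega)]
      rcases lt_or_ge c (2 * g.y + j) with h3 | h3
      · rw [min_eq_left h3.le, min_eq_left (by omega), abs_le]
        constructor <;> linarith
      · rw [min_eq_right h3, min_eq_right (by omega)]
        simp; linarith

/-- The potential changes by at most the weight along vertical edges: between neighbouring rows the
slopes differ by `10 * Ω`, which outweighs the variation of the matrix entries. -/
theorem phi_ver {j : ℕ} (hj : j ≤ g.y) (T : ℤ) (r c : ℕ) :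
    |g.phi a T j (r + 1) c - g.phi a T j r c| ≤ 10 * g.Ω * g.y := by
  have hΩ : (1 : ℤ) ≤ g.Ω := by exact_mod_cast g.Ω_pos
  have hy : (1 : ℤ) ≤ g.y := by exact_mod_cast g.y_pos
  have hy' := g.y_pos
  unfold phi
  by_cases h1 : c < 2 * g.y
  · rw [if_pos h1, if_pos h1]
    obtain ⟨d, hd, hd'⟩ : ∃ d : ℕ, max c (2 * g.y - 1 - j) = 2 * g.y - 1 - (j - d) ∧ d ≤ j := by
      rcases le_or_gt (2 * g.y - 1 - j) c with h2 | h2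
      · exact ⟨c - (2 * g.y - 1 - j), by rw [max_eq_left h2]; omega, by omega⟩
      · exact ⟨0, by rw [max_eq_right h2.le]; simp, by omega⟩
    have h3 : ∀ r, g.pot a r (max c (2 * g.y - 1 - j)) = -(g.left r * (j - d)) := fun r => by
      rw [hd, pot_left_source (by omega), Nat.cast_sub hd']
    have h4 : (10 * (g.Ω : ℤ)) * d ≤ 10 * g.Ω * g.y :=
      mul_le_mul_of_nonneg_left (by exact_mod_cast hd'.trans hj) (by positivity)
    have h5 : (0 : ℤ) ≤ (10 * (g.Ω : ℤ)) * d := by positivity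
    rw [h3, h3, pot_left_source (by omega), pot_left_source (by omega)]
    have h6 : (((r + 1 : ℕ) : ℤ) * (10 * g.Ω * g.y) + -(g.left (r + 1) * (j - d)) -
        -(g.left (r + 1) * j)) - ((r : ℤ) * (10 * g.Ω * g.y) + -(g.left r * (j - d)) -
        -(g.left r * j)) = 10 * g.Ω * g.y - 10 * g.Ω * d := by
      unfold left; push_cast; ring
    rw [h6, abs_le]
    constructor <;> linarith
  · rw [if_neg h1, if_neg h1]
    obtain ⟨d, hd, hd'⟩ : ∃ d : ℕ, min c (2 * g.y + j) = 2 * g.y + d ∧ d ≤ j := by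
      rcases le_or_gt (2 * g.y + j) c with h2 | h2
      · exact ⟨j, by rw [min_eq_right h2], le_rfl⟩
      · exact ⟨c - 2 * g.y, by rw [min_eq_left h2.le]; omega, by omega⟩
    rw [hd, pot_right_target, pot_right_target, pot_right_target, pot_right_target]
    have h6 : (T - (g.x - 1 - ((r + 1 : ℕ) : ℤ)) * (10 * g.Ω * g.y) -
        (a (r + 1) + g.right (r + 1) * j + g.b (r + 1) j -
          (a (r + 1) + g.right (r + 1) * d + g.b (r + 1) d))) -
        (T - (g.x - 1 - (r : ℤ)) * (10 * g.Ω * g.y) -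
        (a r + g.right r * j + g.b r j - (a r + g.right r * d + g.b r d))) =
        10 * g.Ω * g.y - (10 * g.Ω * (j - d) +
          (g.b (r + 1) j - g.b (r + 1) d - g.b r j + g.b r d)) := by
      unfold right; push_cast; ring
    rw [h6, abs_le]
    rcases hd'.eq_or_lt with rfl | hlt
    · constructor <;> ring_nf <;> nlinarith
    · have b1 := g.b_nonneg (r + 1) j
      have b2 := g.b_nonneg (r + 1) d
      have b3 := g.b_nonneg r j
      have b4 := g.b_nonneg r d
      have c1 := g.b_le (r + 1) j
      have c2 := g.b_le (r + 1) d
      have c3 := g.b_le r j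
      have c4 := g.b_le r d
      have e1 : (10 * (g.Ω : ℤ)) * (j - d) ≤ 10 * g.Ω * g.y :=
        mul_le_mul_of_nonneg_left (by omega) (by positivity)
      have e2 : (10 * (g.Ω : ℤ)) * 1 ≤ 10 * g.Ω * (j - d) :=
        mul_le_mul_of_nonneg_left (by omega) (by positivity)
      have e3 : (10 * (g.Ω : ℤ)) * 1 ≤ 10 * g.Ω * g.y :=
        mul_le_mul_of_nonneg_left hy (by positivity)
      constructor <;> linarith

/-- The distance between the two terminals of column `j` is the `j`-th entry of the `(min, +)`
product of the vector `a` with the matrix `b`, up to a known offset. -/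
theorem dist_eq (h : g.Is a G) (ha : ∀ r, r < g.x → 10 * (g.Ω : ℤ) ≤ a r) {j : ℕ} (hj : j ≤ g.y)
    {D : ℤ} (hD : ∀ r, r < g.x → D ≤ a r + g.b r j) (hD' : ∃ r, r < g.x ∧ D = a r + g.b r j) :
    ∃ T : ℕ, (T : ℤ) = g.offset j + D ∧
      G.dist (g.node 0 (2 * g.y - 1 - j) g.x_pos (by have := g.y_pos; omega))
        (g.node (g.x - 1) (2 * g.y + j) (Nat.sub_lt g.x_pos one_pos)
          (by have := g.y_pos; omega)) = T := by
  have hy := g.y_pos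
  have hx := g.x_pos
  have hΩ : (0 : ℤ) ≤ g.Ω := by positivity
  obtain ⟨k, hk, hk'⟩ := hD'
  have hD0 : 0 ≤ D := by have := ha k hk; have := g.b_nonneg k j; linarith
  obtain ⟨l₁, w₁, e₁⟩ := walk_col h (r := 0) (c := 2 * g.y - 1 - j) (by omega) k (by omega)
  obtain ⟨l₂, w₂, e₂⟩ := walk_row h ha (r := k) (c := 2 * g.y - 1 - j) hk (2 * j + 1) (by omega)
  obtain ⟨l₃, w₃, e₃⟩ := walk_col h (r := k) (c := 2 * g.y + j) (by omega) (g.x - 1 - k) (by omega)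
  have w := (w₁.trans (by simpa using w₂)).trans
    (by
      convert w₃ using 2
      omega)
  have hn : g.node (k + (g.x - 1 - k)) (2 * g.y + j) (by omega) (by omega) =
      g.node (g.x - 1) (2 * g.y + j) (by omega) (by omega) := by
    apply Fin.ext; simp only [node]; congr 2; omega
  rw [hn] at w
  have hsum : ((l₁ + l₂ + l₃ : ℕ) : ℤ) = g.offset j + D := by
    push_cast
    rw [e₁, e₂, e₃, show 2 * g.y - 1 - j + (2 * j + 1) = 2 * g.y + j by omega, pot_left_source (by omega),
      pot_right_target, hk', Nat.sub_sub, Nat.cast_sub (by omega)]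
    unfold offset left right; push_cast; ring
  refine ⟨l₁ + l₂ + l₃, hsum, dist_eq_of_potential w
    (fun v => g.phi a (g.offset j + D) j (g.pos v).1 (g.pos v).2) ?_ ?_⟩
  · intro u v huv
    rw [h.1] at huv
    rw [h.2 u v huv]
    have hu := pos_lt g u
    have hv := pos_lt g v
    have huv' : GridAdj (g.pos u) (g.pos v) := huv
    generalize g.pos u = p at *
    generalize g.pos v = q at *
    obtain ⟨r, c⟩ := p
    obtain ⟨r', c'⟩ := q
    simp only at hu hv ⊢
    unfold edgeWeight
    rcases huv' with ⟨h1, h2 | h2⟩ | ⟨h1, h2 | h2⟩ <;> simp only at h1 h2 <;> subst h1 <;> subst h2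
    · have := abs_le.1 (phi_hor ha (by omega) hD hD0 hu.1 c)
      simp only [if_true]
      rw [min_eq_left (by omega)]
      linarith
    · have := abs_le.1 (phi_hor ha (by omega) hD hD0 hu.1 c')
      simp only [if_true]
      rw [min_eq_right (by omega)]
      linarith
    · have := abs_le.1 (phi_ver (a := a) hj (g.offset j + D) r c)
      rw [if_neg (by simp)]
      linarith
    · have := abs_le.1 (phi_ver (a := a) hj (g.offset j + D) r' c)
      rw [if_neg (by simp)]
      linarith
  · rw [pos_node, pos_node, hsum]
    unfold phi
    simp only
    rw [if_neg (by omega), if_pos (by omega), max_self, min_self, Nat.cast_sub (by omega)]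
    push_cast
    ring

end Gadget

/-! ### The operations on the grid, in all variants of the dynamic problem -/

/-- Operations on a gadget with `x` rows: set the variable weight of a row, or ask for the distance
between the terminals of column `j + 1`. -/
inductive GOp (x y : ℕ) : Type
  | set (k : Fin x) (w : ℕ)
  | query (j : Fin y)

namespace GOp

variable {x y : ℕ}

/-- The number of weight changes. -/
def sets : List (GOp x y) → ℕ
  | [] => 0
  | set _ _ :: L => sets L + 1
  | query _ :: L => sets L

/-- The number of queries. -/
def queries : List (GOp x y) → ℕ
  | [] => 0
  | set _ _ :: L => queries L
  | query _ :: L => queries L + 1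

/-- All new weights lie between `U` and `U'`. -/
def Valid (U U' : ℕ) (L : List (GOp x y)) : Prop :=
  ∀ k w, set k w ∈ L → U ≤ w ∧ w ≤ U'

theorem sets_append (L L' : List (GOp x y)) : sets (L ++ L') = sets L + sets L' := by
  induction L with
  | nil => simp [sets]
  | cons o L ih => cases o <;> simp [sets, ih]; omega

theorem queries_append (L L' : List (GOp x y)) : queries (L ++ L') = queries L + queries L' := by
  induction L with
  | nil => simp [queries]
  | cons o L ih => cases o <;> simp [queries, ih]; omega

end GOp

theorem numUpdates_append {V : Type} (L L' : List (Op V)) :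
    numUpdates (L ++ L') = numUpdates L + numUpdates L' := by
  induction L with
  | nil => simp [numUpdates]
  | cons o L ih => cases o <;> simp [numUpdates, ih]; omega

theorem numQueries_append {V : Type} (L L' : List (Op V)) :
    numQueries (L ++ L') = numQueries L + numQueries L' := by
  induction L with
  | nil => simp [numQueries]
  | cons o L ih => cases o <;> simp [numQueries, ih]; omega

namespace Gadget

variable (g : Gadget)

/-- The left end of the variable edge of row `k`. -/
def midLeft (k : Fin g.x) : Fin g.N := g.node k (2 * g.y - 1) k.2 (by have := g.y_pos; omega)

/-- The right end of the variable edge of row `k`. -/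
def midRight (k : Fin g.x) : Fin g.N := g.node k (2 * g.y) k.2 (by have := g.y_pos; omega)

/-- The terminal in the left half for column `j + 1`. -/
def source (j : Fin g.y) : Fin g.N :=
  g.node 0 (2 * g.y - 1 - (j + 1)) g.x_pos (by omega)

/-- The terminal in the right half for column `j + 1`. -/
def target (j : Fin g.y) : Fin g.N :=
  g.node (g.x - 1) (2 * g.y + (j + 1)) (Nat.sub_lt g.x_pos one_pos) (by omega)

/-- The true operations for an operation on the gadget. If `del` is true then a weight is changed by
deleting and inserting the edge. -/
def toOps (del : Bool) : GOp g.x g.y → List (Op (Fin g.N))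
  | .set k w =>
      if del then [.update (.deleteEdge (g.midLeft k) (g.midRight k)),
        .update (.insertEdge (g.midLeft k) (g.midRight k) w)]
      else [.update (.setWeight (g.midLeft k) (g.midRight k) w)]
  | .query j => [.query (g.source j) (g.target j)]

/-- The number of updates that change a weight. -/
def updatesPerSet (del : Bool) : ℕ := if del then 2 else 1

theorem numUpdates_toOps (del : Bool) (L : List (GOp g.x g.y)) :
    numUpdates (L.flatMap (g.toOps del)) = updatesPerSet del * GOp.sets L := by
  induction L with
  | nil => simp [numUpdates, GOp.sets]
  | cons o L ih =>
    rw [List.flatMap_cons, numUpdates_append, ih]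
    cases o <;> cases del <;> simp [toOps, numUpdates, GOp.sets, updatesPerSet] <;> ring

theorem numQueries_toOps (del : Bool) (L : List (GOp g.x g.y)) :
    numQueries (L.flatMap (g.toOps del)) = GOp.queries L := by
  induction L with
  | nil => simp [numQueries, GOp.queries]
  | cons o L ih =>
    rw [List.flatMap_cons, numQueries_append, ih]
    cases o <;> cases del <;> simp [toOps, numQueries, GOp.queries]; all_goals ring

theorem length_toOps (del : Bool) (L : List (GOp g.x g.y)) :
    (L.flatMap (g.toOps del)).length = updatesPerSet del * GOp.sets L + GOp.queries L := by
  induction L with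
  | nil => simp [GOp.sets, GOp.queries]
  | cons o L ih =>
    rw [List.flatMap_cons, List.length_append, ih]
    cases o <;> cases del <;> simp [toOps, GOp.sets, GOp.queries, updatesPerSet] <;> ring

/-- The grid in which all variable weights are `U`. -/
def start (U : ℕ) : WGraph (Fin g.N) where
  graph := g.graph
  weight := Sym2.lift ⟨fun u v => (g.edgeWeight (fun _ => U) (g.pos u) (g.pos v)).toNat,
    fun _ _ => congrArg Int.toNat (g.edgeWeight_comm _ _ _)⟩

/-- An upper bound for all weights. -/
def maxWeight (U : ℕ) : ℕ := 16 * g.Ω + 10 * g.Ω * g.x + 10 * g.Ω * g.y + U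

variable {g} {a : ℕ → ℤ} {G : WGraph (Fin g.N)} {U : ℕ}

theorem edgeWeight_pos (ha : ∀ r, r < g.x → 10 * (g.Ω : ℤ) ≤ a r) {u v : Fin g.N} :
    1 ≤ g.edgeWeight a (g.pos u) (g.pos v) := by
  have h1 := hor_ge ha (pos_lt g u).1 (min (g.pos u).2 (g.pos v).2)
  have hΩ : (1 : ℤ) ≤ g.Ω := by exact_mod_cast g.Ω_pos
  have hy : (1 : ℤ) ≤ g.y := by exact_mod_cast g.y_pos
  unfold edgeWeight
  split_ifs
  · linarith
  · nlinarith

theorem edgeWeight_le (ha : ∀ r, r < g.x → a r ≤ U + 5 * g.Ω) {u v : Fin g.N} :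
    g.edgeWeight a (g.pos u) (g.pos v) ≤ g.maxWeight U := by
  have h1 := (pos_lt g u).1
  have hΩ : (0 : ℤ) ≤ g.Ω := by positivity
  have hx : (0 : ℤ) ≤ 10 * g.Ω * g.x := by positivity
  have hy : (0 : ℤ) ≤ 10 * g.Ω * g.y := by positivity
  have hU : (0 : ℤ) ≤ U := by positivity
  have hm : (g.maxWeight U : ℤ) = 16 * g.Ω + 10 * g.Ω * g.x + 10 * g.Ω * g.y + U := by
    unfold maxWeight; push_cast; ring
  rw [hm]
  have e1 : (10 * (g.Ω : ℤ)) * (g.x - 1 - (g.pos u).1) ≤ 10 * g.Ω * g.x :=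
    mul_le_mul_of_nonneg_left (by omega) (by positivity)
  have e2 : (10 * (g.Ω : ℤ)) * ((g.pos u).1) ≤ 10 * g.Ω * g.x :=
    mul_le_mul_of_nonneg_left (by omega) (by positivity)
  unfold edgeWeight hor left right
  split_ifs
  · linarith
  · have := ha _ h1; linarith
  · have := g.b_le (g.pos u).1 (min (g.pos u).2 (g.pos v).2 - 2 * g.y + 1)
    have := g.b_nonneg (g.pos u).1 (min (g.pos u).2 (g.pos v).2 - 2 * g.y)
    linarith
  · linarith

theorem start_is (hU : 10 * g.Ω ≤ U) : g.Is (fun _ => U) (g.start U) := by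
  refine ⟨rfl, fun u v _ => ?_⟩
  have := edgeWeight_pos (g := g) (a := fun _ => (U : ℤ)) (fun r _ => by exact_mod_cast hU)
    (u := u) (v := v)
  simp only [start, Sym2.lift_mk]
  rw [Int.toNat_of_nonneg (by linarith)]

theorem mid_adj (k : Fin g.x) : g.graph.Adj (g.midLeft k) (g.midRight k) := by
  change GridAdj _ _
  have := g.y_pos
  unfold midLeft midRight
  rw [pos_node, pos_node]
  exact .inl ⟨rfl, .inl (by simp only; omega)⟩

theorem edgeWeight_mid (k : Fin g.x) :
    g.edgeWeight a (g.pos (g.midLeft k)) (g.pos (g.midRight k)) = a k := by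
  have := g.y_pos
  unfold midLeft midRight edgeWeight hor
  rw [pos_node, pos_node]
  simp only [if_true]
  rw [min_eq_left (by omega), if_neg (by omega), if_pos (by omega)]

theorem Is.update (h : g.Is a G) (k : Fin g.x) (w : ℕ) {H : WGraph (Fin g.N)}
    (hH : H.graph = g.graph)
    (hw : H.weight = Function.update G.weight s(g.midLeft k, g.midRight k) w) :
    g.Is (Function.update a k w) H := by
  refine ⟨hH, fun u v huv => ?_⟩
  rw [hw]
  by_cases he : s(u, v) = s(g.midLeft k, g.midRight k)
  · rw [he, Function.update_self]
    rcases Sym2.eq_iff.1 he with ⟨rfl, rfl⟩ | ⟨rfl, rfl⟩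
    · rw [edgeWeight_mid]; simp
    · rw [edgeWeight_comm, edgeWeight_mid]; simp
  · rw [Function.update_of_ne he, h.2 u v huv]
    unfold edgeWeight hor
    by_cases hr : (g.pos u).1 = (g.pos v).1
    · rw [if_pos hr, if_pos hr]
      by_cases hm : min (g.pos u).2 (g.pos v).2 + 1 = 2 * g.y
      · have hk : (g.pos u).1 ≠ k := by
          intro hk
          apply he
          have hk' : (g.pos v).1 = k := by omega
          have h1 : g.pos (g.midLeft k) = (↑k, 2 * g.y - 1) := pos_node ..
          have h2 : g.pos (g.midRight k) = (↑k, 2 * g.y) := pos_node ..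
          have huv' : GridAdj (g.pos u) (g.pos v) := huv
          rcases huv' with ⟨_, h3⟩ | ⟨_, h3⟩
          · rcases h3 with h3 | h3
            · have e1 : u = g.midLeft k := g.pos_injective
                (by simp only [h1]; exact Prod.ext hk (by simp only; omega))
              have e2 : v = g.midRight k := g.pos_injective
                (by simp only [h2]; exact Prod.ext hk' (by simp only; omega))
              rw [e1, e2]
            · have e1 : v = g.midLeft k := g.pos_injective
                (by simp only [h1]; exact Prod.ext hk' (by simp only; omega))
              have e2 : u = g.midRight k := g.pos_injective
                (by simp only [h2]; exact Prod.ext hk (by simp only; omega))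
              rw [e1, e2, Sym2.eq_swap]
          · omega
        rw [Function.update_of_ne hk]
      · simp only [if_neg hm]
    · rw [if_neg hr, if_neg hr]

theorem delete_sup_edge {V : Type} {G : SimpleGraph V} {u v : V} (h : G.Adj u v) :
    G.deleteEdges {s(u, v)} ⊔ SimpleGraph.edge u v = G := by
  classical
  ext p q
  simp only [SimpleGraph.sup_adj, SimpleGraph.deleteEdges_adj, SimpleGraph.edge_adj,
    Set.mem_singleton_iff]
  constructor
  · rintro (⟨h1, -⟩ | ⟨⟨rfl, rfl⟩ | ⟨rfl, rfl⟩, -⟩)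
    exacts [h1, h, h.symm]
  · intro hpq
    by_cases he : s(p, q) = s(u, v)
    · exact .inr ⟨Sym2.eq_iff.1 he, hpq.ne⟩
    · exact .inl ⟨hpq, he⟩

/-- The graph after changing a variable weight. -/
def setGraph (g : Gadget) (del : Bool) (G : WGraph (Fin g.N)) (k : Fin g.x) (w : ℕ) :
    WGraph (Fin g.N) :=
  if del then Update.apply (.insertEdge (g.midLeft k) (g.midRight k) w)
    (Update.apply (.deleteEdge (g.midLeft k) (g.midRight k)) G)
  else Update.apply (.setWeight (g.midLeft k) (g.midRight k) w) G

theorem Is.setGraph (h : g.Is a G) (del : Bool) (k : Fin g.x) (w : ℕ) :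
    g.Is (Function.update a k w) (g.setGraph del G k w) := by
  refine h.update k w ?_ ?_
  · cases del
    · exact h.1
    · simp only [Gadget.setGraph, Update.apply, if_true]
      rw [delete_sup_edge (by rw [h.1]; exact mid_adj k), h.1]
  · cases del <;> rfl

/-- The variant `D` of the dynamic problem allows the grids with variable weights between `U` and
`U + 5 * Ω`, where `U = 5 * μ * Ω`. The flag `del` tells how weights are changed, and `coord` whether
the algorithm is told the coordinates of the nodes. -/
structure Hosts (D : Variant) (del coord : Bool) (c μ : ℕ) : Prop where
  initial : ∀ g : Gadget, g.maxWeight (5 * μ * g.Ω) ≤ g.N ^ c →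
    D.initial (g.start (5 * μ * g.Ω)) fun v => if coord then g.pos v else (0, 0)
  admissible : ∀ g : Gadget, g.maxWeight (5 * μ * g.Ω) ≤ g.N ^ c → ∀ L : List (GOp g.x g.y),
    GOp.Valid (5 * μ * g.Ω) (5 * μ * g.Ω + 5 * g.Ω) L →
    D.Admissible (g.start (5 * μ * g.Ω)) (g.start (5 * μ * g.Ω)) (L.flatMap (g.toOps del))

/-- An induction over the operations: it suffices that every single weight change is allowed on the
full grid. -/
theorem admissible_of {D : Variant} {del : Bool} {S : WGraph (Fin g.N)} {U U' : ℕ}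
    (h : ∀ G : WGraph (Fin g.N), G.graph = g.graph → ∀ (k : Fin g.x) (w : ℕ), U ≤ w → w ≤ U' →
      if del then D.allowed S G (.deleteEdge (g.midLeft k) (g.midRight k)) ∧
        D.allowed S (Update.apply (.deleteEdge (g.midLeft k) (g.midRight k)) G)
          (.insertEdge (g.midLeft k) (g.midRight k) w)
      else D.allowed S G (.setWeight (g.midLeft k) (g.midRight k) w)) :
    ∀ (L : List (GOp g.x g.y)), GOp.Valid U U' L → ∀ (a : ℕ → ℤ) (G : WGraph (Fin g.N)), g.Is a G →
      D.Admissible S G (L.flatMap (g.toOps del))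
  | [], _, _, _, _ => trivial
  | .query j :: L, hL, a, G, hG => by
      have := admissible_of h L (fun k w hm => hL k w (List.mem_cons_of_mem _ hm)) a G hG
      simpa [List.flatMap_cons, toOps, Variant.Admissible] using this
  | .set k w :: L, hL, a, G, hG => by
      have h1 := admissible_of h L (fun k w hm => hL k w (List.mem_cons_of_mem _ hm)) _ _
        (hG.setGraph del k w)
      obtain ⟨hw, hw'⟩ := hL k w List.mem_cons_self
      have h2 := h G hG.1 k w hw hw'
      rw [List.flatMap_cons]
      cases del
      · exact ⟨h2, h1⟩
      · exact ⟨h2.1, h2.2, h1⟩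

theorem planar_of_le {H : SimpleGraph (Fin g.N)} (h : H ≤ g.graph) : IsPlanar H :=
  IsPlanar.mono h (isPlanar_of_gridAdj g.pos_injective fun _ _ h => h)

theorem start_weightsOK {c : ℕ} (hU : 10 * g.Ω ≤ U) (hc : g.maxWeight U ≤ g.N ^ c) :
    (g.start U).WeightsOK c := by
  intro u v huv
  have h1 := (start_is hU).2 u v huv
  have h2 := edgeWeight_pos (g := g) (a := fun _ => (U : ℤ)) (fun r _ => by exact_mod_cast hU)
    (u := u) (v := v)
  have h3 := edgeWeight_le (g := g) (a := fun _ => (U : ℤ)) (U := U) (fun r _ => by simp)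
    (u := u) (v := v)
  have hc' : (g.maxWeight U : ℤ) ≤ (g.N ^ c : ℕ) := by exact_mod_cast hc
  exact ⟨by omega, by omega⟩

theorem weightOK_of {c w : ℕ} (hU : 10 * g.Ω ≤ U) (hc : g.maxWeight U ≤ g.N ^ c)
    (h : U ≤ w) (h' : w ≤ U + 5 * g.Ω) : WeightOK c g.N w := by
  have := g.Ω_pos
  refine ⟨by omega, le_trans ?_ hc⟩
  unfold maxWeight
  nlinarith [Nat.zero_le (10 * g.Ω * g.x), Nat.zero_le (10 * g.Ω * g.y)]

theorem hosts_planarEdgeUpdates (c : ℕ) : Hosts (planarEdgeUpdates c) true false c 2 where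
  initial g hc := ⟨planar_of_le le_rfl, start_weightsOK (by omega) hc, fun _ => rfl⟩
  admissible g hc L hL := by
    refine admissible_of (fun G hG k w hw hw' => ?_) L hL _ _ (start_is (by omega))
    have hadj : G.graph.Adj (g.midLeft k) (g.midRight k) := by rw [hG]; exact mid_adj k
    refine ⟨hadj, hadj.ne, ?_, weightOK_of (by omega) hc hw hw', ?_⟩
    · simp [Update.apply]
    · simp only [Update.apply]
      rw [delete_sup_edge hadj, hG]
      exact planar_of_le le_rfl

theorem hosts_planarWeightUpdates (c : ℕ) : Hosts (planarWeightUpdates c) false false c 2 where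
  initial g hc := ⟨planar_of_le le_rfl, start_weightsOK (by omega) hc, fun _ => rfl⟩
  admissible g hc L hL := by
    refine admissible_of (fun G hG k w hw hw' => ?_) L hL _ _ (start_is (by omega))
    exact ⟨by rw [hG]; exact mid_adj k, weightOK_of (by omega) hc hw hw'⟩

theorem hosts_gridWeightUpdates (c : ℕ) {M : ℝ} {μ : ℕ} (hμ : 2 ≤ μ) (hM : 1 ≤ (M - 1) * μ) :
    Hosts (gridWeightUpdates c M) false true c μ where
  initial g hc := by
    refine ⟨⟨fun u v h => g.pos_injective (by simpa using h), fun v => ?_, fun u v huv => huv⟩,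
      start_weightsOK (by nlinarith) hc⟩
    have h1 := v.2
    simp only [if_true, pos]
    exact ⟨(Nat.div_le_self _ _).trans_lt h1, (Nat.mod_le _ _).trans_lt h1⟩
  admissible g hc L hL := by
    have hU : 10 * g.Ω ≤ 5 * μ * g.Ω := by nlinarith
    refine admissible_of (fun G hG k w hw hw' => ?_) L hL _ _ (start_is hU)
    have h1 := (start_is hU).2 _ _ (mid_adj k)
    rw [edgeWeight_mid] at h1
    have h2 : (g.start (5 * μ * g.Ω)).weight s(g.midLeft k, g.midRight k) = 5 * μ * g.Ω := by
      exact_mod_cast h1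
    refine ⟨by rw [hG]; exact mid_adj k, weightOK_of hU hc hw hw', ?_, ?_⟩
    · rw [h2]; exact hw
    · rw [h2]
      have h3 : (w : ℝ) ≤ 5 * μ * g.Ω + 5 * g.Ω := by exact_mod_cast hw'
      have hΩ : (0 : ℝ) ≤ g.Ω := by positivity
      push_cast
      nlinarith [mul_le_mul_of_nonneg_left hM hΩ]

end Gadget

end DynAPSP

namespace APSP

open WordRAM

/-! ### Shortest walks with a bounded number of edges -/

variable {n : ℕ} {w : WDigraph n}

/-- There is a walk from `u` to `v` with `e` edges and total weight `l`. -/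
def WalkN (w : WDigraph n) : ℕ → Fin n → Fin n → ℤ → Prop
  | 0, u, v, l => u = v ∧ l = 0
  | e + 1, u, x, l => ∃ v a l', w u v = some a ∧ WalkN w e v x l' ∧ l = a + l'

theorem hasWalk_iff {u v : Fin n} {l : ℤ} : HasWalk w u v l ↔ ∃ e, WalkN w e u v l := by
  constructor
  · intro h
    induction h with
    | nil u => exact ⟨0, rfl, rfl⟩
    | cons h _ ih =>
      obtain ⟨e, he⟩ := ih
      exact ⟨e + 1, _, _, _, h, he, rfl⟩
  · rintro ⟨e, he⟩
    induction e generalizing u l with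
    | zero => obtain ⟨rfl, rfl⟩ := he; exact .nil u
    | succ e ih =>
      obtain ⟨x, a, l', h1, h2, rfl⟩ := he
      exact .cons h1 (ih h2)

theorem WalkN.trans {e e' : ℕ} {u v x : Fin n} {l l' : ℤ} (h : WalkN w e u v l)
    (h' : WalkN w e' v x l') : WalkN w (e + e') u x (l + l') := by
  induction e generalizing u l with
  | zero => obtain ⟨rfl, rfl⟩ := h; simpa using h'
  | succ e ih =>
    obtain ⟨y, a, k, h1, h2, rfl⟩ := h
    rw [show e + 1 + e' = e + e' + 1 by omega]
    exact ⟨y, a, k + l', h1, ih h2, by ring⟩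

theorem WalkN.split {e e' : ℕ} {u v : Fin n} {l : ℤ} (h : WalkN w (e + e') u v l) :
    ∃ x l₁ l₂, WalkN w e u x l₁ ∧ WalkN w e' x v l₂ ∧ l = l₁ + l₂ := by
  induction e generalizing u l with
  | zero => exact ⟨u, 0, l, ⟨rfl, rfl⟩, by simpa using h, by simp⟩
  | succ e ih =>
    rw [show e + 1 + e' = e + e' + 1 by omega] at h
    obtain ⟨y, a, k, h1, h2, rfl⟩ := h
    obtain ⟨x, l₁, l₂, h3, h4, rfl⟩ := ih h2
    exact ⟨x, a + l₁, l₂, ⟨y, a, l₁, h1, h3, rfl⟩, h4, by ring⟩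

theorem WalkN.abs_le {c e : ℕ} (hw : WeightsBounded c w) {u v : Fin n} {l : ℤ}
    (h : WalkN w e u v l) : |l| ≤ e * (n : ℤ) ^ c := by
  induction e generalizing u l with
  | zero => obtain ⟨rfl, rfl⟩ := h; simp
  | succ e ih =>
    obtain ⟨y, a, k, h1, h2, rfl⟩ := h
    have h3 := hw _ _ _ h1
    have h4 := ih h2
    push_cast
    have h5 := abs_add_le a k
    linarith

/-- The nodes of a walk and the lengths of its initial segments. -/
theorem WalkN.exists_path {e : ℕ} {u v : Fin n} {l : ℤ} (h : WalkN w e u v l) :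
    ∃ (f : ℕ → Fin n) (s : ℕ → ℤ), f 0 = u ∧ f e = v ∧ s 0 = 0 ∧ s e = l ∧
      ∀ i, i < e → ∃ a, w (f i) (f (i + 1)) = some a ∧ s (i + 1) = s i + a := by
  induction e generalizing u l with
  | zero => obtain ⟨rfl, rfl⟩ := h; exact ⟨fun _ => u, fun _ => 0, rfl, rfl, rfl, rfl, by simp⟩
  | succ e ih =>
    obtain ⟨y, a, k, h1, h2, rfl⟩ := h
    obtain ⟨f, s, f0, fe, s0, se, hs⟩ := ih h2
    refine ⟨fun i => Nat.casesOn i u f, fun i => Nat.casesOn i 0 fun j => a + s j, rfl, fe, rfl,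
      by simp [se], ?_⟩
    rintro (_ | i) hi
    · exact ⟨a, by simpa [f0] using h1, by simp [s0]⟩
    · obtain ⟨b, hb, hb'⟩ := hs i (by omega)
      exact ⟨b, hb, by simp [hb']; ring⟩

theorem walkN_of_path {f : ℕ → Fin n} {s : ℕ → ℤ} {e : ℕ}
    (h : ∀ i, i < e → ∃ a, w (f i) (f (i + 1)) = some a ∧ s (i + 1) = s i + a) (i : ℕ) :
    ∀ d, i + d ≤ e → WalkN w d (f i) (f (i + d)) (s (i + d) - s i)
  | 0, _ => ⟨rfl, by simp⟩
  | d + 1, hd => by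
      obtain ⟨a, h1, h2⟩ := h (i + d) (by omega)
      have h3 : WalkN w 1 (f (i + d)) (f (i + d + 1)) a := ⟨_, a, 0, h1, ⟨rfl, rfl⟩, by simp⟩
      have h4 := (walkN_of_path h i d (by omega)).trans h3
      rw [← add_assoc, h2]
      convert h4 using 1
      ring

/-- Without negative cycles, cutting out cycles does not make a walk longer. -/
theorem WalkN.exists_short (hn : NoNegCycle w) {u v : Fin n} : ∀ {e : ℕ} {l : ℤ},
    WalkN w e u v l → ∃ e' l', e' ≤ e ∧ e' < n ∧ l' ≤ l ∧ WalkN w e' u v l' := by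
  intro e
  induction e using Nat.strong_induction_on with
  | _ e ih =>
    intro l h
    rcases lt_or_ge e n with hlt | hge
    · exact ⟨e, l, le_rfl, hlt, le_rfl, h⟩
    · obtain ⟨f, s, rfl, rfl, s0, rfl, hs⟩ := h.exists_path
      obtain ⟨i, j, hij, hfij⟩ := Fintype.exists_ne_map_eq_of_card_lt
        (fun i : Fin (n + 1) => f i) (by simp)
      obtain ⟨i, j, hij, hj, hfij⟩ : ∃ i j : ℕ, i < j ∧ j ≤ n ∧ f i = f j := by
        rcases lt_or_gt_of_ne hij with h' | h'
        · exact ⟨i, j, h', by omega, hfij⟩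
        · exact ⟨j, i, h', by omega, hfij.symm⟩
      have h1 := walkN_of_path hs 0 i (by omega)
      have h2 := walkN_of_path hs i (j - i) (by omega)
      have h3 := walkN_of_path hs j (e - j) (by omega)
      rw [show 0 + i = i by omega, s0] at h1
      rw [show i + (j - i) = j by omega, ← hfij] at h2
      rw [show j + (e - j) = e by omega, ← hfij] at h3
      have h4 := hn _ _ (hasWalk_iff.2 ⟨_, h2⟩)
      obtain ⟨e', l', h5, h6, h7, h8⟩ := ih (i + (e - j)) (by omega) (h1.trans h3)
      exact ⟨e', l', by omega, h6, by linarith, h8⟩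

/-! ### Matrices of distances, with a code for infinity -/

/-- There is a walk of weight `d` with at most `e` edges; numbers `≥ n` count as isolated nodes. -/
def Reach (w : WDigraph n) (e i j : ℕ) (d : ℤ) : Prop :=
  ∃ (hi : i < n) (hj : j < n), ∃ e' ≤ e, WalkN w e' ⟨i, hi⟩ ⟨j, hj⟩ d

/-- `z` encodes the least weight of a walk with at most `e` edges: finite weights are shifted by `Ω`
and infinity is encoded by `5 * Ω`. -/
def Enc (w : WDigraph n) (Ω e i j : ℕ) (z : ℤ) : Prop :=
  (∀ d, Reach w e i j d → z ≤ Ω + d) ∧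
    ((z = 5 * Ω ∧ ∀ d, ¬ Reach w e i j d) ∨ ∃ d, Reach w e i j d ∧ z = Ω + d)

theorem Reach.exists_short {c Ω e i j : ℕ} {d : ℤ} (hw : WeightsBounded c w) (hn : NoNegCycle w)
    (hΩ : n ^ (c + 1) ≤ Ω) (h : Reach w e i j d) : ∃ d', d' ≤ d ∧ |d'| ≤ Ω ∧ Reach w e i j d' := by
  obtain ⟨hi, hj, e', he', h'⟩ := h
  obtain ⟨e'', l', h1, h2, h3, h4⟩ := h'.exists_short hn
  refine ⟨l', h3, (h4.abs_le hw).trans ?_, hi, hj, e'', by omega, h4⟩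
  have h5 : e'' * n ^ c ≤ Ω := by
    refine le_trans ?_ hΩ
    rw [pow_succ']
    exact Nat.mul_le_mul_right _ h2.le
  exact_mod_cast h5

theorem Enc.cases {c Ω e i j : ℕ} {z : ℤ} (hw : WeightsBounded c w) (hn : NoNegCycle w)
    (hΩ : n ^ (c + 1) ≤ Ω) (h : Enc w Ω e i j z) :
    (z = 5 * Ω ∧ ∀ d, ¬ Reach w e i j d) ∨ ∃ d, Reach w e i j d ∧ z = Ω + d ∧ 0 ≤ z ∧ z ≤ 2 * Ω := by
  rcases h.2 with h' | ⟨d, h1, h2⟩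
  · exact .inl h'
  · obtain ⟨d', h3, h4, h5⟩ := h1.exists_short hw hn hΩ
    have h6 := h.1 d' h5
    have h7 := abs_le.1 h4
    exact .inr ⟨d, h1, h2, by linarith, by linarith⟩

theorem Enc.bounds {c Ω e i j : ℕ} {z : ℤ} (hw : WeightsBounded c w) (hn : NoNegCycle w)
    (hΩ : n ^ (c + 1) ≤ Ω) (h : Enc w Ω e i j z) : 0 ≤ z ∧ z ≤ 5 * Ω := by
  rcases h.cases hw hn hΩ with ⟨rfl, -⟩ | ⟨d, -, -, h1, h2⟩ <;> constructor <;> linarith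

/-- Squaring in the `(min, +)` semiring doubles the number of edges. -/
theorem Enc.square {c Ω e m : ℕ} {X : ℕ → ℕ → ℤ} (hw : WeightsBounded c w) (hn : NoNegCycle w)
    (hΩ : n ^ (c + 1) ≤ Ω) (hΩ0 : 0 < Ω) (hm : n ≤ m)
    (hX : ∀ i j, i < m → j < m → Enc w Ω e i j (X i j)) {i j : ℕ} (hi : i < m) (hj : j < m) {z : ℤ}
    (hz : ∀ k, k < m → z ≤ X i k + X k j) (hz' : ∃ k, k < m ∧ z = X i k + X k j) :
    Enc w Ω (2 * e) i j (if z < 4 * Ω then z - Ω else 5 * Ω) := by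
  have hΩ0' : (0 : ℤ) < Ω := by exact_mod_cast hΩ0
  have hle : ∀ d, Reach w (2 * e) i j d → z ≤ 2 * Ω + d := by
    rintro d ⟨hi', hj', e', he', h'⟩
    rw [show e' = min e e' + (e' - min e e') by omega] at h'
    obtain ⟨x, l₁, l₂, h1, h2, rfl⟩ := h'.split
    have h3 := (hX i x hi (by omega)).1 l₁ ⟨hi', x.2, _, min_le_left _ _, h1⟩
    have h4 := (hX x j (by omega) hj).1 l₂ ⟨x.2, hj', _, by omega, h2⟩
    have h5 := hz x (by omega)
    linarith
  have hfin : z < 4 * Ω → ∃ d, Reach w (2 * e) i j d ∧ z = 2 * Ω + d := by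
    intro hlt
    obtain ⟨k, hk, rfl⟩ := hz'
    have b1 := ((hX i k hi hk).bounds hw hn hΩ).1
    have b2 := ((hX k j hk hj).bounds hw hn hΩ).1
    rcases (hX i k hi hk).cases hw hn hΩ with ⟨h1, -⟩ | ⟨d₁, ⟨hi', hk', e₁, he₁, w₁⟩, h1, -, -⟩
    · linarith
    rcases (hX k j hk hj).cases hw hn hΩ with ⟨h2, -⟩ | ⟨d₂, ⟨_, hj', e₂, he₂, w₂⟩, h2, -, -⟩
    · linarith
    exact ⟨d₁ + d₂, ⟨hi', hj', e₁ + e₂, by omega, w₁.trans w₂⟩, by rw [h1, h2]; ring⟩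
  by_cases hlt : z < 4 * Ω
  · rw [if_pos hlt]
    obtain ⟨d, h1, h2⟩ := hfin hlt
    exact ⟨fun d hd => by have := hle d hd; linarith, .inr ⟨d, h1, by linarith⟩⟩
  · rw [if_neg hlt]
    have hno : ∀ d, ¬ Reach w (2 * e) i j d := fun d hd => by
      obtain ⟨d', -, h1, h2⟩ := hd.exists_short hw hn hΩ
      have h3 := hle d' h2
      have h4 := abs_le.1 h1
      linarith
    exact ⟨fun d hd => absurd hd (hno d), .inl ⟨rfl, hno⟩⟩

/-- The encoded matrix for walks with at most one edge. -/
def initEntry (w : WDigraph n) (Ω i j : ℕ) : ℤ :=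
  if h : i < n ∧ j < n then
    if i = j then Ω else
      match w ⟨i, h.1⟩ ⟨j, h.2⟩ with
      | some a => Ω + a
      | none => 5 * Ω
  else 5 * Ω

theorem enc_initEntry (hn : NoNegCycle w) (Ω i j : ℕ) : Enc w Ω 1 i j (initEntry w Ω i j) := by
  unfold initEntry
  by_cases h : i < n ∧ j < n
  · rw [dif_pos h]
    by_cases hij : i = j
    · subst hij
      rw [if_pos rfl]
      refine ⟨?_, .inr ⟨0, ⟨h.1, h.2, 0, by omega, rfl, rfl⟩, by simp⟩⟩
      rintro d ⟨h1, h2, e, he, hd⟩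
      have := hn _ _ (hasWalk_iff.2 ⟨_, hd⟩)
      linarith
    · rw [if_neg hij]
      have key : ∀ d, Reach w 1 i j d → w ⟨i, h.1⟩ ⟨j, h.2⟩ = some d := by
        rintro d ⟨h1, h2, e, he, hd⟩
        rcases (by omega : e = 0 ∨ e = 1) with rfl | rfl
        · have h3 := hd.1
          simp only [Fin.mk.injEq] at h3
          exact absurd h3 hij
        · obtain ⟨x, a, l', h3, ⟨rfl, rfl⟩, rfl⟩ := hd
          simpa using h3
      rcases hw : w ⟨i, h.1⟩ ⟨j, h.2⟩ with _ | a
      · have hno : ∀ d, ¬ Reach w 1 i j d := fun d hd => by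
          have := key d hd; rw [hw] at this; simp at this
        exact ⟨fun d hd => absurd hd (hno d), .inl ⟨rfl, hno⟩⟩
      · refine ⟨fun d hd => ?_, .inr ⟨a, ⟨h.1, h.2, 1, le_rfl, _, a, 0, hw, ⟨rfl, rfl⟩, by simp⟩, rfl⟩⟩
        have := key d hd
        rw [hw] at this
        simp only [Option.some.injEq] at this
        rw [this]
  · rw [dif_neg h]
    have hno : ∀ d, ¬ Reach w 1 i j d := fun d hd => h ⟨hd.1, hd.2.1⟩
    exact ⟨fun d hd => absurd hd (hno d), .inl ⟨rfl, hno⟩⟩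

/-- With at least `n` edges allowed, the encoded numbers are the distances. -/
theorem Enc.dist {c Ω e : ℕ} {u v : Fin n} {z : ℤ} (hw : WeightsBounded c w) (hn : NoNegCycle w)
    (hΩ : n ^ (c + 1) ≤ Ω) (hΩ0 : 0 < Ω) (he : n ≤ e) (h : Enc w Ω e u v z) :
    ((∃ l, HasWalk w u v l) → z < 4 * Ω ∧ IsLeast {l | HasWalk w u v l} (z - Ω)) ∧
      ((¬ ∃ l, HasWalk w u v l) → ¬ z < 4 * Ω) := by
  have hΩ0' : (0 : ℤ) < Ω := by exact_mod_cast hΩ0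
  have hr : ∀ l, HasWalk w u v l → ∃ l' ≤ l, Reach w e u v l' := fun l hl => by
    obtain ⟨e', he'⟩ := hasWalk_iff.1 hl
    obtain ⟨e'', l', h1, h2, h3, h4⟩ := he'.exists_short hn
    exact ⟨l', h3, u.2, v.2, e'', by omega, h4⟩
  constructor
  · rintro ⟨l, hl⟩
    obtain ⟨l', -, hl'⟩ := hr l hl
    rcases h.cases hw hn hΩ with ⟨-, h1⟩ | ⟨d, ⟨h1, h2, e', he', hd⟩, h3, h4, h5⟩
    · exact absurd hl' (h1 l')
    · refine ⟨by linarith, ?_, fun k hk => ?_⟩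
      · change HasWalk w u v (z - Ω)
        rw [h3, add_sub_cancel_left]
        exact hasWalk_iff.2 ⟨e', hd⟩
      · obtain ⟨k', hk', hk''⟩ := hr k hk
        have := h.1 k' hk''
        linarith
  · intro hno
    rcases h.cases hw hn hΩ with ⟨rfl, -⟩ | ⟨d, ⟨h1, h2, e', he', hd⟩, h3, h4, h5⟩
    · linarith
    · exact absurd ⟨d, hasWalk_iff.2 ⟨e', hd⟩⟩ hno

end APSP

namespace WordRAM

/-! ### Notation for expressions -/

namespace Exp

instance : Add Exp := ⟨.op .add⟩
instance : Sub Exp := ⟨.op .sub⟩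
instance : Mul Exp := ⟨.op .mul⟩
instance : Div Exp := ⟨.op .div⟩
instance : Mod Exp := ⟨.op .mod⟩
instance (k : ℕ) : OfNat Exp k := ⟨.c k⟩

/-- Comparison. -/
def lt (a b : Exp) : Exp := .op .lt a b

/-- Test for equality. -/
def eq (a b : Exp) : Exp := .op .eq a b

variable (m : Mem) (a b p q : Exp)

theorem eval_v (x : ℕ) : (Exp.v x).eval m = m x 0 := rfl
theorem eval_ld (x : ℕ) : (Exp.ld x a).eval m = m x (a.eval m).toNat := rfl
theorem eval_add : (a + b).eval m = a.eval m + b.eval m := rfl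
theorem eval_sub : (a - b).eval m = a.eval m - b.eval m := rfl
theorem eval_mul : (a * b).eval m = a.eval m * b.eval m := rfl
theorem eval_div : (a / b).eval m = a.eval m / b.eval m := rfl
theorem eval_mod : (a % b).eval m = a.eval m % b.eval m := rfl
theorem eval_num (k : ℕ) : (no_index (OfNat.ofNat k) : Exp).eval m = (k : ℤ) := rfl
theorem eval_zero : (0 : Exp).eval m = 0 := rfl
theorem eval_one : (1 : Exp).eval m = 1 := rfl

theorem eval_ite_lt : (Exp.ite (lt a b) p q).eval m =
    if a.eval m < b.eval m then p.eval m else q.eval m := by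
  by_cases h : a.eval m < b.eval m <;> simp [eval, lt, BinOp.eval, h]

theorem eval_ite_eq : (Exp.ite (eq a b) p q).eval m =
    if a.eval m = b.eval m then p.eval m else q.eval m := by
  by_cases h : a.eval m = b.eval m <;> simp [eval, eq, BinOp.eval, h]

end Exp

end WordRAM

namespace DynAPSP

open WordRAM

/-! ### The grid of a block of the matrix

The programs below use the following variables: `7`, the size `m` of the matrix; `8`, the number
`Ω`; `9` and `10`, the numbers `x` and `y` of rows and columns of the block; `11` and `12`, the
indices of its first row and column; `13`, the index of the first cell of the simulated memory;
`14`, the step counter; `15`, the distance between the memories of successive simulations; `16`,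
the number of nodes of the grid; `17` to `20`, loop counters; `21`, the initial weight of the
variable edges. Array `5` holds the matrix, array `6` its square. -/

/-- A block of size `x × y` of an `m × m` matrix `X` with entries in `[0, 5 * Ω]`. -/
structure Block where
  m : ℕ
  Ω : ℕ
  x : ℕ
  y : ℕ
  kb : ℕ
  jb : ℕ
  X : ℕ → ℤ
  x_pos : 0 < x
  y_pos : 0 < y
  Ω_pos : 0 < Ω
  kb_le : kb + x ≤ m
  jb_le : jb + y ≤ m
  X_nonneg : ∀ i, 0 ≤ X i
  X_le : ∀ i, X i ≤ 5 * Ω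

namespace Block

variable (K : Block)

/-- The grid that encodes the block. -/
def gadget : Gadget where
  x := K.x
  y := K.y
  Ω := K.Ω
  b r j := if 1 ≤ j ∧ j ≤ K.y then K.X ((K.kb + r) * K.m + K.jb + (j - 1)) else 0
  x_pos := K.x_pos
  y_pos := K.y_pos
  Ω_pos := K.Ω_pos
  b_zero r := by simp
  b_nonneg r j := by
    split_ifs
    · exact K.X_nonneg _
    · exact le_rfl
  b_le r j := by
    split_ifs
    · exact K.X_le _
    · positivity

/-- The variables and arrays that describe the block. -/
structure Env (U : ℕ) (M : Mem) : Prop where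
  X : M 5 = K.X
  m : M 7 0 = K.m
  Ω : M 8 0 = K.Ω
  x : M 9 0 = K.x
  y : M 10 0 = K.y
  kb : M 11 0 = K.kb
  jb : M 12 0 = K.jb
  N : M 16 0 = K.gadget.N
  U : M 21 0 = U

variable {K}

theorem Env.congr {U : ℕ} {M M' : Mem} (h : K.Env U M)
    (hM : ∀ a ∈ [5, 7, 8, 9, 10, 11, 12, 16, 21], M' a = M a) : K.Env U M' := by
  obtain ⟨h1, h2, h3, h4, h5, h6, h7, h8, h9⟩ := h
  simp only [List.mem_cons, List.not_mem_nil, or_false, forall_eq_or_imp, forall_eq] at hM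
  obtain ⟨e1, e2, e3, e4, e5, e6, e7, e8, e9⟩ := hM
  exact ⟨by rw [e1, h1], by rw [e2, h2], by rw [e3, h3], by rw [e4, h4], by rw [e5, h5],
    by rw [e6, h6], by rw [e7, h7], by rw [e8, h8], by rw [e9, h9]⟩

end Block

/-- The entry `b r j` of the gadget. -/
def entryExp (r j : Exp) : Exp :=
  .ite (.lt 0 j) (.ite (.lt j (.v 10 + 1)) (.ld 5 ((.v 11 + r) * .v 7 + .v 12 + (j - 1))) 0) 0

/-- The weight of the edge in row `r` from column `c` to column `c + 1`. -/
def horExp (r c : Exp) : Exp :=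
  .ite (.lt (c + 1) (2 * .v 10)) (6 * .v 8 + 10 * .v 8 * (.v 9 - 1 - r))
    (.ite (.eq (c + 1) (2 * .v 10)) (.v 21)
      (6 * .v 8 + 10 * .v 8 * r + entryExp r (c - 2 * .v 10 + 1) - entryExp r (c - 2 * .v 10)))

/-- The entry of the weight matrix with the index in variable `17`. -/
def weightExp : Exp :=
  let ru := .v 17 / .v 16 / (4 * .v 10)
  let cu := .v 17 / .v 16 % (4 * .v 10)
  let rv := .v 17 % .v 16 / (4 * .v 10)
  let cv := .v 17 % .v 16 % (4 * .v 10)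
  .ite (.eq ru rv)
    (.ite (.eq (cu + 1) cv) (horExp ru cu) (.ite (.eq (cv + 1) cu) (horExp ru cv) 0))
    (.ite (.eq cu cv)
      (.ite (.eq (ru + 1) rv) (10 * .v 8 * .v 10) (.ite (.eq (rv + 1) ru) (10 * .v 8 * .v 10) 0)) 0)

namespace Block

variable {K : Block} {U : ℕ} {M : Mem}

open Exp

theorem entryExp_eval (h : K.Env U M) {r j : Exp} {R J : ℕ} (hr : r.eval M = R)
    (hj : j.eval M = J) : (entryExp r j).eval M = K.gadget.b R J := by
  simp only [entryExp, eval_ite_lt, eval_zero, hj, eval_add, eval_v, h.y, eval_one, eval_ld, eval_mul,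
    eval_sub, h.kb, hr, h.m, h.jb, gadget]
  by_cases h1 : 1 ≤ J
  · by_cases h2 : J ≤ K.y
    · rw [if_pos (by omega), if_pos (by omega), if_pos ⟨h1, h2⟩, ← h.X]
      congr 1
      zify [h1]
      rw [Int.toNat_of_nonneg]
      have : (0 : ℤ) ≤ (J : ℤ) - 1 := by omega
      positivity
    · rw [if_pos (by omega), if_neg (by omega), if_neg (by omega)]
  · rw [if_neg (by omega), if_neg (by omega)]

theorem horExp_eval (h : K.Env U M) {r c : Exp} {R C : ℕ} (hr : r.eval M = R)
    (hc : c.eval M = C) : (horExp r c).eval M = K.gadget.hor (fun _ => U) R C := by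
  simp only [horExp, eval_ite_lt, eval_ite_eq, hc, eval_add, eval_v, h.y, eval_mul, eval_num, Nat.cast_ofNat, Nat.cast_one,
    eval_sub, hr, h.x, h.U, h.Ω]
  unfold Gadget.hor Gadget.left Gadget.right
  change (if _ then _ else _) = if C + 1 < 2 * K.y then _ else if C + 1 = 2 * K.y then _ else _
  by_cases h1 : C + 1 < 2 * K.y
  · rw [if_pos (by omega), if_pos h1]; rfl
  · rw [if_neg (by omega), if_neg h1]
    by_cases h2 : C + 1 = 2 * K.y
    · rw [if_pos (by omega), if_pos h2]
    · rw [if_neg (by omega), if_neg h2, entryExp_eval h (R := R) (J := C - 2 * K.y + 1) hr,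
        entryExp_eval h (R := R) (J := C - 2 * K.y) hr]
      · rfl
      · simp only [eval_sub, hc, eval_mul, eval_num, Nat.cast_ofNat, eval_v, h.y]; omega
      · simp only [eval_sub, hc, eval_mul, eval_num, Nat.cast_ofNat, Nat.cast_one, eval_v, h.y, eval_add]; omega

open Classical in
theorem weightExp_eval (h : K.Env U M) {i : ℕ} (hi : M 17 0 = i) (hiN : i < K.gadget.N * K.gadget.N)
    (hU : 10 * K.Ω ≤ U) :
    weightExp.eval M = matArray (fun u v => if (K.gadget.start U).graph.Adj u v then
        ((K.gadget.start U).weight s(u, v) : ℤ) else 0) i := by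
  have hu : i / K.gadget.N < K.gadget.N := Nat.div_lt_of_lt_mul hiN
  have hv : i % K.gadget.N < K.gadget.N := Nat.mod_lt _ (by by_contra h0; simp at h0; simp [h0] at hiN)
  rw [matArray, dif_pos ⟨hu, hv⟩]
  have e1 : (.v 17 / .v 16 / (4 * .v 10) : Exp).eval M = (K.gadget.pos (i / K.gadget.N)).1 := by
    simp only [eval_div, eval_v, eval_mul, eval_num, Nat.cast_ofNat, h.y, h.N, hi, Gadget.pos]; rfl
  have e2 : (.v 17 / .v 16 % (4 * .v 10) : Exp).eval M = (K.gadget.pos (i / K.gadget.N)).2 := by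
    simp only [eval_div, eval_mod, eval_v, eval_mul, eval_num, Nat.cast_ofNat, h.y, h.N, hi, Gadget.pos]; rfl
  have e3 : (.v 17 % .v 16 / (4 * .v 10) : Exp).eval M = (K.gadget.pos (i % K.gadget.N)).1 := by
    simp only [eval_div, eval_mod, eval_v, eval_mul, eval_num, Nat.cast_ofNat, h.y, h.N, hi, Gadget.pos]; rfl
  have e4 : (.v 17 % .v 16 % (4 * .v 10) : Exp).eval M = (K.gadget.pos (i % K.gadget.N)).2 := by
    simp only [eval_mod, eval_v, eval_mul, eval_num, Nat.cast_ofNat, h.y, h.N, hi, Gadget.pos]; rfl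
  have hst := (Gadget.start_is (g := K.gadget) (U := U) hU).2 ⟨_, hu⟩ ⟨_, hv⟩
  simp only [weightExp, eval_ite_eq, eval_add, e1, e2, e3, e4, horExp_eval h e1 e2,
    horExp_eval h e1 e4, eval_mul, eval_num, Nat.cast_ofNat, Nat.cast_one, Nat.cast_zero, eval_v, h.Ω, h.y]
  have hadj : (K.gadget.start U).graph.Adj ⟨_, hu⟩ ⟨_, hv⟩ ↔
      GridAdj (K.gadget.pos (i / K.gadget.N)) (K.gadget.pos (i % K.gadget.N)) := Iff.rfl
  change K.gadget.graph.Adj _ _ → _ at hst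
  have hst' : GridAdj (K.gadget.pos (i / K.gadget.N)) (K.gadget.pos (i % K.gadget.N)) →
    ((K.gadget.start U).weight s(⟨_, hu⟩, ⟨_, hv⟩) : ℤ) = K.gadget.edgeWeight (fun _ => U)
      (K.gadget.pos (i / K.gadget.N)) (K.gadget.pos (i % K.gadget.N)) := hst
  rw [show (if (K.gadget.start U).graph.Adj ⟨_, hu⟩ ⟨_, hv⟩ then
      ((K.gadget.start U).weight s(⟨_, hu⟩, ⟨_, hv⟩) : ℤ) else 0) = _ from if_congr hadj rfl rfl]
  generalize K.gadget.pos (i / K.gadget.N) = p at *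
  generalize K.gadget.pos (i % K.gadget.N) = q at *
  by_cases hpq : GridAdj p q
  · rw [if_pos hpq, hst' hpq]
    unfold Gadget.edgeWeight
    rcases hpq with ⟨h1, h2 | h2⟩ | ⟨h1, h2 | h2⟩
    · rw [if_pos (by omega), if_pos (by omega), if_pos h1, min_eq_left (by omega)]
    · rw [if_pos (by omega), if_neg (by omega), if_pos (by omega), if_pos h1, min_eq_right (by omega)]
    · rw [if_neg (by omega), if_pos (by omega), if_pos (by omega), if_neg (by omega)]; rfl
    · rw [if_neg (by omega), if_pos (by omega), if_neg (by omega), if_pos (by omega), if_neg (by omega)]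
      rfl
  · rw [if_neg hpq]
    unfold GridAdj at hpq
    by_cases h1 : p.1 = q.1
    · rw [if_pos (by omega), if_neg (by omega), if_neg (by omega)]
    · rw [if_neg (by omega)]
      by_cases h2 : p.2 = q.2
      · rw [if_pos (by omega), if_neg (by omega), if_neg (by omega)]
      · rw [if_neg (by omega)]

theorem weightExp_chk : weightExp.chk := by decide

end Block

end DynAPSP

namespace WordRAM

/-- The rule for the simulation of a run of another program. -/
theorem Ex.of_sim {V B base c t : ℕ} {p : Prog} {mA mA' M : Mem} {Q : ℕ → Mem → Prop}
    (hr : Runs B p mA t mA') (hw : WF B mA) (hs : Sim base mA M)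
    (hbase : M 13 0 = base) (hc : M 14 0 = c) (hb : base + B ≤ V) (ht : c + t ≤ V)
    (hQ : ∀ M', Sim base mA' M' → M' 14 0 = (c + t : ℕ) → (∀ a < 100, a ≠ 14 → M' a = M a) →
      Q (t * 100) M') : Ex V (sim p) M Q := by
  intro hM
  have hVV : V ≤ V ^ 500 := Nat.le_self_pow (n := 500) (by norm_num) V
  have h := sim_exec (B := B) (Bw := V ^ 500) (hb.trans hVV) hr hw M c hbase (ht.trans hVV)
  rw [← hc, hs.eq_overlay] at h
  refine ⟨t * 100, _, h, ?_, hQ _ (fun a i => overlay_sim ..) (overlay_counter ..)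
    fun a ha ha' => overlay_own _ _ _ _ ha ha'⟩
  intro a ha i
  unfold overlay
  split_ifs
  · exact ((hr.wf hw) _ _).1.trans (by exact_mod_cast (by omega : B ≤ V))
  · rw [abs_of_nonneg (by positivity)]; exact_mod_cast ht
  · exact hM a ha i

end WordRAM

namespace DynAPSP

open WordRAM

theorem Algorithm.Serves.mono {A : Algorithm} {B B' N : ℕ} (hB : B ≤ B') :
    ∀ {ops : List (Op (Fin N))} {G : WGraph (Fin N)} {m : Mem} {t : ℕ},
      A.Serves B G m ops t → A.Serves B' G m ops t
  | [], _, _, _, h => h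
  | .update _ :: _, _, _, _, ⟨t₁, t₂, m', h1, h2, h3⟩ => ⟨t₁, t₂, m', h1.mono hB, h2.mono hB, h3⟩
  | .query _ _ :: _, _, _, _, ⟨t₁, t₂, m', h1, h2, h3, h4⟩ =>
      ⟨t₁, t₂, m', h1.mono hB, h2, h3.mono hB, h4⟩

theorem Algorithm.Serves.length_le {A : Algorithm} {B N : ℕ} :
    ∀ {ops : List (Op (Fin N))} {G : WGraph (Fin N)} {m : Mem} {t : ℕ},
      A.Serves B G m ops t → ops.length ≤ t
  | [], _, _, _, h => by simp
  | .update _ :: _, _, _, _, ⟨t₁, t₂, m', h1, h2, h3⟩ => by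
      have := h1.one_le; have := h2.length_le; simp; omega
  | .query _ _ :: _, _, _, _, ⟨t₁, t₂, m', h1, h2, h3, h4⟩ => by
      have := h1.one_le; have := h3.length_le; simp; omega

/-! ### Serving the operations on a simulated grid -/

/-- The index of the left end of the variable edge of the row in variable `19`. -/
def midLeftExp : Exp := .v 19 * (4 * .v 10) + (2 * .v 10 - 1)

/-- The index of the right end of the variable edge of the row in variable `19`. -/
def midRightExp : Exp := .v 19 * (4 * .v 10) + 2 * .v 10

/-- The new weight of that edge, for the row of the matrix in variable `18`. -/
def newWeightExp : Exp := .v 21 + .ld 5 (.v 18 * .v 7 + .v 11 + .v 19)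

/-- Change the weight of the variable edge of the row in variable `19`. -/
def setProg (A : Algorithm) (del : Bool) : Prog :=
  if del then
    .seq (put 100 (.v 13) midLeftExp) <| .seq (put 101 (.v 13) midRightExp) <|
    .seq (sim A.deleteEdge) <|
    .seq (put 100 (.v 13) midLeftExp) <| .seq (put 101 (.v 13) midRightExp) <|
    .seq (put 102 (.v 13) newWeightExp) <| sim A.insertEdge
  else
    .seq (put 100 (.v 13) midLeftExp) <| .seq (put 101 (.v 13) midRightExp) <|
    .seq (put 102 (.v 13) newWeightExp) <| sim A.setWeight

/-- The index of the left terminal of the column in variable `20`. -/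
def sourceExp : Exp := 2 * .v 10 - 1 - (.v 20 + 1)

/-- The index of the right terminal of the column in variable `20`. -/
def targetExp : Exp := (.v 9 - 1) * (4 * .v 10) + (2 * .v 10 + (.v 20 + 1))

/-- The encoded part of the distance that the last query has returned. -/
def answerExp : Exp :=
  .ld 100 (.v 13) - (12 * .v 8 * (.v 20 + 1) + (.v 9 - 1) * (10 * .v 8 * .v 10) +
    10 * .v 8 * (.v 9 - 1) * (.v 20 + 1)) - .v 21

/-- The index of the entry that the query contributes to. -/
def cellExp : Exp := .v 18 * .v 7 + .v 12 + .v 20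

/-- Ask for the distance of the terminals of the column in variable `20`, and update the square of
the matrix in array `6`. -/
def queryProg (A : Algorithm) : Prog :=
  .seq (put 100 (.v 13) sourceExp) <| .seq (put 101 (.v 13) targetExp) <|
  .seq (sim A.query) <|
  put 6 cellExp (.ite (.lt answerExp (.ld 6 cellExp)) answerExp (.ld 6 cellExp))

/-- The state of a simulation: the memory of the algorithm `A` sits at `base`, the current graph is
the grid with variable weights `a`, and the operations `L` can be served in `t` steps. The counter
will then have reached `T`. -/
def Serving (A : Algorithm) (del : Bool) (g : Gadget) (base B T : ℕ) (L : List (GOp g.x g.y))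
    (a : ℕ → ℤ) (t : ℕ) (M : Mem) : Prop :=
  ∃ (mA : Mem) (G : WGraph (Fin g.N)) (c : ℕ), Sim base mA M ∧ WF B mA ∧ g.Is a G ∧
    A.Serves B G mA (L.flatMap (g.toOps del)) t ∧ M 13 0 = base ∧ M 14 0 = c ∧ c + t = T

theorem Serving.congr {A : Algorithm} {del : Bool} {g : Gadget} {base B T : ℕ}
    {L : List (GOp g.x g.y)} {a : ℕ → ℤ} {t : ℕ} {M M' : Mem} (h : Serving A del g base B T L a t M)
    (hM : ∀ a, 100 ≤ a ∨ a = 13 ∨ a = 14 → M' a = M a) : Serving A del g base B T L a t M' := by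
  obtain ⟨mA, G, c, h1, h2, h3, h4, h5, h6, h7⟩ := h
  exact ⟨mA, G, c, fun a i => by rw [hM _ (by omega), h1], h2, h3, h4,
    by rw [hM _ (by omega), h5], by rw [hM _ (by omega), h6], h7⟩

section steps

variable {A : Algorithm} {del : Bool} {K : Block} {V base B T U : ℕ}
  {L : List (GOp K.gadget.x K.gadget.y)} {a : ℕ → ℤ} {t : ℕ} {M : Mem}

open Exp

theorem midLeftExp_eval (h : K.Env U M) {k : Fin K.gadget.x} (hk : M 19 0 = (k : ℕ)) :
    midLeftExp.eval M = (K.gadget.midLeft k : ℕ) := by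
  simp only [midLeftExp, eval_add, eval_mul, eval_sub, eval_v, eval_num, Nat.cast_ofNat, Nat.cast_one,
    h.y, hk, Gadget.midLeft, Gadget.node]
  have h1 : K.gadget.y = K.y := rfl
  have h2 := K.y_pos
  rw [h1]
  push_cast [(by omega : 1 ≤ 2 * K.y)]
  ring

theorem midRightExp_eval (h : K.Env U M) {k : Fin K.gadget.x} (hk : M 19 0 = (k : ℕ)) :
    midRightExp.eval M = (K.gadget.midRight k : ℕ) := by
  simp only [midRightExp, eval_add, eval_mul, eval_v, eval_num, Nat.cast_ofNat,
    h.y, hk, Gadget.midRight, Gadget.node]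
  have h1 : K.gadget.y = K.y := rfl
  rw [h1]
  push_cast
  ring

theorem newWeightExp_eval (h : K.Env U M) {k : Fin K.gadget.x} {i : ℕ} (hk : M 19 0 = (k : ℕ))
    (hi : M 18 0 = i) : newWeightExp.eval M = (U + (K.X (i * K.m + K.kb + k)).toNat : ℕ) := by
  simp only [newWeightExp, eval_add, eval_mul, eval_v, eval_ld,
    h.U, h.m, h.kb, hk, hi, h.X]
  have h1 : ((i : ℤ) * K.m + K.kb + (k : ℕ)).toNat = i * K.m + K.kb + k := by
    rw [show (i : ℤ) * K.m + K.kb + (k : ℕ) = (i * K.m + K.kb + k : ℕ) by push_cast; ring]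
    exact Int.toNat_natCast _
  rw [h1, Nat.cast_add, Int.toNat_of_nonneg (K.X_nonneg _)]

theorem sourceExp_eval (h : K.Env U M) {j : Fin K.gadget.y} (hj : M 20 0 = (j : ℕ)) :
    sourceExp.eval M = (K.gadget.source j : ℕ) := by
  have h1 : K.gadget.y = K.y := rfl
  have h2 := j.2
  simp only [sourceExp, eval_add, eval_mul, eval_sub, eval_v, eval_num, Nat.cast_ofNat, Nat.cast_one,
    h.y, hj, Gadget.source, Gadget.node]
  omega

theorem targetExp_eval (h : K.Env U M) {j : Fin K.gadget.y} (hj : M 20 0 = (j : ℕ)) :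
    targetExp.eval M = (K.gadget.target j : ℕ) := by
  have h1 : K.gadget.y = K.y := rfl
  have h3 : K.gadget.x = K.x := rfl
  have h2 := K.x_pos
  simp only [targetExp, eval_add, eval_mul, eval_sub, eval_v, eval_num, Nat.cast_ofNat, Nat.cast_one,
    h.y, h.x, hj, Gadget.target, Gadget.node]
  change _ = (((K.x - 1) * (4 * K.y) + (2 * K.y + (j + 1)) : ℕ) : ℤ)
  push_cast [(by omega : 1 ≤ K.x)]
  ring

theorem Ex.of_putArg {V base B : ℕ} {mA M : Mem} {e : Exp} {Q : ℕ → Mem → Prop} {z : ℕ} (x : ℕ)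
    (hV : 100 ≤ V)
    (hc : e.chk) (hs : Sim base mA M) (hw : WF B mA) (hb : M 13 0 = base) (he : e.eval M = z)
    (hzB : z ≤ B) (hBV : B ≤ V)
    (hQ : Sim base (mA.write x 0 z) (M.write (100 + x) base z) → WF B (mA.write x 0 z) →
      Q 2000 (M.write (100 + x) base z)) :
    Ex V (put (100 + x) (.v 13) e) M Q := by
  have hz : |(z : ℤ)| ≤ V := by
    rw [abs_of_nonneg (by positivity)]; exact_mod_cast hzB.trans hBV
  refine Ex.of_put hV (by decide) hc (by rw [he]; exact hz) ?_
  rw [eval_v, hb, he, Int.toNat_natCast]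
  refine hQ (by simpa using hs.write x 0 z) (hw.write (Nat.zero_le _) ?_)
  rw [abs_of_nonneg (by positivity)]; exact_mod_cast hzB

/-- Changing a variable weight. The time is at most a constant times the number of simulated
steps. -/
theorem Serving.set {k : Fin K.gadget.x} {i : ℕ} (hV : 100 ≤ V)
    (h : Serving A del K.gadget base B T
      (.set k (U + (K.X (i * K.m + K.kb + k)).toNat) :: L) a t M)
    (hE : K.Env U M) (hk : M 19 0 = (k : ℕ)) (hi : M 18 0 = i) (hBV : base + B ≤ V) (hT : T ≤ V)
    (hN : K.gadget.N ≤ B) (hU : U + 5 * K.Ω ≤ B) :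
    Ex V (setProg A del) M fun τ M' => ∃ t', t' < t ∧ τ + 12000 * t' ≤ 12000 * t ∧
      (∀ b < 100, b ≠ 14 → M' b = M b) ∧
      Serving A del K.gadget base B T L
        (Function.update a k (U + (K.X (i * K.m + K.kb + k)).toNat : ℕ)) t' M' := by
  obtain ⟨mA, G, c, hs, hw, hG, hserv, hb, hc, hcT⟩ := h
  have hw5 : U + (K.X (i * K.m + K.kb + k)).toNat ≤ B := by
    have := K.X_le (i * K.m + K.kb + k); omega
  have hul := (K.gadget.midLeft k).2
  have hur := (K.gadget.midRight k).2
  have frame : ∀ (M' : Mem) (x : ℕ) (z : ℤ) (b : ℕ), b < 100 → (M'.write (100 + x) base z) b = M' b :=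
    fun M' x z b hb => Mem.write_of_ne _ _ _ (by omega)
  have env : ∀ M' : Mem, (∀ b < 100, b ≠ 14 → M' b = M b) → K.Env U M' ∧ M' 13 0 = base ∧
      M' 19 0 = (k : ℕ) ∧ M' 18 0 = i := fun M' hM' =>
    ⟨hE.congr fun b hb => hM' b (by fin_cases hb <;> norm_num) (by fin_cases hb <;> norm_num),
      by rw [hM' 13 (by norm_num) (by norm_num), hb], by rw [hM' 19 (by norm_num) (by norm_num), hk],
      by rw [hM' 18 (by norm_num) (by norm_num), hi]⟩
  cases del with
  | false =>
    obtain ⟨t₁, t₂, mA', hr, hrest, rfl⟩ := hserv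
    have h1 := hr.one_le
    refine Ex.of_seq (Ex.of_putArg 0 hV (by decide) hs hw hb (midLeftExp_eval hE hk) (by omega)
      (by omega) fun hs1 hw1 => ?_)
    have f1 : ∀ b < 100, b ≠ 14 → (M.write (100 + 0) base (K.gadget.midLeft k : ℕ)) b = M b :=
      fun b hb _ => frame _ _ _ b hb
    obtain ⟨e1, e2, e3, e4⟩ := env _ f1
    refine Ex.of_seq (Ex.of_putArg 1 hV (by decide) hs1 hw1 e2 (midRightExp_eval e1 e3) (by omega)
      (by omega) fun hs2 hw2 => ?_)
    have f2 : ∀ b < 100, b ≠ 14 → ((M.write (100 + 0) base (K.gadget.midLeft k : ℕ)).write (100 + 1)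
        base (K.gadget.midRight k : ℕ)) b = M b :=
      fun b hb hb' => by rw [frame _ _ _ b hb, f1 b hb hb']
    obtain ⟨e1, e2, e3, e4⟩ := env _ f2
    refine Ex.of_seq (Ex.of_putArg 2 hV (by decide) hs2 hw2 e2 (newWeightExp_eval e1 e3 e4) hw5
      (by omega) fun hs3 hw3 => ?_)
    have f3 : ∀ b < 100, (((M.write (100 + 0) base (K.gadget.midLeft k : ℕ)).write (100 + 1)
        base (K.gadget.midRight k : ℕ)).write (100 + 2) base
        (U + (K.X (i * K.m + K.kb + k)).toNat : ℕ)) b = M b :=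
      fun b hb => by rw [frame _ _ _ b hb, frame _ _ _ b hb, frame _ _ _ b hb]
    refine Ex.of_sim hr hw3 hs3 (by rw [f3 13 (by norm_num), hb]) (by rw [f3 14 (by norm_num), hc])
      hBV (by omega) fun M' hs4 hc4 f4 => ?_
    refine ⟨t₂, by omega, by omega, fun b hb hb' => by rw [f4 b hb hb', f3 b hb], mA', _, c + t₁,
      hs4, hr.wf hw3, hG.setGraph false k _, hrest, ?_, hc4, by omega⟩
    rw [f4 13 (by norm_num) (by norm_num), f3 13 (by norm_num), hb]
  | true =>
    obtain ⟨t₀, t', mA₀, hr₀, ⟨t₁, t₂, mA', hr, hrest, rfl⟩, rfl⟩ := hserv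
    have h0 := hr₀.one_le
    have h1 := hr.one_le
    refine Ex.of_seq (Ex.of_putArg 0 hV (by decide) hs hw hb (midLeftExp_eval hE hk) (by omega)
      (by omega) fun hs1 hw1 => ?_)
    have f1 : ∀ b < 100, b ≠ 14 → (M.write (100 + 0) base (K.gadget.midLeft k : ℕ)) b = M b :=
      fun b hb _ => frame _ _ _ b hb
    obtain ⟨e1, e2, e3, e4⟩ := env _ f1
    refine Ex.of_seq (Ex.of_putArg 1 hV (by decide) hs1 hw1 e2 (midRightExp_eval e1 e3) (by omega)
      (by omega) fun hs2 hw2 => ?_)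
    have f2 : ∀ b < 100, ((M.write (100 + 0) base (K.gadget.midLeft k : ℕ)).write (100 + 1)
        base (K.gadget.midRight k : ℕ)) b = M b :=
      fun b hb => by rw [frame _ _ _ b hb, frame _ _ _ b hb]
    refine Ex.of_seq (Ex.of_sim hr₀ hw2 hs2 (by rw [f2 13 (by norm_num), hb])
      (by rw [f2 14 (by norm_num), hc]) hBV (by omega) fun N hsN hcN fN => ?_)
    have hwN := hr₀.wf hw2
    have fN' : ∀ b < 100, b ≠ 14 → N b = M b := fun b hb hb' => by rw [fN b hb hb', f2 b hb]
    obtain ⟨e1, e2, e3, e4⟩ := env _ fN'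
    refine Ex.of_seq (Ex.of_putArg 0 hV (by decide) hsN hwN e2 (midLeftExp_eval e1 e3) (by omega)
      (by omega) fun hs1 hw1 => ?_)
    have f1 : ∀ b < 100, b ≠ 14 → (N.write (100 + 0) base (K.gadget.midLeft k : ℕ)) b = M b :=
      fun b hb hb' => by rw [frame _ _ _ b hb, fN' b hb hb']
    obtain ⟨e1, e2, e3, e4⟩ := env _ f1
    refine Ex.of_seq (Ex.of_putArg 1 hV (by decide) hs1 hw1 e2 (midRightExp_eval e1 e3) (by omega)
      (by omega) fun hs2 hw2 => ?_)
    have f2 : ∀ b < 100, b ≠ 14 → ((N.write (100 + 0) base (K.gadget.midLeft k : ℕ)).write (100 + 1)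
        base (K.gadget.midRight k : ℕ)) b = M b :=
      fun b hb hb' => by rw [frame _ _ _ b hb, f1 b hb hb']
    obtain ⟨e1, e2, e3, e4⟩ := env _ f2
    refine Ex.of_seq (Ex.of_putArg 2 hV (by decide) hs2 hw2 e2 (newWeightExp_eval e1 e3 e4) hw5
      (by omega) fun hs3 hw3 => ?_)
    have f3 : ∀ b < 100, (((N.write (100 + 0) base (K.gadget.midLeft k : ℕ)).write (100 + 1)
        base (K.gadget.midRight k : ℕ)).write (100 + 2) base
        (U + (K.X (i * K.m + K.kb + k)).toNat : ℕ)) b = N b :=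
      fun b hb => by rw [frame _ _ _ b hb, frame _ _ _ b hb, frame _ _ _ b hb]
    refine Ex.of_sim hr hw3 hs3 (by rw [f3 13 (by norm_num), fN' 13 (by norm_num) (by norm_num), hb])
      (by rw [f3 14 (by norm_num), hcN]) hBV (by omega) fun M' hs4 hc4 f4 => ?_
    refine ⟨t₂, by omega, by omega, fun b hb hb' => by rw [f4 b hb hb', f3 b hb, fN' b hb hb'],
      mA', _, c + t₀ + t₁, hs4, hr.wf hw3, hG.setGraph true k _, hrest, ?_, hc4, by omega⟩
    rw [f4 13 (by norm_num) (by norm_num), f3 13 (by norm_num), fN' 13 (by norm_num) (by norm_num), hb]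

end steps

/-- `Y'` arises from `Y` by lowering entries to values `X i k + X k j`. -/
structure Relax (m : ℕ) (X Y Y' : ℕ → ℤ) : Prop where
  le : ∀ p, Y' p ≤ Y p
  attained : ∀ p, Y' p = Y p ∨ ∃ i j k, i < m ∧ j < m ∧ k < m ∧ p = i * m + j ∧
    Y' p = X (i * m + k) + X (k * m + j)

theorem Relax.refl (m : ℕ) (X Y : ℕ → ℤ) : Relax m X Y Y := ⟨fun _ => le_rfl, fun _ => .inl rfl⟩

theorem Relax.trans {m : ℕ} {X Y Y' Y'' : ℕ → ℤ} (h : Relax m X Y Y') (h' : Relax m X Y' Y'') :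
    Relax m X Y Y'' := by
  refine ⟨fun p => (h'.le p).trans (h.le p), fun p => ?_⟩
  rcases h'.attained p with h1 | h1
  · rw [h1]; exact h.attained p
  · exact .inr h1

section steps

variable {A : Algorithm} {del : Bool} {K : Block} {V base B T U : ℕ}
  {L : List (GOp K.gadget.x K.gadget.y)} {a : ℕ → ℤ} {t : ℕ} {M : Mem}

open Exp

theorem distWord_coe (d : ℕ) : distWord (d : ℕ∞) = d := by
  unfold distWord
  rw [if_neg (ENat.natCast_ne_top d), ENat.toNat_natCast]

/-- A query relaxes the entry of the square in its row and column. -/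
theorem Serving.query {j : Fin K.gadget.y} {i : ℕ} (hV : 100 ≤ V)
    (h : Serving A del K.gadget base B T (.query j :: L) a t M)
    (hE : K.Env U M) (hj : M 20 0 = (j : ℕ)) (hi : M 18 0 = i) (him : i < K.m)
    (hBV : base + B ≤ V) (hT : T ≤ V)
    (hN : K.gadget.N ≤ B) (hU : 10 * K.Ω ≤ U) (hΩV : 10 * K.Ω ≤ V)
    (ha : ∀ k, k < K.x → a k = U + K.X (i * K.m + (K.kb + k))) :
    Ex V (queryProg A) M fun τ M' => ∃ t', t' < t ∧ τ + 12000 * t' ≤ 12000 * t ∧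
      (∀ b < 100, b ≠ 14 → b ≠ 6 → M' b = M b) ∧ Relax K.m K.X (M 6) (M' 6) ∧
      (∀ k, k < K.x → M' 6 (i * K.m + (K.jb + j)) ≤
        K.X (i * K.m + (K.kb + k)) + K.X ((K.kb + k) * K.m + (K.jb + j))) ∧
      Serving A del K.gadget base B T L a t' M' := by
  obtain ⟨mA, G, c, hs, hw, hG, ⟨t₁, t₂, mA', hr, hans, hrest, rfl⟩, hb, hc, hcT⟩ := h
  have h1 := hr.one_le
  have hul := (K.gadget.source j).2
  have hur := (K.gadget.target j).2
  have hjy : (j : ℕ) < K.y := j.2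
  have frame : ∀ (M' : Mem) (x : ℕ) (z : ℤ) (b : ℕ), b < 100 → (M'.write (100 + x) base z) b = M' b :=
    fun M' x z b hb => Mem.write_of_ne _ _ _ (by omega)
  have env : ∀ M' : Mem, (∀ b < 100, b ≠ 14 → M' b = M b) → K.Env U M' ∧ M' 13 0 = base ∧
      M' 20 0 = (j : ℕ) ∧ M' 18 0 = i := fun M' hM' =>
    ⟨hE.congr fun b hb => hM' b (by fin_cases hb <;> norm_num) (by fin_cases hb <;> norm_num),
      by rw [hM' 13 (by norm_num) (by norm_num), hb], by rw [hM' 20 (by norm_num) (by norm_num), hj],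
      by rw [hM' 18 (by norm_num) (by norm_num), hi]⟩
  -- the least entry, and the distance
  obtain ⟨k₀, hk₀, hmin⟩ := Finset.exists_min_image (Finset.range K.x)
    (fun k => K.X (i * K.m + (K.kb + k)) + K.X ((K.kb + k) * K.m + (K.jb + j)))
    ⟨0, Finset.mem_range.2 K.x_pos⟩
  rw [Finset.mem_range] at hk₀
  set D := K.X (i * K.m + (K.kb + k₀)) + K.X ((K.kb + k₀) * K.m + (K.jb + j)) with hD
  have hgb : ∀ k, K.gadget.b k (j + 1) = K.X ((K.kb + k) * K.m + (K.jb + j)) := fun k => by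
    change (if 1 ≤ (j : ℕ) + 1 ∧ (j : ℕ) + 1 ≤ K.y then _ else _) = _
    rw [if_pos ⟨by omega, by omega⟩, Nat.add_sub_cancel, add_assoc]
  obtain ⟨T', hT', hdist⟩ := Gadget.dist_eq hG (j := j + 1) (D := U + D)
    (fun r hr => by
      rw [ha r hr]
      have := K.X_nonneg (i * K.m + (K.kb + r))
      have : (10 * K.Ω : ℤ) ≤ U := by exact_mod_cast hU
      change (10 * K.Ω : ℤ) ≤ _
      linarith) hjy
    (fun r hr => by
      rw [ha r hr, hgb]
      have := hmin r (Finset.mem_range.2 hr)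
      linarith)
    ⟨k₀, hk₀, by rw [ha k₀ hk₀, hgb, hD]; ring⟩
  have hans' : mA' 0 0 = T' := by
    rw [hans, ← distWord_coe, ← hdist]; rfl
  refine Ex.of_seq (Ex.of_putArg 0 hV (by decide) hs hw hb (sourceExp_eval hE hj) (by omega)
    (by omega) fun hs1 hw1 => ?_)
  have f1 : ∀ b < 100, b ≠ 14 → (M.write (100 + 0) base (K.gadget.source j : ℕ)) b = M b :=
    fun b hb _ => frame _ _ _ b hb
  obtain ⟨e1, e2, e3, e4⟩ := env _ f1
  refine Ex.of_seq (Ex.of_putArg 1 hV (by decide) hs1 hw1 e2 (targetExp_eval e1 e3) (by omega)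
    (by omega) fun hs2 hw2 => ?_)
  have f2 : ∀ b < 100, ((M.write (100 + 0) base (K.gadget.source j : ℕ)).write (100 + 1)
      base (K.gadget.target j : ℕ)) b = M b :=
    fun b hb => by rw [frame _ _ _ b hb, frame _ _ _ b hb]
  refine Ex.of_seq (Ex.of_sim hr hw2 hs2 (by rw [f2 13 (by norm_num), hb])
    (by rw [f2 14 (by norm_num), hc]) hBV (by omega) fun N hsN hcN fN => ?_)
  have fN' : ∀ b < 100, b ≠ 14 → N b = M b := fun b hb hb' => by rw [fN b hb hb', f2 b hb]
  obtain ⟨e1, e2, e3, e4⟩ := env _ fN'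
  have hcell : cellExp.eval N = (i * K.m + (K.jb + j) : ℕ) := by
    simp only [cellExp, eval_add, eval_mul, eval_v, e4, e1.m, e1.jb, e3]; push_cast; ring
  have hcell' : (Exp.ld 6 cellExp).eval N = M 6 (i * K.m + (K.jb + j)) := by
    rw [eval_ld, hcell, Int.toNat_natCast, fN' 6 (by norm_num) (by norm_num)]
  have hanswer : answerExp.eval N = D := by
    have h2 : N 100 base = T' := by rw [← hans', ← hsN 0 0]; rfl
    simp only [answerExp, eval_sub, eval_ld, eval_add, eval_mul, eval_v, eval_num, Nat.cast_ofNat,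
      Nat.cast_one, e1.Ω, e1.x, e1.y, e1.U, e2, e3, Int.toNat_natCast, h2, hT', Gadget.offset]
    change (12 * (K.Ω : ℤ) * ((j + 1 : ℕ) : ℤ) + (K.x - 1) * (10 * K.Ω * K.y) +
      10 * K.Ω * (K.x - 1) * ((j + 1 : ℕ) : ℤ) + (U + D)) - _ - _ = _
    push_cast; ring
  have hval : (Exp.ite (.lt answerExp (.ld 6 cellExp)) answerExp (.ld 6 cellExp)).eval N =
      min D (M 6 (i * K.m + (K.jb + j))) := by
    rw [eval_ite_lt, hanswer, hcell']
    split_ifs with h2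
    · rw [min_eq_left h2.le]
    · rw [min_eq_right (not_lt.1 h2)]
  refine Ex.intro fun hNb => Ex.of_put hV (by decide) (by decide) ?_ ?_
  · rw [hval]
    have b1 := K.X_nonneg (i * K.m + (K.kb + k₀))
    have b2 := K.X_le (i * K.m + (K.kb + k₀))
    have b3 := K.X_nonneg ((K.kb + k₀) * K.m + (K.jb + j))
    have b4 := K.X_le ((K.kb + k₀) * K.m + (K.jb + j))
    have b5 : (10 * K.Ω : ℤ) ≤ V := by exact_mod_cast hΩV
    rcases min_choice D (M 6 (i * K.m + (K.jb + j))) with h2 | h2 <;> rw [h2]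
    · rw [abs_le]; constructor <;> linarith
    · rw [← fN' 6 (by norm_num) (by norm_num)]; exact hNb 6 (by decide) _
  · rw [hval, hcell, Int.toNat_natCast]
    have hM6 : ∀ p, (N.write 6 (i * K.m + (K.jb + j)) (min D (M 6 (i * K.m + (K.jb + j))))) 6 p =
        if p = i * K.m + (K.jb + j) then min D (M 6 (i * K.m + (K.jb + j))) else M 6 p := fun p => by
      rw [Mem.write_apply]; simp only [true_and]; rw [fN' 6 (by norm_num) (by norm_num)]
    refine ⟨t₂, by omega, by omega, fun b hb hb' hb6 => by
      rw [Mem.write_of_ne _ _ _ hb6, fN' b hb hb'], ⟨fun p => ?_, fun p => ?_⟩, fun k hk => ?_,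
      mA', G, c + t₁, hsN.write_own (by norm_num) _ _, hr.wf hw2, hG, hrest, ?_, ?_, by omega⟩
    · rw [hM6]
      split_ifs with h2
      · rw [h2]; exact min_le_right _ _
      · exact le_rfl
    · rw [hM6]
      split_ifs with h2
      · rcases min_choice D (M 6 (i * K.m + (K.jb + j))) with h3 | h3
        · refine .inr ⟨i, K.jb + j, K.kb + k₀, him, ?_, ?_, h2, by rw [h3]⟩
          · have := K.jb_le; omega
          · have := K.kb_le; omega
        · exact .inl (by rw [h3, h2])
      · exact .inl rfl
    · rw [hM6, if_pos rfl]
      exact (min_le_left _ _).trans (hmin k (Finset.mem_range.2 hk))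
    · rw [Mem.write_of_ne _ _ _ (by norm_num), e2]
    · rw [Mem.write_of_ne _ _ _ (by norm_num), hcN]

end steps

/-! ### All operations on one block -/

/-- The operations for one row of the matrix. -/
def Block.rowOps (K : Block) (U i : ℕ) : List (GOp K.gadget.x K.gadget.y) :=
  (List.finRange K.gadget.x).map (fun k => .set k (U + (K.X (i * K.m + K.kb + k)).toNat)) ++
    (List.finRange K.gadget.y).map (fun j => GOp.query j)

/-- All operations for one block. -/
def Block.ops (K : Block) (U : ℕ) : List (GOp K.gadget.x K.gadget.y) :=
  (List.range K.m).flatMap (K.rowOps U)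

/-- The program for one row of the matrix, after the preprocessing. -/
def rowProg (A : Algorithm) (del : Bool) : Prog :=
  .seq (for_ 19 (.v 9) (setProg A del)) (for_ 20 (.v 10) (queryProg A))

section loops

variable {A : Algorithm} {del : Bool} {K : Block} {V base B T U : ℕ}
  {L : List (GOp K.gadget.x K.gadget.y)} {a : ℕ → ℤ} {t : ℕ} {M : Mem}

/-- The weight changes for one row of the matrix. -/
theorem Serving.sets {i : ℕ} (hV : 100 ≤ V)
    (h : Serving A del K.gadget base B T
      ((List.finRange K.gadget.x).map (fun k => .set k (U + (K.X (i * K.m + K.kb + k)).toNat)) ++ L) a t M)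
    (hE : K.Env U M) (hi : M 18 0 = i) (hBV : base + B ≤ V) (hT : T ≤ V)
    (hN : K.gadget.N ≤ B) (hU : U + 5 * K.Ω ≤ B) :
    Ex V (for_ 19 (.v 9) (setProg A del)) M fun τ M' => ∃ t' a', t' + K.x ≤ t ∧
      τ + 13200 * t' ≤ 13200 * t + 1200 ∧
      (∀ b < 100, b ≠ 14 → b ≠ 19 → M' b = M b) ∧
      (∀ k, k < K.x → a' k = U + K.X (i * K.m + (K.kb + k))) ∧
      Serving A del K.gadget base B T L a' t' M' := by
  have hxN : K.x ≤ K.gadget.N := Nat.le_mul_of_pos_right _ (by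
    have : K.gadget.y = K.y := rfl
    have := K.y_pos; omega)
  let I : ℕ → ℕ → Mem → Prop := fun r τ M' => M' 19 0 = r ∧ ∃ t' a', t' + r ≤ t ∧
    τ + 12000 * t' ≤ 12000 * t ∧ (∀ b < 100, b ≠ 14 → b ≠ 19 → M' b = M b) ∧
    (∀ k, k < r → a' k = U + K.X (i * K.m + (K.kb + k))) ∧
    Serving A del K.gadget base B T
      (((List.finRange K.gadget.x).drop r).map (fun k => .set k (U + (K.X (i * K.m + K.kb + k)).toNat)) ++ L)
      a' t' M'
  refine Ex.of_for (n := K.x) hV I (by decide) (by decide) (by omega) ?_ ?_ ?_ ?_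
  · exact ⟨by simp [Mem.write_self], t, a, le_rfl, by simp, fun b _ _ hb => Mem.write_of_ne _ _ _ hb,
      by simp, h.congr fun b hb => Mem.write_of_ne _ _ _ (by omega)⟩
  · rintro r τ M' hr ⟨h1, t', a', -, -, h2, -⟩
    exact ⟨h1, by rw [Exp.eval_v, h2 9 (by norm_num) (by norm_num) (by norm_num), hE.x]⟩
  · rintro r τ M' hr ⟨h1, t', a', h2, h3, h4, h5, h6⟩ -
    rw [List.drop_eq_getElem_cons (by rw [List.length_finRange]; exact hr), List.map_cons, List.cons_append] at h6
    have hE' : K.Env U M' := hE.congr fun b hb =>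
      h4 b (by fin_cases hb <;> norm_num) (by fin_cases hb <;> norm_num) (by fin_cases hb <;> norm_num)
    simp only [List.getElem_finRange, Fin.val_cast] at h6
    refine (Serving.set (k := (⟨r, hr⟩ : Fin K.gadget.x)) hV h6 hE' h1 (by
      rw [h4 18 (by norm_num) (by norm_num) (by norm_num), hi]) hBV hT hN hU).imp ?_
    rintro τ' M'' - ⟨t'', h7, h8, h9, h10⟩
    refine ⟨by rw [h9 19 (by norm_num) (by norm_num), h1], by simp [Mem.write_self], t'', _, by omega,
      by omega, fun b hb hb' hb'' => ?_, ?_, h10.congr fun b hb => Mem.write_of_ne _ _ _ (by omega)⟩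
    · rw [Mem.write_of_ne _ _ _ hb'', h9 b hb hb', h4 b hb hb' hb'']
    · intro k hk
      rcases Nat.lt_succ_iff_lt_or_eq.1 hk with hk | rfl
      · rw [Function.update_of_ne (by simp only; omega), h5 k hk]
      · simp only [Function.update_self]
        rw [Nat.cast_add, Int.toNat_of_nonneg (K.X_nonneg _), add_assoc (i * K.m)]
  · rintro τ M' ⟨h1, t', a', h2, h3, h4, h5, h6⟩
    refine ⟨t', a', by omega, by omega, h4, h5, ?_⟩
    rw [List.drop_eq_nil_of_le (by rw [List.length_finRange]; exact le_rfl)] at h6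
    simpa using h6

/-- The queries for one row of the matrix relax all entries of the square in this row and the
columns of the block. -/
theorem Serving.queries {i : ℕ} (hV : 100 ≤ V)
    (h : Serving A del K.gadget base B T ((List.finRange K.gadget.y).map (fun j => GOp.query j) ++ L) a t M)
    (hE : K.Env U M) (hi : M 18 0 = i) (him : i < K.m) (hBV : base + B ≤ V) (hT : T ≤ V)
    (hN : K.gadget.N ≤ B) (hU : 10 * K.Ω ≤ U) (hΩV : 10 * K.Ω ≤ V)
    (ha : ∀ k, k < K.x → a k = U + K.X (i * K.m + (K.kb + k))) :
    Ex V (for_ 20 (.v 10) (queryProg A)) M fun τ M' => ∃ t', t' ≤ t ∧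
      τ + 13200 * t' ≤ 13200 * t + 1200 ∧
      (∀ b < 100, b ≠ 14 → b ≠ 6 → b ≠ 20 → M' b = M b) ∧ Relax K.m K.X (M 6) (M' 6) ∧
      (∀ j, j < K.y → ∀ k, k < K.x → M' 6 (i * K.m + (K.jb + j)) ≤
        K.X (i * K.m + (K.kb + k)) + K.X ((K.kb + k) * K.m + (K.jb + j))) ∧
      Serving A del K.gadget base B T L a t' M' := by
  have hyN : K.y ≤ K.gadget.N := by
    have h1 : K.gadget.N = K.x * (4 * K.y) := rfl
    have := K.x_pos; nlinarith
  let I : ℕ → ℕ → Mem → Prop := fun r τ M' => M' 20 0 = r ∧ ∃ t', t' + r ≤ t ∧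
    τ + 12000 * t' ≤ 12000 * t ∧ (∀ b < 100, b ≠ 14 → b ≠ 6 → b ≠ 20 → M' b = M b) ∧
    Relax K.m K.X (M 6) (M' 6) ∧
    (∀ j, j < r → ∀ k, k < K.x → M' 6 (i * K.m + (K.jb + j)) ≤
        K.X (i * K.m + (K.kb + k)) + K.X ((K.kb + k) * K.m + (K.jb + j))) ∧
    Serving A del K.gadget base B T (((List.finRange K.gadget.y).drop r).map (fun j => GOp.query j) ++ L) a t' M'
  refine Ex.of_for (n := K.y) hV I (by decide) (by decide) (by omega) ?_ ?_ ?_ ?_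
  · refine ⟨by simp [Mem.write_self], t, le_rfl, by simp, fun b _ _ _ hb => Mem.write_of_ne _ _ _ hb,
      ?_, by simp, h.congr fun b hb => Mem.write_of_ne _ _ _ (by omega)⟩
    rw [Mem.write_of_ne _ _ _ (by norm_num)]; exact .refl _ _ _
  · rintro r τ M' hr ⟨h1, t', -, -, h2, -⟩
    exact ⟨h1, by rw [Exp.eval_v, h2 10 (by norm_num) (by norm_num) (by norm_num) (by norm_num), hE.y]⟩
  · rintro r τ M' hr ⟨h1, t', h2, h3, h4, h5, h5', h6⟩ -
    rw [List.drop_eq_getElem_cons (by rw [List.length_finRange]; exact hr), List.map_cons, List.cons_append] at h6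
    have hE' : K.Env U M' := hE.congr fun b hb => h4 b (by fin_cases hb <;> norm_num)
      (by fin_cases hb <;> norm_num) (by fin_cases hb <;> norm_num) (by fin_cases hb <;> norm_num)
    simp only [List.getElem_finRange] at h6
    refine (Serving.query (j := (⟨r, hr⟩ : Fin K.gadget.y)) hV h6 hE' h1 (by
      rw [h4 18 (by norm_num) (by norm_num) (by norm_num) (by norm_num), hi]) him hBV hT hN hU hΩV
      ha).imp ?_
    rintro τ' M'' - ⟨t'', h7, h8, h9, h10, h11, h12⟩
    refine ⟨by rw [h9 20 (by norm_num) (by norm_num) (by norm_num), h1], by simp [Mem.write_self], t'',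
      by omega, by omega, fun b hb hb' hb6 hb'' => ?_, ?_, ?_,
      h12.congr fun b hb => Mem.write_of_ne _ _ _ (by omega)⟩
    · rw [Mem.write_of_ne _ _ _ hb'', h9 b hb hb' hb6, h4 b hb hb' hb6 hb'']
    · rw [Mem.write_of_ne _ _ _ (by norm_num)]; exact h5.trans h10
    · intro j hj k hk
      rw [Mem.write_of_ne _ _ _ (by norm_num)]
      rcases Nat.lt_succ_iff_lt_or_eq.1 hj with hj | rfl
      · exact (h10.le _).trans (h5' j hj k hk)
      · exact h11 k hk
  · rintro τ M' ⟨h1, t', h2, h3, h4, h5, h5', h6⟩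
    refine ⟨t', by omega, by omega, h4, h5, h5', ?_⟩
    rw [List.drop_eq_nil_of_le (by rw [List.length_finRange]; exact le_rfl)] at h6
    simpa using h6

/-- After all rows, the square is at most the contribution of the block, in all rows and in the
columns of the block. -/
theorem Serving.rows (hV : 100 ≤ V)
    (h : Serving A del K.gadget base B T (K.ops U) a t M)
    (hE : K.Env U M) (hBV : base + B ≤ V) (hT : T ≤ V) (hmV : K.m ≤ V)
    (hN : K.gadget.N ≤ B) (hU : 10 * K.Ω ≤ U) (hU' : U + 5 * K.Ω ≤ B) :
    Ex V (for_ 18 (.v 7) (rowProg A del)) M fun τ M' => ∃ a' t', t' ≤ t ∧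
      τ + 17000 * t' ≤ 17000 * t + 1200 ∧
      (∀ b < 100, b ∉ [6, 14, 18, 19, 20] → M' b = M b) ∧ Relax K.m K.X (M 6) (M' 6) ∧
      (∀ i, i < K.m → ∀ j, j < K.y → ∀ k, k < K.x → M' 6 (i * K.m + (K.jb + j)) ≤
        K.X (i * K.m + (K.kb + k)) + K.X ((K.kb + k) * K.m + (K.jb + j))) ∧
      Serving A del K.gadget base B T [] a' t' M' := by
  let I : ℕ → ℕ → Mem → Prop := fun r τ M' => M' 18 0 = r ∧ ∃ a' t', t' + r ≤ t ∧
    τ + 15700 * t' ≤ 15700 * t ∧ (∀ b < 100, b ∉ [6, 14, 18, 19, 20] → M' b = M b) ∧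
    Relax K.m K.X (M 6) (M' 6) ∧
    (∀ i, i < r → ∀ j, j < K.y → ∀ k, k < K.x → M' 6 (i * K.m + (K.jb + j)) ≤
        K.X (i * K.m + (K.kb + k)) + K.X ((K.kb + k) * K.m + (K.jb + j))) ∧
    Serving A del K.gadget base B T (((List.range K.m).drop r).flatMap (K.rowOps U)) a' t' M'
  refine Ex.of_for (n := K.m) hV I (by decide) (by decide) hmV ?_ ?_ ?_ ?_
  · refine ⟨by simp [Mem.write_self], a, t, le_rfl, by simp, fun b _ hb => Mem.write_of_ne _ _ _ ?_,
      ?_, by simp, h.congr fun b hb => Mem.write_of_ne _ _ _ (by omega)⟩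
    · rintro rfl; simp at hb
    · rw [Mem.write_of_ne _ _ _ (by norm_num)]; exact .refl _ _ _
  · rintro r τ M' hr ⟨h1, a', t', -, -, h2, -⟩
    exact ⟨h1, by rw [Exp.eval_v, h2 7 (by norm_num) (by norm_num), hE.m]⟩
  · rintro r τ M' hr ⟨h1, a', t', h2, h3, h4, h5, h5', h6⟩ -
    rw [List.drop_eq_getElem_cons (by simpa using hr), List.flatMap_cons, List.getElem_range,
      Block.rowOps, List.append_assoc] at h6
    have hE' : K.Env U M' := hE.congr fun b hb => h4 b (by fin_cases hb <;> norm_num)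
      (by fin_cases hb <;> norm_num)
    refine Ex.of_seq ((Serving.sets hV h6 hE' h1 hBV hT hN hU').imp ?_)
    rintro τ₁ M₁ - ⟨t₁, a₁, g1, g2, g3, g4, g5⟩
    have hE₁ : K.Env U M₁ := hE'.congr fun b hb => g3 b (by fin_cases hb <;> norm_num)
      (by fin_cases hb <;> norm_num) (by fin_cases hb <;> norm_num)
    refine (Serving.queries hV g5 hE₁ (by rw [g3 18 (by norm_num) (by norm_num) (by norm_num), h1]) hr
      hBV hT hN hU (by omega) g4).imp ?_
    rintro τ₂ M₂ - ⟨t₂, k1, k2, k3, k4, k5, k6⟩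
    -- every row has at least one set and so takes at least one step
    have hlt : t₂ < t' := by have := K.x_pos; omega
    refine ⟨by rw [k3 18 (by norm_num) (by norm_num) (by norm_num) (by norm_num),
      g3 18 (by norm_num) (by norm_num) (by norm_num), h1], by simp [Mem.write_self], a₁, t₂, by omega,
      by omega, fun b hb hb' => ?_, ?_, ?_, k6.congr fun b hb => Mem.write_of_ne _ _ _ (by omega)⟩
    · simp only [List.mem_cons, List.not_mem_nil, or_false, not_or] at hb'
      obtain ⟨n6, n14, n18, n19, n20⟩ := hb'
      rw [Mem.write_of_ne _ _ _ n18, k3 b hb n14 n6 n20, g3 b hb n14 n19,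
        h4 b hb (by simp [n6, n14, n18, n19, n20])]
    · rw [Mem.write_of_ne _ _ _ (by norm_num)]
      rw [g3 6 (by norm_num) (by norm_num) (by norm_num)] at k4
      exact h5.trans k4
    · intro i hi j hj k hk
      rw [Mem.write_of_ne _ _ _ (by norm_num)]
      rcases Nat.lt_succ_iff_lt_or_eq.1 hi with hi | rfl
      · rw [g3 6 (by norm_num) (by norm_num) (by norm_num)] at k4
        exact (k4.le _).trans (h5' i hi j hj k hk)
      · exact k5 j hj k hk
  · rintro τ M' ⟨h1, a', t', h2, h3, h4, h5, h5', h6⟩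
    refine ⟨a', t', by omega, by omega, h4, h5, h5', ?_⟩
    rw [List.drop_eq_nil_of_le (by simp)] at h6
    simpa using h6

end loops

/-! ### A complete simulation for one block -/

/-- From index `e` on, the arrays of the simulated memories are empty. -/
def Fresh (e : ℕ) (M : Mem) : Prop := ∀ a i, e ≤ i → M (100 + a) i = 0

namespace Block

variable (K : Block) (U : ℕ)

theorem sets_map_set {x y : ℕ} (l : List (Fin x)) (f : Fin x → ℕ) :
    GOp.sets (l.map fun k => (GOp.set k (f k) : GOp x y)) = l.length := by
  induction l with
  | nil => rfl
  | cons k l ih => simp [GOp.sets, ih]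

theorem queries_map_set {x y : ℕ} (l : List (Fin x)) (f : Fin x → ℕ) :
    GOp.queries (l.map fun k => (GOp.set k (f k) : GOp x y)) = 0 := by
  induction l with
  | nil => rfl
  | cons k l ih => simp [GOp.queries, ih]

theorem sets_map_query {x y : ℕ} (l : List (Fin y)) :
    GOp.sets (l.map fun j => (GOp.query j : GOp x y)) = 0 := by
  induction l with
  | nil => rfl
  | cons k l ih => simp [GOp.sets, ih]

theorem queries_map_query {x y : ℕ} (l : List (Fin y)) :
    GOp.queries (l.map fun j => (GOp.query j : GOp x y)) = l.length := by
  induction l with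
  | nil => rfl
  | cons k l ih => simp [GOp.queries, ih]

theorem sets_ops : GOp.sets (K.ops U) = K.m * K.x := by
  unfold ops
  have : ∀ l : List ℕ, GOp.sets (l.flatMap (K.rowOps U)) = l.length * K.x := by
    intro l
    induction l with
    | nil => simp [GOp.sets]
    | cons i l ih =>
      rw [List.flatMap_cons, GOp.sets_append, ih, rowOps, GOp.sets_append, sets_map_set,
        sets_map_query, List.length_finRange, List.length_cons]
      change K.x + 0 + _ = _
      ring
  rw [this, List.length_range]

theorem queries_ops : GOp.queries (K.ops U) = K.m * K.y := by
  unfold ops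
  have : ∀ l : List ℕ, GOp.queries (l.flatMap (K.rowOps U)) = l.length * K.y := by
    intro l
    induction l with
    | nil => simp [GOp.queries]
    | cons i l ih =>
      rw [List.flatMap_cons, GOp.queries_append, ih, rowOps, GOp.queries_append, queries_map_set,
        queries_map_query, List.length_finRange, List.length_cons]
      change 0 + K.y + _ = _
      ring
  rw [this, List.length_range]

theorem valid_ops : GOp.Valid U (U + 5 * K.Ω) (K.ops U) := by
  intro k w h
  simp only [ops, rowOps, List.mem_flatMap, List.mem_append, List.mem_map, List.mem_finRange,
    true_and, reduceCtorEq, exists_false, or_false, GOp.set.injEq] at h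
  obtain ⟨i, -, k', -, rfl⟩ := h
  have := K.X_le (i * K.m + K.kb + k')
  omega

/-- The coordinates that the algorithm is told. -/
def shownPos (coord : Bool) (v : Fin K.gadget.N) : ℕ × ℕ := if coord then K.gadget.pos v else (0, 0)

/-- The algorithm serves the operations for the block in at most `cost` steps. -/
def Served (A : Algorithm) (del coord : Bool) (B cost : ℕ) : Prop :=
  ∃ (t₀ t : ℕ) (mA : Mem), Runs B A.preprocess (input (K.gadget.start U) (K.shownPos coord)) t₀ mA ∧
    A.Serves B (K.gadget.start U) mA ((K.ops U).flatMap (K.gadget.toOps del)) t ∧ t₀ + t ≤ cost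

/-- A bound for `A` on all admissible sequences applies to the `m * x` weight changes and `m * y`
queries for a block. -/
theorem served_of_solves {A : Algorithm} {D : Variant} {P k C c μ cost : ℕ} {del coord : Bool}
    {q u : ℕ → ℝ}
    (hA : ∀ (N : ℕ) (G : WGraph (Fin N)) (pos : Fin N → ℕ × ℕ), D.initial G pos →
      ∀ ops : List (Op (Fin N)), D.Admissible G G ops →
        ∃ (t₀ t : ℕ) (m : Mem),
          Runs ((N + ops.length + 2) ^ k) A.preprocess (input G pos) t₀ m ∧
          A.Serves ((N + ops.length + 2) ^ k) G m ops t ∧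
          (t₀ : ℝ) + t ≤ C * ((N : ℝ) + 1) ^ P + numUpdates ops * u N + numQueries ops * q N)
    (hD : Gadget.Hosts D del coord c μ)
    (hmax : K.gadget.maxWeight (5 * μ * K.Ω) ≤ K.gadget.N ^ c)
    {B : ℕ} (hB : (K.gadget.N + 3 * K.m * K.gadget.N + 2) ^ k ≤ B)
    (hcost : ⌊C * ((K.gadget.N : ℝ) + 1) ^ P +
      (Gadget.updatesPerSet del * (K.m * K.x) : ℕ) * u K.gadget.N +
      (K.m * K.y : ℕ) * q K.gadget.N⌋₊ ≤ cost) :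
    K.Served (5 * μ * K.Ω) A del coord B cost := by
  obtain ⟨t₀, t, m, h1, h2, h3⟩ := hA _ _ _ (hD.initial K.gadget hmax) _
    (hD.admissible K.gadget hmax _ (K.valid_ops (5 * μ * K.Ω)))
  rw [Gadget.numUpdates_toOps, Gadget.numQueries_toOps, sets_ops, queries_ops] at h3
  have hlen : K.gadget.N + ((K.ops (5 * μ * K.Ω)).flatMap (K.gadget.toOps del)).length + 2 ≤
      K.gadget.N + 3 * K.m * K.gadget.N + 2 := by
    rw [Gadget.length_toOps, sets_ops, queries_ops]
    have h4 : K.gadget.N = K.x * (4 * K.y) := rfl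
    have hx : K.x ≤ K.gadget.N := by rw [h4]; have := K.y_pos; nlinarith
    have hy : K.y ≤ K.gadget.N := by rw [h4]; have := K.x_pos; nlinarith
    have h5 : Gadget.updatesPerSet del ≤ 2 := by cases del <;> simp [Gadget.updatesPerSet]
    have h6 : Gadget.updatesPerSet del * (K.m * K.x) ≤ 2 * (K.m * K.gadget.N) :=
      Nat.mul_le_mul h5 (Nat.mul_le_mul_left _ hx)
    have h7 : K.m * K.y ≤ K.m * K.gadget.N := Nat.mul_le_mul_left _ hy
    nlinarith
  have hpow := (Nat.pow_le_pow_left hlen k).trans hB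
  refine ⟨t₀, t, m, h1.mono hpow, h2.mono hpow, le_trans (Nat.le_floor ?_) hcost⟩
  push_cast at h3 ⊢
  exact h3

end Block

/-- The coordinates of the node with the index in variable `17`. -/
def coordExp (coord second : Bool) : Exp :=
  if coord then if second then .v 17 % (4 * .v 10) else .v 17 / (4 * .v 10) else 0

/-- Write down the grid for the current block, run the preprocessing, serve all operations, and move
on to fresh memory. -/
def blockProg (A : Algorithm) (del coord : Bool) : Prog :=
  .seq (for_ 17 (.v 16 * .v 16) (put 101 (.v 13 + .v 17) weightExp)) <|
  .seq (for_ 17 (.v 16) (put 102 (.v 13 + .v 17) (coordExp coord false))) <|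
  .seq (for_ 17 (.v 16) (put 103 (.v 13 + .v 17) (coordExp coord true))) <|
  .seq (put 100 (.v 13) (.v 16)) <|
  .seq (sim A.preprocess) <|
  .seq (for_ 18 (.v 7) (rowProg A del)) (assign 13 (.v 13 + .v 15))

theorem matArray_of_ge {n : ℕ} {f : Fin n → Fin n → ℤ} {i : ℕ} (hi : n * n ≤ i) :
    matArray f i = 0 := by
  rw [matArray, dif_neg]
  rintro ⟨h1, h2⟩
  have h3 := Nat.div_add_mod i n
  have h4 : n * (i / n + 1) ≤ n * n := Nat.mul_le_mul_left _ h1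
  rw [mul_add, mul_one] at h4
  omega

theorem vecArray_of_ge {n : ℕ} {f : Fin n → ℤ} {i : ℕ} (hi : n ≤ i) : vecArray f i = 0 :=
  dif_neg (by omega)

theorem abs_matArray_le {n : ℕ} {f : Fin n → Fin n → ℤ} {b : ℤ} (hb : 0 ≤ b)
    (hf : ∀ i j, |f i j| ≤ b) (i : ℕ) : |matArray f i| ≤ b := by
  rw [matArray]
  split_ifs
  · exact hf _ _
  · simpa

theorem abs_vecArray_le {n : ℕ} {f : Fin n → ℤ} {b : ℤ} (hb : 0 ≤ b)
    (hf : ∀ i, |f i| ≤ b) (i : ℕ) : |vecArray f i| ≤ b := by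
  rw [vecArray]
  split_ifs
  · exact hf _
  · simpa

/-- The input of the preprocessing fits into the simulated memory. -/
theorem wf_input {B N : ℕ} {G : WGraph (Fin N)} {pos : Fin N → ℕ × ℕ} (hN : N * N ≤ B)
    (hw : ∀ u v, G.graph.Adj u v → G.weight s(u, v) ≤ B)
    (hpos : ∀ v, (pos v).1 ≤ B ∧ (pos v).2 ≤ B) : WF B (input G pos) := by
  have hNB : N ≤ B := (Nat.le_mul_self N).trans hN
  intro a i
  match a with
  | 0 =>
    simp only [input]
    refine ⟨?_, fun h => if_neg (by omega)⟩
    split_ifs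
    · rw [abs_of_nonneg (by positivity)]; exact_mod_cast hNB
    · simp
  | 1 =>
    simp only [input]
    refine ⟨abs_matArray_le (by positivity) (fun u v => ?_) i,
      fun h => matArray_of_ge (by omega)⟩
    split_ifs with h
    · rw [abs_of_nonneg (by positivity)]; exact_mod_cast hw u v h
    · simp
  | 2 =>
    simp only [input]
    refine ⟨abs_vecArray_le (by positivity) (fun u => ?_) i, fun h => dif_neg (by omega)⟩
    rw [abs_of_nonneg (by positivity)]; exact_mod_cast (hpos u).1
  | 3 =>
    simp only [input]
    refine ⟨abs_vecArray_le (by positivity) (fun u => ?_) i, fun h => dif_neg (by omega)⟩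
    rw [abs_of_nonneg (by positivity)]; exact_mod_cast (hpos u).2
  | a + 4 => simp [input]

section blockProg

variable {A : Algorithm} {del coord : Bool} {K : Block} {V base B S U cost c : ℕ} {M : Mem}

open Exp

theorem coordExp_chk (coord second : Bool) : (coordExp coord second).chk := by
  cases coord <;> cases second <;> decide

theorem coordExp_eval {second : Bool} {i : ℕ} {M : Mem} (h : K.Env U M) (hi : M 17 0 = i)
    (hiN : i < K.gadget.N) : (coordExp coord second).eval M =
      vecArray (fun v => ((if second then (K.shownPos coord v).2 else (K.shownPos coord v).1 : ℕ) : ℤ))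
        i := by
  rw [vecArray, dif_pos hiN]
  cases coord <;> cases second <;>
    simp only [coordExp, Block.shownPos, eval_div, eval_mod, eval_mul, eval_num, Nat.cast_ofNat,
      eval_v, h.y, hi, if_true, Bool.false_eq_true, if_false, Nat.cast_zero, Gadget.pos]
  · rfl
  · rfl

/-- Processing one block lowers the entries of the square in the columns of the block to the
contribution of its rows. The time is proportional to the number `s` of simulated steps, apart from
writing down the grid. -/
theorem blockProg_spec (hV : 100 ≤ V) (hE : K.Env U M) (hserv : K.Served U A del coord B cost)
    (hb : M 13 0 = base) (hc : M 14 0 = c) (hS : M 15 0 = S) (hfresh : Fresh base M)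
    (hU : 10 * K.Ω ≤ U) (hNB : K.gadget.N * K.gadget.N ≤ B) (hmB : K.gadget.maxWeight U ≤ B)
    (hBS : B < S) (hSV : base + S ≤ V) (hcV : c + cost ≤ V) (hmV : K.m ≤ V) :
    Ex V (blockProg A del coord) M fun τ M' => ∃ s, s ≤ cost ∧ M' 14 0 = (c + s : ℕ) ∧
      M' 13 0 = (base + S : ℕ) ∧ Fresh (base + S) M' ∧
      τ ≤ 17000 * s + 20000 * (K.gadget.N * K.gadget.N) ∧
      (∀ b < 100, b ∉ [6, 13, 14, 17, 18, 19, 20] → M' b = M b) ∧ Relax K.m K.X (M 6) (M' 6) ∧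
      (∀ i, i < K.m → ∀ j, j < K.y → ∀ k, k < K.x → M' 6 (i * K.m + (K.jb + j)) ≤
        K.X (i * K.m + (K.kb + k)) + K.X ((K.kb + k) * K.m + (K.jb + j))) := by
  classical
  obtain ⟨t₀, t, mA, hr, hs, hcost⟩ := hserv
  set N := K.gadget.N with hN
  have hN1 : 1 ≤ N := by
    have h4 : N = K.x * (4 * K.y) := rfl
    rw [h4]; have := K.x_pos; have := K.y_pos
    exact Nat.mul_pos K.x_pos (by omega)
  have hNN : N ≤ N * N := Nat.le_mul_self N
  have hmax : U + 16 * K.Ω ≤ K.gadget.maxWeight U := by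
    unfold Gadget.maxWeight
    change _ ≤ 16 * K.Ω + 10 * K.Ω * _ + 10 * K.Ω * _ + U
    have := Nat.zero_le (10 * K.Ω * K.gadget.x); have := Nat.zero_le (10 * K.Ω * K.gadget.y)
    omega
  have hst := Gadget.start_is (g := K.gadget) (U := U) hU
  have hwle : ∀ u v, (K.gadget.start U).graph.Adj u v → (K.gadget.start U).weight s(u, v) ≤ B := by
    intro u v huv
    have h1 := hst.2 u v huv
    have h3 := Gadget.edgeWeight_le (g := K.gadget) (a := fun _ => (U : ℤ)) (U := U)
      (fun r _ => by simp) (u := u) (v := v)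
    have : (K.gadget.maxWeight U : ℤ) ≤ B := by exact_mod_cast hmB
    have h4 : ((K.gadget.start U).weight s(u, v) : ℤ) ≤ B := by rw [h1]; exact h3.trans this
    exact_mod_cast h4
  have hpos : ∀ v, (K.shownPos coord v).1 ≤ B ∧ (K.shownPos coord v).2 ≤ B := by
    intro v
    have := v.2
    unfold Block.shownPos
    cases coord
    · simp
    · simp only [if_true, Gadget.pos]
      have h1 := Nat.div_le_self (v : ℕ) (4 * K.gadget.y)
      have h2 := Nat.mod_le (v : ℕ) (4 * K.gadget.y)
      omega
  have hwf : WF B (input (K.gadget.start U) (K.shownPos coord)) := wf_input hNB hwle hpos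
  set inp := input (K.gadget.start U) (K.shownPos coord) with hinp
  have hBV : (B : ℤ) ≤ V := by exact_mod_cast (by omega : B ≤ V)
  have env : ∀ M' : Mem, (∀ b < 100, b ≠ 17 → M' b = M b) → K.Env U M' ∧ M' 13 0 = base :=
    fun M' hM' => ⟨hE.congr fun b hb => hM' b (by fin_cases hb <;> norm_num)
      (by fin_cases hb <;> norm_num), by rw [hM' 13 (by norm_num) (by norm_num), hb]⟩
  -- the weights
  refine Ex.of_seq (Ex.of_fill (n := N * N) (off := base) (inp 1) hV (by decide) (by decide)
    (by decide) (by decide) Block.weightExp_chk (by omega) (fun i _ => (hwf 1 i).1.trans hBV) ?_ ?_ ?_)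
  · intro m' hm'
    obtain ⟨e1, -⟩ := env m' fun b hb hb' => hm' b (by omega) hb'
    simp only [eval_mul, eval_v, e1.N]; push_cast; rfl
  · intro i m' hi _ hm' h17 _
    obtain ⟨e1, e2⟩ := env m' fun b hb hb' => hm' b (by omega) hb'
    exact ⟨by simp only [eval_add, eval_v, e2, h17]; push_cast; rfl,
      Block.weightExp_eval e1 h17 hi hU⟩
  intro M₁ f₁ g₁
  -- the coordinates
  refine Ex.of_seq (Ex.of_fill (n := N) (off := base) (inp 2) hV (by decide) (by decide)
    (by decide) (by decide) (coordExp_chk _ _) (by omega) (fun i _ => (hwf 2 i).1.trans hBV) ?_ ?_ ?_)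
  · intro m' hm'
    obtain ⟨e1, -⟩ := env m' fun b hb hb' => by rw [hm' b (by omega) hb', f₁ b (by omega) hb']
    simp only [eval_v, e1.N]; rfl
  · intro i m' hi _ hm' h17 _
    obtain ⟨e1, e2⟩ := env m' fun b hb hb' => by rw [hm' b (by omega) hb', f₁ b (by omega) hb']
    refine ⟨by simp only [eval_add, eval_v, e2, h17]; push_cast; rfl, ?_⟩
    rw [coordExp_eval e1 h17 hi]; rfl
  intro M₂ f₂ g₂
  refine Ex.of_seq (Ex.of_fill (n := N) (off := base) (inp 3) hV (by decide) (by decide)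
    (by decide) (by decide) (coordExp_chk _ _) (by omega) (fun i _ => (hwf 3 i).1.trans hBV) ?_ ?_ ?_)
  · intro m' hm'
    obtain ⟨e1, -⟩ := env m' fun b hb hb' => by
      rw [hm' b (by omega) hb', f₂ b (by omega) hb', f₁ b (by omega) hb']
    simp only [eval_v, e1.N]; rfl
  · intro i m' hi _ hm' h17 _
    obtain ⟨e1, e2⟩ := env m' fun b hb hb' => by
      rw [hm' b (by omega) hb', f₂ b (by omega) hb', f₁ b (by omega) hb']
    refine ⟨by simp only [eval_add, eval_v, e2, h17]; push_cast; rfl, ?_⟩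
    rw [coordExp_eval e1 h17 hi]; rfl
  intro M₃ f₃ g₃
  have F₃ : ∀ b < 100, b ≠ 17 → M₃ b = M b := fun b hb hb' => by
    rw [f₃ b (by omega) hb', f₂ b (by omega) hb', f₁ b (by omega) hb']
  obtain ⟨e1, e2⟩ := env M₃ F₃
  refine Ex.of_seq (Ex.of_put hV (by decide) (by decide) ?_ ?_)
  · rw [eval_v, e1.N, abs_of_nonneg (by positivity)]; exact_mod_cast (by omega : N ≤ V)
  rw [eval_v, eval_v, e1.N, e2, Int.toNat_natCast]
  have hsim : Sim base inp (M₃.write 100 base N) := by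
    have zero : ∀ a i, M (100 + a) (base + i) = 0 := fun a i => hfresh a _ (Nat.le_add_right _ _)
    intro a i
    match a with
    | 0 =>
      rw [Mem.write_apply, f₃ _ (by omega) (by omega), f₂ _ (by omega) (by omega),
        f₁ _ (by omega) (by omega), zero]
      simp only [hinp, input]
      by_cases hi : i = 0
      · subst hi; simp [hN]
      · simp [hi]
    | 1 =>
      rw [Mem.write_of_ne _ _ _ (by omega), f₃ _ (by omega) (by omega), f₂ _ (by omega) (by omega),
        g₁, show M 101 (base + i) = 0 from zero 1 i, Nat.add_sub_cancel_left]
      split_ifs with h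
      · rfl
      · rw [hinp]; simp only [input]
        exact (matArray_of_ge (n := N) (i := i) (by omega)).symm
    | 2 =>
      rw [Mem.write_of_ne _ _ _ (by omega), f₃ _ (by omega) (by omega), g₂,
        f₁ _ (by omega) (by omega), show M 102 (base + i) = 0 from zero 2 i, Nat.add_sub_cancel_left]
      split_ifs with h
      · rfl
      · rw [hinp]; simp only [input]
        exact (vecArray_of_ge (n := N) (i := i) (by omega)).symm
    | 3 =>
      rw [Mem.write_of_ne _ _ _ (by omega), g₃, f₂ _ (by omega) (by omega),
        f₁ _ (by omega) (by omega), show M 103 (base + i) = 0 from zero 3 i, Nat.add_sub_cancel_left]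
      split_ifs with h
      · rfl
      · rw [hinp]; simp only [input]
        exact (vecArray_of_ge (n := N) (i := i) (by omega)).symm
    | a + 4 =>
      rw [Mem.write_of_ne _ _ _ (by omega), f₃ _ (by omega) (by omega), f₂ _ (by omega) (by omega),
        f₁ _ (by omega) (by omega), zero]
      rfl
  have F₄ : ∀ b < 100, b ≠ 17 → (M₃.write 100 base N) b = M b := fun b hb hb' => by
    rw [Mem.write_of_ne _ _ _ (by omega), F₃ b hb hb']
  -- the preprocessing
  refine Ex.of_seq (Ex.of_sim (base := base) (c := c) hr hwf hsim
    (by rw [F₄ 13 (by norm_num) (by norm_num), hb]) (by rw [F₄ 14 (by norm_num) (by norm_num), hc])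
    (by omega) (by omega) fun M₅ hsim₅ hc₅ F₅ => ?_)
  have F₅' : ∀ b < 100, b ≠ 14 → b ≠ 17 → M₅ b = M b := fun b hb hb' hb'' => by
    rw [F₅ b hb hb', F₄ b hb hb'']
  have hE₅ : K.Env U M₅ := hE.congr fun b hb => F₅' b (by fin_cases hb <;> norm_num)
      (by fin_cases hb <;> norm_num) (by fin_cases hb <;> norm_num)
  have hserving : Serving A del K.gadget base B (c + t₀ + t) (K.ops U) (fun _ => U) t M₅ :=
    ⟨mA, _, c + t₀, hsim₅, hr.wf hwf, hst, hs, by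
      rw [F₅' 13 (by norm_num) (by norm_num) (by norm_num), hb], hc₅, rfl⟩
  refine Ex.of_seq ((Serving.rows hV hserving hE₅ (by omega) (by omega) hmV (by omega) hU
    (by omega)).imp ?_)
  rintro τ₆ M₆ - ⟨a', t', ht', hτ₆, F₆, hrel, hcov, mA', G', c', hsim₆, hwf₆, -, hs₆, hb₆, hc₆, hcT⟩
  have h15 : M₆ 15 0 = S := by
    rw [F₆ 15 (by norm_num) (by decide), F₅' 15 (by norm_num) (by norm_num) (by norm_num), hS]
  have hval : (.v 13 + .v 15 : Exp).eval M₆ = (base + S : ℕ) := by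
    simp only [eval_add, eval_v, hb₆, h15]; push_cast; rfl
  refine Ex.of_assign hV (by decide) ?_ ?_
  · rw [hval, abs_of_nonneg (by positivity)]; exact_mod_cast hSV
  rw [hval]
  simp only [List.flatMap_nil, Algorithm.Serves] at hs₆
  refine ⟨t₀ + t, hcost, ?_, Mem.write_self .., fun a i hi => ?_, by nlinarith, fun b hb hb' => ?_, ?_, ?_⟩
  · rw [Mem.write_of_ne _ _ _ (by norm_num), hc₆]; congr 1; omega
  · rw [Mem.write_of_ne _ _ _ (by omega)]
    have := hsim₆ a (i - base)
    rw [show base + (i - base) = i by omega] at this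
    rw [this]
    exact (hwf₆ a _).2 (by omega)
  · have h1 := hb'
    simp only [List.mem_cons, List.not_mem_nil, or_false, not_or] at h1
    rw [Mem.write_of_ne _ _ _ (by omega), F₆ b hb (by simp; omega), F₅' b hb (by omega) (by omega)]
  · rw [Mem.write_of_ne _ _ _ (by norm_num)]
    rw [F₅' 6 (by norm_num) (by norm_num) (by norm_num)] at hrel
    exact hrel
  · rw [Mem.write_of_ne _ _ _ (by norm_num)]; exact hcov

end blockProg

/-! ### The `(min, +)` product of two large blocks

The further variables are: `22`, the number `h`; `23` and `24`, the powers `h ^ K` and `G` whose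
product is the size of the matrix; `25`, the index of the pair of large blocks; `26`, the index of
the small block in it; `27`, the exponent `j` such that the small blocks have size
`h ^ j × h ^ (K - j)`; `28` and `29`, loop counters; `35`, the number `K`. Array `34` holds the powers
of `h`, array `32` the numbers of simulated steps for every exponent. -/

/-- The numerical parameters of the reduction. The matrices have size `h ^ K * G` and are cut into
blocks of size `h ^ j × h ^ (K - j)`; serving such a block takes at most `cost j` steps of `A`, with
words up to `B`. Simulated memories are `S` cells apart; all words of the reduction are bounded by
`V`. -/
structure Setup (A : Algorithm) (del coord : Bool) where
  h : ℕ
  K : ℕ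
  G : ℕ
  Ω : ℕ
  B : ℕ
  S : ℕ
  U : ℕ
  V : ℕ
  cost : ℕ → ℕ
  h_pos : 0 < h
  G_pos : 0 < G
  Ω_pos : 0 < Ω
  hU : 10 * Ω ≤ U
  served : ∀ (j : ℕ) (L : Block), j ≤ K → L.m = h ^ K * G → L.Ω = Ω → L.x = h ^ j →
    L.y = h ^ (K - j) → L.Served U A del coord B (cost j)
  maxWeight_le : ∀ (j : ℕ) (L : Block), j ≤ K → L.Ω = Ω → L.x = h ^ j → L.y = h ^ (K - j) →
    L.gadget.maxWeight U ≤ B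
  NB : 4 * h ^ K * (4 * h ^ K) ≤ B
  BS : B < S
  hV : 100 ≤ V
  mV : h ^ K * G * (h ^ K * G) ≤ V
  KV : K + 1 ≤ V
  ΩV : 10 * Ω ≤ V
  costV : ∀ j, j ≤ K → G * G * (h ^ K * cost j) ≤ V

namespace Setup

variable {A : Algorithm} {del coord : Bool} (Z : Setup A del coord)

/-- The size of the matrices. -/
def m : ℕ := Z.h ^ Z.K * Z.G

/-- The number of nodes of the grids. -/
def N : ℕ := 4 * Z.h ^ Z.K

/-- A matrix with entries in `[0, 5 * Ω]`. -/
structure IsMatrix (X : ℕ → ℤ) : Prop where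
  nonneg : ∀ p, 0 ≤ X p
  le : ∀ p, X p ≤ 5 * Z.Ω

/-- The memory holds the parameters and the matrix `X`. -/
structure Env (X : ℕ → ℤ) (M : Mem) : Prop where
  X : M 5 = X
  m : M 7 0 = Z.m
  Ω : M 8 0 = Z.Ω
  S : M 15 0 = Z.S
  N : M 16 0 = Z.N
  U : M 21 0 = Z.U
  hK : M 23 0 = (Z.h ^ Z.K : ℕ)
  G : M 24 0 = Z.G
  pow : ∀ j, j ≤ Z.K → M 34 j = (Z.h ^ j : ℕ)
  K : M 35 0 = Z.K

variable {Z}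

theorem Env.congr {X : ℕ → ℤ} {M M' : Mem} (h : Z.Env X M)
    (hM : ∀ a ∈ [5, 7, 8, 15, 16, 21, 23, 24, 34, 35], M' a = M a) : Z.Env X M' := by
  obtain ⟨h1, h2, h3, h4, h5, h6, h7, h8, h9, h10⟩ := h
  simp only [List.mem_cons, List.not_mem_nil, or_false, forall_eq_or_imp, forall_eq] at hM
  obtain ⟨e1, e2, e3, e4, e5, e6, e7, e8, e9, e10⟩ := hM
  exact ⟨by rw [e1, h1], by rw [e2, h2], by rw [e3, h3], by rw [e4, h4], by rw [e5, h5],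
    by rw [e6, h6], by rw [e7, h7], by rw [e8, h8], fun j hj => by rw [e9, h9 j hj],
    by rw [e10, h10]⟩

theorem hK_pos : 0 < Z.h ^ Z.K := pow_pos Z.h_pos _

theorem pow_mul_pow {j : ℕ} (hj : j ≤ Z.K) : Z.h ^ (Z.K - j) * Z.h ^ j = Z.h ^ Z.K := by
  rw [← pow_add]; congr 1; omega

theorem hK_le_m : Z.h ^ Z.K ≤ Z.m := Nat.le_mul_of_pos_right _ Z.G_pos

theorem G_le_m : Z.G ≤ Z.m := Nat.le_mul_of_pos_left _ Z.hK_pos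

theorem m_le : Z.m ≤ Z.V := (Nat.le_mul_self _).trans Z.mV

variable (Z) in
/-- The small block number `ch` of the large block pair number `sc`. -/
def block {X : ℕ → ℤ} (hX : Z.IsMatrix X) {j : ℕ} (hj : j ≤ Z.K) {sc ch : ℕ} (hsc : sc < Z.G * Z.G)
    (hch : ch < Z.h ^ Z.K) : Block where
  m := Z.m
  Ω := Z.Ω
  x := Z.h ^ j
  y := Z.h ^ (Z.K - j)
  kb := sc / Z.G * Z.h ^ Z.K + ch / Z.h ^ j * Z.h ^ j
  jb := sc % Z.G * Z.h ^ Z.K + ch % Z.h ^ j * Z.h ^ (Z.K - j)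
  X := X
  x_pos := pow_pos Z.h_pos _
  y_pos := pow_pos Z.h_pos _
  Ω_pos := Z.Ω_pos
  kb_le := by
    have h1 : sc / Z.G < Z.G := Nat.div_lt_of_lt_mul hsc
    have h2 : ch / Z.h ^ j < Z.h ^ (Z.K - j) := by
      rw [Nat.div_lt_iff_lt_mul (pow_pos Z.h_pos _), pow_mul_pow hj]; exact hch
    have h3 : (ch / Z.h ^ j + 1) * Z.h ^ j ≤ Z.h ^ Z.K := by
      rw [← pow_mul_pow hj]; exact Nat.mul_le_mul_right _ h2
    have h4 : (sc / Z.G + 1) * Z.h ^ Z.K ≤ Z.G * Z.h ^ Z.K := Nat.mul_le_mul_right _ h1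
    have h5 : Z.m = Z.G * Z.h ^ Z.K := mul_comm _ _
    rw [h5]; nlinarith
  jb_le := by
    have h1 : sc % Z.G < Z.G := Nat.mod_lt _ Z.G_pos
    have h2 : ch % Z.h ^ j < Z.h ^ j := Nat.mod_lt _ (pow_pos Z.h_pos _)
    have h3 : (ch % Z.h ^ j + 1) * Z.h ^ (Z.K - j) ≤ Z.h ^ Z.K := by
      rw [← pow_mul_pow hj, mul_comm (Z.h ^ (Z.K - j))]; exact Nat.mul_le_mul_right _ h2
    have h4 : (sc % Z.G + 1) * Z.h ^ Z.K ≤ Z.G * Z.h ^ Z.K := Nat.mul_le_mul_right _ h1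
    have h5 : Z.m = Z.G * Z.h ^ Z.K := mul_comm _ _
    rw [h5]; nlinarith
  X_nonneg := hX.nonneg
  X_le := hX.le

theorem block_N {X : ℕ → ℤ} (hX : Z.IsMatrix X) {j : ℕ} (hj : j ≤ Z.K) {sc ch : ℕ}
    (hsc : sc < Z.G * Z.G) (hch : ch < Z.h ^ Z.K) : (Z.block hX hj hsc hch).gadget.N = Z.N := by
  change Z.h ^ j * (4 * Z.h ^ (Z.K - j)) = 4 * Z.h ^ Z.K
  rw [← pow_mul_pow hj]; ring

end Setup

/-- Process all small blocks of a pair of large blocks. -/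
def chunkProg (A : Algorithm) (del coord : Bool) : Prog :=
  for_ 26 (.v 23) <|
    .seq (assign 11 (.v 25 / .v 24 * .v 23 + .v 26 / .v 9 * .v 9)) <|
    .seq (assign 12 (.v 25 % .v 24 * .v 23 + .v 26 % .v 9 * .v 10)) (blockProg A del coord)

/-- Find the exponent for which the fewest steps have been simulated so far. -/
def chooseProg : Prog :=
  .seq (assign 27 0) <| for_ 28 (.v 35 + 1) <|
    assign 27 (.ite (.lt (.ld 32 (.v 28)) (.ld 32 (.v 27))) (.v 28) (.v 27))

/-- Process a pair of large blocks with this exponent. -/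
def pairProg (A : Algorithm) (del coord : Bool) : Prog :=
  .seq chooseProg <| .seq (assign 9 (.ld 34 (.v 27))) <| .seq (assign 10 (.ld 34 (.v 35 - .v 27))) <|
  .seq (assign 14 (.ld 32 (.v 27))) <| .seq (chunkProg A del coord) (put 32 (.v 27) (.v 14))

section specs

variable {A : Algorithm} {del coord : Bool} {Z : Setup A del coord} {X : ℕ → ℤ} {M : Mem}

open Exp

/-- The `h ^ K` small blocks of a pair of large blocks cover it, for every exponent `j`. -/
theorem chunkProg_spec (hE : Z.Env X M) (hX : Z.IsMatrix X) {j sc base c : ℕ} (hj : j ≤ Z.K)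
    (hsc : sc < Z.G * Z.G) (h9 : M 9 0 = (Z.h ^ j : ℕ)) (h10 : M 10 0 = (Z.h ^ (Z.K - j) : ℕ))
    (h25 : M 25 0 = sc) (hb : M 13 0 = base) (hc : M 14 0 = c) (hfresh : Fresh base M)
    (hbV : base + Z.h ^ Z.K * Z.S ≤ Z.V) (hcV : c + Z.h ^ Z.K * Z.cost j ≤ Z.V) :
    Ex Z.V (chunkProg A del coord) M fun τ M' => ∃ s, s ≤ Z.h ^ Z.K * Z.cost j ∧
      M' 14 0 = (c + s : ℕ) ∧ M' 13 0 = (base + Z.h ^ Z.K * Z.S : ℕ) ∧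
      Fresh (base + Z.h ^ Z.K * Z.S) M' ∧
      τ ≤ 17000 * s + Z.h ^ Z.K * (25000 * (Z.N * Z.N)) ∧
      (∀ b < 100, b ∉ [6, 11, 12, 13, 14, 17, 18, 19, 20, 26] → M' b = M b) ∧
      Relax Z.m X (M 6) (M' 6) ∧
      (∀ i, i < Z.m → ∀ j, j < Z.h ^ Z.K → ∀ k, k < Z.h ^ Z.K →
        M' 6 (i * Z.m + (sc % Z.G * Z.h ^ Z.K + j)) ≤ X (i * Z.m + (sc / Z.G * Z.h ^ Z.K + k)) +
          X ((sc / Z.G * Z.h ^ Z.K + k) * Z.m + (sc % Z.G * Z.h ^ Z.K + j))) := by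
  have hxpos : 0 < Z.h ^ j := pow_pos Z.h_pos _
  have hypos : 0 < Z.h ^ (Z.K - j) := pow_pos Z.h_pos _
  have hN1 : 1 ≤ Z.N * Z.N := by
    have := Z.hK_pos; unfold Setup.N
    exact Nat.mul_pos (by omega) (by omega)
  let I : ℕ → ℕ → Mem → Prop := fun r τ M' => M' 26 0 = r ∧ ∃ s, s ≤ r * Z.cost j ∧
    M' 14 0 = (c + s : ℕ) ∧ M' 13 0 = (base + r * Z.S : ℕ) ∧ Fresh (base + r * Z.S) M' ∧
    τ ≤ 17000 * s + r * (22000 * (Z.N * Z.N)) ∧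
    (∀ b < 100, b ∉ [6, 11, 12, 13, 14, 17, 18, 19, 20, 26] → M' b = M b) ∧
    Relax Z.m X (M 6) (M' 6) ∧
    (∀ ch, ch < r → ∀ i, i < Z.m → ∀ j', j' < Z.h ^ (Z.K - j) → ∀ k, k < Z.h ^ j →
      M' 6 (i * Z.m + (sc % Z.G * Z.h ^ Z.K + ch % Z.h ^ j * Z.h ^ (Z.K - j) + j')) ≤
        X (i * Z.m + (sc / Z.G * Z.h ^ Z.K + ch / Z.h ^ j * Z.h ^ j + k)) +
        X ((sc / Z.G * Z.h ^ Z.K + ch / Z.h ^ j * Z.h ^ j + k) * Z.m +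
          (sc % Z.G * Z.h ^ Z.K + ch % Z.h ^ j * Z.h ^ (Z.K - j) + j')))
  refine Ex.of_for (n := Z.h ^ Z.K) Z.hV I (by decide) (by decide)
    (Z.hK_le_m.trans Z.m_le) ?_ ?_ ?_ ?_
  · refine ⟨by simp [Mem.write_self], 0, by simp, ?_, ?_, ?_, by simp, ?_, ?_, by simp⟩
    · rw [Mem.write_of_ne _ _ _ (by norm_num), hc]; rfl
    · rw [Mem.write_of_ne _ _ _ (by norm_num), hb]; simp
    · intro a i hi
      rw [Mem.write_of_ne _ _ _ (by omega)]; exact hfresh a i (by omega)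
    · intro b _ hb
      refine Mem.write_of_ne _ _ _ ?_
      rintro rfl; simp at hb
    · rw [Mem.write_of_ne _ _ _ (by norm_num)]; exact .refl _ _ _
  · rintro r τ M' hr ⟨h1, s, -, -, -, -, -, h2, -⟩
    exact ⟨h1, by rw [eval_v, h2 23 (by norm_num) (by decide), hE.hK]⟩
  · rintro r τ M' hr ⟨h1, s, h2, h3, h4, h5, h6, h7, h8, h8'⟩ -
    have hE' : Z.Env X M' := hE.congr fun b hb => h7 b (by fin_cases hb <;> norm_num)
      (by fin_cases hb <;> decide)
    set L := Z.block hX hj hsc hr with hL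
    have hval1 : (.v 25 / .v 24 * .v 23 + .v 26 / .v 9 * .v 9 : Exp).eval M' = (L.kb : ℕ) := by
      simp only [eval_add, eval_mul, eval_div, eval_v, h1, hE'.G, hE'.hK,
        h7 25 (by norm_num) (by decide), h25, h7 9 (by norm_num) (by decide), h9]
      simp [hL, Setup.block]
    have hkbV : L.kb ≤ Z.V := by
      have := L.kb_le; have h2 : L.m = Z.m := rfl; have := Z.m_le; omega
    have hjbV : L.jb ≤ Z.V := by
      have := L.jb_le; have h2 : L.m = Z.m := rfl; have := Z.m_le; omega
    refine Ex.of_seq (Ex.of_assign Z.hV (by decide) ?_ ?_)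
    · rw [hval1, abs_of_nonneg (by positivity)]; exact_mod_cast hkbV
    rw [hval1]
    have hE₁ := hE'.congr (M' := M'.write 11 0 (L.kb : ℕ)) fun b hb =>
      Mem.write_of_ne _ _ _ (by fin_cases hb <;> norm_num)
    have f₁ : ∀ b, b ≠ 11 → (M'.write 11 0 (L.kb : ℕ)) b = M' b := fun b hb =>
      Mem.write_of_ne _ _ _ hb
    have hval2 : (.v 25 % .v 24 * .v 23 + .v 26 % .v 9 * .v 10 : Exp).eval
        (M'.write 11 0 (L.kb : ℕ)) = (L.jb : ℕ) := by
      simp only [eval_add, eval_mul, eval_mod, eval_v, hE₁.G, hE₁.hK]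
      rw [f₁ 26 (by norm_num), h1, f₁ 25 (by norm_num), h7 25 (by norm_num) (by decide), h25,
        f₁ 9 (by norm_num), h7 9 (by norm_num) (by decide), h9, f₁ 10 (by norm_num),
        h7 10 (by norm_num) (by decide), h10]
      simp [hL, Setup.block]
    refine Ex.of_seq (Ex.of_assign Z.hV (by decide) ?_ ?_)
    · rw [hval2, abs_of_nonneg (by positivity)]; exact_mod_cast hjbV
    rw [hval2]
    set M₂ := (M'.write 11 0 (L.kb : ℕ)).write 12 0 (L.jb : ℕ) with hM₂
    have f₂ : ∀ b, b ≠ 11 → b ≠ 12 → M₂ b = M' b := fun b hb hb' => by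
      rw [hM₂, Mem.write_of_ne _ _ _ hb', f₁ b hb]
    have hE₂ : L.Env Z.U M₂ := by
      refine ⟨?_, ?_, ?_, ?_, ?_, ?_, ?_, ?_, ?_⟩
      · rw [f₂ 5 (by norm_num) (by norm_num), hE'.X]; rfl
      · rw [f₂ 7 (by norm_num) (by norm_num), hE'.m]; rfl
      · rw [f₂ 8 (by norm_num) (by norm_num), hE'.Ω]; rfl
      · rw [f₂ 9 (by norm_num) (by norm_num), h7 9 (by norm_num) (by decide), h9]; rfl
      · rw [f₂ 10 (by norm_num) (by norm_num), h7 10 (by norm_num) (by decide), h10]; rfl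
      · rw [hM₂, Mem.write_of_ne _ _ _ (by norm_num), Mem.write_self]
      · rw [hM₂, Mem.write_self]
      · rw [f₂ 16 (by norm_num) (by norm_num), hE'.N, hL, Setup.block_N]
      · rw [f₂ 21 (by norm_num) (by norm_num), hE'.U]
    have hr1 : (r + 1) * Z.S ≤ Z.h ^ Z.K * Z.S := Nat.mul_le_mul_right _ hr
    have hr2 : (r + 1) * Z.cost j ≤ Z.h ^ Z.K * Z.cost j := Nat.mul_le_mul_right _ hr
    have hspec := blockProg_spec (A := A) (del := del) (coord := coord) (K := L) (V := Z.V)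
      (base := base + r * Z.S) (B := Z.B) (S := Z.S) (U := Z.U) (cost := Z.cost j) (c := c + s)
      (M := M₂) Z.hV hE₂ (Z.served j L hj rfl rfl rfl rfl)
      (by rw [f₂ 13 (by norm_num) (by norm_num), h4]) (by rw [f₂ 14 (by norm_num) (by norm_num), h3])
      (by rw [f₂ 15 (by norm_num) (by norm_num), hE'.S])
      (fun a i hi => by rw [f₂ _ (by omega) (by omega)]; exact h5 a i hi) Z.hU
      (by rw [hL, Setup.block_N]; exact Z.NB) (Z.maxWeight_le j L hj rfl rfl rfl) Z.BS
      (by rw [add_mul, one_mul] at hr1; omega) (by rw [add_mul, one_mul] at hr2; omega) Z.m_le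
    refine hspec.imp ?_
    rintro τ₃ M₃ - ⟨s₃, g1, g2, g3, g4, g5, g6, g7, g8⟩
    rw [hL, Setup.block_N] at g5
    rw [f₂ 6 (by norm_num) (by norm_num)] at g7
    have fr : ∀ b < 100, b ∉ [6, 11, 12, 13, 14, 17, 18, 19, 20] → M₃ b = M' b := fun b hb hb' => by
      simp only [List.mem_cons, List.not_mem_nil, or_false, not_or] at hb'
      rw [g6 b hb (by simp; omega), f₂ b (by omega) (by omega)]
    refine ⟨by rw [fr 26 (by norm_num) (by decide), h1], by simp [Mem.write_self], s + s₃, ?_, ?_, ?_,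
      ?_, ?_, ?_, ?_, ?_⟩
    · rw [add_mul]; omega
    · rw [Mem.write_of_ne _ _ _ (by norm_num), g2, add_assoc]
    · rw [Mem.write_of_ne _ _ _ (by norm_num), g3]; congr 1; ring
    · intro a i hi
      rw [Mem.write_of_ne _ _ _ (by omega)]
      exact g4 a i (by rw [add_mul, one_mul] at hi; omega)
    · nlinarith
    · intro b hb hb'
      have h1 := hb'
      simp only [List.mem_cons, List.not_mem_nil, or_false, not_or] at h1
      rw [Mem.write_of_ne _ _ _ (by omega), fr b hb (by simp; omega), h7 b hb hb']
    · rw [Mem.write_of_ne _ _ _ (by norm_num)]; exact h8.trans g7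
    · intro ch hch i hi j' hj' k hk
      rw [Mem.write_of_ne _ _ _ (by norm_num)]
      rcases Nat.lt_succ_iff_lt_or_eq.1 hch with hch | rfl
      · exact (g7.le _).trans (h8' ch hch i hi j' hj' k hk)
      · exact g8 i hi j' hj' k hk
  · rintro τ M' ⟨h1, s, h2, h3, h4, h5, h6, h7, h8, h8'⟩
    refine ⟨s, h2, h3, h4, h5, ?_, h7, h8, fun i hi j' hj' k hk => ?_⟩
    · have := Z.hK_pos
      have h9 : Z.h ^ Z.K ≤ Z.h ^ Z.K * (Z.N * Z.N) := Nat.le_mul_of_pos_right _ hN1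
      have h10 : Z.h ^ Z.K * (22000 * (Z.N * Z.N)) = 22000 * (Z.h ^ Z.K * (Z.N * Z.N)) := by ring
      have h11 : Z.h ^ Z.K * (25000 * (Z.N * Z.N)) = 25000 * (Z.h ^ Z.K * (Z.N * Z.N)) := by ring
      omega
    · -- the small block that contains the row `k` and the column `j'`
      have e1 : k / Z.h ^ j < Z.h ^ (Z.K - j) := by
        rw [Nat.div_lt_iff_lt_mul hxpos, Setup.pow_mul_pow hj]; exact hk
      have e2 : j' / Z.h ^ (Z.K - j) < Z.h ^ j := by
        rw [Nat.div_lt_iff_lt_mul hypos, mul_comm, Setup.pow_mul_pow hj]; exact hj'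
      have e3 : (k / Z.h ^ j * Z.h ^ j + j' / Z.h ^ (Z.K - j)) / Z.h ^ j = k / Z.h ^ j := by
        rw [mul_comm, Nat.mul_add_div hxpos, Nat.div_eq_of_lt e2, add_zero]
      have e4 : (k / Z.h ^ j * Z.h ^ j + j' / Z.h ^ (Z.K - j)) % Z.h ^ j = j' / Z.h ^ (Z.K - j) := by
        rw [mul_comm, Nat.mul_add_mod, Nat.mod_eq_of_lt e2]
      have e5 : k / Z.h ^ j * Z.h ^ j + j' / Z.h ^ (Z.K - j) < Z.h ^ Z.K := by
        rw [← Setup.pow_mul_pow hj]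
        calc _ < k / Z.h ^ j * Z.h ^ j + Z.h ^ j := by omega
          _ = (k / Z.h ^ j + 1) * Z.h ^ j := by ring
          _ ≤ _ := Nat.mul_le_mul_right _ e1
      have := h8' _ e5 i hi (j' % Z.h ^ (Z.K - j)) (Nat.mod_lt _ hypos) (k % Z.h ^ j)
        (Nat.mod_lt _ hxpos)
      rw [e3, e4, add_assoc (_ * _), add_assoc (_ * _), Nat.div_add_mod', Nat.div_add_mod'] at this
      exact this

/-- The chosen exponent minimizes the counter. -/
theorem chooseProg_spec {V K : ℕ} {tc : ℕ → ℕ} (hV : 100 ≤ V) (hKV : K + 1 ≤ V) (hK : M 35 0 = K)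
    (htc : ∀ j, j ≤ K → M 32 j = tc j) :
    Ex V chooseProg M fun τ M' => τ ≤ 2200 * K + 4600 ∧ (∀ b, b ≠ 27 → b ≠ 28 → M' b = M b) ∧
      ∃ j, j ≤ K ∧ M' 27 0 = j ∧ ∀ j', j' ≤ K → tc j ≤ tc j' := by
  refine Ex.of_seq (Ex.of_assign hV (by decide) (by rw [eval_zero]; simp) ?_)
  rw [eval_zero]
  let I : ℕ → ℕ → Mem → Prop := fun r τ M' => M' 28 0 = r ∧ τ = r * 1000 ∧
    (∀ b, b ≠ 27 → b ≠ 28 → M' b = M b) ∧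
    ∃ j, j ≤ K ∧ M' 27 0 = j ∧ ∀ j', j' < r → tc j ≤ tc j'
  refine Ex.of_for (n := K + 1) hV I (by decide) (by decide) hKV ?_ ?_ ?_ ?_
  · refine ⟨by simp [Mem.write_self], by simp, fun b h1 h2 => by
      rw [Mem.write_of_ne _ _ _ h2, Mem.write_of_ne _ _ _ h1], 0, by omega, ?_, by simp⟩
    rw [Mem.write_of_ne _ _ _ (by norm_num), Mem.write_self]; rfl
  · rintro r τ M' hr ⟨h1, -, h2, -⟩
    refine ⟨h1, ?_⟩
    rw [eval_add, eval_v, h2 35 (by norm_num) (by norm_num), hK, eval_one]; push_cast; rfl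
  · rintro r τ M' hr ⟨h1, rfl, h2, j, hj, h3, h4⟩ -
    have hval : (Exp.ite (.lt (.ld 32 (.v 28)) (.ld 32 (.v 27))) (.v 28) (.v 27)).eval M' =
        ((if tc r < tc j then r else j : ℕ) : ℤ) := by
      rw [eval_ite_lt]
      simp only [eval_ld, eval_v, h1, h3, Int.toNat_natCast, h2 32 (by norm_num) (by norm_num)]
      rw [htc r (by omega), htc j hj]
      push_cast
      exact if_congr (by omega) rfl rfl
    have hle : (if tc r < tc j then r else j) ≤ K := by split_ifs <;> omega
    refine Ex.of_assign hV (by decide) ?_ ?_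
    · rw [hval, abs_of_nonneg (by positivity)]; exact_mod_cast (by omega)
    rw [hval]
    refine ⟨by rw [Mem.write_of_ne _ _ _ (by norm_num), h1], by simp [Mem.write_self], by ring,
      fun b hb hb' => by rw [Mem.write_of_ne _ _ _ hb', Mem.write_of_ne _ _ _ hb, h2 b hb hb'],
      _, hle, by rw [Mem.write_of_ne _ _ _ (by norm_num), Mem.write_self], fun j' hj' => ?_⟩
    rcases Nat.lt_succ_iff_lt_or_eq.1 hj' with hj' | rfl
    · have := h4 j' hj'
      split_ifs <;> omega
    · split_ifs <;> omega
  · rintro τ M' ⟨h1, rfl, h2, j, hj, h3, h4⟩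
    exact ⟨by omega, h2, j, hj, h3, fun j' hj' => h4 j' (by omega)⟩

/-- After a pair of large blocks, the counter of the chosen exponent has increased by the number `s`
of simulated steps. -/
theorem pairProg_spec (hE : Z.Env X M) (hX : Z.IsMatrix X) {sc base : ℕ} {tc : ℕ → ℕ}
    (hsc : sc < Z.G * Z.G) (h25 : M 25 0 = sc) (hb : M 13 0 = base) (hfresh : Fresh base M)
    (hbV : base + Z.h ^ Z.K * Z.S ≤ Z.V) (htc : ∀ j, j ≤ Z.K → M 32 j = tc j)
    (hcV : ∀ j, j ≤ Z.K → tc j + Z.h ^ Z.K * Z.cost j ≤ Z.V) :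
    Ex Z.V (pairProg A del coord) M fun τ M' => ∃ j s, j ≤ Z.K ∧ (∀ j', j' ≤ Z.K → tc j ≤ tc j') ∧
      s ≤ Z.h ^ Z.K * Z.cost j ∧
      (∀ j', j' ≤ Z.K → M' 32 j' = (Function.update tc j (tc j + s) j' : ℕ)) ∧
      M' 13 0 = (base + Z.h ^ Z.K * Z.S : ℕ) ∧ Fresh (base + Z.h ^ Z.K * Z.S) M' ∧
      τ ≤ 17000 * s + (Z.K + 1) * (Z.h ^ Z.K * (40000 * (Z.N * Z.N))) ∧
      (∀ b < 100, b ∉ [6, 9, 10, 11, 12, 13, 14, 17, 18, 19, 20, 26, 27, 28, 32] → M' b = M b) ∧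
      Relax Z.m X (M 6) (M' 6) ∧
      (∀ i, i < Z.m → ∀ j, j < Z.h ^ Z.K → ∀ k, k < Z.h ^ Z.K →
        M' 6 (i * Z.m + (sc % Z.G * Z.h ^ Z.K + j)) ≤ X (i * Z.m + (sc / Z.G * Z.h ^ Z.K + k)) +
          X ((sc / Z.G * Z.h ^ Z.K + k) * Z.m + (sc % Z.G * Z.h ^ Z.K + j))) := by
  refine Ex.of_seq ((chooseProg_spec Z.hV Z.KV hE.K htc).imp ?_)
  rintro τ₁ M₁ - ⟨hτ₁, f₁, j, hj, h27, hmin⟩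
  have hE₁ : Z.Env X M₁ := hE.congr fun b hb => f₁ b (by fin_cases hb <;> norm_num)
    (by fin_cases hb <;> norm_num)
  have hpowV : ∀ i, i ≤ Z.K → Z.h ^ i ≤ Z.V := fun i hi =>
    (Nat.pow_le_pow_right Z.h_pos hi).trans (Z.hK_le_m.trans Z.m_le)
  have hval1 : (Exp.ld 34 (.v 27)).eval M₁ = (Z.h ^ j : ℕ) := by
    rw [eval_ld, eval_v, h27, Int.toNat_natCast, hE₁.pow j hj]
  refine Ex.of_seq (Ex.of_assign Z.hV (by decide) ?_ ?_)
  · rw [hval1, abs_of_nonneg (by positivity)]; exact_mod_cast hpowV j hj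
  rw [hval1]
  set M₂ := M₁.write 9 0 (Z.h ^ j : ℕ) with hM₂
  have f₂ : ∀ b, b ≠ 9 → M₂ b = M₁ b := fun b hb => Mem.write_of_ne _ _ _ hb
  have hval2 : (Exp.ld 34 (.v 35 - .v 27)).eval M₂ = (Z.h ^ (Z.K - j) : ℕ) := by
    rw [eval_ld, eval_sub, eval_v, eval_v, f₂ 35 (by norm_num), f₂ 27 (by norm_num), h27, hE₁.K,
      f₂ 34 (by norm_num), show ((Z.K : ℤ) - j).toNat = Z.K - j by omega, hE₁.pow _ (by omega)]
  refine Ex.of_seq (Ex.of_assign Z.hV (by decide) ?_ ?_)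
  · rw [hval2, abs_of_nonneg (by positivity)]; exact_mod_cast hpowV _ (by omega)
  rw [hval2]
  set M₃ := M₂.write 10 0 (Z.h ^ (Z.K - j) : ℕ) with hM₃
  have f₃ : ∀ b, b ≠ 10 → M₃ b = M₂ b := fun b hb => Mem.write_of_ne _ _ _ hb
  have hval3 : (Exp.ld 32 (.v 27)).eval M₃ = (tc j : ℕ) := by
    rw [eval_ld, eval_v, f₃ 27 (by norm_num), f₂ 27 (by norm_num), h27, Int.toNat_natCast,
      f₃ 32 (by norm_num), f₂ 32 (by norm_num), f₁ 32 (by norm_num) (by norm_num), htc j hj]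
  have hcVj := hcV j hj
  refine Ex.of_seq (Ex.of_assign Z.hV (by decide) ?_ ?_)
  · rw [hval3, abs_of_nonneg (by positivity)]; exact_mod_cast (by omega)
  rw [hval3]
  set M₄ := M₃.write 14 0 (tc j : ℕ) with hM₄
  have f₄ : ∀ b, b ∉ [9, 10, 14, 27, 28] → M₄ b = M b := fun b hb => by
    simp only [List.mem_cons, List.not_mem_nil, or_false, not_or] at hb
    rw [hM₄, Mem.write_of_ne _ _ _ (by omega), f₃ b (by omega), f₂ b (by omega),
      f₁ b (by omega) (by omega)]
  have hE₄ : Z.Env X M₄ := hE.congr fun b hb => f₄ b (by fin_cases hb <;> decide)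
  refine Ex.of_seq ((chunkProg_spec (base := base) (c := tc j) (sc := sc) hE₄ hX hj hsc ?_ ?_ ?_ ?_ ?_
    ?_ hbV hcVj).imp ?_)
  · rw [hM₄, Mem.write_of_ne _ _ _ (by norm_num), f₃ 9 (by norm_num), hM₂, Mem.write_self]
  · rw [hM₄, Mem.write_of_ne _ _ _ (by norm_num), hM₃, Mem.write_self]
  · rw [f₄ 25 (by decide), h25]
  · rw [f₄ 13 (by decide), hb]
  · rw [hM₄, Mem.write_self]
  · intro a i hi
    rw [f₄ _ (by simp; omega)]; exact hfresh a i hi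
  rintro τ₅ M₅ - ⟨s, g1, g2, g3, g4, g5, g6, g7, g8⟩
  have h27' : M₅ 27 0 = j := by
    rw [g6 27 (by norm_num) (by decide), hM₄, Mem.write_of_ne _ _ _ (by norm_num), f₃ 27 (by norm_num),
      f₂ 27 (by norm_num), h27]
  refine Ex.of_put Z.hV (by decide) (by decide) ?_ ?_
  · rw [eval_v, g2, abs_of_nonneg (by positivity)]; exact_mod_cast (by omega)
  rw [eval_v, eval_v, g2, h27', Int.toNat_natCast]
  rw [f₄ 6 (by decide)] at g7
  refine ⟨j, s, hj, hmin, g1, fun j' hj' => ?_, by rw [Mem.write_of_ne _ _ _ (by norm_num), g3], ?_, ?_,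
    ?_, by rw [Mem.write_of_ne _ _ _ (by norm_num)]; exact g7,
    by rw [Mem.write_of_ne _ _ _ (by norm_num)]; exact g8⟩
  · rw [Mem.write_apply, g6 32 (by norm_num) (by decide), f₄ 32 (by decide), htc j' hj']
    by_cases hjj : j' = j
    · subst hjj; simp
    · simp [hjj]
  · intro a i hi
    rw [Mem.write_of_ne _ _ _ (by omega)]; exact g4 a i hi
  · have hN1 : 1 ≤ Z.h ^ Z.K * (Z.N * Z.N) := by
      have := Z.hK_pos; unfold Setup.N
      exact Nat.mul_pos (by omega) (Nat.mul_pos (by omega) (by omega))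
    have h1 : Z.h ^ Z.K * (40000 * (Z.N * Z.N)) = 40000 * (Z.h ^ Z.K * (Z.N * Z.N)) := by ring
    have h2 : Z.h ^ Z.K * (25000 * (Z.N * Z.N)) = 25000 * (Z.h ^ Z.K * (Z.N * Z.N)) := by ring
    rw [h1]; rw [h2] at g5
    generalize Z.h ^ Z.K * (Z.N * Z.N) = w at *
    nlinarith [Nat.zero_le (Z.K * w), Nat.mul_le_mul_left Z.K hN1]
  · intro b hb hb'
    simp only [List.mem_cons, List.not_mem_nil, or_false, not_or] at hb'
    rw [Mem.write_of_ne _ _ _ (by omega), g6 b hb (by simp; omega), f₄ b (by simp; omega)]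

end specs

/-! ### Squaring a matrix, and repeated squaring -/

/-- Replace the matrix by its `(min, +)` square, with the code for infinity restored. -/
def squareProg (A : Algorithm) (del coord : Bool) : Prog :=
  .seq (for_ 17 (.v 7 * .v 7) (put 6 (.v 17) (10 * .v 8))) <|
  .seq (for_ 28 (.v 35 + 1) (put 32 (.v 28) 0)) <|
  .seq (for_ 25 (.v 24 * .v 24) (pairProg A del coord)) <|
  for_ 17 (.v 7 * .v 7) (put 5 (.v 17)
    (.ite (.lt (.ld 6 (.v 17)) (4 * .v 8)) (.ld 6 (.v 17) - .v 8) (5 * .v 8)))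

/-- Square the matrix `D * h` times, which is often enough as `n ≤ h ^ D ≤ 2 ^ (D * h)`. -/
def closureProg (A : Algorithm) (del coord : Bool) : Prog :=
  for_ 29 (.v 36 * .v 22) (squareProg A del coord)

theorem sum_update_add {K j : ℕ} (tc : ℕ → ℕ) (s : ℕ) (hj : j ≤ K) :
    ∑ i ∈ Finset.range (K + 1), Function.update tc j (tc j + s) i =
      ∑ i ∈ Finset.range (K + 1), tc i + s := by
  have hj' : j ∈ Finset.range (K + 1) := Finset.mem_range.2 (by omega)
  rw [Finset.sum_update_of_mem hj', Finset.sum_eq_add_sum_sdiff_singleton_of_mem hj' tc]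
  ring

section specs

variable {A : Algorithm} {del coord : Bool} (Z : Setup A del coord) {X : ℕ → ℤ} {M : Mem}

open Exp

/-- The time bound for a squaring, where `j` is the best exponent: the greedy choice costs at most one
extra pair of large blocks for each exponent. -/
def Setup.squareTime (j : ℕ) : ℕ :=
  17000 * ∑ i ∈ Finset.range (Z.K + 1), (Z.G * Z.G * (Z.h ^ Z.K * Z.cost j) + Z.h ^ Z.K * Z.cost i) +
    (Z.K + 1) * (Z.G * Z.G * (Z.h ^ Z.K * (60000 * (Z.N * Z.N))))

variable {Z}

/-- All pairs of large blocks. As an exponent is chosen only when its counter is minimal, no counter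
exceeds the cost of doing all pairs with any other exponent `j'` by more than the cost of one pair.
-/
theorem pairLoop_spec (hE : Z.Env X M) (hX : Z.IsMatrix X) {base : ℕ} (hb : M 13 0 = base)
    (hfresh : Fresh base M) (hbV : base + Z.G * Z.G * (Z.h ^ Z.K * Z.S) ≤ Z.V)
    (htc : ∀ j, j ≤ Z.K → M 32 j = 0) :
    Ex Z.V (for_ 25 (.v 24 * .v 24) (pairProg A del coord)) M fun τ M' => ∃ tc : ℕ → ℕ,
      (∀ j j', j ≤ Z.K → j' ≤ Z.K →
        tc j ≤ Z.G * Z.G * (Z.h ^ Z.K * Z.cost j') + Z.h ^ Z.K * Z.cost j) ∧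
      M' 13 0 = (base + Z.G * Z.G * (Z.h ^ Z.K * Z.S) : ℕ) ∧
      Fresh (base + Z.G * Z.G * (Z.h ^ Z.K * Z.S)) M' ∧
      τ ≤ 17000 * ∑ j ∈ Finset.range (Z.K + 1), tc j +
        Z.G * Z.G * ((Z.K + 1) * (Z.h ^ Z.K * (40000 * (Z.N * Z.N)))) + (Z.G * Z.G + 1) * 1200 ∧
      (∀ b < 100, b ∉ [6, 9, 10, 11, 12, 13, 14, 17, 18, 19, 20, 25, 26, 27, 28, 32] →
        M' b = M b) ∧
      Relax Z.m X (M 6) (M' 6) ∧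
      (∀ i, i < Z.m → ∀ j, j < Z.m → ∀ k, k < Z.m →
        M' 6 (i * Z.m + j) ≤ X (i * Z.m + k) + X (k * Z.m + j)) := by
  have hGV : Z.G * Z.G ≤ Z.V := (Nat.mul_le_mul Z.G_le_m Z.G_le_m).trans Z.mV
  let c : ℕ → ℕ := fun j => Z.h ^ Z.K * Z.cost j
  have hcV : ∀ j, j ≤ Z.K → Z.G * Z.G * c j ≤ Z.V := Z.costV
  let I : ℕ → ℕ → Mem → Prop := fun s τ M' => M' 25 0 = s ∧ ∃ tc : ℕ → ℕ,
    (∀ j, j ≤ Z.K → M' 32 j = tc j) ∧ (∀ j, j ≤ Z.K → tc j ≤ s * c j) ∧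
    (∀ j j', j ≤ Z.K → j' ≤ Z.K → tc j ≤ s * c j' + c j) ∧
    M' 13 0 = (base + s * (Z.h ^ Z.K * Z.S) : ℕ) ∧ Fresh (base + s * (Z.h ^ Z.K * Z.S)) M' ∧
    τ ≤ 17000 * ∑ j ∈ Finset.range (Z.K + 1), tc j +
        s * ((Z.K + 1) * (Z.h ^ Z.K * (40000 * (Z.N * Z.N)))) ∧
    (∀ b < 100, b ∉ [6, 9, 10, 11, 12, 13, 14, 17, 18, 19, 20, 25, 26, 27, 28, 32] → M' b = M b) ∧
    Relax Z.m X (M 6) (M' 6) ∧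
    (∀ sc, sc < s → ∀ i, i < Z.m → ∀ j, j < Z.h ^ Z.K → ∀ k, k < Z.h ^ Z.K →
        M' 6 (i * Z.m + (sc % Z.G * Z.h ^ Z.K + j)) ≤ X (i * Z.m + (sc / Z.G * Z.h ^ Z.K + k)) +
          X ((sc / Z.G * Z.h ^ Z.K + k) * Z.m + (sc % Z.G * Z.h ^ Z.K + j)))
  refine Ex.of_for (n := Z.G * Z.G) Z.hV I (by decide) (by decide) hGV ?_ ?_ ?_ ?_
  · refine ⟨by simp [Mem.write_self], fun _ => 0, ?_, by simp, by simp, ?_, ?_, by simp, ?_, ?_, by simp⟩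
    · intro j hj
      rw [Mem.write_of_ne _ _ _ (by norm_num), htc j hj]; rfl
    · rw [Mem.write_of_ne _ _ _ (by norm_num), hb]; simp
    · intro a i hi
      rw [Mem.write_of_ne _ _ _ (by omega)]; exact hfresh a i (by omega)
    · intro b _ hb
      refine Mem.write_of_ne _ _ _ ?_
      rintro rfl; simp at hb
    · rw [Mem.write_of_ne _ _ _ (by norm_num)]; exact .refl _ _ _
  · rintro s τ M' hs ⟨h1, tc, -, -, -, -, -, -, h2, -⟩
    exact ⟨h1, by rw [eval_mul, eval_v, h2 24 (by norm_num) (by decide), hE.G]; push_cast; rfl⟩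
  · rintro s τ M' hs ⟨h1, tc, h2, h3, h3', h4, h5, h6, h7, h8, h9⟩ -
    have hE' : Z.Env X M' := hE.congr fun b hb => h7 b (by fin_cases hb <;> norm_num)
      (by fin_cases hb <;> decide)
    have hs1 : (s + 1) * (Z.h ^ Z.K * Z.S) ≤ Z.G * Z.G * (Z.h ^ Z.K * Z.S) :=
      Nat.mul_le_mul_right _ hs
    rw [add_mul, one_mul] at hs1
    refine (pairProg_spec hE' hX hs h1 h4 h5 (by omega) h2 fun j hj => ?_).imp ?_
    · have h10 := h3 j hj
      have h11 : (s + 1) * c j ≤ Z.G * Z.G * c j := Nat.mul_le_mul_right _ hs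
      have h12 := hcV j hj
      rw [add_mul, one_mul] at h11
      change tc j + c j ≤ _
      omega
    rintro τ' M'' - ⟨j, s', g0, g1, g2, g3, g4, g5, g6, g7, g8, g9⟩
    refine ⟨by rw [g7 25 (by norm_num) (by decide), h1], by simp [Mem.write_self],
      Function.update tc j (tc j + s'), ?_, ?_, ?_, ?_, ?_, ?_, ?_, ?_, ?_⟩
    · intro j' hj'
      rw [Mem.write_of_ne _ _ _ (by norm_num), g3 j' hj']
    · intro j' hj'
      rw [add_mul, one_mul]
      by_cases hjj : j' = j
      · subst hjj
        rw [Function.update_self]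
        exact Nat.add_le_add (h3 _ hj') g2
      · rw [Function.update_of_ne hjj]
        exact (h3 _ hj').trans (Nat.le_add_right _ _)
    · intro i j' hi hj'
      rw [add_mul, one_mul]
      by_cases hjj : i = j
      · subst hjj
        rw [Function.update_self]
        have h10 := g1 j' hj'
        have h11 := h3 j' hj'
        change s' ≤ c i at g2
        omega
      · rw [Function.update_of_ne hjj]
        have := h3' i j' hi hj'
        omega
    · rw [Mem.write_of_ne _ _ _ (by norm_num), g4]; congr 1; ring
    · intro a i hi
      rw [Mem.write_of_ne _ _ _ (by omega)]
      exact g5 a i (by rw [add_mul, one_mul] at hi; omega)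
    · rw [sum_update_add tc s' g0, add_mul s 1, one_mul, mul_add]
      omega
    · intro b hb hb'
      have h1 := hb'
      simp only [List.mem_cons, List.not_mem_nil, or_false, not_or] at h1
      rw [Mem.write_of_ne _ _ _ (by omega), g7 b hb (by simp; omega), h7 b hb hb']
    · rw [Mem.write_of_ne _ _ _ (by norm_num)]; exact h8.trans g8
    · intro sc hsc i hi j' hj' k hk
      rw [Mem.write_of_ne _ _ _ (by norm_num)]
      rcases Nat.lt_succ_iff_lt_or_eq.1 hsc with hsc | rfl
      · exact (g8.le _).trans (h9 sc hsc i hi j' hj' k hk)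
      · exact g9 i hi j' hj' k hk
  · rintro τ M' ⟨h1, tc, h2, h3, h3', h4, h5, h6, h7, h8, h9⟩
    refine ⟨tc, h3', h4, h5, by omega, h7, h8, fun i hi j hj k hk => ?_⟩
    have hm : Z.m = Z.G * Z.h ^ Z.K := mul_comm _ _
    have e1 : k / Z.h ^ Z.K < Z.G := by
      rw [Nat.div_lt_iff_lt_mul Z.hK_pos, ← hm]; exact hk
    have e2 : j / Z.h ^ Z.K < Z.G := by
      rw [Nat.div_lt_iff_lt_mul Z.hK_pos, ← hm]; exact hj
    have e3 : (k / Z.h ^ Z.K * Z.G + j / Z.h ^ Z.K) / Z.G = k / Z.h ^ Z.K := by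
      rw [mul_comm, Nat.mul_add_div Z.G_pos, Nat.div_eq_of_lt e2, add_zero]
    have e4 : (k / Z.h ^ Z.K * Z.G + j / Z.h ^ Z.K) % Z.G = j / Z.h ^ Z.K := by
      rw [mul_comm, Nat.mul_add_mod, Nat.mod_eq_of_lt e2]
    have e5 : k / Z.h ^ Z.K * Z.G + j / Z.h ^ Z.K < Z.G * Z.G := by
      calc _ < k / Z.h ^ Z.K * Z.G + Z.G := by omega
        _ = (k / Z.h ^ Z.K + 1) * Z.G := by ring
        _ ≤ _ := Nat.mul_le_mul_right _ e1
    have := h9 _ e5 i hi (j % Z.h ^ Z.K) (Nat.mod_lt _ Z.hK_pos) (k % Z.h ^ Z.K)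
      (Nat.mod_lt _ Z.hK_pos)
    rw [e3, e4, Nat.div_add_mod', Nat.div_add_mod'] at this
    exact this

/-- The square of the matrix, where `z` is the entry of the true `(min, +)` square: both summands
carry a shift by `Ω`, of which one is removed again, and large entries become the code for infinity.
-/
theorem squareProg_spec (hE : Z.Env X M) (hX : Z.IsMatrix X) {base : ℕ} (hb : M 13 0 = base)
    (hfresh : Fresh base M) (hbV : base + Z.G * Z.G * (Z.h ^ Z.K * Z.S) ≤ Z.V) :
    Ex Z.V (squareProg A del coord) M fun τ M' => ∃ X', Z.Env X' M' ∧
      M' 13 0 = (base + Z.G * Z.G * (Z.h ^ Z.K * Z.S) : ℕ) ∧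
      Fresh (base + Z.G * Z.G * (Z.h ^ Z.K * Z.S)) M' ∧ (∀ j, j ≤ Z.K → τ ≤ Z.squareTime j) ∧
      (∀ b < 100, b ∉ [5, 6, 9, 10, 11, 12, 13, 14, 17, 18, 19, 20, 25, 26, 27, 28, 32] →
        M' b = M b) ∧
      (∀ p, Z.m * Z.m ≤ p → X' p = X p) ∧
      (∀ i j, i < Z.m → j < Z.m → ∃ z : ℤ, (∀ k, k < Z.m → z ≤ X (i * Z.m + k) + X (k * Z.m + j)) ∧
        (∃ k, k < Z.m ∧ z = X (i * Z.m + k) + X (k * Z.m + j)) ∧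
        X' (i * Z.m + j) = if z < 4 * Z.Ω then z - Z.Ω else 5 * Z.Ω) := by
  have hm0 : 0 < Z.m := Nat.mul_pos Z.hK_pos Z.G_pos
  have hΩV : (10 * Z.Ω : ℤ) ≤ Z.V := by exact_mod_cast Z.ΩV
  refine Ex.of_seq (Ex.of_fill (n := Z.m * Z.m) (off := 0) (fun _ => 10 * Z.Ω) Z.hV (by decide)
    (by decide) (by decide) (by decide) (by decide) Z.mV (fun i _ => ?_) ?_ ?_ ?_)
  · rw [abs_of_nonneg (by positivity)]; exact hΩV
  · intro m' hm'
    simp only [eval_mul, eval_v, hm' 7 (by norm_num) (by norm_num), hE.m]; push_cast; rfl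
  · intro i m' hi _ hm' h17 _
    refine ⟨by simp only [eval_v, h17, zero_add], ?_⟩
    simp only [eval_mul, eval_v, eval_num, hm' 8 (by norm_num) (by norm_num), hE.Ω, Nat.cast_ofNat]
  intro M₁ f₁ g₁
  have hE₁ : Z.Env X M₁ := hE.congr fun b hb => f₁ b (by fin_cases hb <;> norm_num)
    (by fin_cases hb <;> norm_num)
  refine Ex.of_seq (Ex.of_fill (n := Z.K + 1) (off := 0) (fun _ => 0) Z.hV (by decide)
    (by decide) (by decide) (by decide) (by decide) Z.KV (fun i _ => by simp) ?_ ?_ ?_)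
  · intro m' hm'
    simp only [eval_add, eval_one, eval_v, hm' 35 (by norm_num) (by norm_num), hE₁.K]; push_cast; rfl
  · intro i m' hi _ hm' h17 _
    exact ⟨by simp only [eval_v, h17, zero_add], eval_zero _⟩
  intro M₂ f₂ g₂
  have hE₂ : Z.Env X M₂ := hE₁.congr fun b hb => f₂ b (by fin_cases hb <;> norm_num)
    (by fin_cases hb <;> norm_num)
  have F₂ : ∀ b, b ∉ [6, 17, 28, 32] → M₂ b = M b := fun b hb => by
    simp only [List.mem_cons, List.not_mem_nil, or_false, not_or] at hb
    rw [f₂ b (by omega) (by omega), f₁ b (by omega) (by omega)]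
  refine Ex.of_seq ((pairLoop_spec (base := base) hE₂ hX (by rw [F₂ 13 (by decide), hb])
    (fun a i hi => by rw [F₂ _ (by simp; omega)]; exact hfresh a i hi) hbV
    (fun j hj => by rw [g₂, if_pos ⟨by omega, by omega⟩])).imp ?_)
  rintro τ₃ M₃ - ⟨tc, h1, h2, h3, h4, h5, h6, h7⟩
  have hE₃ : Z.Env X M₃ := hE₂.congr fun b hb => h5 b (by fin_cases hb <;> norm_num)
    (by fin_cases hb <;> decide)
  -- the entries of the square
  have h6₂ : ∀ p, p < Z.m * Z.m → M₂ 6 p = 10 * Z.Ω := fun p hp => by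
    rw [f₂ 6 (by norm_num) (by norm_num), g₁, if_pos ⟨by omega, by omega⟩]
  have hY : ∀ i j, i < Z.m → j < Z.m → (∃ k, k < Z.m ∧
      M₃ 6 (i * Z.m + j) = X (i * Z.m + k) + X (k * Z.m + j)) := by
    intro i j hi hj
    rcases h6.attained (i * Z.m + j) with h | ⟨i', j', k, hi', hj', hk, hp, h⟩
    · rw [h6₂ _ (by have := Nat.mul_le_mul_right Z.m hi; rw [Nat.succ_mul] at this; omega)] at h
      have h8 := h7 i hi j hj 0 hm0
      refine ⟨0, hm0, le_antisymm h8 ?_⟩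
      rw [h]
      have := hX.le (i * Z.m + 0); have := hX.le (0 * Z.m + j)
      linarith
    · have e1 : i = i' := by
        have := congrArg (· / Z.m) hp
        simp only [mul_comm _ Z.m, Nat.mul_add_div hm0, Nat.div_eq_of_lt hj, Nat.div_eq_of_lt hj',
          add_zero] at this
        exact this
      have e2 : j = j' := by subst e1; omega
      subst e1 e2
      exact ⟨k, hk, h⟩
  have hYb : ∀ p, p < Z.m * Z.m → 0 ≤ M₃ 6 p ∧ M₃ 6 p ≤ 10 * Z.Ω := by
    intro p hp
    have e1 : p / Z.m < Z.m := Nat.div_lt_of_lt_mul hp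
    obtain ⟨k, -, hk⟩ := hY (p / Z.m) (p % Z.m) e1 (Nat.mod_lt _ hm0)
    rw [Nat.div_add_mod'] at hk
    have := hX.le (p / Z.m * Z.m + k); have := hX.le (k * Z.m + p % Z.m)
    have := hX.nonneg (p / Z.m * Z.m + k); have := hX.nonneg (k * Z.m + p % Z.m)
    rw [hk]; constructor <;> linarith
  refine Ex.of_fill (n := Z.m * Z.m) (off := 0)
    (fun p => if M₃ 6 p < 4 * Z.Ω then M₃ 6 p - Z.Ω else 5 * Z.Ω) Z.hV (by decide)
    (by decide) (by decide) (by decide) (by decide) Z.mV (fun p hp => ?_) ?_ ?_ ?_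
  · obtain ⟨h8, h9⟩ := hYb p hp
    have : (0 : ℤ) ≤ Z.Ω := by positivity
    rw [abs_le]; split_ifs <;> constructor <;> linarith
  · intro m' hm'
    simp only [eval_mul, eval_v, hm' 7 (by norm_num) (by norm_num), hE₃.m]; push_cast; rfl
  · intro i m' hi _ hm' h17 _
    refine ⟨by simp only [eval_v, h17, zero_add], ?_⟩
    rw [eval_ite_lt]
    simp only [eval_mul, eval_v, eval_num, eval_sub, eval_ld, hm' 8 (by norm_num) (by norm_num), hE₃.Ω,
      Nat.cast_ofNat, h17, Int.toNat_natCast, hm' 6 (by norm_num) (by norm_num)]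
  intro M₄ f₄ g₄
  refine ⟨M₄ 5, ⟨rfl, ?_, ?_, ?_, ?_, ?_, ?_, ?_, ?_, ?_⟩, ?_, ?_, ?_, ?_, ?_, ?_⟩
  · rw [f₄ 7 (by norm_num) (by norm_num), hE₃.m]
  · rw [f₄ 8 (by norm_num) (by norm_num), hE₃.Ω]
  · rw [f₄ 15 (by norm_num) (by norm_num), hE₃.S]
  · rw [f₄ 16 (by norm_num) (by norm_num), hE₃.N]
  · rw [f₄ 21 (by norm_num) (by norm_num), hE₃.U]
  · rw [f₄ 23 (by norm_num) (by norm_num), hE₃.hK]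
  · rw [f₄ 24 (by norm_num) (by norm_num), hE₃.G]
  · intro j hj; rw [f₄ 34 (by norm_num) (by norm_num), hE₃.pow j hj]
  · rw [f₄ 35 (by norm_num) (by norm_num), hE₃.K]
  · rw [f₄ 13 (by norm_num) (by norm_num), h2]
  · intro a i hi
    rw [f₄ _ (by omega) (by omega)]; exact h3 a i hi
  · intro j hj
    have hsum : ∑ i ∈ Finset.range (Z.K + 1), tc i ≤ ∑ i ∈ Finset.range (Z.K + 1),
        (Z.G * Z.G * (Z.h ^ Z.K * Z.cost j) + Z.h ^ Z.K * Z.cost i) :=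
      Finset.sum_le_sum fun i hi => h1 i j (by have := Finset.mem_range.1 hi; omega) hj
    unfold Setup.squareTime
    generalize ∑ i ∈ Finset.range (Z.K + 1), tc i = a at *
    generalize ∑ i ∈ Finset.range (Z.K + 1),
      (Z.G * Z.G * (Z.h ^ Z.K * Z.cost j) + Z.h ^ Z.K * Z.cost i) = b at *
    have hNN : 1 ≤ Z.N * Z.N := by
      have := Z.hK_pos; unfold Setup.N
      exact Nat.mul_pos (by omega) (by omega)
    have hG : 1 ≤ Z.G * Z.G := Nat.mul_pos Z.G_pos Z.G_pos
    set w := Z.G * Z.G * (Z.h ^ Z.K * (Z.N * Z.N)) with hw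
    have w1 : Z.G * Z.G ≤ w := Nat.le_mul_of_pos_right _ (Nat.mul_pos Z.hK_pos hNN)
    have w2 : Z.m * Z.m ≤ w := by
      have e1 : Z.m * Z.m = Z.G * Z.G * (Z.h ^ Z.K * Z.h ^ Z.K) := by unfold Setup.m; ring
      rw [e1, hw]
      refine Nat.mul_le_mul_left _ (Nat.mul_le_mul_left _ ?_)
      have e2 : Z.h ^ Z.K ≤ Z.N := by unfold Setup.N; omega
      exact e2.trans (Nat.le_mul_self _)
    have w3 : Z.G * Z.G * ((Z.K + 1) * (Z.h ^ Z.K * (40000 * (Z.N * Z.N)))) =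
      40000 * ((Z.K + 1) * w) := by rw [hw]; ring
    have w4 : (Z.K + 1) * (Z.G * Z.G * (Z.h ^ Z.K * (60000 * (Z.N * Z.N)))) =
      60000 * ((Z.K + 1) * w) := by rw [hw]; ring
    have w5 : w ≤ (Z.K + 1) * w := Nat.le_mul_of_pos_left _ (by omega)
    have w6 : (Z.K + 1) * 1 ≤ (Z.K + 1) * w := Nat.mul_le_mul_left _ (hG.trans w1)
    rw [w3] at h4
    rw [w4]
    generalize (Z.K + 1) * w = v at *
    omega
  · intro b hb hb'
    simp only [List.mem_cons, List.not_mem_nil, or_false, not_or] at hb'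
    rw [f₄ b (by omega) (by omega), h5 b hb (by simp; omega), F₂ b (by simp; omega)]
  · intro p hp
    rw [g₄, if_neg (by omega), hE₃.X]
  · intro i j hi hj
    refine ⟨M₃ 6 (i * Z.m + j), fun k hk => h7 i hi j hj k hk, hY i j hi hj, ?_⟩
    rw [g₄, if_pos]
    · rfl
    · have := Nat.mul_le_mul_right Z.m hi
      rw [Nat.succ_mul] at this
      omega

/-- After `r` squarings, the matrix encodes the least weights of walks with at most `2 ^ r` edges.
-/
theorem closureProg_spec {n c D : ℕ} {w : APSP.WDigraph n} (hw : APSP.WeightsBounded c w)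
    (hn : APSP.NoNegCycle w) (hΩ : n ^ (c + 1) ≤ Z.Ω) (hnm : n ≤ Z.m)
    (hE : Z.Env X M) (hX : Z.IsMatrix X)
    (hEnc : ∀ i j, i < Z.m → j < Z.m → APSP.Enc w Z.Ω 1 i j (X (i * Z.m + j)))
    (hb : M 13 0 = 0) (hfresh : Fresh 0 M) (h22 : M 22 0 = Z.h) (h36 : M 36 0 = D)
    (hRV : D * Z.h ≤ Z.V) (hbV : D * Z.h * (Z.G * Z.G * (Z.h ^ Z.K * Z.S)) ≤ Z.V) :
    Ex Z.V (closureProg A del coord) M fun τ M' => ∃ X', Z.Env X' M' ∧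
      (∀ j, j ≤ Z.K → τ ≤ D * Z.h * Z.squareTime j + (D * Z.h + 1) * 1200) ∧ M' 0 = M 0 ∧
      (∀ i j, i < Z.m → j < Z.m →
        APSP.Enc w Z.Ω (2 ^ (D * Z.h)) i j (X' (i * Z.m + j))) := by
  let F : List ℕ := [5, 6, 9, 10, 11, 12, 13, 14, 17, 18, 19, 20, 25, 26, 27, 28, 29, 32]
  let I : ℕ → ℕ → Mem → Prop := fun r τ M' => M' 29 0 = r ∧ ∃ X', Z.Env X' M' ∧ Z.IsMatrix X' ∧
    (∀ i j, i < Z.m → j < Z.m → APSP.Enc w Z.Ω (2 ^ r) i j (X' (i * Z.m + j))) ∧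
    M' 13 0 = (r * (Z.G * Z.G * (Z.h ^ Z.K * Z.S)) : ℕ) ∧
    Fresh (r * (Z.G * Z.G * (Z.h ^ Z.K * Z.S))) M' ∧
    (∀ j, j ≤ Z.K → τ ≤ r * Z.squareTime j) ∧
    (∀ b < 100, b ∉ F → M' b = M b)
  refine Ex.of_for (n := D * Z.h) Z.hV I (by decide) (by decide) hRV ?_ ?_ ?_ ?_
  · refine ⟨by simp [Mem.write_self], X, hE.congr fun b hb => Mem.write_of_ne _ _ _ ?_, hX,
      by simpa using hEnc, ?_, ?_, by simp, fun b _ hb => Mem.write_of_ne _ _ _ ?_⟩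
    · fin_cases hb <;> norm_num
    · rw [Mem.write_of_ne _ _ _ (by norm_num), hb]; simp
    · intro a i hi
      rw [Mem.write_of_ne _ _ _ (by omega)]; exact hfresh a i (by omega)
    · rintro rfl; simp [F] at hb
  · rintro r τ M' hr ⟨h1, X', -, -, -, -, -, -, h2⟩
    refine ⟨h1, ?_⟩
    rw [eval_mul, eval_v, eval_v, h2 36 (by norm_num) (by decide), h2 22 (by norm_num) (by decide),
      h22, h36]; push_cast; rfl
  · rintro r τ M' hr ⟨h1, X', h2, h3, h4, h5, h6, h7, h8⟩ -
    have hr1 : (r + 1) * (Z.G * Z.G * (Z.h ^ Z.K * Z.S)) ≤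
        D * Z.h * (Z.G * Z.G * (Z.h ^ Z.K * Z.S)) := Nat.mul_le_mul_right _ hr
    rw [Nat.succ_mul] at hr1
    refine (squareProg_spec h2 h3 h5 h6 (by omega)).imp ?_
    rintro τ' M'' - ⟨X'', g1, g2, g3, g4, g5, g6, g7⟩
    have hEnc' : ∀ i j, i < Z.m → j < Z.m →
        APSP.Enc w Z.Ω (2 ^ (r + 1)) i j (X'' (i * Z.m + j)) := by
      intro i j hi hj
      obtain ⟨z, hz1, hz2, hz3⟩ := g7 i j hi hj
      rw [hz3, pow_succ, mul_comm]
      exact APSP.Enc.square hw hn hΩ Z.Ω_pos hnm (X := fun i j => X' (i * Z.m + j)) h4 hi hj hz1 hz2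
    have hm0 : 0 < Z.m := Nat.mul_pos Z.hK_pos Z.G_pos
    have hbd : ∀ p, 0 ≤ X'' p ∧ X'' p ≤ 5 * Z.Ω := by
      intro p
      rcases lt_or_ge p (Z.m * Z.m) with hp | hp
      · have := (hEnc' (p / Z.m) (p % Z.m) (Nat.div_lt_of_lt_mul hp) (Nat.mod_lt _ hm0)).bounds hw hn hΩ
        rwa [Nat.div_add_mod'] at this
      · rw [g6 p hp]; exact ⟨h3.nonneg p, h3.le p⟩
    refine ⟨by rw [g5 29 (by norm_num) (by decide), h1], by simp [Mem.write_self], X'',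
      g1.congr fun b hb => Mem.write_of_ne _ _ _ ?_, ⟨fun p => (hbd p).1, fun p => (hbd p).2⟩, hEnc', ?_,
      ?_, ?_, ?_⟩
    · fin_cases hb <;> norm_num
    · rw [Mem.write_of_ne _ _ _ (by norm_num), g2, Nat.succ_mul]
    · intro a i hi
      rw [Mem.write_of_ne _ _ _ (by omega)]; exact g3 a i (by rw [Nat.succ_mul] at hi; omega)
    · intro j hj
      rw [Nat.succ_mul]; exact Nat.add_le_add (h7 j hj) (g4 j hj)
    · intro b hb hb'
      have h9 := hb'
      simp only [F, List.mem_cons, List.not_mem_nil, or_false, not_or] at h9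
      rw [Mem.write_of_ne _ _ _ (by omega), g5 b hb (by simp; omega), h8 b hb hb']
  · rintro τ M' ⟨h1, X', h2, h3, h4, h5, h6, h7, h8⟩
    exact ⟨X', h2, fun j hj => Nat.add_le_add_right (h7 j hj) _, h8 0 (by norm_num) (by decide), h4⟩

end specs

end DynAPSP

namespace WordRAM

/-! ### Constants, powers and roots -/

section rules

variable {V : ℕ} {r : Prog} {m : Mem} {Q : ℕ → Mem → Prop}

theorem Ex.of_const_seq {x : ℕ} {z : ℕ} (hz : z ≤ V)
    (hQ : ∀ m' : Mem, m' x 0 = (z : ℤ) → (∀ b, b ≠ x → m' b = m b) → Ex V r m' fun τ => Q (1 + τ)) :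
    Ex V (.seq (.const x z) r) m Q := by
  have hz' : |(z : ℤ)| ≤ V := by rw [abs_of_nonneg (by positivity)]; exact_mod_cast hz
  refine Ex.of_seq fun hb => ⟨1, m.write x 0 z, fun m₁ h₁ => ?_, hb.write _ _ hz',
    hQ _ (Mem.write_self ..) fun b hb => Mem.write_of_ne _ _ _ hb⟩
  refine ⟨1, _, le_rfl, .const x z m₁ (le_pow_fivehundred hz'), fun a ha => ?_⟩
  funext i
  rw [Mem.write_apply, Mem.write_apply, h₁ a ha]

theorem Ex.of_assign_seq {x : ℕ} {e : Exp} {z : ℕ} (hV : 100 ≤ V) (hc : e.chk) (he : e.eval m = z)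
    (hz : z ≤ V)
    (hQ : ∀ m' : Mem, m' x 0 = (z : ℤ) → (∀ b, b ≠ x → m' b = m b) → Ex V r m' fun τ => Q (1000 + τ)) :
    Ex V (.seq (assign x e) r) m Q := by
  refine Ex.of_seq (Ex.of_assign hV hc ?_ (hQ _ ?_ fun b hb => Mem.write_of_ne _ _ _ hb))
  · rw [he, abs_of_nonneg (by positivity)]; exact_mod_cast hz
  · rw [Mem.write_self, he]

end rules

/-- `x := y ^ e` for variables `x`, `y`, `e`. -/
def powProg (x y e : ℕ) : Prog :=
  .seq (assign x 1) (for_ 42 (.v e) (assign x (.v x * .v y)))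

/-- Fill array `34` with the powers of variable `22` up to the exponent in variable `36`. -/
def powersProg : Prog :=
  for_ 42 (.v 36 + 1) (put 34 (.v 42) (.ite (.eq (.v 42) 0) 1 (.ld 34 (.v 42 - 1) * .v 22)))

/-- The least number whose `D`-th power is at least `n`. -/
noncomputable def root (D n : ℕ) : ℕ := sInf {h | n ≤ h ^ D}

theorem le_root_pow {D n : ℕ} (hD : 0 < D) : n ≤ root D n ^ D :=
  Nat.sInf_mem (s := {h | n ≤ h ^ D}) ⟨n, Nat.le_self_pow hD.ne' n⟩

theorem pow_lt_of_lt_root {D n h : ℕ} (hh : h < root D n) : h ^ D < n := by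
  have := Nat.notMem_of_lt_sInf hh
  simpa using this

theorem root_le {D n : ℕ} (hD : 0 < D) : root D n ≤ n :=
  Nat.sInf_le (show n ≤ n ^ D from Nat.le_self_pow hD.ne' n)

theorem root_pos {D n : ℕ} (hD : 0 < D) (hn : 0 < n) : 0 < root D n := by
  by_contra h
  have h1 := le_root_pow (n := n) hD
  rw [show root D n = 0 by omega, zero_pow hD.ne'] at h1
  omega

/-- Find the root of variable `0` by linear search. -/
def rootProg : Prog :=
  for_ 41 (.v 0) (.seq powersProg
    (assign 22 (.ite (.lt (.ld 34 (.v 36)) (.v 0)) (.v 22 + 1) (.v 22))))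

section specs

open Exp

variable {V : ℕ} {M : Mem}

theorem powProg_spec {x y e b k : ℕ} (hV : 100 ≤ V) (hx' : x ≠ 42) (hy : y ≠ 42)
    (he : e ≠ 42) (hxy : y ≠ x) (hxe : e ≠ x) (hc : (.v x * .v y : Exp).chk) (hce : (Exp.v e).chk)
    (hMy : M y 0 = b) (hMe : M e 0 = k) (hb : 1 ≤ b) (hbV : b ^ k ≤ V) (hkV : k ≤ V) :
    Ex V (powProg x y e) M fun τ M' => τ = 1000 + (k * 1000 + (k + 1) * 1200) ∧
      M' x 0 = (b ^ k : ℕ) ∧ ∀ a, a ≠ x → a ≠ 42 → M' a = M a := by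
  have hpow : ∀ i, i ≤ k → b ^ i ≤ V := fun i hi => (Nat.pow_le_pow_right hb hi).trans hbV
  refine Ex.of_assign_seq (z := 1) hV (by decide) rfl (by omega) fun M₁ h₁ f₁ => ?_
  refine Ex.of_for (n := k) hV (fun i τ M' => M' 42 0 = i ∧ τ = i * 1000 ∧ M' x 0 = (b ^ i : ℕ) ∧
    ∀ a, a ≠ x → a ≠ 42 → M' a = M a) hce (by decide) hkV ?_ ?_ ?_ ?_
  · exact ⟨by simp [Mem.write_self], by simp, by rw [Mem.write_of_ne _ _ _ hx', h₁]; simp,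
      fun a ha ha' => by rw [Mem.write_of_ne _ _ _ ha', f₁ a ha]⟩
  · rintro i τ M' hi ⟨h1, -, -, h2⟩
    exact ⟨h1, by rw [eval_v, h2 e hxe he, hMe]⟩
  · rintro i τ M' hi ⟨h1, h2, h3, h4⟩ -
    have hval : (.v x * .v y : Exp).eval M' = (b ^ (i + 1) : ℕ) := by
      rw [eval_mul, eval_v, eval_v, h3, h4 y hxy hy, hMy]; push_cast; ring
    refine Ex.of_assign hV hc ?_ ?_
    · rw [hval, abs_of_nonneg (by positivity)]; exact_mod_cast hpow (i + 1) hi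
    · rw [hval]
      exact ⟨by rw [Mem.write_of_ne _ _ _ hx'.symm, h1], by simp [Mem.write_self], by omega,
        by rw [Mem.write_of_ne _ _ _ hx', Mem.write_self], fun a ha ha' => by
          rw [Mem.write_of_ne _ _ _ ha', Mem.write_of_ne _ _ _ ha, h4 a ha ha']⟩
  · rintro τ M' ⟨h1, rfl, h3, h4⟩
    exact ⟨rfl, h3, h4⟩

theorem powersProg_spec {D h : ℕ} (hV : 100 ≤ V) (hDV : D + 1 ≤ V) (h36 : M 36 0 = D)
    (h22 : M 22 0 = h) (hhV : ∀ i, i ≤ D → h ^ i ≤ V) :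
    Ex V powersProg M fun τ M' => τ = (D + 1) * 2000 + (D + 1 + 1) * 1200 ∧
      (∀ i, i ≤ D → M' 34 i = (h ^ i : ℕ)) ∧ ∀ a, a ≠ 34 → a ≠ 42 → M' a = M a := by
  refine Ex.of_fill (n := D + 1) (off := 0) (fun i => ((h ^ i : ℕ) : ℤ)) hV (by decide) (by decide)
    (by decide) (by decide) (by decide) hDV (fun i hi => ?_) ?_ ?_ ?_
  · rw [abs_of_nonneg (by positivity)]; exact_mod_cast hhV i (by omega)
  · intro m' hm'
    rw [eval_add, eval_v, hm' 36 (by norm_num) (by norm_num), h36, eval_one]; push_cast; rfl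
  · intro i m' hi _ hm' h42 h34
    refine ⟨by rw [eval_v, h42, zero_add], ?_⟩
    rw [eval_ite_eq, eval_v, h42, eval_zero]
    rcases Nat.eq_zero_or_pos i with rfl | hi0
    · simp [eval_one]
    · rw [if_neg (by exact_mod_cast hi0.ne'), eval_mul, eval_ld, eval_sub, eval_v, eval_v, h42, eval_one,
        hm' 22 (by norm_num) (by norm_num), h22, show ((i : ℤ) - 1).toNat = i - 1 by omega, h34,
        if_pos (by omega)]
      rw [Nat.sub_zero]
      norm_cast
      rw [← pow_succ]; congr 1; omega
  · intro m' f g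
    exact ⟨rfl, fun i hi => by rw [g, if_pos (by omega), Nat.sub_zero], f⟩

theorem rootProg_spec {D n : ℕ} (hV : 100 ≤ V) (hD : 0 < D) (hn : 0 < n) (hDV : D + 1 ≤ V)
    (hnV : n ≤ V) (h0 : M 0 0 = n) (h36 : M 36 0 = D) (h22 : M 22 0 = 0) (hrV : root D n ^ D ≤ V) :
    Ex V rootProg M fun τ M' =>
      τ = n * ((D + 1) * 2000 + (D + 1 + 1) * 1200 + 1000) + (n + 1) * 1200 ∧
      M' 22 0 = (root D n : ℕ) ∧ ∀ a, a ∉ [22, 34, 41, 42] → M' a = M a := by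
  have hpos := root_pos hD hn
  have hrV1 : root D n ≤ V := (root_le hD).trans hnV
  refine Ex.of_for (n := n) hV (fun i τ M' => M' 41 0 = i ∧
    τ = i * ((D + 1) * 2000 + (D + 1 + 1) * 1200 + 1000) ∧
    M' 22 0 = (min i (root D n) : ℕ) ∧ ∀ a, a ∉ [22, 34, 41, 42] → M' a = M a) (by decide) (by decide)
    hnV ?_ ?_ ?_ ?_
  · refine ⟨by simp [Mem.write_self], by simp, ?_, fun a ha => Mem.write_of_ne _ _ _ ?_⟩
    · rw [Mem.write_of_ne _ _ _ (by norm_num), h22]; simp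
    · rintro rfl; simp at ha
  · rintro i τ M' hi ⟨h1, -, -, h2⟩
    exact ⟨h1, by rw [eval_v, h2 0 (by decide), h0]⟩
  · rintro i τ M' hi ⟨h1, h2, h3, h4⟩ -
    refine Ex.of_seq ((powersProg_spec hV hDV (by rw [h4 36 (by decide), h36]) h3 fun k hk => ?_).imp ?_)
    · refine (Nat.pow_le_pow_left (min_le_right _ _) k).trans ?_
      exact (Nat.pow_le_pow_right hpos hk).trans hrV
    rintro τ' M'' - ⟨rfl, g1, g2⟩
    have hval : (Exp.ite (.lt (.ld 34 (.v 36)) (.v 0)) (.v 22 + 1) (.v 22)).eval M'' =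
        (min (i + 1) (root D n) : ℕ) := by
      rw [eval_ite_lt, eval_ld, eval_v, eval_v, eval_add, eval_v, eval_one, g2 36 (by norm_num) (by norm_num),
        h4 36 (by decide), h36, Int.toNat_natCast, g1 D le_rfl, g2 0 (by norm_num) (by norm_num),
        h4 0 (by decide), h0, g2 22 (by norm_num) (by norm_num), h3]
      rcases lt_or_ge i (root D n) with hlt | hge
      · rw [min_eq_left hlt.le, min_eq_left (by omega), if_pos (by exact_mod_cast pow_lt_of_lt_root hlt)]
        push_cast; rfl
      · rw [min_eq_right hge, min_eq_right (by omega), if_neg]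
        rw [not_lt]; exact_mod_cast le_root_pow hD
    refine Ex.of_assign hV (by decide) ?_ ?_
    · rw [hval, abs_of_nonneg (by positivity)]; exact_mod_cast (min_le_right _ _).trans hrV1
    · rw [hval]
      refine ⟨by rw [Mem.write_of_ne _ _ _ (by norm_num), g2 41 (by norm_num) (by norm_num), h1],
        by simp [Mem.write_self], by rw [h2]; ring,
        by rw [Mem.write_of_ne _ _ _ (by norm_num), Mem.write_self], fun a ha => ?_⟩
      have ha' := ha
      simp only [List.mem_cons, List.not_mem_nil, or_false, not_or] at ha'
      rw [Mem.write_of_ne _ _ _ (by omega), Mem.write_of_ne _ _ _ (by omega), g2 a (by omega) (by omega),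
        h4 a ha]
  · rintro τ M' ⟨h1, rfl, h3, h4⟩
    exact ⟨rfl, by rw [h3, min_eq_right (root_le hD)], h4⟩

end specs

end WordRAM

namespace DynAPSP

open WordRAM

/-! ### The complete reduction -/

/-- Put the constants of the reduction into variables. -/
def constsProg (K D μ k e : ℕ) : Prog :=
  .seq (.const 35 (K : ℤ)) <| .seq (.const 36 (D : ℤ)) <| .seq (.const 38 (μ : ℤ)) <|
  .seq (.const 39 (k : ℤ)) <| .seq (.const 40 (e : ℤ)) rootProg

/-- Compute the sizes that depend on the number of nodes. -/
def sizesProg : Prog :=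
  .seq powersProg <| .seq (assign 7 (.ld 34 (.v 36))) <| .seq (assign 23 (.ld 34 (.v 35))) <|
  .seq (assign 24 (.ld 34 (.v 36 - .v 35))) <| .seq (assign 16 (4 * .v 23)) <|
  .seq (powProg 8 7 40) <| .seq (assign 43 (.v 16 + 3 * .v 7 * .v 16 + 2)) <|
  .seq (powProg 15 43 39) <| assign 21 (5 * .v 38 * .v 8)

/-- The initial matrix. -/
def initExp : Exp :=
  .ite (.lt (.v 17 / .v 7) (.v 0)) (.ite (.lt (.v 17 % .v 7) (.v 0))
    (.ite (.eq (.v 17 / .v 7) (.v 17 % .v 7)) (.v 8)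
      (.ite (.eq (.ld 1 (.v 17 / .v 7 * .v 0 + .v 17 % .v 7)) 0) (5 * .v 8)
        (.v 8 + .ld 2 (.v 17 / .v 7 * .v 0 + .v 17 % .v 7))))
    (5 * .v 8)) (5 * .v 8)

/-- The entry of the matrix that the output cell in variable `17` stands for. -/
def finalExp : Exp := .ld 5 (.v 17 / .v 0 * .v 7 + .v 17 % .v 0)

/-- Write the output. -/
def outputProg : Prog :=
  .seq (for_ 17 (.v 0 * .v 0) (put 3 (.v 17) (.ite (.lt finalExp (4 * .v 8)) 1 0)))
    (for_ 17 (.v 0 * .v 0) (put 4 (.v 17) (finalExp - .v 8)))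

/-- The reduction: an algorithm for static APSP that simulates the dynamic algorithm `A`. -/
def mainProg (A : Algorithm) (del coord : Bool) (K D μ k e : ℕ) : Prog :=
  .seq (constsProg K D μ k e) <| .seq sizesProg <|
  .seq (for_ 17 (.v 7 * .v 7) (put 5 (.v 17) initExp)) <|
  .seq (closureProg A del coord) outputProg

/-- The reduction, except that an empty graph needs no output. -/
def apspProg (A : Algorithm) (del coord : Bool) (K D μ k e : ℕ) : Prog :=
  cond (.v 0) (mainProg A del coord K D μ k e) (assign 22 0)

section specs

variable {A : Algorithm} {del coord : Bool} {Z : Setup A del coord} {M : Mem}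

open Exp

theorem constsProg_spec {V K D μ k e n : ℕ} (hV : 100 ≤ V) (hD : 0 < D) (hn : 0 < n) (hK : K ≤ V)
    (hDV : D + 1 ≤ V) (hμ : μ ≤ V) (hk : k ≤ V) (he : e ≤ V)
    (hnV : n ≤ V) (h0 : M 0 0 = n) (h22 : M 22 0 = 0) (hrV : root D n ^ D ≤ V) :
    Ex V (constsProg K D μ k e) M fun τ M' =>
      τ = 5 + (n * ((D + 1) * 2000 + (D + 1 + 1) * 1200 + 1000) + (n + 1) * 1200) ∧
      M' 22 0 = (root D n : ℕ) ∧ M' 35 0 = K ∧ M' 36 0 = D ∧ M' 38 0 = μ ∧ M' 39 0 = k ∧ M' 40 0 = e ∧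
      ∀ a, a ∉ [22, 34, 35, 36, 38, 39, 40, 41, 42] → M' a = M a := by
  refine Ex.of_const_seq hK fun M₁ h₁ f₁ => ?_
  refine Ex.of_const_seq (by omega) fun M₂ h₂ f₂ => ?_
  refine Ex.of_const_seq hμ fun M₃ h₃ f₃ => ?_
  refine Ex.of_const_seq hk fun M₄ h₄ f₄ => ?_
  refine Ex.of_const_seq he fun M₅ h₅ f₅ => ?_
  have F : ∀ a, a ∉ [35, 36, 38, 39, 40] → M₅ a = M a := fun a ha => by
    simp only [List.mem_cons, List.not_mem_nil, or_false, not_or] at ha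
    rw [f₅ a (by omega), f₄ a (by omega), f₃ a (by omega), f₂ a (by omega), f₁ a (by omega)]
  refine (rootProg_spec hV hD hn hDV hnV (by rw [F 0 (by decide), h0]) (by
    rw [f₅ 36 (by norm_num), f₄ 36 (by norm_num), f₃ 36 (by norm_num), h₂])
    (by rw [F 22 (by decide), h22]) hrV).imp ?_
  rintro τ M' - ⟨rfl, h1, h2⟩
  refine ⟨by ring, h1, ?_, ?_, ?_, ?_, ?_, fun a ha => ?_⟩
  · rw [h2 35 (by decide), f₅ 35 (by norm_num), f₄ 35 (by norm_num), f₃ 35 (by norm_num),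
      f₂ 35 (by norm_num), h₁]
  · rw [h2 36 (by decide), f₅ 36 (by norm_num), f₄ 36 (by norm_num), f₃ 36 (by norm_num), h₂]
  · rw [h2 38 (by decide), f₅ 38 (by norm_num), f₄ 38 (by norm_num), h₃]
  · rw [h2 39 (by decide), f₅ 39 (by norm_num), h₄]
  · rw [h2 40 (by decide), h₅]
  · simp only [List.mem_cons, List.not_mem_nil, or_false, not_or] at ha
    rw [h2 a (by simp; omega), F a (by simp; omega)]

theorem sizesProg_spec {D μ k e : ℕ} (hKD : Z.K ≤ D) (hG : Z.G = Z.h ^ (D - Z.K))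
    (hΩ : Z.Ω = Z.m ^ e) (hS : Z.S = (Z.N + 3 * Z.m * Z.N + 2) ^ k) (hU : Z.U = 5 * μ * Z.Ω)
    (hDV : D + 1 ≤ Z.V) (hk : k ≤ Z.V) (he : e ≤ Z.V) (hbV : Z.N + 3 * Z.m * Z.N + 2 ≤ Z.V)
    (hSV : Z.S ≤ Z.V) (hUV : Z.U ≤ Z.V)
    (h22 : M 22 0 = Z.h) (h35 : M 35 0 = Z.K) (h36 : M 36 0 = D) (h38 : M 38 0 = μ) (h39 : M 39 0 = k)
    (h40 : M 40 0 = e) :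
    Ex Z.V sizesProg M fun τ M' =>
      τ ≤ (D + 1) * 2000 + (D + 1 + 1) * 1200 + 6000 + (1000 + (e * 1000 + (e + 1) * 1200)) +
        (1000 + (k * 1000 + (k + 1) * 1200)) ∧
      Z.Env (M' 5) M' ∧ ∀ a, a ∉ [7, 8, 15, 16, 21, 23, 24, 34, 42, 43] → M' a = M a := by
  have hmD : Z.h ^ D = Z.m := by
    unfold Setup.m; rw [hG, ← pow_add]; congr 1; omega
  have hpow : ∀ i, i ≤ D → Z.h ^ i ≤ Z.V := fun i hi =>
    (Nat.pow_le_pow_right Z.h_pos hi).trans (by rw [hmD]; exact Z.m_le)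
  have hm0 : 0 < Z.m := Nat.mul_pos Z.hK_pos Z.G_pos
  refine Ex.of_seq ((powersProg_spec Z.hV hDV h36 h22 hpow).imp ?_)
  rintro τ₁ M₁ - ⟨rfl, g₁, f₁⟩
  refine Ex.of_assign_seq (z := Z.m) Z.hV (by decide) ?_ Z.m_le fun M₂ h₂ f₂ => ?_
  · rw [eval_ld, eval_v, f₁ 36 (by norm_num) (by norm_num), h36, Int.toNat_natCast, g₁ D le_rfl, hmD]
  refine Ex.of_assign_seq (z := Z.h ^ Z.K) Z.hV (by decide) ?_ (hpow _ hKD) fun M₃ h₃ f₃ => ?_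
  · rw [eval_ld, eval_v, f₂ 35 (by norm_num), f₁ 35 (by norm_num) (by norm_num), h35,
      Int.toNat_natCast, f₂ 34 (by norm_num), g₁ _ hKD]
  have F₃ : ∀ a, a ∉ [7, 23, 34, 42] → M₃ a = M a := fun a ha => by
    simp only [List.mem_cons, List.not_mem_nil, or_false, not_or] at ha
    rw [f₃ a (by omega), f₂ a (by omega), f₁ a (by omega) (by omega)]
  have g₃ : M₃ 34 = M₁ 34 := by rw [f₃ 34 (by norm_num), f₂ 34 (by norm_num)]
  refine Ex.of_assign_seq (z := Z.G) Z.hV (by decide) ?_ (Z.G_le_m.trans Z.m_le) fun M₄ h₄ f₄ => ?_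
  · rw [eval_ld, eval_sub, eval_v, eval_v, F₃ 35 (by decide), F₃ 36 (by decide), h35, h36, g₃,
      show ((D : ℤ) - Z.K).toNat = D - Z.K by omega, g₁ _ (by omega), hG]
  refine Ex.of_assign_seq (z := Z.N) Z.hV (by decide) ?_ (by omega) fun M₅ h₅ f₅ => ?_
  · rw [eval_mul, eval_v, eval_num, f₄ 23 (by norm_num), h₃]; unfold Setup.N; push_cast; rfl
  have F₅ : ∀ a, a ∉ [7, 16, 23, 24, 34, 42] → M₅ a = M a := fun a ha => by
    simp only [List.mem_cons, List.not_mem_nil, or_false, not_or] at ha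
    rw [f₅ a (by omega), f₄ a (by omega), F₃ a (by simp; omega)]
  have h7 : M₅ 7 0 = Z.m := by rw [f₅ 7 (by norm_num), f₄ 7 (by norm_num), f₃ 7 (by norm_num), h₂]
  refine Ex.of_seq ((powProg_spec (b := Z.m) (k := e) Z.hV (by decide) (by decide) (by decide)
    (by decide) (by decide) (by decide) (by decide) h7 (by rw [F₅ 40 (by decide), h40]) hm0 ?_ he).imp ?_)
  · rw [← hΩ]; have := Z.ΩV; omega
  rintro τ₆ M₆ - ⟨rfl, h₆, f₆⟩
  rw [← hΩ] at h₆
  have h7' : M₆ 7 0 = Z.m := by rw [f₆ 7 (by norm_num) (by norm_num), h7]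
  have h16' : M₆ 16 0 = Z.N := by rw [f₆ 16 (by norm_num) (by norm_num), h₅]
  refine Ex.of_assign_seq (z := Z.N + 3 * Z.m * Z.N + 2) Z.hV (by decide) ?_ hbV fun M₇ h₇ f₇ => ?_
  · simp only [eval_add, eval_mul, eval_v, eval_num, h7', h16']; push_cast; rfl
  have F₇ : ∀ a, a ∉ [7, 8, 16, 23, 24, 34, 42, 43] → M₇ a = M a := fun a ha => by
    simp only [List.mem_cons, List.not_mem_nil, or_false, not_or] at ha
    rw [f₇ a (by omega), f₆ a (by omega) (by omega), F₅ a (by simp; omega)]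
  refine Ex.of_seq ((powProg_spec (k := k) Z.hV (by decide) (by decide) (by decide)
    (by decide) (by decide) (by decide) (by decide) h₇ (by rw [F₇ 39 (by decide), h39]) (by omega) ?_ hk).imp
    ?_)
  · rw [← hS]; exact hSV
  rintro τ₈ M₈ - ⟨rfl, h₈, f₈⟩
  rw [← hS] at h₈
  have h8 : M₈ 8 0 = Z.Ω := by rw [f₈ 8 (by norm_num) (by norm_num), f₇ 8 (by norm_num), h₆]
  have hval : (5 * .v 38 * .v 8 : Exp).eval M₈ = (Z.U : ℕ) := by
    simp only [eval_mul, eval_v, eval_num, h8, f₈ 38 (by norm_num) (by norm_num), F₇ 38 (by decide), h38]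
    rw [hU]; push_cast; rfl
  refine Ex.of_assign Z.hV (by decide) ?_ ?_
  · rw [hval, abs_of_nonneg (by positivity)]; exact_mod_cast hUV
  rw [hval]
  have f₉ : ∀ a, a ≠ 21 → (M₈.write 21 0 (Z.U : ℕ)) a = M₈ a := fun a ha => Mem.write_of_ne _ _ _ ha
  refine ⟨by omega, ⟨rfl, ?_, ?_, ?_, ?_, Mem.write_self .., ?_, ?_, fun j hj => ?_, ?_⟩, fun a ha => ?_⟩
  · rw [f₉ 7 (by norm_num), f₈ 7 (by norm_num) (by norm_num), f₇ 7 (by norm_num), h7']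
  · rw [f₉ 8 (by norm_num), h8]
  · rw [f₉ 15 (by norm_num), h₈]
  · rw [f₉ 16 (by norm_num), f₈ 16 (by norm_num) (by norm_num), f₇ 16 (by norm_num), h16']
  · rw [f₉ 23 (by norm_num), f₈ 23 (by norm_num) (by norm_num), f₇ 23 (by norm_num),
      f₆ 23 (by norm_num) (by norm_num), f₅ 23 (by norm_num), f₄ 23 (by norm_num), h₃]
  · rw [f₉ 24 (by norm_num), f₈ 24 (by norm_num) (by norm_num), f₇ 24 (by norm_num),
      f₆ 24 (by norm_num) (by norm_num), f₅ 24 (by norm_num), h₄]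
  · rw [f₉ 34 (by norm_num), f₈ 34 (by norm_num) (by norm_num), f₇ 34 (by norm_num),
      f₆ 34 (by norm_num) (by norm_num), f₅ 34 (by norm_num), f₄ 34 (by norm_num), g₃, g₁ j (by omega)]
  · rw [f₉ 35 (by norm_num), f₈ 35 (by norm_num) (by norm_num), F₇ 35 (by decide), h35]
  · simp only [List.mem_cons, List.not_mem_nil, or_false, not_or] at ha
    rw [f₉ a (by omega), f₈ a (by omega) (by omega), F₇ a (by simp; omega)]

theorem matArray_mul_add {n : ℕ} (f : Fin n → Fin n → ℤ) (i j : Fin n) :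
    matArray f (i * n + j) = f i j := by
  have hn : 0 < n := i.pos
  have h1 : ((i : ℕ) * n + j) / n = i := by
    rw [mul_comm, Nat.mul_add_div hn, Nat.div_eq_of_lt j.2, add_zero]
  have h2 : ((i : ℕ) * n + j) % n = j := by rw [mul_comm, Nat.mul_add_mod, Nat.mod_eq_of_lt j.2]
  rw [matArray, dif_pos ⟨by rw [h1]; exact i.2, by rw [h2]; exact j.2⟩]
  congr 1 <;> exact Fin.ext (by assumption)

theorem initExp_eval {n m Ω p : ℕ} {w : APSP.WDigraph n} (h0 : M 0 0 = n)
    (h1 : M 1 = APSP.input w 1) (h2 : M 2 = APSP.input w 2) (h7 : M 7 0 = m) (h8 : M 8 0 = Ω)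
    (h17 : M 17 0 = p) : initExp.eval M = APSP.initEntry w Ω (p / m) (p % m) := by
  have e1 : (.v 17 / .v 7 : Exp).eval M = (p / m : ℕ) := by
    rw [eval_div, eval_v, eval_v, h17, h7]; push_cast; rfl
  have e2 : (.v 17 % .v 7 : Exp).eval M = (p % m : ℕ) := by
    rw [eval_mod, eval_v, eval_v, h17, h7]; push_cast; rfl
  simp only [initExp, eval_ite_lt, eval_ite_eq, eval_add, eval_mul, eval_ld, eval_v, eval_num,
    e1, e2, h0, h8, h1, h2]
  generalize p / m = i
  generalize p % m = j
  have e3 : ((i : ℤ) * n + j).toNat = i * n + j := by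
    rw [show (i : ℤ) * n + j = (i * n + j : ℕ) by push_cast; rfl, Int.toNat_natCast]
  rw [e3, APSP.initEntry]
  by_cases hi : i < n
  · by_cases hj : j < n
    · rw [if_pos (by omega), if_pos (by omega), dif_pos ⟨hi, hj⟩]
      have m1 := matArray_mul_add (fun u v : Fin n => if (w u v).isSome then (1 : ℤ) else 0) ⟨i, hi⟩ ⟨j, hj⟩
      have m2 := matArray_mul_add (fun u v : Fin n => (w u v).getD 0) ⟨i, hi⟩ ⟨j, hj⟩
      simp only at m1 m2
      simp only [APSP.input, m1, m2]
      by_cases hij : i = j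
      · rw [if_pos (by omega), if_pos hij]
      · rw [if_neg (by omega), if_neg hij]
        rcases w ⟨i, hi⟩ ⟨j, hj⟩ with _ | a <;> simp
    · rw [if_pos (by omega), if_neg (by omega), dif_neg (by tauto)]; simp
  · rw [if_neg (by omega), dif_neg (by tauto)]; simp

theorem outputProg_spec {n m Ω V : ℕ} {X : ℕ → ℤ} (hV : 100 ≤ V) (hn : 0 < n) (hnV : n * n ≤ V)
    (h0 : M 0 0 = n) (h5 : M 5 = X) (h7 : M 7 0 = m) (h8 : M 8 0 = Ω) (hΩ : 6 * Ω ≤ V)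
    (hX : ∀ i j, i < n → j < n → 0 ≤ X (i * m + j) ∧ X (i * m + j) ≤ 5 * Ω) :
    Ex V outputProg M fun τ M' => τ ≤ 2 * (n * n * 2000 + (n * n + 1) * 1200) ∧
      ∀ i j, i < n → j < n → M' 3 (i * n + j) = (if X (i * m + j) < 4 * Ω then 1 else 0) ∧
        M' 4 (i * n + j) = X (i * m + j) - Ω := by
  have hfin : ∀ (M' : Mem) (p : ℕ), (∀ b, b ≠ 3 → b ≠ 4 → b ≠ 17 → M' b = M b) → M' 17 0 = p →
      finalExp.eval M' = X (p / n * m + p % n) := by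
    intro M' p hM' h17
    simp only [finalExp, eval_ld, eval_add, eval_mul, eval_div, eval_mod, eval_v, h17,
      hM' 0 (by norm_num) (by norm_num) (by norm_num), h0, hM' 7 (by norm_num) (by norm_num) (by norm_num),
      h7, hM' 5 (by norm_num) (by norm_num) (by norm_num), h5]
    congr 1
  have hdiv : ∀ p, p < n * n → p / n < n ∧ p % n < n := fun p hp =>
    ⟨Nat.div_lt_of_lt_mul hp, Nat.mod_lt _ hn⟩
  have hΩV : (6 * Ω : ℤ) ≤ V := by exact_mod_cast hΩ
  refine Ex.of_seq (Ex.of_fill (n := n * n) (off := 0)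
    (fun p => if X (p / n * m + p % n) < 4 * Ω then 1 else 0) hV (by decide)
    (by decide) (by decide) (by decide) (by decide) hnV (fun p hp => ?_) ?_ ?_ ?_)
  · split_ifs
    · rw [abs_one]; exact_mod_cast (by omega : 1 ≤ V)
    · simp
  · intro m' hm'
    simp only [eval_mul, eval_v, hm' 0 (by norm_num) (by norm_num), h0]; push_cast; rfl
  · intro i m' hi _ hm' h17 _
    refine ⟨by simp only [eval_v, h17, zero_add], ?_⟩
    rw [eval_ite_lt, hfin m' i (fun b hb hb' hb'' => hm' b hb hb'') h17]
    simp only [eval_mul, eval_v, eval_num, hm' 8 (by norm_num) (by norm_num), h8,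
      Nat.cast_ofNat, Nat.cast_one, Nat.cast_zero]
  intro M₁ f₁ g₁
  refine Ex.of_fill (n := n * n) (off := 0)
    (fun p => X (p / n * m + p % n) - Ω) hV (by decide)
    (by decide) (by decide) (by decide) (by decide) hnV (fun p hp => ?_) ?_ ?_ ?_
  · obtain ⟨h1, h2⟩ := hX _ _ (hdiv p hp).1 (hdiv p hp).2
    have : (0 : ℤ) ≤ Ω := by positivity
    rw [abs_le]; constructor <;> linarith
  · intro m' hm'
    simp only [eval_mul, eval_v, hm' 0 (by norm_num) (by norm_num), f₁ 0 (by norm_num) (by norm_num), h0]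
    push_cast; rfl
  · intro i m' hi _ hm' h17 _
    refine ⟨by simp only [eval_v, h17, zero_add], ?_⟩
    rw [eval_sub, hfin m' i (fun b hb hb' hb'' => by rw [hm' b hb' hb'', f₁ b hb hb'']) h17]
    simp only [eval_v, hm' 8 (by norm_num) (by norm_num), f₁ 8 (by norm_num) (by norm_num), h8]
  intro M₂ f₂ g₂
  refine ⟨by omega, fun i j hi hj => ?_⟩
  have h1 : (i * n + j) / n = i := by
    rw [mul_comm, Nat.mul_add_div hn, Nat.div_eq_of_lt hj, add_zero]
  have h2 : (i * n + j) % n = j := by rw [mul_comm, Nat.mul_add_mod, Nat.mod_eq_of_lt hj]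
  have h3 : i * n + j < n * n := by
    have := Nat.mul_le_mul_right n hi
    rw [Nat.succ_mul] at this; omega
  refine ⟨?_, ?_⟩
  · rw [f₂ 3 (by norm_num) (by norm_num), g₁, if_pos (by omega), Nat.sub_zero, h1, h2]
  · rw [g₂, if_pos (by omega), Nat.sub_zero, h1, h2]

end specs

section specs

variable {A : Algorithm} {del coord : Bool} {Z : Setup A del coord}

open Exp

/-- A time bound for the reduction, where `j` is the best exponent. -/
def Setup.totalTime (Z : Setup A del coord) (D k e j : ℕ) : ℕ :=
  D * Z.h * Z.squareTime j + 20000 * (D + k + e + 10) * (Z.m * Z.m)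

theorem bdd_input {n c V : ℕ} {w : APSP.WDigraph n} (hw : APSP.WeightsBounded c w) (hV : 100 ≤ V)
    (hnV : n ≤ V) (hcV : n ^ c ≤ V) : Bdd V (APSP.input w) := by
  have hV0 : (0 : ℤ) ≤ V := by positivity
  intro a _ i
  match a with
  | 0 =>
    simp only [APSP.input]
    split_ifs
    · rw [abs_of_nonneg (by positivity)]; exact_mod_cast hnV
    · simp
  | 1 =>
    simp only [APSP.input]
    refine abs_matArray_le hV0 (fun u v => ?_) i
    split_ifs
    · rw [abs_one]; exact_mod_cast (by omega : 1 ≤ V)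
    · simp
  | 2 =>
    simp only [APSP.input]
    refine abs_matArray_le hV0 (fun u v => ?_) i
    rcases h : w u v with _ | a
    · simp
    · exact (hw u v a h).trans (by exact_mod_cast hcV)
  | a + 3 => simp [APSP.input]

theorem mainProg_spec {n c D μ k e : ℕ} {w : APSP.WDigraph n} (hw : APSP.WeightsBounded c w)
    (hneg : APSP.NoNegCycle w) (hn : 0 < n) (hKD : Z.K ≤ D) (hD : 0 < D) (hh : Z.h = root D n)
    (hG : Z.G = Z.h ^ (D - Z.K)) (hΩ : Z.Ω = Z.m ^ e) (he : c + 1 ≤ e)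
    (hS : Z.S = (Z.N + 3 * Z.m * Z.N + 2) ^ k) (hU : Z.U = 5 * μ * Z.Ω)
    (hDV : D + 1 ≤ Z.V) (hμV : μ ≤ Z.V) (hkV : k ≤ Z.V) (heV : e ≤ Z.V)
    (hbaseV : Z.N + 3 * Z.m * Z.N + 2 ≤ Z.V) (hUV : Z.U ≤ Z.V)
    (hbV : D * Z.h * (Z.G * Z.G * (Z.h ^ Z.K * Z.S)) ≤ Z.V) :
    Ex Z.V (mainProg A del coord Z.K D μ k e) (APSP.input w) fun τ M' => APSP.IsOutput w M' ∧
      ∀ j, j ≤ Z.K → τ ≤ Z.totalTime D k e j := by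
  have hmD : Z.h ^ D = Z.m := by
    unfold Setup.m; rw [hG, ← pow_add]; congr 1; omega
  have hm0 : 0 < Z.m := Nat.mul_pos Z.hK_pos Z.G_pos
  have hnm : n ≤ Z.m := by rw [← hmD, hh]; exact le_root_pow hD
  have hhm : Z.h ≤ Z.m := by rw [← hmD]; exact Nat.le_self_pow hD.ne' _
  have hS0 : 0 < Z.S := by have := Z.BS; omega
  have hGG : 0 < Z.G * Z.G := Nat.mul_pos Z.G_pos Z.G_pos
  have hΩn : n ^ (c + 1) ≤ Z.Ω := by
    rw [hΩ]
    exact (Nat.pow_le_pow_left hnm _).trans (Nat.pow_le_pow_right hm0 he)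
  have hDhV : D * Z.h ≤ Z.V :=
    (Nat.le_mul_of_pos_right _ (Nat.mul_pos hGG (Nat.mul_pos Z.hK_pos hS0))).trans hbV
  have hSV : Z.S ≤ Z.V := by
    refine le_trans ?_ hbV
    calc Z.S ≤ Z.h ^ Z.K * Z.S := Nat.le_mul_of_pos_left _ Z.hK_pos
      _ ≤ Z.G * Z.G * (Z.h ^ Z.K * Z.S) := Nat.le_mul_of_pos_left _ hGG
      _ ≤ _ := Nat.le_mul_of_pos_left _ (Nat.mul_pos hD Z.h_pos)
  refine Ex.of_seq ((constsProg_spec (n := n) Z.hV hD hn (by have := Z.KV; omega) hDV hμV hkV heV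
    (hnm.trans Z.m_le) rfl rfl (by rw [← hh, hmD]; exact Z.m_le)).imp ?_)
  rintro τ₁ M₁ - ⟨hτ₁, h22, h35, h36, h38, h39, h40, f₁⟩
  rw [← hh] at h22
  refine Ex.of_seq ((sizesProg_spec hKD hG hΩ hS hU hDV hkV heV hbaseV hSV hUV h22 h35 h36 h38 h39
    h40).imp ?_)
  rintro τ₂ M₂ - ⟨hτ₂, hE₂, f₂⟩
  have F₂ : ∀ a, a ∉ [7, 8, 15, 16, 21, 22, 23, 24, 34, 35, 36, 38, 39, 40, 41, 42, 43] →
      M₂ a = APSP.input w a := fun a ha => by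
    simp only [List.mem_cons, List.not_mem_nil, or_false, not_or] at ha
    rw [f₂ a (by simp; omega), f₁ a (by simp; omega)]
  -- the initial matrix
  have hinit : ∀ i j, 0 ≤ APSP.initEntry w Z.Ω i j ∧ APSP.initEntry w Z.Ω i j ≤ 5 * Z.Ω :=
    fun i j => (APSP.enc_initEntry hneg Z.Ω i j).bounds hw hneg hΩn
  have hΩV : (10 * Z.Ω : ℤ) ≤ Z.V := by exact_mod_cast Z.ΩV
  refine Ex.of_seq (Ex.of_fill (n := Z.m * Z.m) (off := 0)
    (fun p => APSP.initEntry w Z.Ω (p / Z.m) (p % Z.m)) Z.hV (by decide) (by decide) (by decide)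
    (by decide) (by decide) Z.mV (fun p _ => ?_) ?_ ?_ ?_)
  · obtain ⟨h1, h2⟩ := hinit (p / Z.m) (p % Z.m)
    rw [abs_of_nonneg h1]
    have : (0 : ℤ) ≤ Z.Ω := by positivity
    linarith
  · intro m' hm'
    rw [eval_mul, eval_v, hm' 7 (by norm_num) (by norm_num), hE₂.m]; push_cast; rfl
  · intro p m' hp _ hm' h17 _
    refine ⟨by rw [eval_v, h17, zero_add], ?_⟩
    refine initExp_eval ?_ ?_ ?_ ?_ ?_ h17
    · rw [hm' 0 (by norm_num) (by norm_num), F₂ 0 (by decide)]; rfl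
    · rw [hm' 1 (by norm_num) (by norm_num), F₂ 1 (by decide)]
    · rw [hm' 2 (by norm_num) (by norm_num), F₂ 2 (by decide)]
    · rw [hm' 7 (by norm_num) (by norm_num), hE₂.m]
    · rw [hm' 8 (by norm_num) (by norm_num), hE₂.Ω]
  intro M₃ f₃ g₃
  have hE₃ : Z.Env (M₃ 5) M₃ := by
    obtain ⟨-, e2, e3, e4, e5, e6, e7, e8, e9, e10⟩ := hE₂
    refine ⟨rfl, ?_, ?_, ?_, ?_, ?_, ?_, ?_, fun j hj => ?_, ?_⟩ <;>
      rw [f₃ _ (by norm_num) (by norm_num)]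
    all_goals first | assumption | exact e9 j hj
  have h5 : ∀ p, M₃ 5 p = if p < Z.m * Z.m then APSP.initEntry w Z.Ω (p / Z.m) (p % Z.m) else 0 := by
    intro p
    rw [g₃, F₂ 5 (by decide)]
    simp only [zero_le, true_and, zero_add, Nat.sub_zero]
    rfl
  have hmat : Z.IsMatrix (M₃ 5) := by
    constructor <;> intro p <;> rw [h5] <;> split_ifs
    · exact (hinit _ _).1
    · exact le_rfl
    · exact (hinit _ _).2
    · positivity
  refine Ex.of_seq ((closureProg_spec (D := D) hw hneg hΩn hnm hE₃ hmat ?_ ?_ ?_ ?_ ?_ hDhV hbV).imp ?_)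
  · intro i j hi hj
    have h1 : (i * Z.m + j) / Z.m = i := by
      rw [mul_comm, Nat.mul_add_div hm0, Nat.div_eq_of_lt hj, add_zero]
    have h2 : (i * Z.m + j) % Z.m = j := by rw [mul_comm, Nat.mul_add_mod, Nat.mod_eq_of_lt hj]
    have h3 : i * Z.m + j < Z.m * Z.m := by
      have := Nat.mul_le_mul_right Z.m hi
      rw [Nat.succ_mul] at this; omega
    rw [h5, if_pos h3, h1, h2]
    exact APSP.enc_initEntry hneg Z.Ω i j
  · rw [f₃ 13 (by norm_num) (by norm_num), F₂ 13 (by decide)]; rfl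
  · intro a i _
    rw [f₃ _ (by omega) (by omega), F₂ _ (by simp; omega), show 100 + a = a + 97 + 3 by ring]; rfl
  · rw [f₃ 22 (by norm_num) (by norm_num), f₂ 22 (by decide), h22]
  · rw [f₃ 36 (by norm_num) (by norm_num), f₂ 36 (by decide), h36]
  rintro τ₄ M₄ - ⟨X, hE₄, hτ₄, h0, hEnc⟩
  have hne : n ≤ 2 ^ (D * Z.h) := by
    calc n ≤ Z.h ^ D := by rw [hh]; exact le_root_pow hD
      _ ≤ (2 ^ Z.h) ^ D := Nat.pow_le_pow_left Nat.lt_two_pow_self.le _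
      _ = 2 ^ (D * Z.h) := by rw [← pow_mul, mul_comm]
  have hnn : n * n ≤ Z.m * Z.m := Nat.mul_le_mul hnm hnm
  refine (outputProg_spec (n := n) Z.hV hn (hnn.trans Z.mV) ?_ hE₄.X hE₄.m hE₄.Ω (by
    have := Z.ΩV; omega) fun i j hi hj => (hEnc i j (by omega) (by omega)).bounds hw hneg hΩn).imp ?_
  · rw [h0, f₃ 0 (by norm_num) (by norm_num), F₂ 0 (by decide)]; rfl
  rintro τ₅ M₅ - ⟨hτ₅, hout⟩
  refine ⟨fun u v => ?_, fun j hj => ?_⟩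
  · obtain ⟨h1, h2⟩ := hout u v u.2 v.2
    have h3 := (hEnc u v (by omega) (by omega)).dist hw hneg hΩn Z.Ω_pos hne
    rw [h1, h2]
    refine ⟨fun h => ?_, fun h => ?_⟩
    · rw [if_pos (h3.1 h).1]; exact ⟨rfl, (h3.1 h).2⟩
    · rw [if_neg (h3.2 h)]
  · have h1 := hτ₄ j hj
    unfold Setup.totalTime
    have hmm : Z.m ≤ Z.m * Z.m := Nat.le_mul_self _
    have w1 : 1 ≤ Z.m * Z.m := by omega
    have w2 : n ≤ Z.m * Z.m := by omega
    have w3 : Z.h ≤ Z.m * Z.m := by omega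
    generalize Z.m * Z.m = W at *
    have w4 : n * D ≤ D * W := by rw [mul_comm]; exact Nat.mul_le_mul_left _ w2
    have w5 : D * Z.h ≤ D * W := Nat.mul_le_mul_left _ w3
    have w6 : k ≤ k * W := Nat.le_mul_of_pos_right _ w1
    have w7 : e ≤ e * W := Nat.le_mul_of_pos_right _ w1
    have w8 : D ≤ D * W := Nat.le_mul_of_pos_right _ w1
    have w9 : n * ((D + 1) * 2000 + (D + 1 + 1) * 1200 + 1000) = 3200 * (n * D) + 5400 * n := by ring
    have w10 : 20000 * (D + k + e + 10) * W =
      20000 * (D * W) + 20000 * (k * W) + 20000 * (e * W) + 200000 * W := by ring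
    rw [w9] at hτ₁
    rw [w10]
    generalize D * Z.h * Z.squareTime j = T at *
    omega

/-- The reduction solves APSP on a nonempty graph. -/
theorem apspProg_runs {n c D μ k e : ℕ} {w : APSP.WDigraph n} (hw : APSP.WeightsBounded c w)
    (hneg : APSP.NoNegCycle w) (hn : 0 < n) (hKD : Z.K ≤ D) (hD : 0 < D) (hh : Z.h = root D n)
    (hG : Z.G = Z.h ^ (D - Z.K)) (hΩ : Z.Ω = Z.m ^ e) (he : c + 1 ≤ e)
    (hS : Z.S = (Z.N + 3 * Z.m * Z.N + 2) ^ k) (hU : Z.U = 5 * μ * Z.Ω)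
    (hDV : D + 1 ≤ Z.V) (hμV : μ ≤ Z.V) (hkV : k ≤ Z.V) (heV : e ≤ Z.V)
    (hbaseV : Z.N + 3 * Z.m * Z.N + 2 ≤ Z.V) (hUV : Z.U ≤ Z.V)
    (hbV : D * Z.h * (Z.G * Z.G * (Z.h ^ Z.K * Z.S)) ≤ Z.V) :
    ∃ t M, Runs (Z.V ^ 500) (apspProg A del coord Z.K D μ k e) (APSP.input w) t M ∧
      APSP.IsOutput w M ∧ ∀ j, j ≤ Z.K → t ≤ Z.totalTime D k e j + 1000 := by
  have hm0 : 0 < Z.m := Nat.mul_pos Z.hK_pos Z.G_pos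
  have hmD : Z.h ^ D = Z.m := by
    unfold Setup.m; rw [hG, ← pow_add]; congr 1; omega
  have hnm : n ≤ Z.m := by rw [← hmD, hh]; exact le_root_pow hD
  have hcV : n ^ c ≤ Z.V := by
    have h1 : n ^ c ≤ Z.Ω := by
      rw [hΩ]
      exact (Nat.pow_le_pow_left hnm _).trans (Nat.pow_le_pow_right hm0 (by omega))
    have := Z.ΩV; omega
  have hmain := mainProg_spec hw hneg hn hKD hD hh hG hΩ he hS hU hDV hμV hkV heV hbaseV hUV hbV
  have h0 : (Exp.v 0).eval (APSP.input w) ≠ 0 := by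
    change (n : ℤ) ≠ 0; exact_mod_cast hn.ne'
  obtain ⟨τ, M', h1, -, h2, h3⟩ := Ex.of_cond (r := assign 22 0)
    (Q := fun τ M' => APSP.IsOutput w M' ∧ ∀ j, j ≤ Z.K → τ ≤ Z.totalTime D k e j + 1000) Z.hV
    (by decide) (fun _ => hmain.imp fun τ M' _ h => ⟨h.1, fun j hj => Nat.add_le_add_right (h.2 j hj) _⟩)
    (fun h => absurd h h0) (bdd_input hw Z.hV (hnm.trans Z.m_le) hcV)
  obtain ⟨t, M, ht, hr, heqv⟩ := h1 _ fun _ _ => rfl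
  refine ⟨t, M, hr, ?_, fun j hj => ht.trans (h3 j hj)⟩
  unfold APSP.IsOutput at h2 ⊢
  rw [← heqv 3 (by decide), ← heqv 4 (by decide)]
  exact h2

theorem apspProg_runs_zero (K D μ k e : ℕ) (w : APSP.WDigraph 0) :
    ∃ t M, Runs (100 ^ 500) (apspProg A del coord K D μ k e) (APSP.input w) t M ∧
      APSP.IsOutput w M ∧ t ≤ 2000 := by
  have h0 : (Exp.v 0).eval (APSP.input w) = 0 := rfl
  have hb : Bdd 100 (APSP.input w) := bdd_input (c := 0) (fun u => u.elim0) le_rfl (by norm_num)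
    (by norm_num)
  obtain ⟨τ, M', h1, -, h2⟩ := Ex.of_cond (e := .v 0) (r := assign 22 0) (V := 100) (p := mainProg A del coord K D μ k e)
    (Q := fun τ M' => τ ≤ 2000) le_rfl (by decide) (fun h => absurd h0 h)
    (fun _ => Ex.of_assign le_rfl (by decide) (by rw [eval_zero]; simp) (le_refl 2000)) hb
  obtain ⟨t, M, ht, hr, -⟩ := h1 _ fun _ _ => rfl
  exact ⟨t, M, hr, fun u => u.elim0, ht.trans h2⟩

end specs

end DynAPSP

/-! ### Polynomially bounded functions -/

/-- `f` is bounded by a polynomial. -/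
def PolyBdd (f : ℕ → ℕ) : Prop := ∃ k, ∀ n, f n ≤ (n + 2) ^ k

namespace PolyBdd

variable {f g : ℕ → ℕ}

theorem mono (hg : PolyBdd g) (h : ∀ n, f n ≤ g n) : PolyBdd f :=
  let ⟨k, hk⟩ := hg
  ⟨k, fun n => (h n).trans (hk n)⟩

theorem const (c : ℕ) : PolyBdd fun _ => c :=
  ⟨c, fun n => Nat.lt_two_pow_self.le.trans (Nat.pow_le_pow_left (by omega) c)⟩

theorem id : PolyBdd fun n => n := ⟨1, fun n => by simp⟩

theorem mul (hf : PolyBdd f) (hg : PolyBdd g) : PolyBdd fun n => f n * g n := by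
  obtain ⟨k, hk⟩ := hf
  obtain ⟨l, hl⟩ := hg
  exact ⟨k + l, fun n => by rw [pow_add]; exact Nat.mul_le_mul (hk n) (hl n)⟩

theorem add (hf : PolyBdd f) (hg : PolyBdd g) : PolyBdd fun n => f n + g n := by
  obtain ⟨k, hk⟩ := hf
  obtain ⟨l, hl⟩ := hg
  refine ⟨k + l + 1, fun n => ?_⟩
  have h1 : (n + 2) ^ k ≤ (n + 2) ^ (k + l) := Nat.pow_le_pow_right (by omega) (by omega)
  have h2 : (n + 2) ^ l ≤ (n + 2) ^ (k + l) := Nat.pow_le_pow_right (by omega) (by omega)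
  have h3 : (n + 2) ^ (k + l + 1) = n * (n + 2) ^ (k + l) + 2 * (n + 2) ^ (k + l) := by ring
  have h4 := hk n
  have h5 := hl n
  have h6 : 0 ≤ n * (n + 2) ^ (k + l) := Nat.zero_le _
  show f n + g n ≤ _
  rw [h3]
  omega

theorem pow (hf : PolyBdd f) (c : ℕ) : PolyBdd fun n => f n ^ c := by
  obtain ⟨k, hk⟩ := hf
  exact ⟨k * c, fun n => by rw [pow_mul]; exact Nat.pow_le_pow_left (hk n) c⟩

theorem sum {ι : Type} (s : Finset ι) {F : ι → ℕ → ℕ} (h : ∀ i ∈ s, PolyBdd (F i)) :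
    PolyBdd fun n => ∑ i ∈ s, F i n := by
  classical
  induction s using Finset.induction_on with
  | empty => simpa using const 0
  | insert a s ha ih =>
    simp only [Finset.sum_insert ha]
    exact (h a (Finset.mem_insert_self _ _)).add
      (ih fun i hi => h i (Finset.mem_insert_of_mem hi))

end PolyBdd

namespace DynAPSP

open WordRAM

/-! ### The update and query times of a hypothetical fast algorithm -/

/-- Let the number `r` of operations tend to infinity. -/
theorem one_le_of_linear {a x : ℝ} (h : ∀ r : ℕ, (r : ℝ) ≤ a + r * x) : 1 ≤ x := by
  by_contra hx
  push Not at hx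
  obtain ⟨r, hr⟩ := exists_nat_gt (a / (1 - x))
  have h1 : 0 < 1 - x := by linarith
  rw [div_lt_iff₀ h1] at hr
  have := h r
  nlinarith

/-- The weights are polynomial in the number of nodes of the grid if `Ω` is. -/
theorem Gadget.maxWeight_le {g : Gadget} {a μ : ℕ} (h : g.Ω ≤ g.N ^ a) :
    g.maxWeight (5 * μ * g.Ω) ≤ g.N ^ (a + (10 + 5 * μ)) := by
  have hN : g.N = g.x * (4 * g.y) := rfl
  have hx := g.x_pos
  have hy := g.y_pos
  have h1 : 4 * g.x ≤ g.N := by rw [hN]; nlinarith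
  have h2 : 4 * g.y ≤ g.N := by rw [hN]; nlinarith
  have h3 : 16 + 10 * g.x + 10 * g.y + 5 * μ ≤ g.N ^ (10 + 5 * μ) := by
    calc 16 + 10 * g.x + 10 * g.y + 5 * μ ≤ g.N * (9 + 5 * μ) := by
          have : 5 * μ ≤ g.N * (5 * μ) := Nat.le_mul_of_pos_left _ (by omega)
          rw [mul_add]; omega
      _ ≤ g.N * 2 ^ (9 + 5 * μ) := Nat.mul_le_mul_left _ Nat.lt_two_pow_self.le
      _ ≤ g.N * g.N ^ (9 + 5 * μ) := Nat.mul_le_mul_left _ (Nat.pow_le_pow_left (by omega) _)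
      _ = g.N ^ (10 + 5 * μ) := by rw [← pow_succ']; congr 1; omega
  calc g.maxWeight (5 * μ * g.Ω) = g.Ω * (16 + 10 * g.x + 10 * g.y + 5 * μ) := by
        unfold Gadget.maxWeight; ring
    _ ≤ g.N ^ a * g.N ^ (10 + 5 * μ) := Nat.mul_le_mul h h3
    _ = _ := (pow_add _ _ _).symm

/-- A bound for the running time of `A` on all admissible sequences. -/
def Algorithm.Bound (A : Algorithm) (D : Variant) (P k C : ℕ) (q u : ℕ → ℝ) : Prop :=
  ∀ (N : ℕ) (G : WGraph (Fin N)) (pos : Fin N → ℕ × ℕ), D.initial G pos →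
    ∀ ops : List (Op (Fin N)), D.Admissible G G ops →
      ∃ (t₀ t : ℕ) (m : Mem),
        Runs ((N + ops.length + 2) ^ k) A.preprocess (input G pos) t₀ m ∧
        A.Serves ((N + ops.length + 2) ^ k) G m ops t ∧
        (t₀ : ℝ) + t ≤ C * ((N : ℝ) + 1) ^ P + numUpdates ops * u N + numQueries ops * q N

theorem updatesPerSet_pos (del : Bool) : 1 ≤ Gadget.updatesPerSet del := by cases del <;> decide

/-- Every operation takes at least one step, so that the amortized times are at least `1`. -/
theorem one_le_rates {A : Algorithm} {D : Variant} {P k C c μ : ℕ} {q u : ℕ → ℝ} {del coord : Bool}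
    (hA : A.Bound D P k C q u) (hD : Gadget.Hosts D del coord c μ) (g : Gadget)
    (hg : g.maxWeight (5 * μ * g.Ω) ≤ g.N ^ c) : 1 ≤ q g.N ∧ 1 ≤ u g.N := by
  have key : ∀ L : List (GOp g.x g.y), GOp.Valid (5 * μ * g.Ω) (5 * μ * g.Ω + 5 * g.Ω) L →
      ((Gadget.updatesPerSet del * GOp.sets L + GOp.queries L : ℕ) : ℝ) ≤
        C * ((g.N : ℝ) + 1) ^ P + (Gadget.updatesPerSet del * GOp.sets L : ℕ) * u g.N +
          (GOp.queries L : ℕ) * q g.N := by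
    intro L hL
    obtain ⟨t₀, t, m, -, h2, h3⟩ := hA _ _ _ (hD.initial g hg) _ (hD.admissible g hg L hL)
    have h4 := h2.length_le
    rw [Gadget.numUpdates_toOps, Gadget.numQueries_toOps] at h3
    rw [Gadget.length_toOps] at h4
    have h5 : ((Gadget.updatesPerSet del * GOp.sets L + GOp.queries L : ℕ) : ℝ) ≤ t := by
      exact_mod_cast h4
    have h6 : (0 : ℝ) ≤ t₀ := by positivity
    linarith
  have hups := updatesPerSet_pos del
  constructor
  · refine one_le_of_linear (a := C * ((g.N : ℝ) + 1) ^ P) fun r => ?_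
    have hq : ∀ r, GOp.sets (List.replicate r (GOp.query ⟨0, g.y_pos⟩ : GOp g.x g.y)) = 0 ∧
        GOp.queries (List.replicate r (GOp.query ⟨0, g.y_pos⟩ : GOp g.x g.y)) = r := by
      intro r
      induction r with
      | zero => exact ⟨rfl, rfl⟩
      | succ r ih => rw [List.replicate_succ]; exact ⟨ih.1, congrArg (· + 1) ih.2⟩
    have := key (List.replicate r (.query ⟨0, g.y_pos⟩)) fun k w h => by
      have := List.eq_of_mem_replicate h; simp at this
    rw [(hq r).1, (hq r).2] at this
    simpa using this
  · refine one_le_of_linear (a := C * ((g.N : ℝ) + 1) ^ P) fun r => ?_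
    have hq : ∀ r, GOp.sets (List.replicate r (GOp.set ⟨0, g.x_pos⟩ (5 * μ * g.Ω) : GOp g.x g.y)) = r ∧
        GOp.queries (List.replicate r (GOp.set ⟨0, g.x_pos⟩ (5 * μ * g.Ω) : GOp g.x g.y)) = 0 := by
      intro r
      induction r with
      | zero => exact ⟨rfl, rfl⟩
      | succ r ih => rw [List.replicate_succ]; exact ⟨congrArg (· + 1) ih.1, ih.2⟩
    have := key (List.replicate r (.set ⟨0, g.x_pos⟩ (5 * μ * g.Ω))) fun k w h => by
      have := List.eq_of_mem_replicate h
      simp only [GOp.set.injEq] at this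
      rw [this.2]; exact ⟨le_rfl, Nat.le_add_right _ _⟩
    rw [(hq r).1, (hq r).2] at this
    simp only [add_zero, Nat.cast_zero, zero_mul, Nat.cast_mul] at this
    have hups' : (1 : ℝ) ≤ Gadget.updatesPerSet del := by exact_mod_cast hups
    have hC : (0 : ℝ) ≤ C * ((g.N : ℝ) + 1) ^ P := by positivity
    have hr : (0 : ℝ) ≤ r := by positivity
    by_contra hcon
    push Not at hcon
    have h1 : 0 < r * (1 - u g.N) := by linarith
    nlinarith

/-- If `q * u` is small compared with `h ^ K`, then some block shape `h ^ j × h ^ (K - j)` balances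
the times for updates and queries. -/
theorem exists_good_exponent {q u C : ℝ} {h K : ℕ} (hh : 2 ≤ h) (hq : 1 ≤ q) (hu : 1 ≤ u)
    (hC : C ≤ h) (hqu : q * u * (h : ℝ) ^ 6 ≤ C * (h : ℝ) ^ K) :
    ∃ j ≤ K, (h : ℝ) ^ (K - j) * q * (h : ℝ) ^ 2 ≤ (h : ℝ) ^ K ∧
      (h : ℝ) ^ j * u * (h : ℝ) ^ 2 ≤ C * (h : ℝ) ^ K := by
  classical
  have h2 : (2 : ℝ) ≤ h := by exact_mod_cast hh
  have h1 : (1 : ℝ) ≤ h := by linarith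
  have h0 : (0 : ℝ) < h := by linarith
  have hp : ∀ i, (0 : ℝ) < (h : ℝ) ^ i := fun i => pow_pos h0 i
  have hex : ∃ j, q * (h : ℝ) ^ 2 ≤ (h : ℝ) ^ j := by
    refine ⟨K, ?_⟩
    have e1 : q * (h : ℝ) ^ 6 ≤ q * u * (h : ℝ) ^ 6 := by
      have := hp 6; nlinarith [mul_nonneg (by linarith : 0 ≤ q) (by linarith : 0 ≤ u - 1)]
    have e2 : C * (h : ℝ) ^ K ≤ (h : ℝ) ^ 4 * (h : ℝ) ^ K :=
      mul_le_mul_of_nonneg_right (hC.trans (le_self_pow₀ h1 (by norm_num))) (hp K).le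
    have e3 : (h : ℝ) ^ 4 * (q * (h : ℝ) ^ 2) ≤ (h : ℝ) ^ 4 * (h : ℝ) ^ K := by
      calc (h : ℝ) ^ 4 * (q * (h : ℝ) ^ 2) = q * (h : ℝ) ^ 6 := by ring
        _ ≤ _ := e1.trans (hqu.trans e2)
    exact le_of_mul_le_mul_left e3 (hp 4)
  have hspec := Nat.find_spec hex
  have hmin := fun i => Nat.find_min (H := hex) (m := i)
  have hjK : Nat.find hex ≤ K := by
    refine Nat.find_min' hex ?_
    have e1 : q * (h : ℝ) ^ 6 ≤ q * u * (h : ℝ) ^ 6 := by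
      have := hp 6; nlinarith [mul_nonneg (by linarith : 0 ≤ q) (by linarith : 0 ≤ u - 1)]
    have e2 : C * (h : ℝ) ^ K ≤ (h : ℝ) ^ 4 * (h : ℝ) ^ K :=
      mul_le_mul_of_nonneg_right (hC.trans (le_self_pow₀ h1 (by norm_num))) (hp K).le
    have e3 : (h : ℝ) ^ 4 * (q * (h : ℝ) ^ 2) ≤ (h : ℝ) ^ 4 * (h : ℝ) ^ K := by
      calc (h : ℝ) ^ 4 * (q * (h : ℝ) ^ 2) = q * (h : ℝ) ^ 6 := by ring
        _ ≤ _ := e1.trans (hqu.trans e2)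
    exact le_of_mul_le_mul_left e3 (hp 4)
  generalize Nat.find hex = j at *
  refine ⟨j, hjK, ?_, ?_⟩
  · calc (h : ℝ) ^ (K - j) * q * (h : ℝ) ^ 2 = (h : ℝ) ^ (K - j) * (q * (h : ℝ) ^ 2) := by ring
      _ ≤ (h : ℝ) ^ (K - j) * (h : ℝ) ^ j := mul_le_mul_of_nonneg_left hspec (hp _).le
      _ = (h : ℝ) ^ K := by rw [← pow_add]; congr 1; omega
  · have hj0 : j ≠ 0 := by
      rintro rfl
      rw [pow_zero] at hspec
      nlinarith
    obtain ⟨i, rfl⟩ := Nat.exists_eq_succ_of_ne_zero hj0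
    have e1 := hmin i (Nat.lt_succ_self i)
    push Not at e1
    have e2 : (h : ℝ) ^ (i + 1) ≤ q * (h : ℝ) ^ 3 := by
      calc (h : ℝ) ^ (i + 1) = (h : ℝ) ^ i * h := pow_succ _ _
        _ ≤ q * (h : ℝ) ^ 2 * h := mul_le_mul_of_nonneg_right e1.le h0.le
        _ = q * (h : ℝ) ^ 3 := by ring
    calc (h : ℝ) ^ (i + 1) * u * (h : ℝ) ^ 2 ≤ q * (h : ℝ) ^ 3 * u * (h : ℝ) ^ 2 := by
          have : 0 ≤ u * (h : ℝ) ^ 2 := by have := hp 2; positivity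
          nlinarith
      _ = q * u * (h : ℝ) ^ 5 := by ring
      _ ≤ q * u * (h : ℝ) ^ 6 := mul_le_mul_of_nonneg_left
          (pow_le_pow_right₀ h1 (by norm_num)) (by positivity)
      _ ≤ _ := hqu

/-- On the sizes `4 * h ^ K` of the grids, a fast algorithm has linear update and query times, and
their product is smaller than `h ^ K` by a factor `h ^ 6`. -/
theorem rates_bounds {q u : ℕ → ℝ} {ε : ℝ} {K : ℕ} (hε : 0 < ε) (hK : 6 ≤ K * ε) (hK0 : 0 < K)
    (h1 : ∀ h : ℕ, 0 < h → 1 ≤ q (4 * h ^ K) ∧ 1 ≤ u (4 * h ^ K))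
    (hO : Asymptotics.IsBigO Filter.atTop (fun N => q N * u N) (fun N : ℕ => (N : ℝ) ^ (1 - ε))) :
    (∃ C' : ℕ, ∀ h : ℕ, 0 < h → q (4 * h ^ K) ≤ C' * (h : ℝ) ^ K ∧ u (4 * h ^ K) ≤ C' * (h : ℝ) ^ K) ∧
    ∃ (C : ℝ) (h₀ : ℕ), ∀ h : ℕ, h₀ ≤ h → 0 < h →
      q (4 * h ^ K) * u (4 * h ^ K) * (h : ℝ) ^ 6 ≤ C * (h : ℝ) ^ K := by
  obtain ⟨C, hC⟩ := hO.bound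
  obtain ⟨N₀, hN₀⟩ := Filter.eventually_atTop.1 hC
  have hN : ∀ h : ℕ, h ≤ 4 * h ^ K := fun h => (Nat.le_self_pow hK0.ne' h).trans (by omega)
  have key : ∀ h : ℕ, N₀ ≤ 4 * h ^ K → 0 < h →
      q (4 * h ^ K) * u (4 * h ^ K) * (h : ℝ) ^ 6 ≤ 4 * |C| * (h : ℝ) ^ K := by
    intro h hh hpos
    have e1 := hN₀ _ hh
    obtain ⟨hq, hu⟩ := h1 h hpos
    have hh0 : (0 : ℝ) < h := by exact_mod_cast hpos
    have hh1 : (1 : ℝ) ≤ h := by exact_mod_cast hpos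
    have hp : (0 : ℝ) < (h : ℝ) ^ K := pow_pos hh0 K
    rw [Real.norm_of_nonneg (by positivity), Real.norm_of_nonneg (by positivity)] at e1
    have e2 : (((4 * h ^ K : ℕ) : ℝ)) ^ (1 - ε) * (h : ℝ) ^ 6 ≤ 4 * (h : ℝ) ^ K := by
      push_cast
      rw [Real.rpow_sub (by positivity), Real.rpow_one, div_mul_eq_mul_div,
        div_le_iff₀ (by positivity)]
      refine mul_le_mul_of_nonneg_left ?_ (by positivity)
      calc (h : ℝ) ^ 6 = (h : ℝ) ^ (6 : ℝ) := by norm_cast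
        _ ≤ (h : ℝ) ^ (K * ε) := Real.rpow_le_rpow_of_exponent_le hh1 hK
        _ = ((h : ℝ) ^ K) ^ ε := by rw [Real.rpow_mul hh0.le, Real.rpow_natCast]
        _ ≤ (4 * (h : ℝ) ^ K) ^ ε := Real.rpow_le_rpow hp.le (by linarith) hε.le
    have hrp : (0 : ℝ) ≤ ((4 * h ^ K : ℕ) : ℝ) ^ (1 - ε) := by positivity
    calc q (4 * h ^ K) * u (4 * h ^ K) * (h : ℝ) ^ 6
        ≤ C * (((4 * h ^ K : ℕ) : ℝ)) ^ (1 - ε) * (h : ℝ) ^ 6 :=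
          mul_le_mul_of_nonneg_right e1 (by positivity)
      _ ≤ |C| * (((4 * h ^ K : ℕ) : ℝ)) ^ (1 - ε) * (h : ℝ) ^ 6 := by
          have := le_abs_self C
          gcongr
      _ = |C| * ((((4 * h ^ K : ℕ) : ℝ)) ^ (1 - ε) * (h : ℝ) ^ 6) := by ring
      _ ≤ |C| * (4 * (h : ℝ) ^ K) := mul_le_mul_of_nonneg_left e2 (abs_nonneg _)
      _ = _ := by ring
  refine ⟨?_, 4 * |C|, N₀, fun h hh hpos => key h (hh.trans (hN h)) hpos⟩
  obtain ⟨C', hC'⟩ := exists_nat_ge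
    (4 * |C| + ∑ N ∈ Finset.range N₀, (|q N| + |u N|))
  refine ⟨C', fun h hpos => ?_⟩
  obtain ⟨hq, hu⟩ := h1 h hpos
  have hh1 : (1 : ℝ) ≤ h := by exact_mod_cast hpos
  have hp : (1 : ℝ) ≤ (h : ℝ) ^ K := one_le_pow₀ hh1
  have hsum : (0 : ℝ) ≤ ∑ N ∈ Finset.range N₀, (|q N| + |u N|) :=
    Finset.sum_nonneg fun _ _ => by positivity
  rcases lt_or_ge (4 * h ^ K) N₀ with hlt | hge
  · have e1 : |q (4 * h ^ K)| + |u (4 * h ^ K)| ≤ ∑ N ∈ Finset.range N₀, (|q N| + |u N|) :=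
      Finset.single_le_sum (f := fun N => |q N| + |u N|) (fun _ _ => by positivity)
        (Finset.mem_range.2 hlt)
    have e2 := le_abs_self (q (4 * h ^ K))
    have e3 := le_abs_self (u (4 * h ^ K))
    have e4 := abs_nonneg (q (4 * h ^ K))
    have e5 := abs_nonneg (u (4 * h ^ K))
    have e6 := abs_nonneg C
    have e7 : (0 : ℝ) ≤ C' := by positivity
    constructor <;> nlinarith
  · have e1 := key h hge hpos
    have e2 : (1 : ℝ) ≤ (h : ℝ) ^ 6 := one_le_pow₀ hh1
    have e3 : 4 * |C| * (h : ℝ) ^ K ≤ C' * (h : ℝ) ^ K :=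
      mul_le_mul_of_nonneg_right (by linarith) (by linarith)
    have e4 : q (4 * h ^ K) * u (4 * h ^ K) ≤ q (4 * h ^ K) * u (4 * h ^ K) * (h : ℝ) ^ 6 :=
      le_mul_of_one_le_right (by positivity) e2
    constructor <;> nlinarith

/-- Rounding up at most doubles the root. -/
theorem root_asymptotics {D n : ℕ} (hD : 0 < D) (hn : 0 < n) :
    ((root D n : ℕ) : ℝ) ≤ 2 * (n : ℝ) ^ (1 / (D : ℝ)) := by
  have hn1 : (1 : ℝ) ≤ n := by exact_mod_cast hn
  have hD0 : (0 : ℝ) < D := by exact_mod_cast hD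
  have h1 : (1 : ℝ) ≤ (n : ℝ) ^ (1 / (D : ℝ)) := Real.one_le_rpow hn1 (by positivity)
  obtain ⟨i, hi⟩ := Nat.exists_eq_succ_of_ne_zero (root_pos hD hn).ne'
  have h2 : i ^ D < n := pow_lt_of_lt_root (by omega)
  have h3 : (i : ℝ) ≤ (n : ℝ) ^ (1 / (D : ℝ)) := by
    have h4 : ((i : ℝ) ^ D) ≤ n := by exact_mod_cast h2.le
    calc (i : ℝ) = ((i : ℝ) ^ D) ^ (1 / (D : ℝ)) := by
          rw [one_div, Real.pow_rpow_inv_natCast (by positivity) hD.ne']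
      _ ≤ _ := Real.rpow_le_rpow (by positivity) h4 (by positivity)
  rw [hi]; push_cast; linarith

/-! ### The running time of the reduction -/

/-- The amortized bound for serving one block of size `h ^ j × h ^ (K - j)` of a matrix with
`h ^ D` rows. -/
noncomputable def blockCost (P C K D ups : ℕ) (q u : ℕ → ℝ) (h j : ℕ) : ℕ :=
  ⌊C * (((4 * h ^ K : ℕ) : ℝ) + 1) ^ P + (ups * (h ^ K * h ^ (D - K) * h ^ j) : ℕ) * u (4 * h ^ K) +
    (h ^ K * h ^ (D - K) * h ^ (K - j) : ℕ) * q (4 * h ^ K)⌋₊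

theorem blockCost_le {P C K D ups h j : ℕ} {q u : ℕ → ℝ} (hq : 0 ≤ q (4 * h ^ K))
    (hu : 0 ≤ u (4 * h ^ K)) (hKD : K ≤ D) :
    (blockCost P C K D ups q u h j : ℝ) ≤ C * (4 * (h : ℝ) ^ K + 1) ^ P +
      ups * (h ^ D * (h ^ j * u (4 * h ^ K))) + h ^ D * (h ^ (K - j) * q (4 * h ^ K)) := by
  have e : (h : ℝ) ^ K * h ^ (D - K) = h ^ D := by rw [← pow_add]; congr 1; omega
  refine (Nat.floor_le (by positivity)).trans (le_of_eq ?_)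
  push_cast
  rw [e]
  ring

/-- For `h = 0` there is no information on `q` and `u`, but then the cost is a constant. -/
theorem polyBdd_blockCost {P C K D ups C' : ℕ} {q u : ℕ → ℝ} (j : ℕ) (hKD : K ≤ D)
    (h0 : ∀ h : ℕ, 0 < h → 0 ≤ q (4 * h ^ K) ∧ 0 ≤ u (4 * h ^ K))
    (h1 : ∀ h : ℕ, 0 < h → q (4 * h ^ K) ≤ C' * (h : ℝ) ^ K ∧ u (4 * h ^ K) ≤ C' * (h : ℝ) ^ K) :
    PolyBdd fun h => blockCost P C K D ups q u h j := by
  have hid := PolyBdd.id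
  have hc := PolyBdd.const
  refine PolyBdd.mono (g := fun h => blockCost P C K D ups q u 0 j +
    (C * (4 * h ^ K + 1) ^ P + ups * (h ^ D * (h ^ j * (C' * h ^ K))) +
      h ^ D * (h ^ (K - j) * (C' * h ^ K)))) ?_ fun h => ?_
  · exact (hc _).add (((hc C |>.mul ((((hc 4).mul (hid.pow K)).add (hc 1)).pow P)).add
      ((hc ups).mul ((hid.pow D).mul ((hid.pow j).mul ((hc C').mul (hid.pow K)))))).add
      ((hid.pow D).mul ((hid.pow (K - j)).mul ((hc C').mul (hid.pow K)))))
  · rcases Nat.eq_zero_or_pos h with rfl | hpos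
    · exact Nat.le_add_right _ _
    · refine le_trans ?_ (Nat.le_add_left _ _)
      have e1 := blockCost_le (P := P) (C := C) (ups := ups) (j := j) (h0 h hpos).1 (h0 h hpos).2 hKD
      obtain ⟨e2, e3⟩ := h1 h hpos
      have e4 : (blockCost P C K D ups q u h j : ℝ) ≤ C * (4 * (h : ℝ) ^ K + 1) ^ P +
          ups * (h ^ D * (h ^ j * (C' * (h : ℝ) ^ K))) + h ^ D * (h ^ (K - j) * (C' * (h : ℝ) ^ K)) :=
        e1.trans (by gcongr)
      exact_mod_cast e4

/-- The time bound for the reduction on matrices with `h ^ D` rows, where `j` is the exponent of a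
good block shape. -/
noncomputable def reductionTime (P C K D ups k e : ℕ) (q u : ℕ → ℝ) (h j : ℕ) : ℕ :=
  D * h * (17000 * ∑ i ∈ Finset.range (K + 1), (h ^ (D - K) * h ^ (D - K) *
      (h ^ K * blockCost P C K D ups q u h j) + h ^ K * blockCost P C K D ups q u h i) +
    (K + 1) * (h ^ (D - K) * h ^ (D - K) * (h ^ K * (60000 * (4 * h ^ K * (4 * h ^ K)))))) +
  20000 * (D + k + e + 10) * (h ^ K * h ^ (D - K) * (h ^ K * h ^ (D - K))) + 1000

/-- With a good block shape, the reduction takes truly subcubic time. -/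
theorem reductionTime_le {P C K D ups C' : ℕ} (k e : ℕ) (C₁ : ℝ) (hK : 0 < K)
    (hD : K * (P + 4) + 2 ≤ D) :
    ∃ A : ℝ, ∀ (q u : ℕ → ℝ) (h j : ℕ), 2 ≤ h → 0 ≤ q (4 * h ^ K) → 0 ≤ u (4 * h ^ K) →
      q (4 * h ^ K) ≤ C' * (h : ℝ) ^ K → u (4 * h ^ K) ≤ C' * (h : ℝ) ^ K →
      (h : ℝ) ^ (K - j) * q (4 * h ^ K) * (h : ℝ) ^ 2 ≤ (h : ℝ) ^ K →
      (h : ℝ) ^ j * u (4 * h ^ K) * (h : ℝ) ^ 2 ≤ C₁ * (h : ℝ) ^ K →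
      (reductionTime P C K D ups k e q u h j : ℝ) ≤ A * (h : ℝ) ^ (3 * D - 1) := by
  have hKP : K * (P + 4) = K * P + 4 * K := by ring
  set a : ℝ := C * 5 ^ P + ups * |C₁| + 1 with ha
  set b : ℝ := C * 5 ^ P + ups * C' + C' with hb
  refine ⟨D * (17000 * ((K + 1) * (a + b)) + (K + 1) * (60000 * 16)) +
    20000 * (D + k + e + 10) + 1000, fun q u h j hh hq hu hq' hu' hqj huj => ?_⟩
  have hh1 : (1 : ℝ) ≤ h := by exact_mod_cast (by omega : 1 ≤ h)
  have hh0 : (0 : ℝ) < h := by linarith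
  have hp : ∀ i, (0 : ℝ) < (h : ℝ) ^ i := fun i => pow_pos hh0 i
  have mono : ∀ {i l : ℕ}, i ≤ l → (h : ℝ) ^ i ≤ (h : ℝ) ^ l := fun hil => pow_le_pow_right₀ hh1 hil
  have hN : (4 * (h : ℝ) ^ K + 1) ^ P ≤ 5 ^ P * (h : ℝ) ^ (K * P) := by
    rw [pow_mul, ← mul_pow]
    refine pow_le_pow_left₀ (by positivity) ?_ P
    have : (1 : ℝ) ≤ (h : ℝ) ^ K := one_le_pow₀ hh1
    linarith
  have hGK : (h : ℝ) ^ (D - K) * (h : ℝ) ^ (D - K) * (h : ℝ) ^ K = (h : ℝ) ^ (2 * D - K) := by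
    rw [← pow_add, ← pow_add]; congr 1; omega
  have hC₁ := le_abs_self C₁
  -- the pairs of large blocks with the good shape
  have e1 : (h : ℝ) ^ (D - K) * (h : ℝ) ^ (D - K) *
      ((h : ℝ) ^ K * (blockCost P C K D ups q u h j : ℝ)) ≤ a * (h : ℝ) ^ (3 * D - 2) := by
    rw [← mul_assoc, hGK]
    have f1 := blockCost_le (P := P) (C := C) (ups := ups) (j := j) hq hu (by omega : K ≤ D)
    have g1 : (h : ℝ) ^ (2 * D - K) * (C * (4 * (h : ℝ) ^ K + 1) ^ P) ≤
        C * 5 ^ P * (h : ℝ) ^ (3 * D - 2) := by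
      calc (h : ℝ) ^ (2 * D - K) * (C * (4 * (h : ℝ) ^ K + 1) ^ P)
          ≤ (h : ℝ) ^ (2 * D - K) * (C * (5 ^ P * (h : ℝ) ^ (K * P))) := by gcongr
        _ = C * 5 ^ P * (h : ℝ) ^ (2 * D - K + K * P) := by rw [pow_add]; ring
        _ ≤ _ := mul_le_mul_of_nonneg_left (mono (by omega)) (by positivity)
    have g2 : (h : ℝ) ^ (2 * D - K) * (ups * (h ^ D * (h ^ j * u (4 * h ^ K)))) ≤
        ups * |C₁| * (h : ℝ) ^ (3 * D - 2) := by
      calc (h : ℝ) ^ (2 * D - K) * (ups * (h ^ D * (h ^ j * u (4 * h ^ K))))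
          = ups * (h : ℝ) ^ (3 * D - K - 2) * (h ^ j * u (4 * h ^ K) * h ^ 2) := by
            rw [show 3 * D - K - 2 = (2 * D - K) + (D - 2) by omega, pow_add,
              show (h : ℝ) ^ D = (h : ℝ) ^ (D - 2) * (h : ℝ) ^ 2 by rw [← pow_add]; congr 1; omega]
            ring
        _ ≤ ups * (h : ℝ) ^ (3 * D - K - 2) * (|C₁| * (h : ℝ) ^ K) := by
            refine mul_le_mul_of_nonneg_left (huj.trans ?_) (by positivity)
            gcongr
        _ = ups * |C₁| * (h : ℝ) ^ (3 * D - 2) := by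
            rw [show 3 * D - 2 = (3 * D - K - 2) + K by omega, pow_add]; ring
    have g3 : (h : ℝ) ^ (2 * D - K) * (h ^ D * (h ^ (K - j) * q (4 * h ^ K))) ≤
        1 * (h : ℝ) ^ (3 * D - 2) := by
      calc (h : ℝ) ^ (2 * D - K) * (h ^ D * (h ^ (K - j) * q (4 * h ^ K)))
          = (h : ℝ) ^ (3 * D - K - 2) * (h ^ (K - j) * q (4 * h ^ K) * h ^ 2) := by
            rw [show 3 * D - K - 2 = (2 * D - K) + (D - 2) by omega, pow_add,
              show (h : ℝ) ^ D = (h : ℝ) ^ (D - 2) * (h : ℝ) ^ 2 by rw [← pow_add]; congr 1; omega]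
            ring
        _ ≤ (h : ℝ) ^ (3 * D - K - 2) * (h : ℝ) ^ K := mul_le_mul_of_nonneg_left hqj (hp _).le
        _ = 1 * (h : ℝ) ^ (3 * D - 2) := by
            rw [show 3 * D - 2 = (3 * D - K - 2) + K by omega, pow_add]; ring
    calc _ ≤ (h : ℝ) ^ (2 * D - K) * _ := mul_le_mul_of_nonneg_left f1 (hp _).le
      _ ≤ _ := by rw [mul_add, mul_add, ha, add_mul, add_mul]; linarith
  -- the single pairs of large blocks with other shapes
  have e2 : ∀ i ≤ K, (h : ℝ) ^ K * (blockCost P C K D ups q u h i : ℝ) ≤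
      b * (h : ℝ) ^ (3 * D - 2) := by
    intro i hi
    have f1 := blockCost_le (P := P) (C := C) (ups := ups) (j := i) hq hu (by omega : K ≤ D)
    have g1 : (h : ℝ) ^ K * (C * (4 * (h : ℝ) ^ K + 1) ^ P) ≤ C * 5 ^ P * (h : ℝ) ^ (3 * D - 2) := by
      calc (h : ℝ) ^ K * (C * (4 * (h : ℝ) ^ K + 1) ^ P)
          ≤ (h : ℝ) ^ K * (C * (5 ^ P * (h : ℝ) ^ (K * P))) := by gcongr
        _ = C * 5 ^ P * (h : ℝ) ^ (K + K * P) := by rw [pow_add]; ring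
        _ ≤ _ := mul_le_mul_of_nonneg_left (mono (by omega)) (by positivity)
    have g2 : (h : ℝ) ^ K * (ups * (h ^ D * (h ^ i * u (4 * h ^ K)))) ≤
        ups * C' * (h : ℝ) ^ (3 * D - 2) := by
      calc (h : ℝ) ^ K * (ups * (h ^ D * (h ^ i * u (4 * h ^ K))))
          ≤ (h : ℝ) ^ K * (ups * (h ^ D * (h ^ i * (C' * (h : ℝ) ^ K)))) := by gcongr
        _ = ups * C' * (h : ℝ) ^ (K + D + i + K) := by rw [pow_add, pow_add, pow_add]; ring
        _ ≤ _ := mul_le_mul_of_nonneg_left (mono (by omega)) (by positivity)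
    have g3 : (h : ℝ) ^ K * (h ^ D * (h ^ (K - i) * q (4 * h ^ K))) ≤
        C' * (h : ℝ) ^ (3 * D - 2) := by
      calc (h : ℝ) ^ K * (h ^ D * (h ^ (K - i) * q (4 * h ^ K)))
          ≤ (h : ℝ) ^ K * (h ^ D * (h ^ (K - i) * (C' * (h : ℝ) ^ K))) := by gcongr
        _ = C' * (h : ℝ) ^ (K + D + (K - i) + K) := by rw [pow_add, pow_add, pow_add]; ring
        _ ≤ _ := mul_le_mul_of_nonneg_left (mono (by omega)) (by positivity)
    calc _ ≤ (h : ℝ) ^ K * _ := mul_le_mul_of_nonneg_left f1 (hp _).le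
      _ ≤ _ := by rw [mul_add, mul_add, hb, add_mul, add_mul]; linarith
  have e3 : (h : ℝ) ^ (D - K) * (h : ℝ) ^ (D - K) *
      ((h : ℝ) ^ K * (60000 * (4 * (h : ℝ) ^ K * (4 * (h : ℝ) ^ K)))) ≤
      60000 * 16 * (h : ℝ) ^ (3 * D - 2) := by
    calc _ = 60000 * 16 * ((h : ℝ) ^ (D - K) * (h : ℝ) ^ (D - K) * (h : ℝ) ^ K *
            ((h : ℝ) ^ K * (h : ℝ) ^ K)) := by ring
      _ = 60000 * 16 * (h : ℝ) ^ (2 * D - K + (K + K)) := by rw [hGK, pow_add, pow_add]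
      _ ≤ _ := mul_le_mul_of_nonneg_left (mono (by omega)) (by positivity)
  have e4 : (h : ℝ) ^ K * (h : ℝ) ^ (D - K) * ((h : ℝ) ^ K * (h : ℝ) ^ (D - K)) ≤
      (h : ℝ) ^ (3 * D - 1) := by
    rw [← pow_add, ← pow_add]; exact mono (by omega)
  have e5 : (1 : ℝ) ≤ (h : ℝ) ^ (3 * D - 1) := one_le_pow₀ hh1
  have e6 : (h : ℝ) * (h : ℝ) ^ (3 * D - 2) = (h : ℝ) ^ (3 * D - 1) := by
    rw [← pow_succ']; congr 1; omega
  have e7 : ∑ i ∈ Finset.range (K + 1), ((h : ℝ) ^ (D - K) * (h : ℝ) ^ (D - K) *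
      ((h : ℝ) ^ K * (blockCost P C K D ups q u h j : ℝ)) +
        (h : ℝ) ^ K * (blockCost P C K D ups q u h i : ℝ)) ≤
      (K + 1) * (a + b) * (h : ℝ) ^ (3 * D - 2) := by
    refine (Finset.sum_le_card_nsmul _ _ ((a + b) * (h : ℝ) ^ (3 * D - 2)) fun i hi => ?_).trans
      (le_of_eq ?_)
    · rw [add_mul]
      exact add_le_add e1 (e2 i (by have := Finset.mem_range.1 hi; omega))
    · rw [Finset.card_range, nsmul_eq_mul]; push_cast; ring
  unfold reductionTime
  push_cast
  calc _ ≤ (D : ℝ) * h * (17000 * ((K + 1) * (a + b) * (h : ℝ) ^ (3 * D - 2)) +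
        (K + 1) * (60000 * 16 * (h : ℝ) ^ (3 * D - 2))) +
        20000 * (D + k + e + 10) * (h : ℝ) ^ (3 * D - 1) + 1000 * (h : ℝ) ^ (3 * D - 1) := by
        gcongr
        linarith
    _ = _ := by rw [← e6]; ring

/-! ### The reduction solves all pairs shortest paths -/

/-- A bound for all quantities that occur in the reduction. -/
noncomputable def sizeBound (P C K D ups μ k e : ℕ) (q u : ℕ → ℝ) (h : ℕ) : ℕ :=
  100 + h ^ K * h ^ (D - K) * (h ^ K * h ^ (D - K)) + (K + 1) +
    10 * (h ^ K * h ^ (D - K)) ^ e +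
    (∑ j ∈ Finset.range (K + 1), h ^ (D - K) * h ^ (D - K) * (h ^ K * blockCost P C K D ups q u h j)) +
    (D + 1) + μ + k + e + (4 * h ^ K + 3 * (h ^ K * h ^ (D - K)) * (4 * h ^ K) + 2) +
    5 * μ * (h ^ K * h ^ (D - K)) ^ e +
    D * h * (h ^ (D - K) * h ^ (D - K) *
      (h ^ K * (4 * h ^ K + 3 * (h ^ K * h ^ (D - K)) * (4 * h ^ K) + 2) ^ k))

theorem polyBdd_sizeBound {P C K D ups C' : ℕ} {q u : ℕ → ℝ} (μ k e : ℕ) (hKD : K ≤ D)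
    (h0 : ∀ h : ℕ, 0 < h → 0 ≤ q (4 * h ^ K) ∧ 0 ≤ u (4 * h ^ K))
    (h1 : ∀ h : ℕ, 0 < h → q (4 * h ^ K) ≤ C' * (h : ℝ) ^ K ∧ u (4 * h ^ K) ≤ C' * (h : ℝ) ^ K) :
    PolyBdd (sizeBound P C K D ups μ k e q u) := by
  have c := PolyBdd.const
  have hid := PolyBdd.id
  have hK := hid.pow K
  have hG := hid.pow (D - K)
  have hm := hK.mul hG
  have hb := (((c 4).mul hK).add (((c 3).mul hm).mul ((c 4).mul hK))).add (c 2)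
  exact (((((((((((c 100).add (hm.mul hm)).add (c (K + 1))).add ((c 10).mul (hm.pow e))).add
    (PolyBdd.sum _ fun j _ => (hG.mul hG).mul (hK.mul (polyBdd_blockCost j hKD h0 h1)))).add
    (c (D + 1))).add (c μ)).add (c k)).add (c e)).add hb).add ((c (5 * μ)).mul (hm.pow e))).add
    (((c D).mul hid).mul ((hG.mul hG).mul (hK.mul (hb.pow k))))

/-- If a variant of the dynamic problem hosts the grids, then an algorithm for it yields an algorithm
for APSP. -/
theorem solves_apspProg {A : Algorithm} {Dv : Variant} {P k C c c' μ K D C' : ℕ} {q u : ℕ → ℝ}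
    {del coord : Bool} (hA : A.Bound Dv P k C q u) (hH : Gadget.Hosts Dv del coord c μ) (hμ : 2 ≤ μ)
    (hK : 0 < K) (hKD : K ≤ D) (hc : c = D * (c' + 1) + (10 + 5 * μ))
    (h0 : ∀ h : ℕ, 0 < h → 0 ≤ q (4 * h ^ K) ∧ 0 ≤ u (4 * h ^ K))
    (h1 : ∀ h : ℕ, 0 < h → q (4 * h ^ K) ≤ C' * (h : ℝ) ^ K ∧ u (4 * h ^ K) ≤ C' * (h : ℝ) ^ K) :
    APSP.Solves (apspProg A del coord K D μ (k + c + 3) (c' + 1)) c' fun n =>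
      if 0 < n then ⨅ j : Fin (K + 1), (reductionTime P C K D (Gadget.updatesPerSet del) (k + c + 3)
        (c' + 1) q u (root D n) j : ℝ) else 2000 := by
  have hD0 : 0 < D := by omega
  obtain ⟨l, hl⟩ := polyBdd_sizeBound (P := P) (C := C) (ups := Gadget.updatesPerSet del) μ
    (k + c + 3) (c' + 1) hKD h0 h1
  refine ⟨(l + 7) * 500, fun n w hw hneg => ?_⟩
  rcases Nat.eq_zero_or_pos n with rfl | hn
  · obtain ⟨t, M, hr, ho, ht⟩ := apspProg_runs_zero (A := A) (del := del) (coord := coord) K D μ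
      (k + c + 3) (c' + 1) w
    refine ⟨t, M, hr.mono ?_, by simpa using (by exact_mod_cast ht : (t : ℝ) ≤ 2000), ho⟩
    have h7 : 100 ≤ (0 + 2) ^ (l + 7) :=
      le_trans (by norm_num) (Nat.pow_le_pow_right (by norm_num) (Nat.le_add_left 7 l))
    exact (Nat.pow_le_pow_left h7 _).trans (pow_mul _ _ _).ge
  have hh := root_pos hD0 hn
  have hV := hl (root D n)
  have hhn := root_le (n := n) hD0
  generalize hhdef : root D n = h at *
  have hK0 : 0 < h ^ K := Nat.pow_pos hh
  have hG0 : 0 < h ^ (D - K) := Nat.pow_pos hh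
  have hm0 := Nat.mul_pos hK0 hG0
  have hbase : 4 * h ^ K ≤ 4 * h ^ K + 3 * (h ^ K * h ^ (D - K)) * (4 * h ^ K) + 2 := by omega
  have hbase2 : 2 ≤ 4 * h ^ K + 3 * (h ^ K * h ^ (D - K)) * (4 * h ^ K) + 2 := by omega
  have hN : ∀ j ≤ K, h ^ j * (4 * h ^ (K - j)) = 4 * h ^ K := fun j hj => by
    calc h ^ j * (4 * h ^ (K - j)) = 4 * (h ^ j * h ^ (K - j)) := by ring
      _ = 4 * h ^ K := by rw [← pow_add]; congr 2; omega
  have hΩN : (h ^ K * h ^ (D - K)) ^ (c' + 1) ≤ (4 * h ^ K) ^ (D * (c' + 1)) := by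
    rw [pow_mul]
    refine Nat.pow_le_pow_left ?_ _
    rw [← pow_add, show K + (D - K) = D by omega]
    exact Nat.pow_le_pow_left ((Nat.le_self_pow hK.ne' h).trans (by omega)) D
  have hmax : ∀ (j : ℕ) (L : Block), j ≤ K → L.Ω = (h ^ K * h ^ (D - K)) ^ (c' + 1) → L.x = h ^ j →
      L.y = h ^ (K - j) → L.gadget.N = 4 * h ^ K ∧
        L.gadget.maxWeight (5 * μ * L.Ω) ≤ L.gadget.N ^ c := by
    intro j L hj hΩ hx hy
    have e1 : L.gadget.N = 4 * h ^ K := by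
      change L.x * (4 * L.y) = _
      rw [hx, hy, hN j hj]
    refine ⟨e1, ?_⟩
    rw [hc]
    refine Gadget.maxWeight_le (g := L.gadget) ?_
    rw [e1]
    exact hΩ.le.trans hΩN
  set base := 4 * h ^ K + 3 * (h ^ K * h ^ (D - K)) * (4 * h ^ K) + 2 with hbdef
  have hcost : ∀ j ≤ K, h ^ (D - K) * h ^ (D - K) *
      (h ^ K * blockCost P C K D (Gadget.updatesPerSet del) q u h j) ≤
      ∑ j ∈ Finset.range (K + 1), h ^ (D - K) * h ^ (D - K) *
        (h ^ K * blockCost P C K D (Gadget.updatesPerSet del) q u h j) := fun j hj =>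
    Finset.single_le_sum (f := fun j => h ^ (D - K) * h ^ (D - K) *
      (h ^ K * blockCost P C K D (Gadget.updatesPerSet del) q u h j)) (fun _ _ => Nat.zero_le _)
      (Finset.mem_range.2 (by omega))
  have hVdef : ∃ V, V = sizeBound P C K D (Gadget.updatesPerSet del) μ (k + c + 3) (c' + 1) q u h :=
    ⟨_, rfl⟩
  obtain ⟨V, hVd⟩ := hVdef
  rw [← hVd] at hV
  unfold sizeBound at hVd
  rw [← hbdef] at hVd
  let Z : Setup A del coord :=
    { h := h
      K := K
      G := h ^ (D - K)
      Ω := (h ^ K * h ^ (D - K)) ^ (c' + 1)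
      B := base ^ (k + c + 2)
      S := base ^ (k + c + 3)
      U := 5 * μ * (h ^ K * h ^ (D - K)) ^ (c' + 1)
      V := V
      cost := blockCost P C K D (Gadget.updatesPerSet del) q u h
      h_pos := hh
      G_pos := hG0
      Ω_pos := Nat.pow_pos hm0
      hU := Nat.mul_le_mul_right _ (by omega)
      served := by
        intro j L hj hm hΩ hx hy
        obtain ⟨e1, e2⟩ := hmax j L hj hΩ hx hy
        rw [← hΩ]
        refine L.served_of_solves hA hH e2 ?_ ?_
        · rw [e1, hm]
          exact Nat.pow_le_pow_right (by omega) (by omega)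
        · rw [e1, hm, hx, hy]
          exact le_rfl
      maxWeight_le := by
        intro j L hj hΩ hx hy
        obtain ⟨e1, e2⟩ := hmax j L hj hΩ hx hy
        rw [← hΩ]
        refine e2.trans ?_
        rw [e1]
        exact (Nat.pow_le_pow_left hbase c).trans (Nat.pow_le_pow_right (by omega) (by omega))
      NB := by
        calc 4 * h ^ K * (4 * h ^ K) ≤ base * base := Nat.mul_le_mul hbase hbase
          _ = base ^ 2 := (sq _).symm
          _ ≤ _ := Nat.pow_le_pow_right (by omega) (by omega)
      BS := Nat.pow_lt_pow_right (by omega) (by omega)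
      hV := by omega
      mV := by omega
      KV := by omega
      ΩV := by omega
      costV := fun j hj => (hcost j hj).trans (by omega) }
  obtain ⟨t, M, hr, ho, ht⟩ := apspProg_runs (Z := Z) (D := D) (μ := μ) (k := k + c + 3) (e := c' + 1)
    hw hneg hn hKD hD0 hhdef.symm rfl rfl le_rfl rfl rfl (by change _ ≤ V; omega) (by change _ ≤ V; omega)
    (by change _ ≤ V; omega) (by change _ ≤ V; omega) (by change base ≤ V; omega)
    (by change 5 * μ * (h ^ K * h ^ (D - K)) ^ (c' + 1) ≤ V; omega)
    (by change D * h * (h ^ (D - K) * h ^ (D - K) * (h ^ K * base ^ (k + c + 3))) ≤ V; omega)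
  refine ⟨t, M, hr.mono ?_, ?_, ho⟩
  · calc V ^ 500 ≤ ((n + 2) ^ l) ^ 500 :=
          Nat.pow_le_pow_left (hV.trans (Nat.pow_le_pow_left (by omega) l)) _
      _ ≤ ((n + 2) ^ (l + 7)) ^ 500 :=
          Nat.pow_le_pow_left (Nat.pow_le_pow_right (by omega) (by omega)) _
      _ = (n + 2) ^ ((l + 7) * 500) := (pow_mul _ _ _).symm
  · show (t : ℝ) ≤ if 0 < n then _ else _
    rw [if_pos hn, hhdef]
    exact le_ciInf fun j => by exact_mod_cast ht j (by have := j.2; change (j : ℕ) ≤ K; omega)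

/-- Under the APSP conjecture, no variant that hosts the grids has a fast algorithm. -/
theorem not_hasFastAlgorithm (hAPSP : APSP.Conjecture) {ε : ℝ} (hε : 0 < ε) (P : ℕ) {μ : ℕ}
    (hμ : 2 ≤ μ) (del coord : Bool) : ∃ c, ∀ Dv : Variant, Gadget.Hosts Dv del coord c μ →
      ¬ HasFastAlgorithm Dv P ε := by
  obtain ⟨K, hKε⟩ := exists_nat_ge (6 / ε)
  have hK6 : 6 ≤ K * ε := by rwa [div_le_iff₀ hε] at hKε
  have hK : 0 < K := by
    rcases Nat.eq_zero_or_pos K with rfl | h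
    · norm_num at hK6
    · exact h
  -- large enough for the preprocessing of all blocks to take less than `h ^ (3 * D - 2)` steps
  obtain ⟨D, hD⟩ : ∃ D, D = K * (P + 4) + 2 := ⟨_, rfl⟩
  have hKD : K ≤ D := by
    have : K * (P + 4) = K * P + 4 * K := by ring
    omega
  have hD0 : 0 < D := by omega
  have hDr : (0 : ℝ) < D := by exact_mod_cast hD0
  obtain ⟨c', hc'⟩ := hAPSP (1 / D) (by positivity)
  refine ⟨D * (c' + 1) + (10 + 5 * μ), fun Dv hH ⟨A, q, u, ⟨k, C, hA⟩, hO⟩ => hc' ?_⟩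
  set c := D * (c' + 1) + (10 + 5 * μ) with hc
  have hone : ∀ h : ℕ, 0 < h → 1 ≤ q (4 * h ^ K) ∧ 1 ≤ u (4 * h ^ K) := by
    intro h hh
    -- any grid with `4 * h ^ K` nodes serves to show that operations take time
    let g : Gadget :=
      { x := h ^ K
        y := 1
        Ω := 1
        b := fun _ _ => 0
        x_pos := Nat.pow_pos hh
        y_pos := Nat.one_pos
        Ω_pos := Nat.one_pos
        b_zero := fun _ => rfl
        b_nonneg := fun _ _ => le_rfl
        b_le := fun _ _ => by norm_num }
    have hgN : g.N = 4 * h ^ K := by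
      change h ^ K * (4 * 1) = _
      ring
    have hpos : 0 < g.N := by rw [hgN]; have := Nat.pow_pos (n := K) hh; omega
    rw [← hgN]
    exact one_le_rates hA hH g (Gadget.maxWeight_le (Nat.pow_pos hpos))
  obtain ⟨⟨C', hC'⟩, C₁, h₁, hC₁⟩ := rates_bounds hε hK6 hK hone hO
  have hnonneg : ∀ h : ℕ, 0 < h → 0 ≤ q (4 * h ^ K) ∧ 0 ≤ u (4 * h ^ K) := fun h hh =>
    ⟨zero_le_one.trans (hone h hh).1, zero_le_one.trans (hone h hh).2⟩
  -- the time bound is the minimum over all exponents, so that it does not matter which one is best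
  refine ⟨_, _, ?_, solves_apspProg hA hH hμ hK hKD hc hnonneg hC'⟩
  obtain ⟨a, ha⟩ := reductionTime_le (C := C) (ups := Gadget.updatesPerSet del) (C' := C') (k + c + 3)
    (c' + 1) C₁ hK hD.ge
  obtain ⟨h₂, hh₂⟩ := exists_nat_ge C₁
  refine Asymptotics.IsBigO.of_bound (|a| * 2 ^ (3 * D - 1)) ?_
  filter_upwards [Filter.eventually_gt_atTop ((h₁ + h₂ + 2) ^ D)] with n hn
  have hn0 : 0 < n := by omega
  have hn0' : (0 : ℝ) < n := by exact_mod_cast hn0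
  have hlarge : h₁ + h₂ + 2 < root D n := by
    by_contra hcon
    push Not at hcon
    exact absurd ((le_root_pow hD0).trans (Nat.pow_le_pow_left hcon D)) (by omega)
  have hroot := root_asymptotics hD0 hn0
  rw [if_pos hn0]
  generalize root D n = h at *
  have hh : 0 < h := by omega
  obtain ⟨hq1, hu1⟩ := hone h hh
  have hhC : C₁ ≤ h := hh₂.trans (by exact_mod_cast (by omega : h₂ ≤ h))
  obtain ⟨j, hj, hqj, huj⟩ := exists_good_exponent (by omega) hq1 hu1 hhC (hC₁ h (by omega) hh)
  have htime := ha q u h j (by omega) (hnonneg h hh).1 (hnonneg h hh).2 (hC' h hh).1 (hC' h hh).2 hqj huj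
  have hinf : ⨅ j : Fin (K + 1), (reductionTime P C K D (Gadget.updatesPerSet del) (k + c + 3) (c' + 1)
      q u h j : ℝ) ≤ a * (h : ℝ) ^ (3 * D - 1) :=
    (ciInf_le ⟨0, by rintro _ ⟨i, rfl⟩; positivity⟩ (⟨j, by omega⟩ : Fin (K + 1))).trans htime
  rw [Real.norm_of_nonneg (Real.iInf_nonneg fun _ => by positivity), Real.norm_of_nonneg (by positivity)]
  calc _ ≤ a * (h : ℝ) ^ (3 * D - 1) := hinf
    _ ≤ |a| * (h : ℝ) ^ (3 * D - 1) := by gcongr; exact le_abs_self a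
    _ ≤ |a| * (2 * (n : ℝ) ^ (1 / (D : ℝ))) ^ (3 * D - 1) := by gcongr
    _ = |a| * 2 ^ (3 * D - 1) * (n : ℝ) ^ (3 - 1 / (D : ℝ)) := by
      rw [mul_pow, mul_assoc, ← Real.rpow_mul_natCast hn0'.le]
      congr 3
      rw [Nat.cast_sub (by omega)]
      push_cast
      field_simp

end DynAPSP

theorem theorem1 (hAPSP : APSP.Conjecture) (ε : ℝ) (hε : 0 < ε) (P : ℕ) :
    (∃ c : ℕ, ¬ DynAPSP.HasFastAlgorithm (DynAPSP.planarEdgeUpdates c) P ε) ∧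
    (∃ c : ℕ, ¬ DynAPSP.HasFastAlgorithm (DynAPSP.planarWeightUpdates c) P ε) ∧
    (∀ M : ℝ, 1 < M →
      ∃ c : ℕ, ¬ DynAPSP.HasFastAlgorithm (DynAPSP.gridWeightUpdates c M) P ε) := by
  refine ⟨?_, ?_, fun M hM => ?_⟩
  · obtain ⟨c, hc⟩ := DynAPSP.not_hasFastAlgorithm hAPSP hε P le_rfl true false
    exact ⟨c, hc _ (DynAPSP.Gadget.hosts_planarEdgeUpdates c)⟩
  · obtain ⟨c, hc⟩ := DynAPSP.not_hasFastAlgorithm hAPSP hε P le_rfl false false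
    exact ⟨c, hc _ (DynAPSP.Gadget.hosts_planarWeightUpdates c)⟩
  · -- a basic weight of `5 * μ * Ω` may grow by `5 * Ω` if `μ * (M - 1) ≥ 1`
    obtain ⟨μ, hμ⟩ := exists_nat_ge (1 / (M - 1))
    have hM0 : 0 < M - 1 := by linarith
    rw [div_le_iff₀ hM0] at hμ
    obtain ⟨c, hc⟩ := DynAPSP.not_hasFastAlgorithm hAPSP hε P (μ := μ + 2) (by omega) false true
    exact ⟨c, hc _ (DynAPSP.Gadget.hosts_gridWeightUpdates c (by omega) (by push_cast; nlinarith))⟩
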